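/- Let $\gamma\in(0,1]$, $\nu\in(0,2)$ and $\kappa_1,\kappa_2\in(0,\infty)$. Consider the spatially homogeneous Boltzmann equation in $\mathbb{R}^3$, $$\partial_t f_t(v)=\int_{\mathbb{R}^3}dv_*\int_{\mathbb{S}^2}d\sigma\,B(|v-v_*|,\cos\theta)\,[f_t(v')f_t(v'_*)-f_t(v)f_t(v_*)],$$ with a kernel of non-cutoff hard potential type: for some measurable $\beta:(0,\pi]\to[0,\infty)$, $$B(|v-v_*|,\cos\theta)\sin\theta=|v-v_*|^\gamma\beta(\theta)\quad(\theta\in(0,\pi)),\qquad \kappa_1\theta^{-\nu-1}\le\beta(\theta)\le\kappa_2\theta^{-\nu-1}\quad(\theta\in(0,\pi]).$$ *Parameterization.* For $X\in\mathbb{R}^3\setminus\{0\}$ let $I(X),J(X)\in\mathbb{R}^3$ be such that $\left(\frac{X}{|X|},\frac{I(X)}{|X|},\frac{J(X)}{|X|}\right)$ is an orthonormal basis, and let $I(0)=J(0)=0$. Put $\Gamma(X,\varphi)=(\cos\varphi)I(X)+(\sin\varphi)J(X)$ and $$v'=v-\tfrac{1-\cos\theta}{2}(v-v_*)+\tfrac{\sin\theta}{2}\Gamma(v-v_*,\varphi),\qquad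 v'_*=v_*+\tfrac{1-\cos\theta}{2}(v-v_*)-\tfrac{\sin\theta}{2}\Gamma(v-v_*,\varphi).$$ *Weak solutions.* A weakly continuous family $(f_t)_{t\ge0}$ of probability measures on $\mathbb{R}^3$ is a weak solution if $\int v\,f_t(dv)=0$ and $\int|v|^2f_t(dv)=1$ for all $t\ge0$, and if for every $\phi\in C^2_b(\mathbb{R}^3)$ (bounded, with bounded derivatives of orders one and two) and every $t>0$, $$\frac{d}{dt}\int\phi(v)f_t(dv)=\int\!\!\int\left(\int_0^\pi\left(\int_0^{2\pi}[\phi(v')+\phi(v'_*)-\phi(v)-\phi(v_*)]\,|v-v_*|^\gamma d\varphi\right)\beta(\theta)d\theta\right)f_t(dv_*)f_t(dv),$$ where the integral over $(v,v_*)$ on the right-hand side converges absolutely. **(i) Creation.** Let $\rho=\min\{2\gamma/(2-\nu),2\}$. There are $T>0$ and $\sigma>0$, depending only on $\gamma,\nu,\kappa_1,\kappa_2$, such that every weak solution satisfies $$\sup_{t\in[0,T]}\int_{\mathbb{R}^3}\exp\!\left(\sigma t^{\rho/\gamma}|v|^\rho\right)f_t(dv)\le 4.$$ **(ii) Propagation.**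 For all $A>0$, $\sigma_0>0$ and $\rho\in(0,2]$ there is $\sigma>0$, depending only on $\gamma,\nu,\kappa_1,\kappa_2,\rho,\sigma_0,A$, such that for every weak solution $$\int_{\mathbb{R}^3}\exp(\sigma_0|v|^\rho)f_0(dv)\le A\quad\Longrightarrow\quad\sup_{t\ge0}\int_{\mathbb{R}^3}\exp(\sigma|v|^\rho)f_t(dv)\le 6.$$ -/

import Mathlib

open MeasureTheory

/-- The velocity space, with its Euclidean norm. -/
abbrev Velocity : Type := EuclideanSpace ℝ (Fin 3)

/-- The hypotheses on the collision kernel `B`, with angular part `β` (only the values of `β` on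
`(0, π]` matter). The factorization is asked for deviation angles `θ ∈ (0, π)`: at `θ = π` the
factor `sin θ` vanishes, whereas `β π` is positive. -/
structure IsHardPotential (γ ν κ₁ κ₂ : ℝ) (B : ℝ → ℝ → ℝ) (β : ℝ → ℝ) : Prop where
  measurable : Measurable β
  nonneg : ∀ θ ∈ Set.Ioc 0 Real.pi, 0 ≤ β θ
  factor : ∀ v w : Velocity, ∀ θ ∈ Set.Ioo 0 Real.pi,
    B ‖v - w‖ (Real.cos θ) * Real.sin θ = ‖v - w‖ ^ γ * β θ
  lower : ∀ θ ∈ Set.Ioc 0 Real.pi, κ₁ * θ ^ (-ν - 1) ≤ β θ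
  upper : ∀ θ ∈ Set.Ioc 0 Real.pi, β θ ≤ κ₂ * θ ^ (-ν - 1)

/-- `(X / |X|, I X / |X|, J X / |X|)` is an orthonormal basis for every `X ≠ 0`, and
`I 0 = J 0 = 0`. (Three orthonormal vectors form a basis in dimension three.) -/
structure IsFrame (I J : Velocity → Velocity) : Prop where
  orthonormal : ∀ X : Velocity, X ≠ 0 →
    Orthonormal ℝ ![‖X‖⁻¹ • X, ‖X‖⁻¹ • I X, ‖X‖⁻¹ • J X]
  left_zero : I 0 = 0
  right_zero : J 0 = 0

/-- `Γ(X, φ) = (cos φ) I(X) + (sin φ) J(X)`. -/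
noncomputable def frameRotation (I J : Velocity → Velocity) (X : Velocity) (φ : ℝ) : Velocity :=
  Real.cos φ • I X + Real.sin φ • J X

/-- The post-collisional velocity `v'` of a particle with velocity `v` that collides with a
particle with velocity `w`. -/
noncomputable def postVelocity (I J : Velocity → Velocity) (v w : Velocity) (θ φ : ℝ) : Velocity :=
  v - ((1 - Real.cos θ) / 2) • (v - w) + (Real.sin θ / 2) • frameRotation I J (v - w) φ

/-- The post-collisional velocity `v'_*` of the particle with velocity `w`. -/
noncomputable def postVelocityStar (I J : Velocity → Velocity) (v w : Velocity) (θ φ : ℝ) :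
    Velocity :=
  w + ((1 - Real.cos θ) / 2) • (v - w) - (Real.sin θ / 2) • frameRotation I J (v - w) φ

/-- The collision integral
`∫₀^π ∫₀^{2π} [ψ(v') + ψ(v'_*) - ψ(v) - ψ(w)] |v - w|^γ dφ β(θ) dθ`.
The integral in `φ` is performed first; for `ψ` of class `C²` with bounded derivatives, its value
is `O(θ²)`, so that the integral in `θ` converges absolutely. -/
noncomputable def collisionIntegral (γ : ℝ) (β : ℝ → ℝ) (I J : Velocity → Velocity)
    (ψ : Velocity → ℝ) (v w : Velocity) : ℝ :=
  ∫ θ in (0 : ℝ)..Real.pi,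
    (∫ φ in (0 : ℝ)..(2 * Real.pi),
      (ψ (postVelocity I J v w θ φ) + ψ (postVelocityStar I J v w θ φ) - ψ v - ψ w)
        * ‖v - w‖ ^ γ) * β θ

/-- The class `C²_b(ℝ³)`: twice continuously differentiable functions that are bounded together
with their derivatives of order one and two. -/
def IsCb2 (ψ : Velocity → ℝ) : Prop :=
  ContDiff ℝ 2 ψ ∧ ∀ k ≤ 2, ∃ C : ℝ, ∀ v, ‖iteratedFDeriv ℝ k ψ v‖ ≤ C

/-- Weak solutions `(f_t)_{t ≥ 0}` (the values of `f` at negative times play no role).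
`energy` forces `|v|²`, hence also `v`, to be integrable under `f_t`. The right-hand side of the
weak equation is asked to converge absolutely. The weak equation is asked at times `t > 0` only:
at `t = 0` its right-hand side can diverge when nothing beyond finite energy is known about `f_0`;
the initial condition is attained through weak continuity at `t = 0`. -/
structure IsWeakSolution (γ : ℝ) (β : ℝ → ℝ) (I J : Velocity → Velocity)
    (f : ℝ → ProbabilityMeasure Velocity) : Prop where
  weakly_continuous : ContinuousOn f (Set.Ici 0)
  momentum : ∀ t, 0 ≤ t → ∫ v, v ∂(f t : Measure Velocity) = 0
  energy : ∀ t, 0 ≤ t → ∫ v, ‖v‖ ^ 2 ∂(f t : Measure Velocity) = 1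
  integrable : ∀ ψ : Velocity → ℝ, IsCb2 ψ → ∀ t, 0 < t →
    Integrable (fun p : Velocity × Velocity => collisionIntegral γ β I J ψ p.1 p.2)
      ((f t : Measure Velocity).prod (f t : Measure Velocity))
  weak_eq : ∀ ψ : Velocity → ℝ, IsCb2 ψ → ∀ t, 0 < t →
    HasDerivAt (fun s => ∫ v, ψ v ∂(f s : Measure Velocity))
      (∫ v, ∫ w, collisionIntegral γ β I J ψ v w ∂(f t : Measure Velocity)
        ∂(f t : Measure Velocity)) t

/-- The exponential moment `∫ exp(a |v|^ρ) μ(dv)`, with values in `[0, ∞]`. -/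
noncomputable def expMoment (a ρ : ℝ) (μ : ProbabilityMeasure Velocity) : ENNReal :=
  ∫⁻ v, ENNReal.ofReal (Real.exp (a * ‖v‖ ^ ρ)) ∂(μ : Measure Velocity)

/-! Everything is tested on radial functions. With x = |v|², y = |w|² and u = sin²(θ/2), the
energies after a collision are (1 - u)x + uy + t and ux + (1 - u)y - t, where t is proportional to
cos φ and t² ≤ 4u(1 - u)xy (`IsFrame.exists_radial`). Averaging over φ removes whatever is linear in
t. A collision is therefore a convex mixing, which is a loss for a convex function of the energy,
plus a gain of second order in t.

The first half is qualitative: only the energy is known to be finite, and all moments have to be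
produced. The tests are atoms z (z/(n+z))^(q+1). They are convex, and they differ from z by a
function giving a `C²_b` test, so energy conservation makes them admissible. The atom at scale n
dissipates n |v|^γ (z/(n+z))^(q+2). Dyadic sums over n of n^α times the atoms rebuild |v|^(2+2α),
and the same sums of the dissipations rebuild |v|^(2+2α+γ). Integrating in time thus trades a finite
moment for a higher one at some later time (`IsWeakSolution.moment_step`). The gain must be
controlled by moments already known. This is possible high enough on the ladder of exponents
(`IsWeakSolution.collision_atom_le`). On the first rungs it is not, and the atom with q = 0, whose
explicit form gives a gain absorbed by its own loss, is used instead (`exists_sharp_dissipation`).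
The ladder yields all moments at positive times, or from time 0 if they are finite there. Letting n
tend to infinity then gives the moment equations for integer powers of |v|².

The second half is quantitative and does not see the sizes of these moments. The φ-average of (a + b
+ 2√(ab) cos φ)^p is a sum of squared binomial terms, and one binomial factor can be read as a
probability. With the weight θ^(-ν-1), gain and loss both have size p^(ν/2). Writing m_p for the
moment of |v|^(2p) and g_p for that of |v|^(2p+γ), this gives m_p' ≤ p^(ν/2) (C Σ binom(p,k) g_max
m_min + C m_p - c g_p) (`exists_moment_inequality`), max and min being those of k and p - k.

Multiply by a^p/(p!)^s with s = 2/ρ ≥ 1 and sum over p ≥ 1. These weights turn the binomial sum into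
a convolution, bounded by the sum E of the weighted m_p times the weighted dissipation. As long as E
≤ δ it is absorbed (`exists_sum_momentRate_le`), and a barrier argument keeps E below δ. For
propagation a is a small constant. For creation a = b τ^(2/γ), and differentiating a costs p m_p/τ;
interpolating against p^(ν/2) g_p leaves a remainder of size p^(p(2-ν)/γ), which (p!)^s compensates
when s ≥ (2-ν)/γ. Together with s ≥ 1 this is ρ = min(2γ/(2-ν), 2). Since b depends on no moment of
the solution, creation may be started at time t/2. Finally E controls the exponential moment
(`exp_le_three_add_sum`). -/

/-! ### The half-angle variable and polar coordinates. -/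

/-- `sin² (θ / 2)`. -/
noncomputable def halfSinSq (θ : ℝ) : ℝ := (1 - Real.cos θ) / 2

theorem halfSinSq_nonneg (θ : ℝ) : 0 ≤ halfSinSq θ := by
  unfold halfSinSq; linarith [Real.cos_le_one θ]

theorem halfSinSq_le_one (θ : ℝ) : halfSinSq θ ≤ 1 := by
  unfold halfSinSq; linarith [Real.neg_one_le_cos θ]

theorem continuous_halfSinSq : Continuous halfSinSq := by
  unfold halfSinSq; fun_prop

theorem sin_sq_eq_halfSinSq (θ : ℝ) :
    Real.sin θ ^ 2 = 4 * (halfSinSq θ * (1 - halfSinSq θ)) := by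
  unfold halfSinSq; linarith [Real.sin_sq_add_cos_sq θ]

theorem halfSinSq_eq (θ : ℝ) : halfSinSq θ = Real.sin (θ / 2) ^ 2 := by
  unfold halfSinSq
  have := Real.cos_sq (θ / 2)
  have h2 := Real.sin_sq_add_cos_sq (θ / 2)
  rw [show 2 * (θ / 2) = θ by ring] at this
  linarith

theorem halfSinSq_le (θ : ℝ) : halfSinSq θ ≤ θ ^ 2 / 4 := by
  unfold halfSinSq; linarith [@Real.one_sub_sq_div_two_le_cos θ]

theorem le_halfSinSq {θ : ℝ} (h0 : 0 ≤ θ) (h1 : θ ≤ Real.pi) :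
    θ ^ 2 / Real.pi ^ 2 ≤ halfSinSq θ := by
  rw [halfSinSq_eq]
  have := Real.mul_le_sin (x := θ / 2) (by linarith) (by linarith)
  have hp := Real.pi_pos
  calc θ ^ 2 / Real.pi ^ 2 = (2 / Real.pi * (θ / 2)) ^ 2 := by field_simp
    _ ≤ _ := by gcongr

/-- A pair of coordinates in polar form. -/
theorem exists_polar (P Q : ℝ) : ∃ R φ₀ : ℝ, 0 ≤ R ∧ R ^ 2 = P ^ 2 + Q ^ 2 ∧
    ∀ φ, Real.cos φ * P + Real.sin φ * Q = R * Real.cos (φ - φ₀) := by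
  refine ⟨‖(⟨P, Q⟩ : ℂ)‖, Complex.arg ⟨P, Q⟩, norm_nonneg _, ?_, fun φ => ?_⟩
  · rw [← Complex.normSq_eq_norm_sq, Complex.normSq_mk]; ring
  · have h1 := Complex.norm_mul_cos_arg ⟨P, Q⟩
    have h2 := Complex.norm_mul_sin_arg ⟨P, Q⟩
    rw [Real.cos_sub]
    simp only at h1 h2
    linear_combination (-Real.cos φ) * h1 - Real.sin φ * h2

/-! ### Energies after a collision. -/

section Geometry

variable {I J : Velocity → Velocity}

/-- The orthogonality relations of a frame and the decomposition of the collision. -/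
theorem IsFrame.exists_radial (hF : IsFrame I J) (v w : Velocity) :
    ∃ R φ₀ : ℝ, 0 ≤ R ∧ R ^ 2 ≤ ‖v‖ ^ 2 * ‖w‖ ^ 2 ∧ ∀ θ φ,
      ‖postVelocity I J v w θ φ‖ ^ 2 = (1 - halfSinSq θ) * ‖v‖ ^ 2 + halfSinSq θ * ‖w‖ ^ 2
        + Real.sin θ * R * Real.cos (φ - φ₀) ∧
      ‖postVelocityStar I J v w θ φ‖ ^ 2 = halfSinSq θ * ‖v‖ ^ 2 + (1 - halfSinSq θ) * ‖w‖ ^ 2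
        - Real.sin θ * R * Real.cos (φ - φ₀) := by
  by_cases hX : v - w = 0
  · refine ⟨0, 0, le_rfl, by rw [zero_pow two_ne_zero]; positivity, fun θ φ => ?_⟩
    have hvw : v = w := sub_eq_zero.mp hX
    subst hvw
    simp only [postVelocity, postVelocityStar, frameRotation, sub_self, hF.left_zero,
      hF.right_zero, smul_zero, add_zero, sub_zero]
    constructor <;> ring
  · have ho := hF.orthonormal _ hX
    set X := v - w with hXdef
    have hN : 0 < ‖X‖ := norm_pos_iff.mpr hX
    have key : ∀ a b : Velocity, inner ℝ (‖X‖⁻¹ • a) (‖X‖⁻¹ • b) = 0 → inner ℝ a b = 0 := by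
      intro a b h
      rw [real_inner_smul_left, real_inner_smul_right] at h
      simpa [hN.ne'] using h
    have h01 : inner ℝ X (I X) = 0 := key _ _ (by
      simpa using ho.2 (show (0 : Fin 3) ≠ 1 by decide))
    have h02 : inner ℝ X (J X) = 0 := key _ _ (by
      simpa using ho.2 (show (0 : Fin 3) ≠ 2 by decide))
    have h12 : inner ℝ (I X) (J X) = 0 := key _ _ (by
      simpa using ho.2 (show (1 : Fin 3) ≠ 2 by decide))
    have n1 : ‖I X‖ = ‖X‖ := by
      have := ho.1 1
      simp [norm_smul] at this
      field_simp at this; exact this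
    have n2 : ‖J X‖ = ‖X‖ := by
      have := ho.1 2
      simp [norm_smul] at this
      field_simp at this; exact this
    obtain ⟨R, φ₀, hR0, hR, hpol⟩ := exists_polar (inner ℝ v (I X)) (inner ℝ v (J X))
    have hbes : ‖X‖ ^ 2 * ‖v‖ ^ 2 ≥ (inner ℝ v X) ^ 2 + R ^ 2 := by
      have hb := ho.sum_inner_products_le (s := Finset.univ) v
      rw [Fin.sum_univ_three] at hb
      simp only [Matrix.cons_val_zero, Matrix.cons_val_one, Matrix.cons_val,
        real_inner_smul_left, Real.norm_eq_abs, sq_abs, mul_pow] at hb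
      rw [real_inner_comm, real_inner_comm v (I X), real_inner_comm v (J X)] at hb
      rw [hR]
      have e : ‖X‖ ^ 2 * ((‖X‖⁻¹) ^ 2 * inner ℝ v X ^ 2 + (‖X‖⁻¹) ^ 2 * inner ℝ v (I X) ^ 2
        + (‖X‖⁻¹) ^ 2 * inner ℝ v (J X) ^ 2) = inner ℝ v X ^ 2 + (inner ℝ v (I X) ^ 2
        + inner ℝ v (J X) ^ 2) := by field_simp; ring
      rw [← e]
      gcongr
    have hX2 : ‖X‖ ^ 2 = ‖v‖ ^ 2 - 2 * inner ℝ v w + ‖w‖ ^ 2 := norm_sub_sq_real v w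
    have hvX : inner ℝ v X = ‖v‖ ^ 2 - inner ℝ v w := by
      rw [hXdef, inner_sub_right, real_inner_self_eq_norm_sq]
    have hwX : inner ℝ w X = inner ℝ v w - ‖w‖ ^ 2 := by
      rw [hXdef, inner_sub_right, real_inner_self_eq_norm_sq, real_inner_comm]
    -- Bessel's inequality gives R² ≤ |X|²|v|² - ⟨v, X⟩², and with X = v - w the right-hand side is
    -- |v|²|w|² - ⟨v, w⟩².
    have hR2 : R ^ 2 ≤ ‖v‖ ^ 2 * ‖w‖ ^ 2 := by
      rw [hX2, hvX] at hbes
      nlinarith [sq_nonneg (inner ℝ v w)]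
    refine ⟨R, φ₀, hR0, hR2, fun θ φ => ?_⟩
    set Γ := frameRotation I J X φ with hΓ
    have hΓX : inner ℝ X Γ = 0 := by
      simp [hΓ, frameRotation, inner_add_right, real_inner_smul_right, h01, h02]
    have hΓv : inner ℝ v Γ = R * Real.cos (φ - φ₀) := by
      rw [← hpol]
      simp [hΓ, frameRotation, inner_add_right, real_inner_smul_right]
    have hΓw : inner ℝ w Γ = R * Real.cos (φ - φ₀) := by
      rw [← hΓv, ← sub_eq_zero, ← neg_eq_zero, neg_sub, ← inner_sub_left]; exact hΓX
    have hΓn : ‖Γ‖ ^ 2 = ‖X‖ ^ 2 := by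
      rw [hΓ, frameRotation, norm_add_sq_real, real_inner_smul_left, real_inner_smul_right, h12,
        norm_smul, norm_smul, n1, n2, mul_pow, mul_pow, Real.norm_eq_abs, Real.norm_eq_abs, sq_abs,
        sq_abs]
      linear_combination ‖X‖ ^ 2 * Real.sin_sq_add_cos_sq φ
    have hs := sin_sq_eq_halfSinSq θ
    set u := halfSinSq θ with hu
    have e1 : postVelocity I J v w θ φ = v + (-(u • X) + (Real.sin θ / 2) • Γ) := by
      simp only [postVelocity, hu, halfSinSq, hΓ, hXdef]; abel
    have e2 : postVelocityStar I J v w θ φ = w + ((u • X) - (Real.sin θ / 2) • Γ) := by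
      simp only [postVelocityStar, hu, halfSinSq, hΓ, hXdef]; abel
    have hd : ‖u • X - (Real.sin θ / 2) • Γ‖ ^ 2 = u * ‖X‖ ^ 2 := by
      rw [norm_sub_sq_real, real_inner_smul_left, real_inner_smul_right, hΓX, norm_smul, norm_smul,
        mul_pow, mul_pow, hΓn, Real.norm_eq_abs, Real.norm_eq_abs, sq_abs, sq_abs]
      linear_combination ‖X‖ ^ 2 / 4 * hs
    have hd' : ‖-(u • X) + (Real.sin θ / 2) • Γ‖ ^ 2 = u * ‖X‖ ^ 2 := by
      rw [← hd, ← norm_neg (u • X - _)]; congr 2; abel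
    constructor
    · rw [e1, norm_add_sq_real, hd', inner_add_right, inner_neg_right, real_inner_smul_right,
        real_inner_smul_right, hΓv, hvX, hX2]
      ring
    · rw [e2, norm_add_sq_real, hd, inner_sub_right, real_inner_smul_right,
        real_inner_smul_right, hΓw, hwX, hX2]
      ring

end Geometry

/-! ### Averages over the azimuthal angle. -/

/-- The average over `φ` of the collisional increment of the radial function `g (|v|²)`, as a
function of the energies `x`, `y` of the particles. -/
noncomputable def angularAverage (g : ℝ → ℝ) (x y R θ : ℝ) : ℝ :=
  ∫ φ in (0 : ℝ)..(2 * Real.pi),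
    (g ((1 - halfSinSq θ) * x + halfSinSq θ * y + Real.sin θ * R * Real.cos φ)
      + g (halfSinSq θ * x + (1 - halfSinSq θ) * y - Real.sin θ * R * Real.cos φ) - g x - g y)

/-- The phase of the frame disappears by periodicity in φ. The radius R is chosen before g, so that
collision integrals of different radial functions at the same pair (v, w) can be added and
subtracted. -/
theorem IsFrame.exists_collisionIntegral_eq {I J : Velocity → Velocity} (hF : IsFrame I J) (γ : ℝ)
    (β : ℝ → ℝ) (v w : Velocity) :
    ∃ R : ℝ, 0 ≤ R ∧ R ^ 2 ≤ ‖v‖ ^ 2 * ‖w‖ ^ 2 ∧ ∀ g : ℝ → ℝ,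
      collisionIntegral γ β I J (fun v => g (‖v‖ ^ 2)) v w =
        ‖v - w‖ ^ γ * ∫ θ in (0 : ℝ)..Real.pi, angularAverage g (‖v‖ ^ 2) (‖w‖ ^ 2) R θ * β θ := by
  obtain ⟨R, φ₀, hR0, hR, h⟩ := hF.exists_radial v w
  refine ⟨R, hR0, hR, fun g => ?_⟩
  unfold collisionIntegral
  rw [← intervalIntegral.integral_const_mul]
  congr 1
  ext θ
  rw [intervalIntegral.integral_mul_const]
  simp only [(h θ _).1, (h θ _).2]
  set G : ℝ → ℝ := fun φ =>
    (g ((1 - halfSinSq θ) * ‖v‖ ^ 2 + halfSinSq θ * ‖w‖ ^ 2 + Real.sin θ * R * Real.cos φ)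
      + g (halfSinSq θ * ‖v‖ ^ 2 + (1 - halfSinSq θ) * ‖w‖ ^ 2 - Real.sin θ * R * Real.cos φ)
      - g (‖v‖ ^ 2) - g (‖w‖ ^ 2)) with hG
  have hper : Function.Periodic G (2 * Real.pi) := by
    intro φ; simp [hG, Real.cos_add_two_pi]
  have : (∫ φ in (0 : ℝ)..(2 * Real.pi), G (φ - φ₀)) = ∫ φ in (0 : ℝ)..(2 * Real.pi), G φ := by
    rw [intervalIntegral.integral_comp_sub_right]
    have := hper.intervalIntegral_add_eq (0 - φ₀) 0
    rw [zero_add] at this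
    rw [← this]
    congr 1
    ring
  have e : angularAverage g (‖v‖ ^ 2) (‖w‖ ^ 2) R θ = ∫ φ in (0 : ℝ)..(2 * Real.pi), G φ := rfl
  rw [e, ← this]
  ring

section AngularAverage

variable {x y R : ℝ}

theorem collision_shift_sq_le (hR : R ^ 2 ≤ x * y) (θ φ : ℝ) :
    (Real.sin θ * R * Real.cos φ) ^ 2 ≤ 4 * (halfSinSq θ * (1 - halfSinSq θ)) * (x * y) := by
  rw [mul_pow, mul_pow, sin_sq_eq_halfSinSq]
  have h0 := halfSinSq_nonneg θ
  have h1 := halfSinSq_le_one θ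
  have hc : Real.cos φ ^ 2 ≤ 1 := Real.cos_sq_le_one φ
  have : 0 ≤ halfSinSq θ * (1 - halfSinSq θ) := mul_nonneg h0 (by linarith)
  have hR2 : 0 ≤ R ^ 2 := sq_nonneg R
  calc 4 * (halfSinSq θ * (1 - halfSinSq θ)) * R ^ 2 * Real.cos φ ^ 2
      ≤ 4 * (halfSinSq θ * (1 - halfSinSq θ)) * R ^ 2 * 1 := by gcongr
    _ ≤ _ := by rw [mul_one]; gcongr

/-- This is 4ab ≤ (a + b)² applied to the two summands of each mixed energy. It ensures that radial
profiles are only evaluated on [0, ∞), which is why hypotheses on profiles are restricted to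
nonnegative arguments. -/
theorem neg_le_of_sq_le_mixing {u t : ℝ} (hx : 0 ≤ x) (hy : 0 ≤ y) (h0 : 0 ≤ u) (h1 : u ≤ 1)
    (ht : t ^ 2 ≤ 4 * (u * (1 - u)) * (x * y)) :
    0 ≤ (1 - u) * x + u * y + t ∧ 0 ≤ u * x + (1 - u) * y - t := by
  have h1' : 0 ≤ 1 - u := by linarith
  have a1 : 0 ≤ (1 - u) * x + u * y := by positivity
  have a2 : 0 ≤ u * x + (1 - u) * y := by positivity
  constructor
  · have : |t| ≤ (1 - u) * x + u * y :=
      abs_le_of_sq_le_sq (by nlinarith [sq_nonneg ((1 - u) * x - u * y)]) a1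
    linarith [(abs_le.mp this).1]
  · have : |t| ≤ u * x + (1 - u) * y :=
      abs_le_of_sq_le_sq (by nlinarith [sq_nonneg (u * x - (1 - u) * y)]) a2
    linarith [(abs_le.mp this).2]

theorem angularAverage_congr {g g' : ℝ → ℝ} (hx : 0 ≤ x) (hy : 0 ≤ y) (hR : R ^ 2 ≤ x * y)
    (h : ∀ z, 0 ≤ z → g z = g' z) (θ : ℝ) :
    angularAverage g x y R θ = angularAverage g' x y R θ := by
  unfold angularAverage
  congr 1
  ext φ
  have := neg_le_of_sq_le_mixing hx hy (halfSinSq_nonneg θ) (halfSinSq_le_one θ)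
    (collision_shift_sq_le hR θ φ)
  rw [h _ this.1, h _ this.2, h _ hx, h _ hy]

theorem continuous_extend_nonneg {g : ℝ → ℝ} (hg : ContinuousOn g (Set.Ici 0)) :
    Continuous fun z => g (max z 0) :=
  hg.comp_continuous (by fun_prop) fun z => le_max_right z 0

theorem continuous_collision_increment {g : ℝ → ℝ} (hg : Continuous g) (x y R θ : ℝ) :
    Continuous fun φ =>
      g ((1 - halfSinSq θ) * x + halfSinSq θ * y + Real.sin θ * R * Real.cos φ)
      + g (halfSinSq θ * x + (1 - halfSinSq θ) * y - Real.sin θ * R * Real.cos φ) - g x - g y := by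
  have h1 : Continuous fun φ => (1 - halfSinSq θ) * x + halfSinSq θ * y
      + Real.sin θ * R * Real.cos φ := by fun_prop
  have h2 : Continuous fun φ => halfSinSq θ * x + (1 - halfSinSq θ) * y
      - Real.sin θ * R * Real.cos φ := by fun_prop
  exact (((hg.comp h1).add (hg.comp h2)).sub continuous_const).sub continuous_const

theorem continuous_angularAverage {g : ℝ → ℝ} (hg : ContinuousOn g (Set.Ici 0)) (hx : 0 ≤ x)
    (hy : 0 ≤ y) (hR : R ^ 2 ≤ x * y) : Continuous (angularAverage g x y R) := by
  have e : angularAverage g x y R = angularAverage (fun z => g (max z 0)) x y R := by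
    ext θ
    exact angularAverage_congr hx hy hR (fun z hz => by rw [max_eq_left hz]) θ
  rw [e]
  have hG := continuous_extend_nonneg hg
  have hu := continuous_halfSinSq
  unfold angularAverage
  apply intervalIntegral.continuous_parametric_intervalIntegral_of_continuous'
  have h1 : Continuous fun p : ℝ × ℝ => (1 - halfSinSq p.1) * x + halfSinSq p.1 * y
      + Real.sin p.1 * R * Real.cos p.2 := by fun_prop
  have h2 : Continuous fun p : ℝ × ℝ => halfSinSq p.1 * x + (1 - halfSinSq p.1) * y
      - Real.sin p.1 * R * Real.cos p.2 := by fun_prop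
  exact (((hG.comp h1).add (hG.comp h2)).sub continuous_const).sub continuous_const

/-- Only the deviation from an affine function of the shift contributes to the average. -/
theorem angularAverage_le {g : ℝ → ℝ} {A b θ : ℝ} (hg : ContinuousOn g (Set.Ici 0)) (hx : 0 ≤ x)
    (hy : 0 ≤ y) (hR : R ^ 2 ≤ x * y)
    (h : ∀ t, t ^ 2 ≤ 4 * (halfSinSq θ * (1 - halfSinSq θ)) * (x * y) →
      0 ≤ (1 - halfSinSq θ) * x + halfSinSq θ * y + t →
      0 ≤ halfSinSq θ * x + (1 - halfSinSq θ) * y - t →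
      g ((1 - halfSinSq θ) * x + halfSinSq θ * y + t)
        + g (halfSinSq θ * x + (1 - halfSinSq θ) * y - t) - g x - g y ≤ A + b * t) :
    angularAverage g x y R θ ≤ 2 * Real.pi * A := by
  have hG := continuous_extend_nonneg hg
  rw [angularAverage_congr (g' := fun z => g (max z 0)) hx hy hR
    (fun z hz => by rw [max_eq_left hz]) θ]
  have hp := Real.pi_pos
  have e : (∫ φ in (0 : ℝ)..(2 * Real.pi), (A + b * (Real.sin θ * R * Real.cos φ)))
      = 2 * Real.pi * A := by
    rw [intervalIntegral.integral_add intervalIntegrable_const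
      (Continuous.intervalIntegrable (by fun_prop) _ _)]
    simp [intervalIntegral.integral_const_mul]
  rw [← e]
  unfold angularAverage
  apply intervalIntegral.integral_mono_on (by linarith)
  · exact (continuous_collision_increment hG x y R θ).intervalIntegrable _ _
  · exact Continuous.intervalIntegrable (by fun_prop) _ _
  · intro φ _
    have ht := collision_shift_sq_le hR θ φ
    have := neg_le_of_sq_le_mixing hx hy (halfSinSq_nonneg θ) (halfSinSq_le_one θ) ht
    have h' := h _ ht this.1 this.2
    simpa [max_eq_left this.1, max_eq_left this.2, max_eq_left hx, max_eq_left hy] using h'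

theorem angularAverage_neg (g : ℝ → ℝ) (x y R θ : ℝ) :
    angularAverage (fun z => -g z) x y R θ = -angularAverage g x y R θ := by
  unfold angularAverage
  rw [← intervalIntegral.integral_neg]
  congr 1; ext φ; ring

/-- Energy conservation: the two energies after the collision add up to x + y, so the identity
profile contributes nothing. -/
theorem angularAverage_affine_sub (g : ℝ → ℝ) (x y R θ : ℝ) :
    angularAverage (fun z => z - g z) x y R θ = -angularAverage g x y R θ := by
  unfold angularAverage
  rw [← intervalIntegral.integral_neg]
  congr 1; ext φ; ring

theorem angularAverage_const_mul (k : ℝ) (g : ℝ → ℝ) (x y R θ : ℝ) :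
    angularAverage (fun z => k * g z) x y R θ = k * angularAverage g x y R θ := by
  unfold angularAverage
  rw [← intervalIntegral.integral_const_mul]
  congr 1; ext φ; ring

theorem angularAverage_sub {g g' : ℝ → ℝ} (hg : ContinuousOn g (Set.Ici 0))
    (hg' : ContinuousOn g' (Set.Ici 0)) (hx : 0 ≤ x)
    (hy : 0 ≤ y) (hR : R ^ 2 ≤ x * y) (θ : ℝ) :
    angularAverage (fun z => g z - g' z) x y R θ
      = angularAverage g x y R θ - angularAverage g' x y R θ := by
  have hG := continuous_extend_nonneg hg
  have hG' := continuous_extend_nonneg hg'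
  rw [angularAverage_congr (g := g) (g' := fun z => g (max z 0)) hx hy hR
    (fun z hz => by rw [max_eq_left hz]) θ, angularAverage_congr (g := g')
    (g' := fun z => g' (max z 0)) hx hy hR (fun z hz => by rw [max_eq_left hz]) θ,
    angularAverage_congr (g' := fun z => g (max z 0) - g' (max z 0)) hx hy hR
    (fun z hz => by rw [max_eq_left hz]) θ]
  unfold angularAverage
  rw [← intervalIntegral.integral_sub
    ((continuous_collision_increment hG x y R θ).intervalIntegrable _ _)
    ((continuous_collision_increment hG' x y R θ).intervalIntegrable _ _)]
  congr 1; ext φ; ring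

/-- First order Taylor estimate under a bound on the second derivative on `[0, S]`. -/
theorem abs_sub_sub_deriv_mul_le {g g₁ g₂ : ℝ → ℝ} {S D z z' : ℝ}
    (h₁ : ∀ z, 0 ≤ z → HasDerivAt g (g₁ z) z) (h₂ : ∀ z, 0 ≤ z → HasDerivAt g₁ (g₂ z) z)
    (hD : ∀ z, 0 ≤ z → z ≤ S → |g₂ z| ≤ D) (hz : 0 ≤ z) (hzS : z ≤ S) (hz' : 0 ≤ z')
    (hzS' : z' ≤ S) :
    |g z' - g z - g₁ z * (z' - z)| ≤ D * (z' - z) ^ 2 := by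
  have hsub : Set.uIcc z z' ⊆ Set.Icc 0 S := by
    intro r hr
    rw [Set.mem_uIcc] at hr
    constructor <;> rcases hr with hr | hr <;> linarith
  have hD0 : 0 ≤ D := (abs_nonneg _).trans (hD z hz hzS)
  have b1 : ∀ r ∈ Set.uIcc z z', |g₁ r - g₁ z| ≤ D * |z' - z| := by
    intro r hr
    have := (convex_uIcc z z').norm_image_sub_le_of_norm_hasDerivWithin_le
      (f := g₁) (f' := g₂) (C := D) (x := z) (y := r)
      (fun q hq => (h₂ q (hsub hq).1).hasDerivWithinAt)
      (fun q hq => hD q (hsub hq).1 (hsub hq).2) Set.left_mem_uIcc hr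
    rw [Real.norm_eq_abs, Real.norm_eq_abs] at this
    refine this.trans ?_
    exact mul_le_mul_of_nonneg_left (Set.abs_sub_left_of_mem_uIcc hr) hD0
  have := (convex_uIcc z z').norm_image_sub_le_of_norm_hasDerivWithin_le
      (f := fun r => g r - g₁ z * r) (f' := fun r => g₁ r - g₁ z * 1) (C := D * |z' - z|) (x := z)
      (y := z') (fun q hq => ((h₁ q (hsub hq).1).sub ((hasDerivAt_id q).const_mul _)).hasDerivWithinAt)
      (fun q hq => by rw [mul_one]; exact b1 q hq) Set.left_mem_uIcc Set.right_mem_uIcc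
  rw [Real.norm_eq_abs, Real.norm_eq_abs, mul_assoc, ← abs_mul, abs_mul_self] at this
  calc |g z' - g z - g₁ z * (z' - z)| = |g z' - g₁ z * z' - (g z - g₁ z * z)| := by
        congr 1; ring
    _ ≤ _ := this
    _ = _ := by ring

/-- Taylor's formula at x and at y. The displacements are ∓u(x - y) ± t: their squares are at most
4u(x + y)², and the first-order part is (g₁ x - g₁ y)(t - u(x - y)), where the t term averages to
zero and the other is of order u. The factor u makes the θ-integral against θ^(-ν-1) converge. -/
theorem angularAverage_le_of_deriv {g g₁ g₂ : ℝ → ℝ} {D : ℝ}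
    (h₁ : ∀ z, 0 ≤ z → HasDerivAt g (g₁ z) z) (h₂ : ∀ z, 0 ≤ z → HasDerivAt g₁ (g₂ z) z)
    (hx : 0 ≤ x) (hy : 0 ≤ y) (hR : R ^ 2 ≤ x * y)
    (hD : ∀ z, 0 ≤ z → z ≤ x + y → |g₂ z| ≤ D) (θ : ℝ) :
    angularAverage g x y R θ ≤ 2 * Real.pi * (15 * D * (x + y) ^ 2) * halfSinSq θ := by
  have hg : ContinuousOn g (Set.Ici 0) := fun z hz => (h₁ z hz).continuousAt.continuousWithinAt
  have hu0 := halfSinSq_nonneg θ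
  have hu1 := halfSinSq_le_one θ
  set u := halfSinSq θ with hu
  have hD0 : 0 ≤ D := (abs_nonneg _).trans (hD x hx (by linarith))
  rw [mul_assoc]
  apply angularAverage_le (b := g₁ x - g₁ y) hg hx hy hR
  intro t ht p1 p2
  rw [← hu] at ht p1 p2 ⊢
  have t1 := abs_sub_sub_deriv_mul_le (S := x + y) (z := x) (z' := (1 - u) * x + u * y + t) h₁ h₂ hD
    hx (by linarith) p1 (by linarith)
  have t2 := abs_sub_sub_deriv_mul_le (S := x + y) (z := y) (z' := u * x + (1 - u) * y - t) h₁ h₂ hD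
    hy (by linarith) p2 (by linarith)
  have t3 : |g₁ x - g₁ y| ≤ D * |x - y| := by
    have := (convex_Icc 0 (x + y)).norm_image_sub_le_of_norm_hasDerivWithin_le
      (f := g₁) (f' := g₂) (C := D) (x := y) (y := x)
      (fun q hq => (h₂ q hq.1).hasDerivWithinAt)
      (fun q hq => hD q hq.1 hq.2) ⟨hy, by linarith⟩ ⟨hx, by linarith⟩
    simpa [Real.norm_eq_abs] using this
  have t4 : -(g₁ x - g₁ y) * (x - y) ≤ D * (x - y) ^ 2 := by
    calc -(g₁ x - g₁ y) * (x - y) ≤ |-(g₁ x - g₁ y) * (x - y)| := le_abs_self _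
      _ = |g₁ x - g₁ y| * |x - y| := by rw [abs_mul, abs_neg]
      _ ≤ D * |x - y| * |x - y| := by gcongr
      _ = D * (x - y) ^ 2 := by rw [mul_assoc, abs_mul_abs_self]; ring
  have s1 := (abs_le.mp t1).2
  have s2 := (abs_le.mp t2).2
  have hxy : (x - y) ^ 2 ≤ (x + y) ^ 2 := by nlinarith [mul_nonneg hx hy]
  have hxy2 : 4 * (x * y) ≤ (x + y) ^ 2 := by nlinarith [sq_nonneg (x - y)]
  have q : ((1 - u) * x + u * y + t - x) ^ 2 ≤ 4 * u * (x + y) ^ 2 := by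
    have e : (1 - u) * x + u * y + t - x = -(u * (x - y)) + t := by ring
    rw [e]
    calc (-(u * (x - y)) + t) ^ 2 ≤ 2 * (u ^ 2 * (x - y) ^ 2) + 2 * t ^ 2 := by
          nlinarith [sq_nonneg (u * (x - y) + t)]
      _ ≤ 2 * (u * (x + y) ^ 2) + 2 * (u * (x + y) ^ 2) := by
          have : u ^ 2 ≤ u := by nlinarith
          have k1 : u ^ 2 * (x - y) ^ 2 ≤ u * (x + y) ^ 2 := by gcongr
          have k2 : t ^ 2 ≤ u * (x + y) ^ 2 := by
            refine ht.trans ?_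
            calc 4 * (u * (1 - u)) * (x * y) = u * (1 - u) * (4 * (x * y)) := by ring
              _ ≤ u * 1 * (x + y) ^ 2 := by
                gcongr
                linarith
              _ = _ := by ring
          linarith
      _ = _ := by ring
  have q' : (u * x + (1 - u) * y - t - y) ^ 2 ≤ 4 * u * (x + y) ^ 2 := by
    calc (u * x + (1 - u) * y - t - y) ^ 2 = ((1 - u) * x + u * y + t - x) ^ 2 := by ring
      _ ≤ _ := q
  have r1 : D * ((1 - u) * x + u * y + t - x) ^ 2 ≤ D * (4 * u * (x + y) ^ 2) := by gcongr
  have r2 : D * (u * x + (1 - u) * y - t - y) ^ 2 ≤ D * (4 * u * (x + y) ^ 2) := by gcongr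
  have r3 : u * (-(g₁ x - g₁ y) * (x - y)) ≤ u * (D * (x + y) ^ 2) := by
    exact mul_le_mul_of_nonneg_left
      (t4.trans (mul_le_mul_of_nonneg_left hxy hD0)) hu0
  have r0 : 0 ≤ D * (u * (x + y) ^ 2) := by positivity
  nlinarith

theorem abs_angularAverage_le_of_deriv {g g₁ g₂ : ℝ → ℝ} {D : ℝ}
    (h₁ : ∀ z, 0 ≤ z → HasDerivAt g (g₁ z) z) (h₂ : ∀ z, 0 ≤ z → HasDerivAt g₁ (g₂ z) z)
    (hx : 0 ≤ x) (hy : 0 ≤ y) (hR : R ^ 2 ≤ x * y)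
    (hD : ∀ z, 0 ≤ z → z ≤ x + y → |g₂ z| ≤ D) (θ : ℝ) :
    |angularAverage g x y R θ| ≤ 2 * Real.pi * (15 * D * (x + y) ^ 2) * halfSinSq θ := by
  rw [abs_le]
  constructor
  · have := angularAverage_le_of_deriv (g := fun z => -g z) (g₁ := fun z => -g₁ z)
      (g₂ := fun z => -g₂ z) (fun z hz => (h₁ z hz).neg) (fun z hz => (h₂ z hz).neg) hx hy hR
      (fun z hz hz' => by rw [abs_neg]; exact hD z hz hz') θ
    rw [angularAverage_neg] at this
    linarith
  · exact angularAverage_le_of_deriv h₁ h₂ hx hy hR hD θ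

end AngularAverage

/-! ### Integrals against the singular angular kernel. -/

section AngularIntegral

variable {γ ν κ₁ κ₂ : ℝ} {B : ℝ → ℝ → ℝ} {β : ℝ → ℝ}

/-- Since sin²(θ/2) ≤ θ²/4, the integrand is dominated by a multiple of θ^(1-ν), integrable at 0
because ν < 2. -/
theorem intervalIntegrable_mul_rpow {f : ℝ → ℝ} {C : ℝ} (hν : ν < 2) (hf : Continuous f)
    (h : ∀ θ ∈ Set.Ioc 0 Real.pi, |f θ| ≤ C * halfSinSq θ) :
    IntervalIntegrable (fun θ => f θ * θ ^ (-ν - 1)) volume 0 Real.pi := by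
  have hC : 0 ≤ C := by
    have h1 := h Real.pi ⟨Real.pi_pos, le_rfl⟩
    have : halfSinSq Real.pi = 1 := by simp [halfSinSq]
    rw [this, mul_one] at h1
    exact (abs_nonneg _).trans h1
  have hi : IntervalIntegrable (fun θ : ℝ => C / 4 * θ ^ (1 - ν)) volume 0 Real.pi :=
    (intervalIntegral.intervalIntegrable_rpow' (by linarith)).const_mul _
  refine hi.mono_fun' ?_ ?_
  · exact (hf.aestronglyMeasurable).mul (Measurable.aestronglyMeasurable (by fun_prop))
  · rw [Set.uIoc_of_le Real.pi_pos.le]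
    refine (ae_restrict_iff' measurableSet_Ioc).mpr (ae_of_all _ fun θ hθ => ?_)
    have hw : 0 ≤ θ ^ (-ν - 1) := Real.rpow_nonneg hθ.1.le _
    simp only [norm_mul, Real.norm_eq_abs, abs_of_nonneg hw]
    calc |f θ| * θ ^ (-ν - 1) ≤ C * (θ ^ 2 / 4) * θ ^ (-ν - 1) := by
          gcongr; exact (h θ hθ).trans (by gcongr; exact halfSinSq_le θ)
      _ = C / 4 * (θ ^ (2 : ℝ) * θ ^ (-ν - 1)) := by rw [Real.rpow_two]; ring
      _ = C / 4 * θ ^ (1 - ν) := by rw [← Real.rpow_add hθ.1]; ring_nf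

theorem IsHardPotential.intervalIntegrable_mul (hB : IsHardPotential γ ν κ₁ κ₂ B β) {f : ℝ → ℝ}
    {C : ℝ} (hν : ν < 2) (hf : Continuous f)
    (h : ∀ θ ∈ Set.Ioc 0 Real.pi, |f θ| ≤ C * halfSinSq θ) :
    IntervalIntegrable (fun θ => f θ * β θ) volume 0 Real.pi := by
  have hi := ((intervalIntegrable_mul_rpow hν hf h).norm).const_mul κ₂
  refine hi.mono_fun' ((hf.aestronglyMeasurable).mul hB.measurable.aestronglyMeasurable) ?_
  rw [Set.uIoc_of_le Real.pi_pos.le]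
  refine (ae_restrict_iff' measurableSet_Ioc).mpr (ae_of_all _ fun θ hθ => ?_)
  have hw : 0 ≤ θ ^ (-ν - 1) := Real.rpow_nonneg hθ.1.le _
  simp only [norm_mul, Real.norm_eq_abs, abs_of_nonneg hw, abs_of_nonneg (hB.nonneg θ hθ)]
  calc |f θ| * β θ ≤ |f θ| * (κ₂ * θ ^ (-ν - 1)) := by gcongr; exact hB.upper θ hθ
    _ = _ := by ring

/-- Comparison of a collision integral with a loss and a gain term. -/
theorem IsHardPotential.integral_le (hB : IsHardPotential γ ν κ₁ κ₂ B β) (hν : ν < 2)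
    {A L G : ℝ → ℝ} {CA CL CG : ℝ}
    (hA : Continuous A) (hL : Continuous L) (hG : Continuous G)
    (hA' : ∀ θ ∈ Set.Ioc 0 Real.pi, |A θ| ≤ CA * halfSinSq θ)
    (hL0 : ∀ θ ∈ Set.Ioc 0 Real.pi, 0 ≤ L θ)
    (hL' : ∀ θ ∈ Set.Ioc 0 Real.pi, L θ ≤ CL * halfSinSq θ)
    (hG0 : ∀ θ ∈ Set.Ioc 0 Real.pi, 0 ≤ G θ)
    (hG' : ∀ θ ∈ Set.Ioc 0 Real.pi, G θ ≤ CG * halfSinSq θ)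
    (h : ∀ θ ∈ Set.Ioc 0 Real.pi, A θ ≤ G θ - L θ) :
    ∫ θ in (0 : ℝ)..Real.pi, A θ * β θ ≤
      κ₂ * (∫ θ in (0 : ℝ)..Real.pi, G θ * θ ^ (-ν - 1))
        - κ₁ * ∫ θ in (0 : ℝ)..Real.pi, L θ * θ ^ (-ν - 1) := by
  have iG := intervalIntegrable_mul_rpow hν hG
    (fun θ hθ => by rw [abs_of_nonneg (hG0 θ hθ)]; exact hG' θ hθ)
  have iL := intervalIntegrable_mul_rpow hν hL
    (fun θ hθ => by rw [abs_of_nonneg (hL0 θ hθ)]; exact hL' θ hθ)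
  rw [← intervalIntegral.integral_const_mul, ← intervalIntegral.integral_const_mul,
    ← intervalIntegral.integral_sub (iG.const_mul _) (iL.const_mul _)]
  refine intervalIntegral.integral_mono_on_of_le_Ioo Real.pi_pos.le
    (hB.intervalIntegrable_mul hν hA hA') ((iG.const_mul _).sub (iL.const_mul _)) ?_
  intro θ hθ'
  have hθ : θ ∈ Set.Ioc 0 Real.pi := ⟨hθ'.1, hθ'.2.le⟩
  have b0 := hB.nonneg θ hθ
  have b1 := hB.lower θ hθ
  have b2 := hB.upper θ hθ
  have m1 : L θ * (κ₁ * θ ^ (-ν - 1)) ≤ L θ * β θ := mul_le_mul_of_nonneg_left b1 (hL0 θ hθ)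
  have m2 : G θ * β θ ≤ G θ * (κ₂ * θ ^ (-ν - 1)) := mul_le_mul_of_nonneg_left b2 (hG0 θ hθ)
  have m3 : A θ * β θ ≤ (G θ - L θ) * β θ := mul_le_mul_of_nonneg_right (h θ hθ) b0
  linarith

/-- `∫₀^π sin²(θ/2) θ^(-ν-1) dθ`. -/
noncomputable def angularMass (ν : ℝ) : ℝ :=
  ∫ θ in (0 : ℝ)..Real.pi, halfSinSq θ * θ ^ (-ν - 1)

/-- `∫₀^π sin²(θ/2) cos²(θ/2) θ^(-ν-1) dθ`. -/
noncomputable def angularSpread (ν : ℝ) : ℝ :=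
  ∫ θ in (0 : ℝ)..Real.pi, (halfSinSq θ * (1 - halfSinSq θ)) * θ ^ (-ν - 1)

theorem angularMass_nonneg (ν : ℝ) : 0 ≤ angularMass ν :=
  intervalIntegral.integral_nonneg Real.pi_pos.le fun θ hθ =>
    mul_nonneg (halfSinSq_nonneg θ) (Real.rpow_nonneg hθ.1 _)

theorem halfSinSq_mem_Ioo {θ : ℝ} (hθ : θ ∈ Set.Ioo 0 Real.pi) :
    0 < halfSinSq θ ∧ halfSinSq θ < 1 := by
  have hs := Real.sin_pos_of_mem_Ioo hθ
  have := sin_sq_eq_halfSinSq θ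
  have h2 : 0 < halfSinSq θ * (1 - halfSinSq θ) := by
    have : 0 < Real.sin θ ^ 2 := by positivity
    linarith
  have h0 := halfSinSq_nonneg θ
  constructor
  · exact lt_of_le_of_ne h0 (by intro h; rw [← h] at h2; simp at h2)
  · by_contra hc
    push Not at hc
    have := mul_nonneg h0 (by linarith : 0 ≤ halfSinSq θ - 1)
    linarith

theorem angularSpread_pos (hν : ν < 2) : 0 < angularSpread ν := by
  apply intervalIntegral.intervalIntegral_pos_of_pos_on _ _ Real.pi_pos
  · apply intervalIntegrable_mul_rpow (C := 1) hν
    · have := continuous_halfSinSq; fun_prop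
    · intro θ _
      have h0 := halfSinSq_nonneg θ
      have h1 := halfSinSq_le_one θ
      rw [abs_of_nonneg (mul_nonneg h0 (by linarith))]
      nlinarith
  · intro θ hθ
    have := halfSinSq_mem_Ioo hθ
    have hw : 0 < θ ^ (-ν - 1) := Real.rpow_pos_of_pos hθ.1 _
    have : 0 < 1 - halfSinSq θ := by linarith
    exact mul_pos (mul_pos (by tauto) this) hw

end AngularIntegral

/-! ### Radial test functions of class `C²_b`. -/

theorem norm_toDual_le_one : ‖(innerSL ℝ : Velocity →L[ℝ] Velocity →L[ℝ] ℝ)‖ ≤ 1 :=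
  ContinuousLinearMap.opNorm_le_bound _ zero_le_one fun v => by rw [innerSL_apply_norm, one_mul]

theorem hasFDerivAt_radial {g g₁ : ℝ → ℝ} (h₁ : ∀ z, 0 ≤ z → HasDerivAt g (g₁ z) z)
    (v : Velocity) :
    HasFDerivAt (fun v : Velocity => g (‖v‖ ^ 2)) ((2 * g₁ (‖v‖ ^ 2)) • innerSL ℝ v) v := by
  have := (h₁ (‖v‖ ^ 2) (by positivity)).comp_hasFDerivAt v
    (hasStrictFDerivAt_norm_sq v).hasFDerivAt
  refine this.congr_fderiv ?_
  ext w
  simp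
  ring

/-- A criterion for radial functions to be of class `C²_b`. -/
theorem isCb2_radial {g g₁ g₂ : ℝ → ℝ} {C : ℝ}
    (hsm : ContDiff ℝ 2 fun v : Velocity => g (‖v‖ ^ 2))
    (h₁ : ∀ z, 0 ≤ z → HasDerivAt g (g₁ z) z) (h₂ : ∀ z, 0 ≤ z → HasDerivAt g₁ (g₂ z) z)
    (b0 : ∀ z, 0 ≤ z → |g z| ≤ C) (b1 : ∀ z, 0 ≤ z → |g₁ (z ^ 2)| * (1 + z) ≤ C)
    (b2 : ∀ z, 0 ≤ z → |g₂ z| * z ≤ C) : IsCb2 fun v : Velocity => g (‖v‖ ^ 2) := by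
  have hC : 0 ≤ C := (abs_nonneg _).trans (b0 0 le_rfl)
  have hf : fderiv ℝ (fun v : Velocity => g (‖v‖ ^ 2))
      = fun v => (2 * g₁ (‖v‖ ^ 2)) • innerSL ℝ v := by
    ext1 v; exact (hasFDerivAt_radial h₁ v).fderiv
  refine ⟨hsm, fun k hk => ?_⟩
  interval_cases k
  · refine ⟨C, fun v => ?_⟩
    rw [norm_iteratedFDeriv_zero]
    exact b0 _ (by positivity)
  · refine ⟨2 * C, fun v => ?_⟩
    rw [← norm_iteratedFDeriv_fderiv, norm_iteratedFDeriv_zero, hf]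
    have := b1 ‖v‖ (norm_nonneg v)
    have h0 := abs_nonneg (g₁ (‖v‖ ^ 2))
    simp only [norm_smul, norm_mul, Real.norm_eq_abs, innerSL_apply_norm, abs_two]
    nlinarith
  · refine ⟨6 * C, fun v => ?_⟩
    rw [← norm_iteratedFDeriv_fderiv, ← norm_iteratedFDeriv_fderiv, norm_iteratedFDeriv_zero, hf]
    have hc : HasFDerivAt (fun v : Velocity => 2 * g₁ (‖v‖ ^ 2))
        ((2 : ℝ) • ((2 * g₂ (‖v‖ ^ 2)) • innerSL ℝ v)) v :=
      (hasFDerivAt_radial h₂ v).const_mul 2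
    have hs := hc.smul (innerSL ℝ (E := Velocity)).hasFDerivAt
    rw [show (fun v : Velocity => (2 * g₁ (‖v‖ ^ 2)) • innerSL ℝ v)
      = (fun v : Velocity => 2 * g₁ (‖v‖ ^ 2)) • ⇑(innerSL ℝ) from rfl, hs.fderiv]
    have := b1 ‖v‖ (norm_nonneg v)
    have h0 := abs_nonneg (g₁ (‖v‖ ^ 2))
    have h3 := b2 (‖v‖ ^ 2) (by positivity)
    have hn := norm_nonneg v
    refine (norm_add_le _ _).trans ?_
    rw [ContinuousLinearMap.norm_smulRight_apply]
    simp only [norm_smul, norm_mul, Real.norm_eq_abs, innerSL_apply_norm, abs_two]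
    have h5 : ‖innerSL ℝ v‖ = ‖v‖ := innerSL_apply_norm ℝ v
    have h6 : |g₂ (‖v‖ ^ 2)| * ‖v‖ * ‖innerSL ℝ v‖ ≤ C := by
      rw [h5]; linarith
    have h4 : 2 * |g₁ (‖v‖ ^ 2)| * ‖(innerSL ℝ : Velocity →L[ℝ] Velocity →L[ℝ] ℝ)‖
        ≤ 2 * |g₁ (‖v‖ ^ 2)| * 1 := by
      gcongr; exact norm_toDual_le_one
    nlinarith

/-! ### Atoms: convex profiles saturating at scale n. -/

/-- `z / (n + z)`. -/
noncomputable def satRatio (n z : ℝ) : ℝ := z / (n + z)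

/-- The function `z (z / (n + z))^(q+1)`, which is convex and grows linearly at infinity. -/
noncomputable def atom (n : ℝ) (q : ℕ) (z : ℝ) : ℝ := z * satRatio n z ^ (q + 1)

noncomputable def atomDeriv (n : ℝ) (q : ℕ) (z : ℝ) : ℝ :=
  (q + 2) * satRatio n z ^ (q + 1) - (q + 1) * satRatio n z ^ (q + 2)

noncomputable def atomDeriv₂ (n : ℝ) (q : ℕ) (z : ℝ) : ℝ :=
  (q + 2) * (q + 1) * satRatio n z ^ q * (1 - satRatio n z) ^ 3 / n

section Atom

variable {n z : ℝ}

theorem satRatio_nonneg (hn : 0 < n) (hz : 0 ≤ z) : 0 ≤ satRatio n z := by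
  unfold satRatio; positivity

theorem satRatio_lt_one (hn : 0 < n) (hz : 0 ≤ z) : satRatio n z < 1 := by
  unfold satRatio; rw [div_lt_one (by linarith)]; linarith

theorem satRatio_le_div (hn : 0 < n) (hz : 0 ≤ z) : satRatio n z ≤ z / n := by
  unfold satRatio; gcongr; linarith

theorem mul_satRatio_le (hn : 0 < n) (hz : 0 ≤ z) : n * satRatio n z ≤ z := by
  have := satRatio_le_div hn hz
  rw [le_div_iff₀ hn] at this; linarith

theorem one_sub_satRatio (hn : 0 < n) (hz : 0 ≤ z) : 1 - satRatio n z = n / (n + z) := by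
  unfold satRatio; field_simp; ring

theorem mul_one_sub_satRatio (hn : 0 < n) (hz : 0 ≤ z) :
    z * (1 - satRatio n z) = n * satRatio n z := by
  rw [one_sub_satRatio hn hz]; unfold satRatio; ring

theorem satRatio_mono (hn : 0 < n) {z' : ℝ} (hz : 0 ≤ z) (h : z ≤ z') :
    satRatio n z ≤ satRatio n z' := by
  unfold satRatio
  rw [div_le_div_iff₀ (by linarith) (by linarith)]
  nlinarith

theorem mul_satRatio_le_satRatio_mul (hn : 0 < n) (hz : 0 ≤ z) {u : ℝ} (h0 : 0 ≤ u) (h1 : u ≤ 1) :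
    u * satRatio n z ≤ satRatio n (u * z) := by
  unfold satRatio
  rw [← mul_div_assoc]
  gcongr
  nlinarith

theorem satRatio_two_mul_le (hn : 0 < n) (hz : 0 ≤ z) :
    satRatio n (2 * z) ≤ 2 * satRatio n z := by
  have := mul_satRatio_le_satRatio_mul hn (by linarith : 0 ≤ 2 * z) (u := 1 / 2) (by norm_num)
    (by norm_num)
  rw [show 1 / 2 * (2 * z) = z by ring] at this
  linarith

theorem hasDerivAt_satRatio (hn : 0 < n) (hz : 0 ≤ z) :
    HasDerivAt (satRatio n) ((1 - satRatio n z) ^ 2 / n) z := by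
  have h := (hasDerivAt_id z).div ((hasDerivAt_id z).const_add n) (by simp; linarith)
  rw [one_sub_satRatio hn hz]
  refine h.congr_deriv ?_
  have : n + z ≠ 0 := by linarith
  simp
  field_simp

theorem hasDerivAt_atom (hn : 0 < n) (q : ℕ) (hz : 0 ≤ z) :
    HasDerivAt (atom n q) (atomDeriv n q z) z := by
  have h := (hasDerivAt_id z).mul ((hasDerivAt_satRatio hn hz).pow (q + 1))
  have e := mul_one_sub_satRatio hn hz
  refine h.congr_deriv ?_
  simp only [atomDeriv, id, Nat.add_sub_cancel]
  push_cast
  have : z * ((q + 1) * satRatio n z ^ q * ((1 - satRatio n z) ^ 2 / n))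
      = (q + 1) * satRatio n z ^ q * ((z * (1 - satRatio n z)) * (1 - satRatio n z) / n) := by ring
  simp only [Pi.pow_apply]
  rw [this, e]
  field_simp
  ring

theorem hasDerivAt_atomDeriv (hn : 0 < n) (q : ℕ) (hz : 0 ≤ z) :
    HasDerivAt (atomDeriv n q) (atomDeriv₂ n q z) z := by
  have h1 := ((hasDerivAt_satRatio hn hz).pow (q + 1)).const_mul ((q : ℝ) + 2)
  have h2 := ((hasDerivAt_satRatio hn hz).pow (q + 2)).const_mul ((q : ℝ) + 1)
  refine (h1.sub h2).congr_deriv ?_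
  simp only [atomDeriv₂, Nat.add_sub_cancel, show q + 2 - 1 = q + 1 by omega]
  push_cast
  ring

theorem atom_nonneg (hn : 0 < n) (q : ℕ) (hz : 0 ≤ z) : 0 ≤ atom n q z :=
  mul_nonneg hz (pow_nonneg (satRatio_nonneg hn hz) _)

theorem atom_le (hn : 0 < n) (q : ℕ) (hz : 0 ≤ z) : atom n q z ≤ z :=
  mul_le_of_le_one_right hz (pow_le_one₀ (satRatio_nonneg hn hz) (satRatio_lt_one hn hz).le)

theorem atomDeriv₂_nonneg (hn : 0 < n) (q : ℕ) (hz : 0 ≤ z) : 0 ≤ atomDeriv₂ n q z := by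
  have h0 := satRatio_nonneg hn hz
  have h1 := (satRatio_lt_one hn hz).le
  have : 0 ≤ 1 - satRatio n z := by linarith
  unfold atomDeriv₂; positivity

theorem atomDeriv₂_le (hn : 0 < n) (q : ℕ) (hz : 0 ≤ z) :
    atomDeriv₂ n q z ≤ (q + 2) * (q + 1) * satRatio n z ^ q / n := by
  have h0 := satRatio_nonneg hn hz
  have h1 := (satRatio_lt_one hn hz).le
  have h2 : 0 ≤ 1 - satRatio n z := by linarith
  unfold atomDeriv₂
  have : (1 - satRatio n z) ^ 3 ≤ 1 := pow_le_one₀ h2 (by linarith)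
  have h3 : 0 ≤ ((q : ℝ) + 2) * (q + 1) * satRatio n z ^ q := by positivity
  exact div_le_div_of_nonneg_right (mul_le_of_le_one_right h3 this) hn.le

/-- The expression vanishes to second order at a = 1; passing from q to q + 1 adds exactly (q+2)
a^(q+1) (1-a)². The decay in 1 - a keeps the gradient of z minus the atom bounded in velocity,
despite the factor |v| of the chain rule. -/
theorem one_sub_atomDeriv_nonneg_le {a : ℝ} (q : ℕ) (h0 : 0 ≤ a) (h1 : a ≤ 1) :
    0 ≤ 1 - ((q + 2) * a ^ (q + 1) - (q + 1) * a ^ (q + 2)) ∧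
    1 - ((q + 2) * a ^ (q + 1) - (q + 1) * a ^ (q + 2)) ≤ (q + 2) ^ 2 * (1 - a) ^ 2 := by
  induction q with
  | zero => constructor <;> · simp; nlinarith [sq_nonneg (1 - a)]
  | succ q ih =>
    have e : 1 - (((q + 1 : ℕ) + 2) * a ^ (q + 1 + 1) - ((q + 1 : ℕ) + 1) * a ^ (q + 1 + 2))
      = (1 - ((q + 2) * a ^ (q + 1) - (q + 1) * a ^ (q + 2)))
        + (q + 2) * a ^ (q + 1) * (1 - a) ^ 2 := by push_cast; ring
    rw [e]
    have p0 : 0 ≤ a ^ (q + 1) := pow_nonneg h0 _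
    have p1 : a ^ (q + 1) ≤ 1 := pow_le_one₀ h0 h1
    have hs := sq_nonneg (1 - a)
    refine ⟨by have := ih.1; positivity, ?_⟩
    have : ((q : ℝ) + 2) * a ^ (q + 1) * (1 - a) ^ 2 ≤ (q + 2) * 1 * (1 - a) ^ 2 := by gcongr
    push_cast
    nlinarith [ih.2]

theorem contDiff_atom (hn : 0 < n) (q : ℕ) :
    ContDiff ℝ 2 fun v : Velocity => ‖v‖ ^ 2 - atom n q (‖v‖ ^ 2) := by
  unfold atom satRatio
  have hs : ContDiff ℝ 2 fun v : Velocity => ‖v‖ ^ 2 := contDiff_norm_sq ℝ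
  exact hs.sub (hs.mul ((hs.div (contDiff_const.add hs) fun v => by positivity).pow _))

/-- An atom grows linearly in the energy and is not itself an admissible test. Its difference with
the conserved energy is, because z(1 - z/(n+z)) = n · z/(n+z) stays below n. -/
theorem isCb2_atom (hn : 1 ≤ n) (q : ℕ) :
    IsCb2 fun v : Velocity => ‖v‖ ^ 2 - atom n q (‖v‖ ^ 2) := by
  have hn0 : 0 < n := by linarith
  refine isCb2_radial (g := fun z => z - atom n q z) (g₁ := fun z => 1 - atomDeriv n q z)
    (g₂ := fun z => -atomDeriv₂ n q z) (C := (q + 2) ^ 2 * n * 4) (contDiff_atom hn0 q)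
    (fun z hz => (hasDerivAt_id z).sub (hasDerivAt_atom hn0 q hz))
    (fun z hz => by simpa using (hasDerivAt_atomDeriv hn0 q hz).const_sub 1) ?_ ?_ ?_
  · intro z hz
    have h0 := satRatio_nonneg hn0 hz
    have h1 := (satRatio_lt_one hn0 hz).le
    rw [abs_of_nonneg (by linarith [atom_le hn0 q hz])]
    have hb : (1 : ℝ) + ((q + 1 : ℕ) : ℝ) * (satRatio n z - 1) ≤ satRatio n z ^ (q + 1) := by
      have := one_add_mul_le_pow (a := satRatio n z - 1) (by linarith) (q + 1)
      simpa using this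
    have e := mul_one_sub_satRatio hn0 hz
    unfold atom
    have : z * (1 + ((q + 1 : ℕ) : ℝ) * (satRatio n z - 1)) ≤ z * satRatio n z ^ (q + 1) := by gcongr
    push_cast at this
    have h2 : z - z * satRatio n z ^ (q + 1) ≤ (q + 1) * (n * satRatio n z) := by
      rw [← e]; linarith
    have h3 : ((q : ℝ) + 1) * (n * satRatio n z) ≤ (q + 1) * (n * 1) := by gcongr
    have hq : (0 : ℝ) ≤ q := by positivity
    have h4 : ((q : ℝ) + 1) * n ≤ ((q + 2) ^ 2 * 4) * n := by gcongr; nlinarith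
    linarith
  · intro z hz
    have hz2 : 0 ≤ z ^ 2 := by positivity
    have h0 := satRatio_nonneg hn0 hz2
    have h1 := (satRatio_lt_one hn0 hz2).le
    have hb := one_sub_atomDeriv_nonneg_le q h0 h1
    rw [show 1 - atomDeriv n q (z ^ 2) = 1 - ((q + 2) * satRatio n (z ^ 2) ^ (q + 1)
      - (q + 1) * satRatio n (z ^ 2) ^ (q + 2)) from rfl, abs_of_nonneg hb.1]
    have h2 : (1 - satRatio n (z ^ 2)) * (1 + z) ≤ 2 * n := by
      rw [one_sub_satRatio hn0 hz2, div_mul_eq_mul_div, div_le_iff₀ (by positivity)]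
      nlinarith [sq_nonneg (z - 1)]
    have h3 : (1 - satRatio n (z ^ 2)) ^ 2 * (1 + z) ≤ 2 * n := by
      calc (1 - satRatio n (z ^ 2)) ^ 2 * (1 + z)
          = (1 - satRatio n (z ^ 2)) * ((1 - satRatio n (z ^ 2)) * (1 + z)) := by ring
        _ ≤ 1 * ((1 - satRatio n (z ^ 2)) * (1 + z)) := by
            have : 0 ≤ (1 - satRatio n (z ^ 2)) * (1 + z) := mul_nonneg (by linarith) (by linarith)
            exact mul_le_mul_of_nonneg_right (by linarith) this
        _ ≤ _ := by linarith
    calc _ ≤ ((q : ℝ) + 2) ^ 2 * (1 - satRatio n (z ^ 2)) ^ 2 * (1 + z) := by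
          gcongr; exact hb.2
      _ = (q + 2) ^ 2 * ((1 - satRatio n (z ^ 2)) ^ 2 * (1 + z)) := by ring
      _ ≤ (q + 2) ^ 2 * (2 * n) := by gcongr
      _ ≤ _ := by nlinarith [sq_nonneg ((q : ℝ) + 2)]
  · intro z hz
    have h0 := satRatio_nonneg hn0 hz
    have h1 := (satRatio_lt_one hn0 hz).le
    have h2 : 0 ≤ 1 - satRatio n z := by linarith
    rw [abs_neg, abs_of_nonneg (atomDeriv₂_nonneg hn0 q hz)]
    have e := mul_one_sub_satRatio hn0 hz
    have : atomDeriv₂ n q z * z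
        = (q + 2) * (q + 1) * (satRatio n z ^ (q + 1) * (1 - satRatio n z) ^ 2) := by
      unfold atomDeriv₂
      calc _ = ((q : ℝ) + 2) * (q + 1) * satRatio n z ^ q * (1 - satRatio n z) ^ 2
            * (z * (1 - satRatio n z)) / n := by ring
        _ = _ := by rw [e]; field_simp; ring
    rw [this]
    have h3 : satRatio n z ^ (q + 1) * (1 - satRatio n z) ^ 2 ≤ 1 :=
      mul_le_one₀ (pow_le_one₀ h0 h1) (by positivity) (pow_le_one₀ h2 (by linarith))
    have hq : (0 : ℝ) ≤ q := by positivity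
    calc ((q : ℝ) + 2) * (q + 1) * (satRatio n z ^ (q + 1) * (1 - satRatio n z) ^ 2)
        ≤ (q + 2) * (q + 1) * 1 := by gcongr
      _ ≤ _ := by nlinarith

theorem continuousOn_atom (hn : 0 < n) (q : ℕ) : ContinuousOn (atom n q) (Set.Ici 0) :=
  fun _ hz => (hasDerivAt_atom hn q hz).continuousAt.continuousWithinAt

theorem convexOn_atom (hn : 0 < n) (q : ℕ) : ConvexOn ℝ (Set.Ici 0) (atom n q) := by
  apply convexOn_of_hasDerivWithinAt2_nonneg (convex_Ici 0) (continuousOn_atom hn q)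
    (f' := atomDeriv n q) (f'' := atomDeriv₂ n q)
  · intro z hz
    rw [interior_Ici] at hz
    exact (hasDerivAt_atom hn q (le_of_lt hz)).hasDerivWithinAt
  · intro z hz
    rw [interior_Ici] at hz
    exact (hasDerivAt_atomDeriv hn q (le_of_lt hz)).hasDerivWithinAt
  · intro z hz
    rw [interior_Ici] at hz
    exact atomDeriv₂_nonneg hn q (le_of_lt hz)

theorem continuous_atom_norm (hn : 0 < n) (q : ℕ) :
    Continuous fun v : Velocity => atom n q (‖v‖ ^ 2) :=
  (continuousOn_atom hn q).comp_continuous (by fun_prop) fun v => by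
    show (0 : ℝ) ≤ ‖v‖ ^ 2; positivity

theorem continuousOn_satRatio (hn : 0 < n) : ContinuousOn (satRatio n) (Set.Ici 0) :=
  fun _ hz => (hasDerivAt_satRatio hn hz).continuousAt.continuousWithinAt

end Atom

/-! ### Weak solutions tested against atoms. -/

section Solution

variable {γ ν κ₁ κ₂ : ℝ} {B : ℝ → ℝ → ℝ} {β : ℝ → ℝ} {I J : Velocity → Velocity}
  {f : ℝ → ProbabilityMeasure Velocity}

namespace IsWeakSolution

theorem integrable_energy (hf : IsWeakSolution γ β I J f) {t : ℝ} (ht : 0 ≤ t) :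
    Integrable (fun v : Velocity => ‖v‖ ^ 2) (f t : Measure Velocity) := by
  by_contra h
  have := hf.energy t ht
  -- The Bochner integral of a non-integrable function is 0, whereas the energy is 1.
  rw [integral_undef h] at this
  exact zero_ne_one this

theorem continuousOn_integral (hf : IsWeakSolution γ β I J f) {h : Velocity → ℝ} {C : ℝ}
    (hc : Continuous h) (hb : ∀ v, |h v| ≤ C) :
    ContinuousOn (fun t => ∫ v, h v ∂(f t : Measure Velocity)) (Set.Ici 0) := by
  intro t ht
  have := hf.weakly_continuous t ht
  rw [ContinuousWithinAt, ProbabilityMeasure.tendsto_iff_forall_integral_tendsto] at this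
  exact this (BoundedContinuousFunction.ofNormedAddCommGroup h hc C hb)

theorem integrable_atom (hf : IsWeakSolution γ β I J f) {n : ℝ} (hn : 0 < n) (q : ℕ) {t : ℝ}
    (ht : 0 ≤ t) :
    Integrable (fun v : Velocity => atom n q (‖v‖ ^ 2)) (f t : Measure Velocity) := by
  refine (hf.integrable_energy ht).mono' (continuous_atom_norm hn q).aestronglyMeasurable
    (ae_of_all _ fun v => ?_)
  have : (0 : ℝ) ≤ ‖v‖ ^ 2 := by positivity
  rw [Real.norm_eq_abs, abs_of_nonneg (atom_nonneg hn q this)]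
  exact atom_le hn q this

theorem integral_atom_eq (hf : IsWeakSolution γ β I J f) {n : ℝ} (hn : 0 < n) (q : ℕ) {t : ℝ}
    (ht : 0 ≤ t) :
    ∫ v, atom n q (‖v‖ ^ 2) ∂(f t : Measure Velocity)
      = 1 - ∫ v, (‖v‖ ^ 2 - atom n q (‖v‖ ^ 2)) ∂(f t : Measure Velocity) := by
  rw [integral_sub (hf.integrable_energy ht) (hf.integrable_atom hn q ht), hf.energy t ht]
  ring

theorem continuousOn_atom (hf : IsWeakSolution γ β I J f) {n : ℝ} (hn : 1 ≤ n) (q : ℕ) :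
    ContinuousOn (fun t => ∫ v, atom n q (‖v‖ ^ 2) ∂(f t : Measure Velocity)) (Set.Ici 0) := by
  have hn0 : 0 < n := by linarith
  obtain ⟨C, hC⟩ := (isCb2_atom hn q).2 0 (by norm_num)
  have h := hf.continuousOn_integral (C := C) (isCb2_atom hn q).1.continuous
    (fun v => by simpa [norm_iteratedFDeriv_zero] using hC v)
  exact (continuousOn_const (c := (1 : ℝ)).sub h).congr fun t ht => hf.integral_atom_eq hn0 q ht

end IsWeakSolution

theorem IsFrame.collisionIntegral_sub_atom (hF : IsFrame I J) (n : ℝ) (q : ℕ) (v w : Velocity) :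
    collisionIntegral γ β I J (fun v => ‖v‖ ^ 2 - atom n q (‖v‖ ^ 2)) v w
      = -collisionIntegral γ β I J (fun v => atom n q (‖v‖ ^ 2)) v w := by
  obtain ⟨R, -, -, h⟩ := hF.exists_collisionIntegral_eq γ β v w
  have h1 := h (fun z => z - atom n q z)
  rw [h1, h (atom n q)]
  simp only [angularAverage_affine_sub, neg_mul, intervalIntegral.integral_neg, mul_neg]

namespace IsWeakSolution

theorem integrable_collision_atom (hf : IsWeakSolution γ β I J f) (hF : IsFrame I J) {n : ℝ}
    (hn : 1 ≤ n) (q : ℕ) {t : ℝ} (ht : 0 < t) :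
    Integrable (fun p : Velocity × Velocity =>
      collisionIntegral γ β I J (fun v => atom n q (‖v‖ ^ 2)) p.1 p.2)
      ((f t : Measure Velocity).prod (f t : Measure Velocity)) := by
  have := (hf.integrable _ (isCb2_atom hn q) t ht).neg
  refine this.congr (ae_of_all _ fun p => ?_)
  simp only [Pi.neg_apply, hF.collisionIntegral_sub_atom, neg_neg]

theorem hasDerivAt_atom (hf : IsWeakSolution γ β I J f) (hF : IsFrame I J) {n : ℝ}
    (hn : 1 ≤ n) (q : ℕ) {t : ℝ} (ht : 0 < t) :
    HasDerivAt (fun t => ∫ v, atom n q (‖v‖ ^ 2) ∂(f t : Measure Velocity))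
      (∫ p, collisionIntegral γ β I J (fun v => atom n q (‖v‖ ^ 2)) p.1 p.2
        ∂((f t : Measure Velocity).prod (f t : Measure Velocity))) t := by
  have hn0 : 0 < n := by linarith
  have h := (hf.weak_eq _ (isCb2_atom hn q) t ht).const_sub 1
  have e : -(∫ v, ∫ w, collisionIntegral γ β I J (fun v => ‖v‖ ^ 2 - atom n q (‖v‖ ^ 2)) v w
        ∂(f t : Measure Velocity) ∂(f t : Measure Velocity))
      = ∫ p, collisionIntegral γ β I J (fun v => atom n q (‖v‖ ^ 2)) p.1 p.2
        ∂((f t : Measure Velocity).prod (f t : Measure Velocity)) := by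
    rw [integral_prod _ (hf.integrable_collision_atom hF hn q ht)]
    simp only [hF.collisionIntegral_sub_atom, integral_neg, neg_neg]
  rw [e] at h
  refine h.congr_of_eventuallyEq ?_
  filter_upwards [lt_mem_nhds ht] with s hs
  exact hf.integral_atom_eq hn0 q hs.le

end IsWeakSolution

theorem norm_sub_rpow_le (hγ0 : 0 ≤ γ) (hγ1 : γ ≤ 1) (v w : Velocity) :
    ‖v - w‖ ^ γ ≤ ‖v‖ ^ γ + ‖w‖ ^ γ :=
  (Real.rpow_le_rpow (norm_nonneg _) (norm_sub_le v w) hγ0).trans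
    (Real.rpow_add_le_add_rpow (norm_nonneg _) (norm_nonneg _) hγ0 hγ1)

theorem norm_rpow_sub_le (hγ0 : 0 ≤ γ) (hγ1 : γ ≤ 1) (v w : Velocity) :
    ‖v‖ ^ γ - ‖w‖ ^ γ ≤ ‖v - w‖ ^ γ := by
  have h : ‖v‖ ≤ ‖v - w‖ + ‖w‖ := by simpa using norm_add_le (v - w) w
  have := (Real.rpow_le_rpow (norm_nonneg _) h hγ0).trans
    (Real.rpow_add_le_add_rpow (norm_nonneg _) (norm_nonneg _) hγ0 hγ1)
  linarith

theorem half_norm_rpow_le (hγ0 : 0 ≤ γ) (hγ1 : γ ≤ 1) {v w : Velocity}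
    (h : ‖w‖ ^ 2 ≤ ‖v‖ ^ 2 / 4) : ‖v‖ ^ γ / 2 ≤ ‖v - w‖ ^ γ := by
  have h1 : ‖w‖ ≤ ‖v‖ / 2 := by
    refine abs_le_of_sq_le_sq' ?_ (by positivity) |>.2
    rw [div_pow]; linarith
  have h2 : ‖v‖ / 2 ≤ ‖v - w‖ := by
    have : ‖v‖ ≤ ‖v - w‖ + ‖w‖ := by simpa using norm_add_le (v - w) w
    linarith
  calc ‖v‖ ^ γ / 2 ≤ ‖v‖ ^ γ / 2 ^ γ := by
        gcongr
        calc (2 : ℝ) ^ γ ≤ 2 ^ (1 : ℝ) := Real.rpow_le_rpow_of_exponent_le (by norm_num) hγ1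
          _ = 2 := Real.rpow_one 2
    _ = (‖v‖ / 2) ^ γ := by rw [Real.div_rpow (norm_nonneg _) (by norm_num)]
    _ ≤ _ := Real.rpow_le_rpow (by positivity) h2 hγ0

/-! ### Gain and loss of an atom in a collision. -/

section AtomEstimates

variable {n x y R : ℝ}

/-- The midpoint defect of convexity of an atom. -/
noncomputable def atomDefect (n : ℝ) (q : ℕ) (x y : ℝ) : ℝ :=
  atom n q x + atom n q y - 2 * atom n q ((x + y) / 2)

theorem atomDefect_nonneg (hn : 0 < n) (q : ℕ) (hx : 0 ≤ x) (hy : 0 ≤ y) :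
    0 ≤ atomDefect n q x y := by
  have := (convexOn_atom hn q).2 (show x ∈ Set.Ici 0 from hx) (show y ∈ Set.Ici 0 from hy)
    (show (0 : ℝ) ≤ 1 / 2 by norm_num) (show (0 : ℝ) ≤ 1 / 2 by norm_num) (by norm_num)
  simp only [smul_eq_mul] at this
  unfold atomDefect
  rw [show (x + y) / 2 = 1 / 2 * x + 1 / 2 * y by ring]
  linarith

/-- Let a, b be the saturation ratios at x and at the midpoint. As y ≤ x/4 the midpoint is at most
5x/8, whence a - b ≥ (3/8) a(1 - a), and x(1 - a) = n a turns this into a defect of (3/8) n a^(q+2).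
The smallness of y is set so that the term y b^(q+1) eats at most half of it. -/
theorem le_atomDefect (hn : 0 < n) (q : ℕ) (hx : 0 ≤ x) (hy : 0 ≤ y)
    (hyx : y ≤ 3 / 16 * (n * satRatio n x)) :
    3 / 16 * (n * satRatio n x ^ (q + 2)) ≤ atomDefect n q x y := by
  have ha0 := satRatio_nonneg hn hx
  have hna := mul_satRatio_le hn hx
  have hyx' : y ≤ x / 4 := by linarith
  set a := satRatio n x with ha
  set b := satRatio n ((x + y) / 2) with hb
  have hb0 : 0 ≤ b := satRatio_nonneg hn (by linarith)
  have hba : b ≤ a := satRatio_mono hn (by linarith) (by linarith)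
  have e : atomDefect n q x y = x * (a ^ (q + 1) - b ^ (q + 1)) - y * b ^ (q + 1) + atom n q y := by
    unfold atomDefect atom; rw [← ha, ← hb]; ring
  have h1 : a ^ q * (a - b) ≤ a ^ (q + 1) - b ^ (q + 1) := by
    have : b ^ q ≤ a ^ q := by gcongr
    have := mul_le_mul_of_nonneg_right this hb0
    rw [pow_succ, pow_succ]; linarith
  have h2 : 3 / 8 * (a * (1 - a)) ≤ a - b := by
    have h3 : b ≤ satRatio n (5 / 8 * x) := satRatio_mono hn (by linarith) (by linarith)
    have h4 : a * (1 - a) = x * n / ((n + x) * (n + x)) := by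
      rw [ha, one_sub_satRatio hn hx, satRatio]; field_simp
    have h5 : a - satRatio n (5 / 8 * x) = (3 / 8 * (x * n)) / ((n + x) * (n + 5 / 8 * x)) := by
      rw [ha, satRatio, satRatio]
      have : n + x ≠ 0 := by positivity
      have : n + 5 / 8 * x ≠ 0 := by positivity
      field_simp; ring
    have h6 : (3 / 8 * (x * n)) / ((n + x) * (n + x))
        ≤ (3 / 8 * (x * n)) / ((n + x) * (n + 5 / 8 * x)) := by
      gcongr; linarith
    rw [h4]
    rw [mul_div_assoc] at h6
    linarith
  have h7 : x * (a ^ q * (3 / 8 * (a * (1 - a)))) ≤ x * (a ^ (q + 1) - b ^ (q + 1)) := by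
    refine mul_le_mul_of_nonneg_left ?_ hx
    exact (mul_le_mul_of_nonneg_left h2 (by positivity)).trans h1
  have h8 : x * (a ^ q * (3 / 8 * (a * (1 - a)))) = 3 / 8 * (n * a ^ (q + 2)) := by
    have := mul_one_sub_satRatio hn hx
    rw [← ha] at this
    calc _ = 3 / 8 * (a ^ (q + 1) * (x * (1 - a))) := by ring
      _ = _ := by rw [this]; ring
  have h9 : y * b ^ (q + 1) ≤ 3 / 16 * (n * a) * a ^ (q + 1) := by gcongr
  have h10 := atom_nonneg hn q hy
  rw [e]
  have h11 : 3 / 16 * (n * a) * a ^ (q + 1) = 3 / 16 * (n * a ^ (q + 2)) := by ring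
  linarith

/-- For u ≤ 1/2 the mixed energy (1 - u)x + uy is the barycentre of x and the midpoint with weights
1 - 2u and 2u. Convexity thus yields 2 min(u, 1 - u) times the midpoint defect, which dominates 2u(1
- u) times it. -/
theorem atom_loss_le (hn : 0 < n) (q : ℕ) (hx : 0 ≤ x) (hy : 0 ≤ y) {u : ℝ} (h0 : 0 ≤ u)
    (h1 : u ≤ 1) :
    atom n q ((1 - u) * x + u * y) + atom n q (u * x + (1 - u) * y) - atom n q x - atom n q y
      ≤ -(2 * (u * (1 - u)) * atomDefect n q x y) := by
  have hJ := atomDefect_nonneg hn q hx hy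
  have key : ∀ u, 0 ≤ u → u ≤ 1 / 2 → ∀ x y, 0 ≤ x → 0 ≤ y →
      atom n q ((1 - u) * x + u * y) ≤ (1 - 2 * u) * atom n q x
        + 2 * u * atom n q ((x + y) / 2) := by
    intro u h0 h1 x y hx hy
    have := (convexOn_atom hn q).2 (show x ∈ Set.Ici 0 from hx)
      (show (x + y) / 2 ∈ Set.Ici 0 by simp only [Set.mem_Ici]; linarith)
      (show 0 ≤ 1 - 2 * u by linarith) (show 0 ≤ 2 * u by linarith) (by ring)
    simp only [smul_eq_mul] at this
    rwa [show (1 - 2 * u) * x + 2 * u * ((x + y) / 2) = (1 - u) * x + u * y by ring] at this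
  rcases le_total u (1 / 2) with hu | hu
  · have k1 := key u h0 hu x y hx hy
    have k2 := key u h0 hu y x hy hx
    rw [add_comm y x, add_comm ((1 - u) * y)] at k2
    have : 2 * (u * (1 - u)) * atomDefect n q x y ≤ 2 * u * atomDefect n q x y := by
      gcongr; nlinarith
    have e : 2 * u * atomDefect n q x y = 2 * u * (atom n q x + atom n q y
      - 2 * atom n q ((x + y) / 2)) := rfl
    linarith
  · have k1 := key (1 - u) (by linarith) (by linarith) x y hx hy
    have k2 := key (1 - u) (by linarith) (by linarith) y x hy hx
    rw [add_comm y x, add_comm ((1 - (1 - u)) * y)] at k2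
    rw [show 1 - (1 - u) = u by ring] at k1 k2
    have : 2 * (u * (1 - u)) * atomDefect n q x y ≤ 2 * (1 - u) * atomDefect n q x y := by
      gcongr; nlinarith
    have e : 2 * (1 - u) * atomDefect n q x y = 2 * (1 - u) * (atom n q x + atom n q y
      - 2 * atom n q ((x + y) / 2)) := rfl
    linarith

/-- Expansion around the mixed energies, not around x and y: the unshifted part is the convexity
loss, the linear part in the shift averages out, and the quadratic part is bounded by the second
derivative times t² ≤ 4u xy. -/
theorem angularAverage_atom_le (hn : 0 < n) (q : ℕ) (hx : 0 ≤ x) (hy : 0 ≤ y)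
    (hR : R ^ 2 ≤ x * y) (θ : ℝ) :
    angularAverage (atom n q) x y R θ ≤
      16 * Real.pi * ((q + 2) * (q + 1) * satRatio n (x + y) ^ q / n) * (x * y) * halfSinSq θ
        - 4 * Real.pi * atomDefect n q x y * (halfSinSq θ * (1 - halfSinSq θ)) := by
  have hu0 := halfSinSq_nonneg θ
  have hu1 := halfSinSq_le_one θ
  have h := angularAverage_le (g := atom n q)
    (A := 8 * ((q + 2) * (q + 1) * satRatio n (x + y) ^ q / n) * (x * y) * halfSinSq θ
      - 2 * (halfSinSq θ * (1 - halfSinSq θ)) * atomDefect n q x y)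
    (b := atomDeriv n q ((1 - halfSinSq θ) * x + halfSinSq θ * y)
      - atomDeriv n q (halfSinSq θ * x + (1 - halfSinSq θ) * y)) (θ := θ)
    (continuousOn_atom hn q) hx hy hR ?_
  · linarith
  intro t ht p1 p2
  set u := halfSinSq θ with hu
  have hu1' : 0 ≤ 1 - u := by linarith
  set D := (q + 2) * (q + 1) * satRatio n (x + y) ^ q / n with hDdef
  have hD : ∀ z, 0 ≤ z → z ≤ x + y → |atomDeriv₂ n q z| ≤ D := by
    intro z hz hz'
    rw [abs_of_nonneg (atomDeriv₂_nonneg hn q hz)]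
    refine (atomDeriv₂_le hn q hz).trans ?_
    have := satRatio_mono hn hz hz'
    have h0 := satRatio_nonneg hn hz
    rw [hDdef]
    gcongr
  have q1 : 0 ≤ (1 - u) * x + u * y := by positivity
  have q2 : 0 ≤ u * x + (1 - u) * y := by positivity
  have t1 := abs_sub_sub_deriv_mul_le (S := x + y) (fun z hz => hasDerivAt_atom hn q hz)
    (fun z hz => hasDerivAt_atomDeriv hn q hz) hD q1 (by linarith) p1 (by linarith)
  have t2 := abs_sub_sub_deriv_mul_le (S := x + y) (fun z hz => hasDerivAt_atom hn q hz)
    (fun z hz => hasDerivAt_atomDeriv hn q hz) hD q2 (by linarith) p2 (by linarith)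
  have s1 := (abs_le.mp t1).2
  have s2 := (abs_le.mp t2).2
  have l := atom_loss_le hn q hx hy hu0 hu1
  have hD0 : 0 ≤ D := (abs_nonneg _).trans (hD x hx (by linarith))
  have ht' : t ^ 2 ≤ 4 * u * (x * y) := by
    refine ht.trans ?_
    have : u * (1 - u) ≤ u := by nlinarith
    have : 4 * (u * (1 - u)) ≤ 4 * u := by linarith
    gcongr
  have hDt : D * t ^ 2 ≤ D * (4 * u * (x * y)) := by gcongr
  rw [show (1 - u) * x + u * y + t - ((1 - u) * x + u * y) = t by ring] at s1
  rw [show u * x + (1 - u) * y - t - (u * x + (1 - u) * y) = -t by ring, neg_sq] at s2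
  linarith

end AtomEstimates

end Solution

/-! ### Dissipation of an atom when a higher moment is known. -/

section CrudeEstimate

variable {γ ν κ₁ κ₂ : ℝ} {B : ℝ → ℝ → ℝ} {β : ℝ → ℝ} {I J : Velocity → Velocity}
  {f : ℝ → ProbabilityMeasure Velocity} {n : ℝ}

theorem rpow_half_norm_sq (v : Velocity) (r : ℝ) : (‖v‖ ^ 2) ^ (r / 2) = ‖v‖ ^ r := by
  rw [← Real.rpow_natCast, ← Real.rpow_mul (norm_nonneg v)]
  congr 1; push_cast; ring

theorem abs_angularAverage_atom_le {x y R : ℝ} (hn : 0 < n) (q : ℕ) (hx : 0 ≤ x) (hy : 0 ≤ y)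
    (hR : R ^ 2 ≤ x * y) (θ : ℝ) :
    |angularAverage (atom n q) x y R θ| ≤
      2 * Real.pi * (15 * ((q + 2) * (q + 1) * satRatio n (x + y) ^ q / n) * (x + y) ^ 2)
        * halfSinSq θ := by
  refine abs_angularAverage_le_of_deriv (fun z hz => hasDerivAt_atom hn q hz)
    (fun z hz => hasDerivAt_atomDeriv hn q hz) hx hy hR (fun z hz hz' => ?_) θ
  rw [abs_of_nonneg (atomDeriv₂_nonneg hn q hz)]
  refine (atomDeriv₂_le hn q hz).trans ?_
  have := satRatio_mono hn hz hz'
  have h0 := satRatio_nonneg hn hz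
  gcongr

theorem collisionIntegral_atom_le (hB : IsHardPotential γ ν κ₁ κ₂ B β) (hF : IsFrame I J)
    (hν : ν < 2) (hn : 0 < n) (q : ℕ) (v w : Velocity) :
    collisionIntegral γ β I J (fun v => atom n q (‖v‖ ^ 2)) v w ≤ ‖v - w‖ ^ γ *
      (κ₂ * (16 * Real.pi * ((q + 2) * (q + 1) * satRatio n (‖v‖ ^ 2 + ‖w‖ ^ 2) ^ q / n)
        * (‖v‖ ^ 2 * ‖w‖ ^ 2) * angularMass ν)
      - κ₁ * (4 * Real.pi * atomDefect n q (‖v‖ ^ 2) (‖w‖ ^ 2) * angularSpread ν)) := by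
  obtain ⟨R, hR0, hR, h⟩ := hF.exists_collisionIntegral_eq γ β v w
  rw [h]
  refine mul_le_mul_of_nonneg_left ?_ (Real.rpow_nonneg (norm_nonneg _) _)
  have hx : 0 ≤ ‖v‖ ^ 2 := by positivity
  have hy : 0 ≤ ‖w‖ ^ 2 := by positivity
  have hu := continuous_halfSinSq
  set x := ‖v‖ ^ 2
  set y := ‖w‖ ^ 2
  have ha0 := satRatio_nonneg hn (add_nonneg hx hy)
  have hJ := atomDefect_nonneg hn q hx hy
  have hpi := Real.pi_pos
  set E := 16 * Real.pi * ((q + 2) * (q + 1) * satRatio n (x + y) ^ q / n) * (x * y) with hE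
  have hE0 : 0 ≤ E := by positivity
  set P := 4 * Real.pi * atomDefect n q x y with hP
  have hP0 : 0 ≤ P := by positivity
  have key := hB.integral_le hν (A := angularAverage (atom n q) x y R)
    (L := fun θ => P * (halfSinSq θ * (1 - halfSinSq θ))) (G := fun θ => E * halfSinSq θ)
    (CL := P) (CG := E)
    (continuous_angularAverage (continuousOn_atom hn q) hx hy hR) (by fun_prop) (by fun_prop)
    (fun θ _ => abs_angularAverage_atom_le hn q hx hy hR θ)
    (fun θ _ => mul_nonneg hP0 (mul_nonneg (halfSinSq_nonneg θ)
      (by linarith [halfSinSq_le_one θ])))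
    (fun θ _ => mul_le_mul_of_nonneg_left (by
      nlinarith [halfSinSq_nonneg θ, halfSinSq_le_one θ]) hP0)
    (fun θ _ => mul_nonneg hE0 (halfSinSq_nonneg θ))
    (fun θ _ => le_rfl)
    (fun θ _ => angularAverage_atom_le hn q hx hy hR θ)
  refine key.trans (le_of_eq ?_)
  simp only [mul_assoc E, mul_assoc P, intervalIntegral.integral_const_mul]
  rfl

/-- A saturation ratio is at most 1 and at most z/n, so its q-th power is bounded by (z/n)^(α -
γ/2). With |v - w|^γ ≤ 2|v|^γ the powers of the faster particle add up to 1 + α, and negative powers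
of n are left over. -/
theorem gain_le_of_le (hγ0 : 0 ≤ γ) (hγ1 : γ ≤ 1) (hn : 0 < n) (q : ℕ) {α : ℝ}
    (h1 : γ / 2 ≤ α) (h2 : α - γ / 2 ≤ q) {v w : Velocity} (hvw : ‖w‖ ≤ ‖v‖) :
    ‖v - w‖ ^ γ * (satRatio n (‖v‖ ^ 2 + ‖w‖ ^ 2) ^ q / n * (‖v‖ ^ 2 * ‖w‖ ^ 2)) ≤
      2 ^ (q + 1) * n ^ (γ / 2 - α - 1) * (‖v‖ ^ 2 * (‖v‖ ^ 2) ^ α * ‖w‖ ^ 2) := by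
  have hx : 0 ≤ ‖v‖ ^ 2 := by positivity
  have hy : 0 ≤ ‖w‖ ^ 2 := by positivity
  have hyx : ‖w‖ ^ 2 ≤ ‖v‖ ^ 2 := by gcongr
  have b1 : ‖v - w‖ ^ γ ≤ 2 * (‖v‖ ^ 2) ^ (γ / 2) := by
    rw [rpow_half_norm_sq]
    have := norm_sub_rpow_le hγ0 hγ1 v w
    have h3 := Real.rpow_le_rpow (norm_nonneg _) hvw hγ0
    linarith
  set x := ‖v‖ ^ 2
  set y := ‖w‖ ^ 2
  have a0 := satRatio_nonneg hn (add_nonneg hx hy)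
  have a1 := satRatio_nonneg hn hx
  have b2 : satRatio n (x + y) ^ q ≤ 2 ^ q * (x ^ (α - γ / 2) * n ^ (-(α - γ / 2))) := by
    calc satRatio n (x + y) ^ q ≤ (2 * satRatio n x) ^ q := by
          gcongr
          exact (satRatio_mono hn (by linarith) (by linarith)).trans (satRatio_two_mul_le hn hx)
      _ = 2 ^ q * satRatio n x ^ (q : ℝ) := by rw [mul_pow, Real.rpow_natCast]
      _ ≤ 2 ^ q * satRatio n x ^ (α - γ / 2) := by
          gcongr 2 ^ q * ?_
          exact Real.rpow_le_rpow_of_exponent_ge' a1 (satRatio_lt_one hn hx).le (by linarith) h2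
      _ ≤ 2 ^ q * (x / n) ^ (α - γ / 2) := by
          gcongr 2 ^ q * ?_
          exact Real.rpow_le_rpow a1 (satRatio_le_div hn hx) (by linarith)
      _ = _ := by rw [Real.div_rpow hx hn.le, Real.rpow_neg hn.le]; rfl
  have e1 : x ^ α = x ^ (γ / 2) * x ^ (α - γ / 2) := by
    rw [← Real.rpow_add_of_nonneg hx (by linarith) (by linarith)]; ring_nf
  have e2 : n ^ (γ / 2 - α - 1) = n ^ (-(α - γ / 2)) / n := by
    rw [show γ / 2 - α - 1 = -(α - γ / 2) - 1 by ring, Real.rpow_sub_one hn.ne']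
  calc _ ≤ (2 * x ^ (γ / 2)) * (2 ^ q * (x ^ (α - γ / 2) * n ^ (-(α - γ / 2))) / n * (x * y)) := by
        gcongr
    _ = _ := by rw [e1, e2, pow_succ]; ring

theorem gain_le (hγ0 : 0 ≤ γ) (hγ1 : γ ≤ 1) (hn : 0 < n) (q : ℕ) {α : ℝ}
    (h1 : γ / 2 ≤ α) (h2 : α - γ / 2 ≤ q) (v w : Velocity) :
    ‖v - w‖ ^ γ * (satRatio n (‖v‖ ^ 2 + ‖w‖ ^ 2) ^ q / n * (‖v‖ ^ 2 * ‖w‖ ^ 2)) ≤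
      2 ^ (q + 1) * n ^ (γ / 2 - α - 1) * (‖v‖ ^ 2 * (‖v‖ ^ 2) ^ α * ‖w‖ ^ 2
        + ‖v‖ ^ 2 * (‖w‖ ^ 2 * (‖w‖ ^ 2) ^ α)) := by
  have p1 : 0 ≤ ‖v‖ ^ 2 * (‖v‖ ^ 2) ^ α * ‖w‖ ^ 2 := by positivity
  have p2 : 0 ≤ ‖v‖ ^ 2 * (‖w‖ ^ 2 * (‖w‖ ^ 2) ^ α) := by positivity
  have p3 : 0 ≤ 2 ^ (q + 1) * n ^ (γ / 2 - α - 1) := by positivity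
  rw [mul_add]
  rcases le_total ‖w‖ ‖v‖ with h | h
  · exact (gain_le_of_le hγ0 hγ1 hn q h1 h2 h).trans (le_add_of_nonneg_right (mul_nonneg p3 p2))
  · have := gain_le_of_le hγ0 hγ1 hn q h1 h2 h
    rw [norm_sub_rev, add_comm (‖w‖ ^ 2), mul_comm (‖w‖ ^ 2) (‖v‖ ^ 2)] at this
    refine this.trans ?_
    have e : ‖w‖ ^ 2 * (‖w‖ ^ 2) ^ α * ‖v‖ ^ 2 = ‖v‖ ^ 2 * (‖w‖ ^ 2 * (‖w‖ ^ 2) ^ α) := by ring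
    rw [e]
    exact le_add_of_nonneg_left (mul_nonneg p3 p1)

/-- The dissipation density associated with an atom. -/
noncomputable def atomLoss (γ n : ℝ) (q : ℕ) (v : Velocity) : ℝ :=
  n * ‖v‖ ^ γ * satRatio n (‖v‖ ^ 2) ^ (q + 2)

theorem continuous_satRatio_norm (hn : 0 < n) :
    Continuous fun v : Velocity => satRatio n (‖v‖ ^ 2) :=
  (continuousOn_satRatio hn).comp_continuous (by fun_prop) fun v => by
    show (0 : ℝ) ≤ ‖v‖ ^ 2; positivity

theorem continuous_norm_rpow (hγ0 : 0 ≤ γ) : Continuous fun v : Velocity => ‖v‖ ^ γ :=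
  continuous_norm.rpow_const fun _ => Or.inr hγ0

theorem continuous_atomLoss (hγ0 : 0 ≤ γ) (hn : 0 < n) (q : ℕ) :
    Continuous (atomLoss γ n q) :=
  (continuous_const.mul (continuous_norm_rpow hγ0)).mul ((continuous_satRatio_norm hn).pow _)

theorem atomLoss_nonneg (hn : 0 < n) (q : ℕ) (v : Velocity) : 0 ≤ atomLoss γ n q v := by
  have := satRatio_nonneg hn (show 0 ≤ ‖v‖ ^ 2 by positivity)
  unfold atomLoss; positivity

theorem atomLoss_le_of_le (hγ0 : 0 ≤ γ) (hγ1 : γ ≤ 1) (hn : 0 < n) (q : ℕ) {v : Velocity} {r : ℝ}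
    (hr : 1 ≤ r) (h : ‖v‖ ^ 2 ≤ r) : atomLoss γ n q v ≤ r ^ (q + 3) / n ^ (q + 1) := by
  have hx : 0 ≤ ‖v‖ ^ 2 := by positivity
  have h0 := satRatio_nonneg hn hx
  have h1 : satRatio n (‖v‖ ^ 2) ≤ r / n := (satRatio_le_div hn hx).trans (by gcongr)
  have h2 : ‖v‖ ^ γ ≤ r := by
    rw [← rpow_half_norm_sq]
    calc (‖v‖ ^ 2) ^ (γ / 2) ≤ r ^ (γ / 2) := Real.rpow_le_rpow hx h (by linarith)
      _ ≤ r ^ (1 : ℝ) := Real.rpow_le_rpow_of_exponent_le hr (by linarith)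
      _ = r := Real.rpow_one r
  calc atomLoss γ n q v ≤ n * r * (r / n) ^ (q + 2) := by unfold atomLoss; gcongr
    _ = _ := by rw [div_pow]; field_simp; ring

/-- The atom loss of fast particles, truncated at height `N`. -/
noncomputable def fastLoss (γ n : ℝ) (q : ℕ) (N r : ℝ) (v : Velocity) : ℝ :=
  if r ≤ ‖v‖ ^ 2 then min (atomLoss γ n q v) N else 0

theorem fastLoss_nonneg (hn : 0 < n) (q : ℕ) {N : ℝ} (hN : 0 ≤ N) (r : ℝ) (v : Velocity) :
    0 ≤ fastLoss γ n q N r v := by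
  unfold fastLoss
  split_ifs
  · exact le_min (atomLoss_nonneg hn q v) hN
  · exact le_rfl

theorem fastLoss_le {N : ℝ} (q : ℕ) (hN : 0 ≤ N) (r : ℝ) (v : Velocity) :
    fastLoss γ n q N r v ≤ N := by
  unfold fastLoss
  split_ifs
  · exact min_le_right _ _
  · exact hN

theorem measurable_fastLoss (hγ0 : 0 ≤ γ) (hn : 0 < n) (q : ℕ) (N r : ℝ) :
    Measurable (fastLoss γ n q N r) := by
  unfold fastLoss
  refine Measurable.ite ?_ ?_ measurable_const
  · exact measurableSet_le measurable_const (by fun_prop)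
  · exact (continuous_atomLoss hγ0 hn q).measurable.min measurable_const

theorem integrable_fastLoss (μ : Measure Velocity) [IsFiniteMeasure μ] (hγ0 : 0 ≤ γ) (hn : 0 < n)
    (q : ℕ) {N : ℝ} (hN : 0 ≤ N) (r : ℝ) : Integrable (fastLoss γ n q N r) μ :=
  (integrable_const N).mono' (measurable_fastLoss hγ0 hn q N r).aestronglyMeasurable
    (ae_of_all _ fun v => by
      rw [Real.norm_eq_abs, abs_of_nonneg (fastLoss_nonneg hn q hN r v)]
      exact fastLoss_le q hN r v)

theorem integrable_min_atomLoss (μ : Measure Velocity) [IsFiniteMeasure μ] (hγ0 : 0 ≤ γ)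
    (hn : 0 < n) (q : ℕ) {N : ℝ} (hN : 0 ≤ N) :
    Integrable (fun v => min (atomLoss γ n q v) N) μ :=
  (integrable_const N).mono'
    ((continuous_atomLoss hγ0 hn q).min continuous_const).aestronglyMeasurable
    (ae_of_all _ fun v => by
      rw [Real.norm_eq_abs, abs_of_nonneg (le_min (atomLoss_nonneg hn q v) hN)]
      exact min_le_right _ _)

/-- Slow particles contribute a small negative power of n, so dissipation of the fast ones is
enough. The truncation at N keeps the loss bounded, hence integrable and weakly continuous in time,
before any moment is known. -/
theorem integral_min_atomLoss_le (μ : Measure Velocity) [IsProbabilityMeasure μ] (hγ0 : 0 ≤ γ)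
    (hγ1 : γ ≤ 1) (hn : 0 < n) (q : ℕ) {N : ℝ} (hN : 0 ≤ N) {r : ℝ} (hr : 1 ≤ r) :
    ∫ v, min (atomLoss γ n q v) N ∂μ ≤ ∫ v, fastLoss γ n q N r v ∂μ + r ^ (q + 3) / n ^ (q + 1) := by
  have e : ∫ v, fastLoss γ n q N r v ∂μ + r ^ (q + 3) / n ^ (q + 1)
      = ∫ v, (fastLoss γ n q N r v + r ^ (q + 3) / n ^ (q + 1)) ∂μ := by
    rw [integral_add (integrable_fastLoss μ hγ0 hn q hN r) (integrable_const _)]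
    simp
  rw [e]
  refine integral_mono (integrable_min_atomLoss μ hγ0 hn q hN)
    ((integrable_fastLoss μ hγ0 hn q hN r).add (integrable_const _)) fun v => ?_
  simp only [fastLoss]
  split_ifs with h
  · have : 0 ≤ r ^ (q + 3) / n ^ (q + 1) := by positivity
    linarith
  · rw [zero_add]
    exact (min_le_left _ _).trans (atomLoss_le_of_le hγ0 hγ1 hn q hr (not_le.mp h).le)

/-- The weight 1 - |w|²/2 is a minorant of the indicator of |w|² < 2 whose mean is exactly 1/2 since
the energy is 1. It decouples the fast particle from its partner: pairs with a fast partner get a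
nonpositive weight and need no lower bound on the loss. -/
theorem IsWeakSolution.integral_mul_one_sub (hf : IsWeakSolution γ β I J f) {t : ℝ} (ht : 0 ≤ t)
    (h : Velocity → ℝ) :
    ∫ p : Velocity × Velocity, h p.1 * (1 - ‖p.2‖ ^ 2 / 2)
      ∂((f t : Measure Velocity).prod (f t : Measure Velocity))
      = (∫ v, h v ∂(f t : Measure Velocity)) / 2 := by
  rw [integral_prod_mul h (fun w : Velocity => 1 - ‖w‖ ^ 2 / 2), integral_sub (integrable_const _)
    ((hf.integrable_energy ht).div_const 2), integral_div, hf.energy t ht]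
  simp
  ring

/-- The gain is integrated with the moment of order 1 + α in one particle and the energy in the
other; the loss is kept only for slow partners, through the weight 1 - |w|²/2. -/
theorem IsWeakSolution.collision_atom_le (hf : IsWeakSolution γ β I J f)
    (hB : IsHardPotential γ ν κ₁ κ₂ B β) (hF : IsFrame I J) (hγ0 : 0 ≤ γ) (hγ1 : γ ≤ 1)
    (hν : ν < 2) (hκ₁ : 0 < κ₁) (hκ₂ : 0 < κ₂) (q : ℕ) {α : ℝ} (h1 : γ / 2 ≤ α)
    (h2 : α - γ / 2 ≤ q) (hn : 32 ≤ n) {t K : ℝ} (ht : 0 < t)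
    (hi : Integrable (fun v : Velocity => ‖v‖ ^ 2 * (‖v‖ ^ 2) ^ α) (f t : Measure Velocity))
    (hK : ∫ v, ‖v‖ ^ 2 * (‖v‖ ^ 2) ^ α ∂(f t : Measure Velocity) ≤ K) {N : ℝ} (hN : 0 ≤ N) :
    ∫ p, collisionIntegral γ β I J (fun v => atom n q (‖v‖ ^ 2)) p.1 p.2
        ∂((f t : Measure Velocity).prod (f t : Measure Velocity)) ≤
      -(3 * Real.pi * κ₁ * angularSpread ν / 16)
          * ∫ v, min (atomLoss γ n q v) N ∂(f t : Measure Velocity)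
        + (3 * Real.pi * κ₁ * angularSpread ν / 16) * (32 ^ (q + 3) / n ^ (q + 1))
        + κ₂ * (32 * Real.pi * ((q + 2) * (q + 1) * 2 ^ (q + 1))) * angularMass ν * K
          * n ^ (γ / 2 - α - 1) := by
  have hn0 : 0 < n := by linarith
  have hpi := Real.pi_pos
  have hSp := angularSpread_pos hν
  have hM := angularMass_nonneg ν
  set c := 3 * Real.pi * κ₁ * angularSpread ν / 16 with hc
  have hc0 : 0 < c := by positivity
  set μ : Measure Velocity := (f t : Measure Velocity) with hμ
  set C := κ₂ * (16 * Real.pi * ((q + 2) * (q + 1) * 2 ^ (q + 1))) * angularMass ν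
    * n ^ (γ / 2 - α - 1) with hC
  have hC0 : 0 ≤ C := by positivity
  have hE : Integrable (fun v : Velocity => ‖v‖ ^ 2) μ := hf.integrable_energy ht.le
  have hpt : ∀ p : Velocity × Velocity,
      collisionIntegral γ β I J (fun v => atom n q (‖v‖ ^ 2)) p.1 p.2 ≤
        C * (‖p.1‖ ^ 2 * (‖p.1‖ ^ 2) ^ α * ‖p.2‖ ^ 2 + ‖p.1‖ ^ 2 * (‖p.2‖ ^ 2 * (‖p.2‖ ^ 2) ^ α))
        - 2 * c * (fastLoss γ n q N 32 p.1 * (1 - ‖p.2‖ ^ 2 / 2)) := by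
    rintro ⟨v, w⟩
    simp only
    have hx : 0 ≤ ‖v‖ ^ 2 := by positivity
    have hy : 0 ≤ ‖w‖ ^ 2 := by positivity
    refine (collisionIntegral_atom_le hB hF hν hn0 q v w).trans ?_
    have g := gain_le hγ0 hγ1 hn0 q h1 h2 v w
    have l : 2 * c * (fastLoss γ n q N 32 v * (1 - ‖w‖ ^ 2 / 2)) ≤ ‖v - w‖ ^ γ *
        (κ₁ * (4 * Real.pi * atomDefect n q (‖v‖ ^ 2) (‖w‖ ^ 2) * angularSpread ν)) := by
      have hJ := atomDefect_nonneg hn0 q hx hy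
      have hr : 0 ≤ ‖v - w‖ ^ γ * (κ₁ * (4 * Real.pi * atomDefect n q (‖v‖ ^ 2) (‖w‖ ^ 2)
        * angularSpread ν)) := by positivity
      have hF0 := fastLoss_nonneg (γ := γ) hn0 q hN 32 v
      by_cases hw : 2 ≤ ‖w‖ ^ 2
      · refine le_trans ?_ hr
        exact mul_nonpos_of_nonneg_of_nonpos (by positivity)
          (mul_nonpos_of_nonneg_of_nonpos hF0 (by linarith))
      · push Not at hw
        by_cases hv : 32 ≤ ‖v‖ ^ 2
        -- With n and |v|² at least 32, nz/(n+z) ≥ 16, and 3/16 of this is 3, above the bound 2 for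
        -- |w|²: the hypothesis of `le_atomDefect` holds.
        · have ha : 16 ≤ n * satRatio n (‖v‖ ^ 2) := by
            unfold satRatio
            rw [← mul_div_assoc, le_div_iff₀ (by linarith)]
            nlinarith
          have hyx : ‖w‖ ^ 2 ≤ 3 / 16 * (n * satRatio n (‖v‖ ^ 2)) := by linarith
          have d := le_atomDefect hn0 q hx hy hyx
          have hh := half_norm_rpow_le hγ0 hγ1 (v := v) (w := w) (by linarith)
          have hfl : fastLoss γ n q N 32 v ≤ atomLoss γ n q v := by
            unfold fastLoss; rw [if_pos hv]; exact min_le_left _ _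
          have ha0 := satRatio_nonneg hn0 hx
          calc 2 * c * (fastLoss γ n q N 32 v * (1 - ‖w‖ ^ 2 / 2))
              ≤ 2 * c * (atomLoss γ n q v * 1) := by
                have : 1 - ‖w‖ ^ 2 / 2 ≤ 1 := by linarith
                have h3 : 0 ≤ 1 - ‖w‖ ^ 2 / 2 := by linarith
                have h4 := atomLoss_nonneg (γ := γ) hn0 q v
                gcongr
            _ = ‖v‖ ^ γ / 2 * (κ₁ * (4 * Real.pi
                * (3 / 16 * (n * satRatio n (‖v‖ ^ 2) ^ (q + 2))) * angularSpread ν)) := by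
                rw [hc, atomLoss]; ring
            _ ≤ _ := by gcongr
        · have : fastLoss γ n q N 32 v = 0 := by unfold fastLoss; rw [if_neg hv]
          rw [this]; simpa using hr
    have g' : ‖v - w‖ ^ γ * (κ₂ * (16 * Real.pi * ((q + 2) * (q + 1)
        * satRatio n (‖v‖ ^ 2 + ‖w‖ ^ 2) ^ q / n) * (‖v‖ ^ 2 * ‖w‖ ^ 2) * angularMass ν))
        ≤ C * (‖v‖ ^ 2 * (‖v‖ ^ 2) ^ α * ‖w‖ ^ 2 + ‖v‖ ^ 2 * (‖w‖ ^ 2 * (‖w‖ ^ 2) ^ α)) := by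
      have := mul_le_mul_of_nonneg_left g (show 0 ≤ κ₂ * (16 * Real.pi * ((q + 2) * (q + 1)))
        * angularMass ν by positivity)
      calc _ = κ₂ * (16 * Real.pi * ((q + 2) * (q + 1))) * angularMass ν *
          (‖v - w‖ ^ γ * (satRatio n (‖v‖ ^ 2 + ‖w‖ ^ 2) ^ q / n * (‖v‖ ^ 2 * ‖w‖ ^ 2))) := by ring
        _ ≤ _ := this
        _ = _ := by rw [hC]; ring
    rw [mul_sub]
    linarith
  have hE1 : Integrable (fun w : Velocity => 1 - ‖w‖ ^ 2 / 2) μ :=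
    (integrable_const _).sub (hE.div_const 2)
  have i1 := hi.mul_prod hE
  have i2 := hE.mul_prod hi
  have i12 : Integrable (fun p : Velocity × Velocity => ‖p.1‖ ^ 2 * (‖p.1‖ ^ 2) ^ α * ‖p.2‖ ^ 2
    + ‖p.1‖ ^ 2 * (‖p.2‖ ^ 2 * (‖p.2‖ ^ 2) ^ α)) (μ.prod μ) := i1.add i2
  have i3 := (integrable_fastLoss μ hγ0 hn0 q hN 32).mul_prod hE1
  have step := integral_mono (hf.integrable_collision_atom hF (by linarith) q ht)
    ((i12.const_mul C).sub (i3.const_mul (2 * c))) hpt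
  refine step.trans ?_
  have e : (∫ p : Velocity × Velocity, (C * (‖p.1‖ ^ 2 * (‖p.1‖ ^ 2) ^ α * ‖p.2‖ ^ 2
        + ‖p.1‖ ^ 2 * (‖p.2‖ ^ 2 * (‖p.2‖ ^ 2) ^ α))
        - 2 * c * (fastLoss γ n q N 32 p.1 * (1 - ‖p.2‖ ^ 2 / 2))) ∂(μ.prod μ))
      = C * (2 * ∫ v, ‖v‖ ^ 2 * (‖v‖ ^ 2) ^ α ∂μ) - c * ∫ v, fastLoss γ n q N 32 v ∂μ := by
    rw [integral_sub (i12.const_mul C) (i3.const_mul (2 * c)), integral_const_mul,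
      integral_const_mul, integral_add i1 i2, hf.integral_mul_one_sub ht.le,
      integral_prod_mul (fun v : Velocity => ‖v‖ ^ 2 * (‖v‖ ^ 2) ^ α) (fun w : Velocity => ‖w‖ ^ 2),
      integral_prod_mul (fun v : Velocity => ‖v‖ ^ 2)
        (fun w : Velocity => ‖w‖ ^ 2 * (‖w‖ ^ 2) ^ α), hf.energy t ht.le]
    ring
  refine (le_of_eq e).trans ?_
  have m := integral_min_atomLoss_le μ hγ0 hγ1 hn0 q hN (r := 32) (by norm_num)
  have m' := mul_le_mul_of_nonneg_left m hc0.le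
  have k := mul_le_mul_of_nonneg_left hK (show 0 ≤ C * 2 by positivity)
  have e2 : κ₂ * (32 * Real.pi * ((q + 2) * (q + 1) * 2 ^ (q + 1))) * angularMass ν * K
          * n ^ (γ / 2 - α - 1) = C * 2 * K := by rw [hC]; ring
  rw [e2]
  linarith

end CrudeEstimate

/-! ### The atom with q = 0: bounds in product form. -/

section SharpEstimate

variable {γ ν κ₁ κ₂ : ℝ} {B : ℝ → ℝ → ℝ} {β : ℝ → ℝ} {I J : Velocity → Velocity}
  {f : ℝ → ProbabilityMeasure Velocity} {n x y u : ℝ}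

/-- `∫₀^π a(x sin²(θ/2)) θ^(-ν-1) dθ` with `a(z) = z / (n + z)`. -/
noncomputable def satMass (ν n x : ℝ) : ℝ :=
  ∫ θ in (0 : ℝ)..Real.pi, satRatio n (halfSinSq θ * x) * θ ^ (-ν - 1)

/-- The variant of `satMass` with weight `cos²(θ/2)`. -/
noncomputable def satSpread (ν n x : ℝ) : ℝ :=
  ∫ θ in (0 : ℝ)..Real.pi, ((1 - halfSinSq θ) * satRatio n (halfSinSq θ * x)) * θ ^ (-ν - 1)

theorem continuous_satRatio_halfSinSq (hn : 0 < n) (hx : 0 ≤ x) :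
    Continuous fun θ => satRatio n (halfSinSq θ * x) := by
  have hu := continuous_halfSinSq
  unfold satRatio
  refine Continuous.div (by fun_prop) (by fun_prop) fun θ => ?_
  have := halfSinSq_nonneg θ
  positivity

theorem satRatio_halfSinSq_le (hn : 0 < n) (hx : 0 ≤ x) (θ : ℝ) :
    satRatio n (halfSinSq θ * x) ≤ x / n * halfSinSq θ := by
  refine (satRatio_le_div hn (mul_nonneg (halfSinSq_nonneg θ) hx)).trans (le_of_eq ?_)
  ring

theorem satRatio_halfSinSq_nonneg (hn : 0 < n) (hx : 0 ≤ x) (θ : ℝ) :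
    0 ≤ satRatio n (halfSinSq θ * x) :=
  satRatio_nonneg hn (mul_nonneg (halfSinSq_nonneg θ) hx)

theorem intervalIntegrable_satMass (hν : ν < 2) (hn : 0 < n) (hx : 0 ≤ x) :
    IntervalIntegrable (fun θ => satRatio n (halfSinSq θ * x) * θ ^ (-ν - 1)) volume 0 Real.pi :=
  intervalIntegrable_mul_rpow hν (continuous_satRatio_halfSinSq hn hx) fun θ _ => by
    rw [abs_of_nonneg (satRatio_halfSinSq_nonneg hn hx θ)]
    exact satRatio_halfSinSq_le hn hx θ

theorem cos_mul_satRatio_le (hn : 0 < n) (hx : 0 ≤ x) (θ : ℝ) :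
    (1 - halfSinSq θ) * satRatio n (halfSinSq θ * x) ≤ satRatio n (halfSinSq θ * x) :=
  mul_le_of_le_one_left (satRatio_halfSinSq_nonneg hn hx θ) (by linarith [halfSinSq_nonneg θ])

theorem cos_mul_satRatio_nonneg (hn : 0 < n) (hx : 0 ≤ x) (θ : ℝ) :
    0 ≤ (1 - halfSinSq θ) * satRatio n (halfSinSq θ * x) :=
  mul_nonneg (by linarith [halfSinSq_le_one θ]) (satRatio_halfSinSq_nonneg hn hx θ)

theorem continuous_cos_mul_satRatio (hn : 0 < n) (hx : 0 ≤ x) :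
    Continuous fun θ => (1 - halfSinSq θ) * satRatio n (halfSinSq θ * x) :=
  (continuous_const.sub continuous_halfSinSq).mul (continuous_satRatio_halfSinSq hn hx)

theorem intervalIntegrable_satSpread (hν : ν < 2) (hn : 0 < n) (hx : 0 ≤ x) :
    IntervalIntegrable (fun θ => ((1 - halfSinSq θ) * satRatio n (halfSinSq θ * x))
      * θ ^ (-ν - 1)) volume 0 Real.pi :=
  intervalIntegrable_mul_rpow hν (continuous_cos_mul_satRatio hn hx) fun θ _ => by
    rw [abs_of_nonneg (cos_mul_satRatio_nonneg hn hx θ)]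
    exact (cos_mul_satRatio_le hn hx θ).trans (satRatio_halfSinSq_le hn hx θ)

theorem intervalIntegrable_angularMass (hν : ν < 2) :
    IntervalIntegrable (fun θ => halfSinSq θ * θ ^ (-ν - 1)) volume 0 Real.pi :=
  intervalIntegrable_mul_rpow (C := 1) hν continuous_halfSinSq fun θ _ => by
    rw [abs_of_nonneg (halfSinSq_nonneg θ), one_mul]

theorem intervalIntegrable_angularSpread (hν : ν < 2) :
    IntervalIntegrable (fun θ => (halfSinSq θ * (1 - halfSinSq θ)) * θ ^ (-ν - 1)) volume 0
      Real.pi :=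
  intervalIntegrable_mul_rpow (C := 1) hν
    (continuous_halfSinSq.mul (continuous_const.sub continuous_halfSinSq)) fun θ _ => by
    have h0 := halfSinSq_nonneg θ
    have h1 := halfSinSq_le_one θ
    rw [abs_of_nonneg (mul_nonneg h0 (by linarith))]
    nlinarith

theorem weighted_integral_mono {g h : ℝ → ℝ}
    (hg : IntervalIntegrable (fun θ => g θ * θ ^ (-ν - 1)) volume 0 Real.pi)
    (hh : IntervalIntegrable (fun θ => h θ * θ ^ (-ν - 1)) volume 0 Real.pi)
    (hgh : ∀ θ, g θ ≤ h θ) :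
    ∫ θ in (0 : ℝ)..Real.pi, g θ * θ ^ (-ν - 1) ≤ ∫ θ in (0 : ℝ)..Real.pi, h θ * θ ^ (-ν - 1) :=
  intervalIntegral.integral_mono_on Real.pi_pos.le hg hh fun θ hθ =>
    mul_le_mul_of_nonneg_right (hgh θ) (Real.rpow_nonneg hθ.1 _)

theorem satMass_nonneg (hn : 0 < n) (hx : 0 ≤ x) : 0 ≤ satMass ν n x :=
  intervalIntegral.integral_nonneg Real.pi_pos.le fun θ hθ =>
    mul_nonneg (satRatio_halfSinSq_nonneg hn hx θ) (Real.rpow_nonneg hθ.1 _)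

theorem satSpread_le_satMass (hν : ν < 2) (hn : 0 < n) (hx : 0 ≤ x) :
    satSpread ν n x ≤ satMass ν n x :=
  weighted_integral_mono (intervalIntegrable_satSpread hν hn hx)
    (intervalIntegrable_satMass hν hn hx) fun θ => cos_mul_satRatio_le hn hx θ

theorem satMass_mono (hν : ν < 2) (hn : 0 < n) (hx : 0 ≤ x) (hxy : x ≤ y) :
    satMass ν n x ≤ satMass ν n y :=
  weighted_integral_mono (intervalIntegrable_satMass hν hn hx)
    (intervalIntegrable_satMass hν hn (hx.trans hxy)) fun θ =>
      satRatio_mono hn (mul_nonneg (halfSinSq_nonneg θ) hx)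
        (mul_le_mul_of_nonneg_left hxy (halfSinSq_nonneg θ))

theorem satMass_le (hν : ν < 2) (hn : 0 < n) (hx : 0 ≤ x) :
    satMass ν n x ≤ angularMass ν * x / n := by
  have hi := (intervalIntegrable_angularMass hν).const_mul (x / n)
  have := weighted_integral_mono (ν := ν) (g := fun θ => satRatio n (halfSinSq θ * x))
    (h := fun θ => x / n * halfSinSq θ) (intervalIntegrable_satMass hν hn hx)
    (by simpa only [mul_assoc] using hi) fun θ => satRatio_halfSinSq_le hn hx θ
  simp only [mul_assoc, intervalIntegral.integral_const_mul] at this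
  refine this.trans (le_of_eq ?_)
  unfold angularMass; ring

theorem angularSpread_mul_le_satSpread (hν : ν < 2) (hn : 0 < n) (hx : 0 ≤ x) :
    angularSpread ν * satRatio n x ≤ satSpread ν n x := by
  have hi := (intervalIntegrable_angularSpread hν).const_mul (satRatio n x)
  have := weighted_integral_mono (ν := ν)
    (g := fun θ => satRatio n x * (halfSinSq θ * (1 - halfSinSq θ)))
    (h := fun θ => (1 - halfSinSq θ) * satRatio n (halfSinSq θ * x))
    (by simpa only [mul_assoc] using hi) (intervalIntegrable_satSpread hν hn hx) fun θ => by
      have h0 := halfSinSq_nonneg θ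
      have h1 := halfSinSq_le_one θ
      have := mul_le_mul_of_nonneg_left (mul_satRatio_le_satRatio_mul hn hx h0 h1)
        (show 0 ≤ 1 - halfSinSq θ by linarith)
      linarith
  simp only [mul_assoc, intervalIntegral.integral_const_mul] at this
  unfold angularSpread satSpread
  simp only [mul_assoc]
  linarith

/-- Write 1 = (1 - u) + u. The part carrying u is at most `angularMass` times the ratio at x, and
`satSpread` already dominates `angularSpread` times that ratio. Gain and loss may thus be compared
without loss of order in n or x. -/
theorem satMass_le_satSpread (hν : ν < 2) (hn : 0 < n) (hx : 0 ≤ x) :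
    satMass ν n x ≤ (1 + angularMass ν / angularSpread ν) * satSpread ν n x := by
  have hSp := angularSpread_pos hν
  have hM := angularMass_nonneg ν
  have h1 : satMass ν n x ≤ satSpread ν n x + angularMass ν * satRatio n x := by
    have hi := (intervalIntegrable_angularMass hν).const_mul (satRatio n x)
    have hi' : IntervalIntegrable (fun θ => (satRatio n x * halfSinSq θ) * θ ^ (-ν - 1)) volume 0
      Real.pi := by simpa only [mul_assoc] using hi
    have e : satSpread ν n x + angularMass ν * satRatio n x = ∫ θ in (0 : ℝ)..Real.pi,
        ((1 - halfSinSq θ) * satRatio n (halfSinSq θ * x) + satRatio n x * halfSinSq θ)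
          * θ ^ (-ν - 1) := by
      simp only [add_mul]
      rw [intervalIntegral.integral_add (intervalIntegrable_satSpread hν hn hx) hi']
      simp only [mul_assoc (satRatio n x), intervalIntegral.integral_const_mul]
      rw [mul_comm (satRatio n x)]; rfl
    rw [e]
    refine weighted_integral_mono (intervalIntegrable_satMass hν hn hx) ?_ fun θ => ?_
    · simp only [add_mul]
      exact (intervalIntegrable_satSpread hν hn hx).add hi'
    · have h0 := halfSinSq_nonneg θ
      have h1 := halfSinSq_le_one θ
      have : satRatio n (halfSinSq θ * x) ≤ satRatio n x :=
        satRatio_mono hn (mul_nonneg h0 hx) (mul_le_of_le_one_left hx h1)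
      have := mul_le_mul_of_nonneg_left this h0
      linarith
  have h2 := angularSpread_mul_le_satSpread hν hn hx
  have h3 : angularMass ν * satRatio n x ≤ angularMass ν / angularSpread ν * satSpread ν n x := by
    rw [div_mul_eq_mul_div, le_div_iff₀ hSp]
    nlinarith
  linarith

/-- For fixed u in [0, 1], the quotient of the ratios at uz and at z is u(n+z)/(n+uz), nondecreasing
in z. This monotonicity feeds the rearrangement in `sharp_gain_le`. -/
theorem satRatio_mul_satMass_le (hν : ν < 2) (hn : 0 < n) (hy : 0 ≤ y) (hyx : y ≤ x) :
    satRatio n x * satMass ν n y ≤ satRatio n y * satMass ν n x := by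
  have hx : 0 ≤ x := hy.trans hyx
  have i1 := (intervalIntegrable_satMass hν hn hy).const_mul (satRatio n x)
  have i2 := (intervalIntegrable_satMass hν hn hx).const_mul (satRatio n y)
  have := weighted_integral_mono (ν := ν)
    (g := fun θ => satRatio n x * satRatio n (halfSinSq θ * y))
    (h := fun θ => satRatio n y * satRatio n (halfSinSq θ * x))
    (by simpa only [mul_assoc] using i1) (by simpa only [mul_assoc] using i2) fun θ => by
      have h0 := halfSinSq_nonneg θ
      have h1 := halfSinSq_le_one θ
      unfold satRatio
      rw [div_mul_div_comm, div_mul_div_comm, div_le_div_iff₀ (by positivity) (by positivity)]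
      have e : (n + y) * (n + halfSinSq θ * x) ≤ (n + x) * (n + halfSinSq θ * y) := by
        nlinarith [mul_nonneg hn.le (mul_nonneg (sub_nonneg.mpr h1) (sub_nonneg.mpr hyx))]
      have p : 0 ≤ halfSinSq θ * (x * y) := by positivity
      calc x * (halfSinSq θ * y) * ((n + y) * (n + halfSinSq θ * x))
          = halfSinSq θ * (x * y) * ((n + y) * (n + halfSinSq θ * x)) := by ring
        _ ≤ halfSinSq θ * (x * y) * ((n + x) * (n + halfSinSq θ * y)) := by gcongr
        _ = _ := by ring
  unfold satMass
  simpa only [mul_assoc, intervalIntegral.integral_const_mul] using this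

theorem atom_zero_eq (hn : 0 < n) {z : ℝ} (hz : 0 ≤ z) :
    atom n 0 z = z - n + n ^ 2 * (n + z)⁻¹ := by
  unfold atom satRatio
  rw [zero_add, pow_one]
  have : n + z ≠ 0 := by positivity
  field_simp; ring

/-- The second-order remainder of the inverse is exactly t²/(A²(A + t)), and A + t is bounded below
by n. Keeping A² in the denominator is what a sup bound on the second derivative would lose. -/
theorem inv_add_le {A t : ℝ} (hn : 0 < n) (hA : 0 < A) (h : n ≤ A + t) :
    (A + t)⁻¹ ≤ A⁻¹ - t / A ^ 2 + t ^ 2 / (A ^ 2 * n) := by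
  have hAt : 0 < A + t := by linarith
  have e : (A + t)⁻¹ = A⁻¹ - t / A ^ 2 + t ^ 2 / (A ^ 2 * (A + t)) := by field_simp; ring
  rw [e]
  gcongr

/-- Because (n + X)(n + Y) ≤ (n + X + Y)², the gain factors into saturation ratios of the two
energies. Unlike a bound in XY/n, this remains under control for large energies with no moment
assumption. -/
theorem shift_gain_le (hn : 0 < n) {X Y t : ℝ} (hX : 0 ≤ X) (hY : 0 ≤ Y)
    (ht : t ^ 2 ≤ 4 * (X * Y)) :
    n ^ 2 * (t ^ 2 / ((n + (X + Y)) ^ 2 * n)) ≤ 4 * n * (satRatio n X * satRatio n Y) := by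
  unfold satRatio
  calc n ^ 2 * (t ^ 2 / ((n + (X + Y)) ^ 2 * n)) = n * (t ^ 2 / (n + (X + Y)) ^ 2) := by
        field_simp
    _ ≤ n * (4 * (X * Y) / ((n + X) * (n + Y))) := by
        have : (n + X) * (n + Y) ≤ (n + (X + Y)) ^ 2 := by nlinarith
        gcongr
    _ = _ := by field_simp

/-- For the profile 1/(n+z) the loss is computable: the mixed energies Z, W have the same sum as x,
y, and ZW - xy = u(1 - u)(x - y)². The conditions on y give (x - y)² ≥ x²/4, n + y ≤ 2n and n + W ≤
2(n + ux). -/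
theorem atom_zero_loss (hn : 0 < n) (hx : 0 ≤ x) (hy : 0 ≤ y) (h0 : 0 ≤ u) (h1 : u ≤ 1)
    (hyx : y ≤ x / 2) (hyn : y ≤ n) :
    n / 16 * satRatio n x * ((1 - u) * satRatio n (u * x)) ≤
      n ^ 2 * ((n + x)⁻¹ + (n + y)⁻¹ - (n + ((1 - u) * x + u * y))⁻¹
        - (n + (u * x + (1 - u) * y))⁻¹) := by
  have h1' : 0 ≤ 1 - u := by linarith
  set Z := (1 - u) * x + u * y with hZ
  set W := u * x + (1 - u) * y with hW
  have hZ0 : 0 ≤ Z := by positivity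
  have hW0 : 0 ≤ W := by positivity
  have e : n ^ 2 * ((n + x)⁻¹ + (n + y)⁻¹ - (n + Z)⁻¹ - (n + W)⁻¹)
      = n ^ 2 * (u * (1 - u) * (x - y) ^ 2 / ((n + x) * (n + y))) * ((n + Z)⁻¹ + (n + W)⁻¹) := by
    have e1 : u * (1 - u) * (x - y) ^ 2 = Z * W - x * y := by rw [hZ, hW]; ring
    have e2 : x = Z + W - y := by rw [hZ, hW]; ring
    rw [e1]
    have k1 : n + x ≠ 0 := by positivity
    have k2 : n + y ≠ 0 := by positivity
    have k3 : n + Z ≠ 0 := by positivity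
    have k4 : n + W ≠ 0 := by positivity
    clear_value Z W
    field_simp
    rw [e2]
    ring
  rw [e]
  have hWle : n + W ≤ 2 * (n + u * x) := by
    have : (1 - u) * y ≤ 1 * n := by gcongr; linarith
    have : 0 ≤ u * x := by positivity
    rw [hW]; linarith
  have hxy : x ^ 2 / 4 ≤ (x - y) ^ 2 := by nlinarith
  unfold satRatio
  calc n / 16 * (x / (n + x)) * ((1 - u) * (u * x / (n + u * x)))
      = n ^ 2 * (u * (1 - u) * (x ^ 2 / 4) / ((n + x) * (2 * n))) * (2 * (n + u * x))⁻¹ := by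
        have : n + u * x ≠ 0 := by positivity
        field_simp; ring
    _ ≤ n ^ 2 * (u * (1 - u) * (x - y) ^ 2 / ((n + x) * (n + y))) * (n + W)⁻¹ := by
        have : n + y ≤ 2 * n := by linarith
        gcongr
    _ ≤ _ := by
        have : 0 ≤ (n + Z)⁻¹ := by positivity
        have : 0 ≤ n ^ 2 * (u * (1 - u) * (x - y) ^ 2 / ((n + x) * (n + y))) := by positivity
        gcongr
        linarith

/-- The switch χ allows one statement for both regimes: with χ = 1 the quantitative loss for a slow
partner is kept, with χ = 0 only its sign, known from convexity, is used. -/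
theorem angularAverage_atom_zero_le (hn : 0 < n) (hx : 0 ≤ x) (hy : 0 ≤ y) {R : ℝ}
    (hR : R ^ 2 ≤ x * y) (θ : ℝ) {χ : ℝ} (hχ : χ = 0 ∨ (χ = 1 ∧ y ≤ x / 2 ∧ y ≤ n)) :
    angularAverage (atom n 0) x y R θ ≤
      8 * Real.pi * n * (satRatio n x * satRatio n (halfSinSq θ * y)
        + satRatio n y * satRatio n (halfSinSq θ * x))
      - χ * (Real.pi * n / 8) * satRatio n x
        * ((1 - halfSinSq θ) * satRatio n (halfSinSq θ * x)) := by
  have hu0 := halfSinSq_nonneg θ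
  have hu1 := halfSinSq_le_one θ
  set u := halfSinSq θ with hu
  have hu1' : 0 ≤ 1 - u := by linarith
  have h := angularAverage_le (g := atom n 0)
    (A := 4 * n * (satRatio n x * satRatio n (u * y) + satRatio n y * satRatio n (u * x))
      - χ * (n / 16 * satRatio n x * ((1 - u) * satRatio n (u * x))))
    (b := n ^ 2 * (-1 / (n + ((1 - u) * x + u * y)) ^ 2 + 1 / (n + (u * x + (1 - u) * y)) ^ 2))
    (θ := θ) (continuousOn_atom hn 0) hx hy hR ?_
  · refine h.trans (le_of_eq ?_); ring
  intro t ht p1 p2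
  rw [← hu] at ht p1 p2 ⊢
  have q1 : 0 ≤ (1 - u) * x + u * y := by positivity
  have q2 : 0 ≤ u * x + (1 - u) * y := by positivity
  rw [atom_zero_eq hn p1, atom_zero_eq hn p2, atom_zero_eq hn hx, atom_zero_eq hn hy]
  have s1 := inv_add_le (A := n + ((1 - u) * x + u * y)) (t := t) hn (by linarith) (by linarith)
  have s2 := inv_add_le (A := n + (u * x + (1 - u) * y)) (t := -t) hn (by linarith) (by linarith)
  have g1 := shift_gain_le hn (X := (1 - u) * x) (Y := u * y) (t := t) (by positivity)
    (by positivity) (by linarith)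
  have g2 := shift_gain_le hn (X := u * x) (Y := (1 - u) * y) (t := t) (by positivity)
    (by positivity) (by linarith)
  have m1 : satRatio n ((1 - u) * x) * satRatio n (u * y) ≤ satRatio n x * satRatio n (u * y) := by
    have := satRatio_nonneg hn (show 0 ≤ u * y by positivity)
    have := satRatio_mono hn (show 0 ≤ (1 - u) * x by positivity)
      (show (1 - u) * x ≤ x from mul_le_of_le_one_left hx (by linarith))
    gcongr
  have m2 : satRatio n (u * x) * satRatio n ((1 - u) * y) ≤ satRatio n y * satRatio n (u * x) := by
    have := satRatio_nonneg hn (show 0 ≤ u * x by positivity)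
    have := satRatio_mono hn (show 0 ≤ (1 - u) * y by positivity)
      (show (1 - u) * y ≤ y from mul_le_of_le_one_left hy (by linarith))
    rw [mul_comm]
    gcongr
  have l : χ * (n / 16 * satRatio n x * ((1 - u) * satRatio n (u * x))) ≤
      n ^ 2 * ((n + x)⁻¹ + (n + y)⁻¹ - (n + ((1 - u) * x + u * y))⁻¹
        - (n + (u * x + (1 - u) * y))⁻¹) := by
    rcases hχ with rfl | ⟨rfl, c1, c2⟩
    · have := atom_loss_le hn 0 hx hy hu0 hu1
      have hJ := atomDefect_nonneg hn 0 hx hy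
      rw [atom_zero_eq hn q1, atom_zero_eq hn q2, atom_zero_eq hn hx, atom_zero_eq hn hy] at this
      have : 0 ≤ 2 * (u * (1 - u)) * atomDefect n 0 x y := by positivity
      linarith
    · rw [one_mul]; exact atom_zero_loss hn hx hy hu0 hu1 c1 c2
  have s1' := mul_le_mul_of_nonneg_left s1 (show 0 ≤ n ^ 2 by positivity)
  have s2' := mul_le_mul_of_nonneg_left s2 (show 0 ≤ n ^ 2 by positivity)
  rw [neg_sq] at s2'
  have n1 := mul_le_mul_of_nonneg_left m1 (show 0 ≤ 4 * n by positivity)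
  have n2 := mul_le_mul_of_nonneg_left m2 (show 0 ≤ 4 * n by positivity)
  have e1 : n + ((1 - u) * x + u * y) + t = n + ((1 - u) * x + u * y + t) := by ring
  have e2 : n + (u * x + (1 - u) * y) + -t = n + (u * x + (1 - u) * y - t) := by ring
  rw [e1] at s1'
  rw [e2] at s2'
  have e3 : n ^ 2 * (-1 / (n + ((1 - u) * x + u * y)) ^ 2 + 1 / (n + (u * x + (1 - u) * y)) ^ 2) * t
    = n ^ 2 * (-(t / (n + ((1 - u) * x + u * y)) ^ 2))
      + n ^ 2 * (t / (n + (u * x + (1 - u) * y)) ^ 2) := by ring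
  rw [e3]
  have e4 : -t / (n + (u * x + (1 - u) * y)) ^ 2 = -(t / (n + (u * x + (1 - u) * y)) ^ 2) := by ring
  rw [e4] at s2'
  linarith

theorem collisionIntegral_atom_zero_le (hB : IsHardPotential γ ν κ₁ κ₂ B β) (hF : IsFrame I J)
    (hν : ν < 2) (hn : 0 < n) (v w : Velocity) {χ : ℝ}
    (hχ : χ = 0 ∨ (χ = 1 ∧ ‖w‖ ^ 2 ≤ ‖v‖ ^ 2 / 2 ∧ ‖w‖ ^ 2 ≤ n)) :
    collisionIntegral γ β I J (fun v => atom n 0 (‖v‖ ^ 2)) v w ≤ ‖v - w‖ ^ γ *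
      (κ₂ * (8 * Real.pi * n * (satRatio n (‖v‖ ^ 2) * satMass ν n (‖w‖ ^ 2)
        + satRatio n (‖w‖ ^ 2) * satMass ν n (‖v‖ ^ 2)))
      - κ₁ * (χ * (Real.pi * n / 8) * satRatio n (‖v‖ ^ 2) * satSpread ν n (‖v‖ ^ 2))) := by
  obtain ⟨R, hR0, hR, h⟩ := hF.exists_collisionIntegral_eq γ β v w
  rw [h]
  refine mul_le_mul_of_nonneg_left ?_ (Real.rpow_nonneg (norm_nonneg _) _)
  have hx : 0 ≤ ‖v‖ ^ 2 := by positivity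
  have hy : 0 ≤ ‖w‖ ^ 2 := by positivity
  set x := ‖v‖ ^ 2
  set y := ‖w‖ ^ 2
  have hax := satRatio_nonneg hn hx
  have hay := satRatio_nonneg hn hy
  have hpi := Real.pi_pos
  have hχ0 : 0 ≤ χ := by rcases hχ with rfl | ⟨rfl, -, -⟩ <;> norm_num
  set P := χ * (Real.pi * n / 8) * satRatio n x with hP
  have hP0 : 0 ≤ P := by positivity
  set E := 8 * Real.pi * n with hE
  have hE0 : 0 ≤ E := by positivity
  have iy := (intervalIntegrable_satMass hν hn hy).const_mul (satRatio n x)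
  have ix := (intervalIntegrable_satMass hν hn hx).const_mul (satRatio n y)
  have key := hB.integral_le hν (A := angularAverage (atom n 0) x y R)
    (L := fun θ => P * ((1 - halfSinSq θ) * satRatio n (halfSinSq θ * x)))
    (G := fun θ => E * (satRatio n x * satRatio n (halfSinSq θ * y)
      + satRatio n y * satRatio n (halfSinSq θ * x)))
    (CL := P * (x / n)) (CG := E * (satRatio n x * (y / n) + satRatio n y * (x / n)))
    (continuous_angularAverage (continuousOn_atom hn 0) hx hy hR)
    (continuous_const.mul (continuous_cos_mul_satRatio hn hx))
    (continuous_const.mul ((continuous_const.mul (continuous_satRatio_halfSinSq hn hy)).add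
      (continuous_const.mul (continuous_satRatio_halfSinSq hn hx))))
    (fun θ _ => abs_angularAverage_atom_le hn 0 hx hy hR θ)
    (fun θ _ => mul_nonneg hP0 (cos_mul_satRatio_nonneg hn hx θ))
    (fun θ _ => by
      rw [mul_assoc P (x / n)]
      exact mul_le_mul_of_nonneg_left
        ((cos_mul_satRatio_le hn hx θ).trans (satRatio_halfSinSq_le hn hx θ)) hP0)
    (fun θ _ => by
      have := satRatio_halfSinSq_nonneg hn hx θ
      have := satRatio_halfSinSq_nonneg hn hy θ
      positivity)
    (fun θ _ => by
      have h1 := mul_le_mul_of_nonneg_left (satRatio_halfSinSq_le hn hx θ) hay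
      have h2 := mul_le_mul_of_nonneg_left (satRatio_halfSinSq_le hn hy θ) hax
      rw [mul_assoc E (satRatio n x * (y / n) + satRatio n y * (x / n))]
      exact mul_le_mul_of_nonneg_left (by linarith) hE0)
    (fun θ _ => angularAverage_atom_zero_le hn hx hy hR θ hχ)
  refine key.trans (le_of_eq ?_)
  simp only [mul_assoc E, mul_assoc P, add_mul, mul_assoc (satRatio n x), mul_assoc (satRatio n y),
    intervalIntegral.integral_const_mul]
  rw [intervalIntegral.integral_add iy ix]
  simp only [intervalIntegral.integral_const_mul]
  rfl

end SharpEstimate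

/-! ### Dissipation of the atom with q = 0 from the energy alone. -/

section SharpDissipation

variable {γ ν κ₁ κ₂ : ℝ} {B : ℝ → ℝ → ℝ} {β : ℝ → ℝ} {I J : Velocity → Velocity}
  {f : ℝ → ProbabilityMeasure Velocity} {n : ℝ}

/-- `|v|^γ` times the saturated mass. -/
noncomputable def satMoment (γ ν n : ℝ) (v : Velocity) : ℝ := ‖v‖ ^ γ * satMass ν n (‖v‖ ^ 2)

theorem satMoment_nonneg (hn : 0 < n) (v : Velocity) : 0 ≤ satMoment γ ν n v :=
  mul_nonneg (Real.rpow_nonneg (norm_nonneg _) _) (satMass_nonneg hn (by positivity))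

theorem measurable_satMoment (hγ0 : 0 ≤ γ) (hν : ν < 2) (hn : 0 < n) :
    Measurable (satMoment γ ν n) := by
  -- Measurability comes from monotonicity; clipping at 0 makes the profile monotone on the whole
  -- line without changing it at |v|².
  have hm : Monotone fun z => satMass ν n (max z 0) := fun a b hab =>
    satMass_mono hν hn (le_max_right _ _) (max_le_max_right 0 hab)
  have e : satMoment γ ν n = fun v => ‖v‖ ^ γ * (fun z => satMass ν n (max z 0)) (‖v‖ ^ 2) := by
    ext v
    simp only [satMoment]
    rw [max_eq_left (by positivity : (0 : ℝ) ≤ ‖v‖ ^ 2)]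
  rw [e]
  exact (continuous_norm_rpow hγ0).measurable.mul (hm.measurable.comp (by fun_prop))

theorem satMoment_le_of_le (hγ0 : 0 ≤ γ) (hγ1 : γ ≤ 1) (hν : ν < 2) (hn : 0 < n) {v : Velocity}
    {r : ℝ} (hr : 1 ≤ r) (h : ‖v‖ ^ 2 ≤ r) :
    satMoment γ ν n v ≤ angularMass ν * r ^ 2 / n := by
  have hx : 0 ≤ ‖v‖ ^ 2 := by positivity
  have hM := angularMass_nonneg ν
  have h2 : ‖v‖ ^ γ ≤ r := by
    rw [← rpow_half_norm_sq]
    calc (‖v‖ ^ 2) ^ (γ / 2) ≤ r ^ (γ / 2) := Real.rpow_le_rpow hx h (by linarith)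
      _ ≤ r ^ (1 : ℝ) := Real.rpow_le_rpow_of_exponent_le hr (by linarith)
      _ = r := Real.rpow_one r
  have h3 : satMass ν n (‖v‖ ^ 2) ≤ angularMass ν * r / n :=
    (satMass_le hν hn hx).trans (by gcongr)
  have h4 := satMass_nonneg (ν := ν) hn hx
  calc satMoment γ ν n v ≤ r * (angularMass ν * r / n) := by unfold satMoment; gcongr
    _ = _ := by ring

/-- A Chebyshev rearrangement: by `satRatio_mul_satMass_le`, |v|^γ - |w|^γ has the same sign as the
difference of the two products. Hence the kinetic factor may be attached to the particle carrying
the saturated mass, and n times the other ratio is at most the other energy. -/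
theorem sharp_gain_le (hγ0 : 0 ≤ γ) (hγ1 : γ ≤ 1) (hν : ν < 2) (hn : 0 < n) (v w : Velocity) :
    ‖v - w‖ ^ γ * (n * (satRatio n (‖v‖ ^ 2) * satMass ν n (‖w‖ ^ 2)
        + satRatio n (‖w‖ ^ 2) * satMass ν n (‖v‖ ^ 2))) ≤
      2 * (satMoment γ ν n v * ‖w‖ ^ 2 + ‖v‖ ^ 2 * satMoment γ ν n w) := by
  have hx : 0 ≤ ‖v‖ ^ 2 := by positivity
  have hy : 0 ≤ ‖w‖ ^ 2 := by positivity
  have hX : 0 ≤ ‖v‖ ^ γ := Real.rpow_nonneg (norm_nonneg _) _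
  have hY : 0 ≤ ‖w‖ ^ γ := Real.rpow_nonneg (norm_nonneg _) _
  have bx := satMass_nonneg (ν := ν) hn hx
  have hby := satMass_nonneg (ν := ν) hn hy
  have ax := satRatio_nonneg hn hx
  have ay := satRatio_nonneg hn hy
  have cheb : 0 ≤ (‖v‖ ^ γ - ‖w‖ ^ γ) * (satRatio n (‖w‖ ^ 2) * satMass ν n (‖v‖ ^ 2)
      - satRatio n (‖v‖ ^ 2) * satMass ν n (‖w‖ ^ 2)) := by
    rcases le_total ‖w‖ ‖v‖ with h | h
    · exact mul_nonneg (sub_nonneg.mpr (Real.rpow_le_rpow (norm_nonneg _) h hγ0))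
        (sub_nonneg.mpr (satRatio_mul_satMass_le hν hn hy (by gcongr)))
    · exact mul_nonneg_of_nonpos_of_nonpos
        (sub_nonpos.mpr (Real.rpow_le_rpow (norm_nonneg _) h hγ0))
        (sub_nonpos.mpr (satRatio_mul_satMass_le hν hn hx (by gcongr)))
  have nx := mul_satRatio_le hn hx
  have ny := mul_satRatio_le hn hy
  have s := norm_sub_rpow_le hγ0 hγ1 v w
  unfold satMoment
  set X := ‖v‖ ^ γ
  set Y := ‖w‖ ^ γ
  set x := ‖v‖ ^ 2
  set y := ‖w‖ ^ 2
  calc _ ≤ (X + Y) * (n * (satRatio n x * satMass ν n y + satRatio n y * satMass ν n x)) := by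
        gcongr
    _ ≤ 2 * (X * satMass ν n x * (n * satRatio n y) + (n * satRatio n x) * (Y * satMass ν n y)) := by
        have := mul_nonneg hn.le cheb
        linarith
    _ ≤ _ := by gcongr

theorem collision_atom_zero_le_aux (hB : IsHardPotential γ ν κ₁ κ₂ B β) (hF : IsFrame I J)
    (hγ0 : 0 ≤ γ) (hγ1 : γ ≤ 1) (hν : ν < 2) (hκ₁ : 0 < κ₁) (hκ₂ : 0 < κ₂) (hn : 2 ≤ n) {r : ℝ}
    (hr : 8 ≤ r) (v w : Velocity) :
    collisionIntegral γ β I J (fun v => atom n 0 (‖v‖ ^ 2)) v w ≤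
      16 * Real.pi * κ₂ * (satMoment γ ν n v * ‖w‖ ^ 2 + ‖v‖ ^ 2 * satMoment γ ν n w)
      - Real.pi * κ₁ / (16 * (1 + angularMass ν / angularSpread ν))
        * ((if r ≤ ‖v‖ ^ 2 then n * satRatio n (‖v‖ ^ 2) * satMoment γ ν n v else 0)
          * (1 - ‖w‖ ^ 2 / 2)) := by
  have hn0 : 0 < n := by linarith
  have hx : 0 ≤ ‖v‖ ^ 2 := by positivity
  have hy : 0 ≤ ‖w‖ ^ 2 := by positivity
  have hSp := angularSpread_pos hν
  have hM := angularMass_nonneg ν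
  have hpi := Real.pi_pos
  set b := 1 + angularMass ν / angularSpread ν with hb
  have hb0 : 0 < b := by positivity
  have g := mul_le_mul_of_nonneg_left (sharp_gain_le (γ := γ) hγ0 hγ1 hν hn0 v w)
    (show 0 ≤ 8 * Real.pi * κ₂ by positivity)
  have hmv := satMoment_nonneg (γ := γ) (ν := ν) hn0 v
  have hav := satRatio_nonneg hn0 hx
  have hbs := satMass_le_satSpread hν hn0 hx
  have hs0 : 0 ≤ satSpread ν n (‖v‖ ^ 2) :=
    le_trans (by positivity) (angularSpread_mul_le_satSpread hν hn0 hx)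
  by_cases hc : ‖w‖ ^ 2 ≤ 2 ∧ r ≤ ‖v‖ ^ 2
  · rw [if_pos hc.2]
    refine (collisionIntegral_atom_zero_le hB hF hν hn0 v w (χ := 1)
      (Or.inr ⟨rfl, by linarith, by linarith⟩)).trans ?_
    have hh := half_norm_rpow_le hγ0 hγ1 (v := v) (w := w) (by linarith)
    have l : Real.pi * κ₁ / (16 * b) * ((n * satRatio n (‖v‖ ^ 2) * satMoment γ ν n v)
          * (1 - ‖w‖ ^ 2 / 2)) ≤ ‖v - w‖ ^ γ * (κ₁ * (1 * (Real.pi * n / 8) * satRatio n (‖v‖ ^ 2)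
            * satSpread ν n (‖v‖ ^ 2))) := by
      calc _ ≤ Real.pi * κ₁ / (16 * b) * ((n * satRatio n (‖v‖ ^ 2) * satMoment γ ν n v) * 1) := by
            gcongr; linarith
        _ ≤ Real.pi * κ₁ / (16 * b) * ((n * satRatio n (‖v‖ ^ 2)
            * (‖v‖ ^ γ * (b * satSpread ν n (‖v‖ ^ 2)))) * 1) := by
            unfold satMoment; gcongr
        _ = ‖v‖ ^ γ / 2 * (κ₁ * (1 * (Real.pi * n / 8) * satRatio n (‖v‖ ^ 2)
            * satSpread ν n (‖v‖ ^ 2))) := by field_simp; ring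
        _ ≤ _ := by gcongr
    rw [mul_sub]
    linarith
  · refine (collisionIntegral_atom_zero_le hB hF hν hn0 v w (χ := 0) (Or.inl rfl)).trans ?_
    have l : Real.pi * κ₁ / (16 * b)
        * ((if r ≤ ‖v‖ ^ 2 then n * satRatio n (‖v‖ ^ 2) * satMoment γ ν n v else 0)
          * (1 - ‖w‖ ^ 2 / 2)) ≤ 0 := by
      refine mul_nonpos_of_nonneg_of_nonpos (by positivity) ?_
      split_ifs with h
      · have : 2 < ‖w‖ ^ 2 := by
          by_contra h'
          exact hc ⟨not_lt.mp h', h⟩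
        exact mul_nonpos_of_nonneg_of_nonpos (by positivity) (by linarith)
      · simp
    rw [mul_sub]
    have e : ‖v - w‖ ^ γ * (κ₁ * (0 * (Real.pi * n / 8) * satRatio n (‖v‖ ^ 2)
      * satSpread ν n (‖v‖ ^ 2))) = 0 := by ring
    rw [e]
    linarith

/-- The gain involves `satMoment`, the loss of fast particles the same quantity multiplied by
nz/(n+z). Once n and |v|² exceed a threshold r this extra factor is at least a large K, so the loss
absorbs the gain; slow particles contribute only O(1/n). -/
theorem exists_sharp_dissipation (hγ0 : 0 ≤ γ) (hγ1 : γ ≤ 1) (hν : ν < 2) (hκ₁ : 0 < κ₁)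
    (hκ₂ : 0 < κ₂) : ∃ c C n₀ : ℝ, 0 < c ∧ 0 ≤ C ∧ 1 ≤ n₀ ∧
      ∀ (B : ℝ → ℝ → ℝ) (β : ℝ → ℝ) (I J : Velocity → Velocity)
        (f : ℝ → ProbabilityMeasure Velocity),
        IsHardPotential γ ν κ₁ κ₂ B β → IsFrame I J → IsWeakSolution γ β I J f →
        ∀ n, n₀ ≤ n → ∀ t, 0 < t → ∀ N, 0 ≤ N →
        ∫ p, collisionIntegral γ β I J (fun v => atom n 0 (‖v‖ ^ 2)) p.1 p.2
          ∂((f t : Measure Velocity).prod (f t : Measure Velocity)) ≤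
        -c * ∫ v, min (atomLoss γ n 0 v) N ∂(f t : Measure Velocity) + C / n := by
  have hSp := angularSpread_pos hν
  have hM := angularMass_nonneg ν
  have hpi := Real.pi_pos
  set b := 1 + angularMass ν / angularSpread ν with hb
  have hb0 : 0 < b := by positivity
  set c₁ := Real.pi * κ₁ / (16 * b) with hc₁
  have hc₁0 : 0 < c₁ := by positivity
  set A := 8 * Real.pi * κ₂ with hA
  have hA0 : 0 < A := by positivity
  -- Large enough that the gain part T/K takes at most half of the loss, both at a fixed partner and
  -- after integration. If n and |v|² are at least r = 2K, then nz/(n+z) ≥ K.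
  set K := 24 * A / c₁ + 4 with hK
  have hK4 : 4 ≤ K := by rw [hK]; linarith [show 0 ≤ 24 * A / c₁ by positivity]
  have hKA : 24 * A ≤ c₁ * K := by
    rw [hK, mul_add, mul_div_cancel₀ _ hc₁0.ne']; linarith
  set r := 2 * K with hr
  refine ⟨c₁ * angularSpread ν / 4,
    4 * A * (angularMass ν * r ^ 2) + c₁ * angularSpread ν / 4 * r ^ 3, r, by positivity,
    by positivity, by linarith, ?_⟩
  intro B β I J f hB hF hf n hnr t ht N hN
  have hn0 : 0 < n := by linarith
  set μ : Measure Velocity := (f t : Measure Velocity) with hμ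
  set T : Velocity → ℝ := fun v =>
    if r ≤ ‖v‖ ^ 2 then n * satRatio n (‖v‖ ^ 2) * satMoment γ ν n v else 0 with hT
  have hT0 : ∀ v, 0 ≤ T v := by
    intro v
    simp only [hT]
    split_ifs
    · have := satRatio_nonneg hn0 (show 0 ≤ ‖v‖ ^ 2 by positivity)
      have := satMoment_nonneg (γ := γ) (ν := ν) hn0 v
      positivity
    · exact le_rfl
  have hmH := measurable_satMoment hγ0 hν hn0
  have hmT : Measurable T := by
    refine Measurable.ite (measurableSet_le measurable_const (by fun_prop)) ?_ measurable_const
    exact (measurable_const.mul (continuous_satRatio_norm hn0).measurable).mul hmH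
  set D := angularMass ν * r ^ 2 / n with hD
  have hD0 : 0 ≤ D := by positivity
  have hHT : ∀ v, satMoment γ ν n v ≤ D + T v / K := by
    intro v
    by_cases hv : r ≤ ‖v‖ ^ 2
    · have ha : K ≤ n * satRatio n (‖v‖ ^ 2) := by
        unfold satRatio
        rw [← mul_div_assoc, le_div_iff₀ (by linarith)]
        nlinarith
      have h0 := satMoment_nonneg (γ := γ) (ν := ν) hn0 v
      have : satMoment γ ν n v ≤ T v / K := by
        simp only [hT]
        rw [if_pos hv, le_div_iff₀ (by linarith), mul_comm]
        gcongr
      linarith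
    · have := satMoment_le_of_le (γ := γ) hγ0 hγ1 hν hn0 (by linarith) (not_le.mp hv).le
      have : 0 ≤ T v / K := div_nonneg (hT0 v) (by linarith)
      linarith
  have hpt : ∀ v w : Velocity, collisionIntegral γ β I J (fun v => atom n 0 (‖v‖ ^ 2)) v w ≤
      2 * A * (satMoment γ ν n v * ‖w‖ ^ 2 + ‖v‖ ^ 2 * satMoment γ ν n w)
        - c₁ * (T v * (1 - ‖w‖ ^ 2 / 2)) := by
    intro v w
    have := collision_atom_zero_le_aux hB hF hγ0 hγ1 hν hκ₁ hκ₂ (by linarith : 2 ≤ n)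
      (r := r) (by linarith) v w
    refine this.trans (le_of_eq ?_)
    rw [hA]; ring
  have hE : Integrable (fun v : Velocity => ‖v‖ ^ 2) μ := hf.integrable_energy ht.le
  have hQ := hf.integrable_collision_atom hF (by linarith : 1 ≤ n) 0 ht
  -- No moment is available, so integrability of the loss is extracted from the absolute convergence
  -- of the collision integral. By Fubini it is integrable in v for almost every w; some such w has
  -- |w|² < 3/2, since otherwise the energy would be at least 3/2. For that w the weight 1 - |w|²/2
  -- is at least 1/4, and the pointwise inequality can be solved for T.
  have hTi : Integrable T μ := by
    obtain ⟨w, hw, hwi⟩ : ∃ w : Velocity, ‖w‖ ^ 2 < 3 / 2 ∧ Integrable (fun v =>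
        collisionIntegral γ β I J (fun v => atom n 0 (‖v‖ ^ 2)) v w) μ := by
      by_contra hcon
      push Not at hcon
      have hae : ∀ᵐ w ∂μ, (3 / 2 : ℝ) ≤ ‖w‖ ^ 2 := by
        filter_upwards [hQ.prod_left_ae] with w hw
        by_contra hlt
        exact hcon w (not_le.mp hlt) hw
      have := integral_mono_ae (integrable_const (3 / 2 : ℝ)) hE hae
      rw [hf.energy t ht.le] at this
      simp at this
      linarith
    have hbd : Integrable (fun v => 8 / c₁ * (-collisionIntegral γ β I J
        (fun v => atom n 0 (‖v‖ ^ 2)) v w + (3 * A * D + 2 * A * (‖v‖ ^ 2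
          * satMoment γ ν n w)))) μ :=
      (hwi.neg.add ((integrable_const _).add ((hE.mul_const _).const_mul _))).const_mul _
    refine hbd.mono' hmT.aestronglyMeasurable (ae_of_all _ fun v => ?_)
    rw [Real.norm_eq_abs, abs_of_nonneg (hT0 v), div_mul_eq_mul_div, le_div_iff₀ hc₁0]
    have h1 := hpt v w
    have h2 := hHT v
    have h3 : 2 * A * (satMoment γ ν n v * ‖w‖ ^ 2) ≤ 2 * A * ((D + T v / K) * (3 / 2)) := by
      have h0 : 0 ≤ D + T v / K := add_nonneg hD0 (div_nonneg (hT0 v) (by linarith))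
      exact mul_le_mul_of_nonneg_left (mul_le_mul h2 hw.le (by positivity) h0) (by positivity)
    have h4 : 3 * A * (T v / K) ≤ c₁ / 8 * T v := by
      rw [← mul_div_assoc, div_le_iff₀ (by linarith)]
      nlinarith [hT0 v]
    have h5 : c₁ * (T v * (1 / 4)) ≤ c₁ * (T v * (1 - ‖w‖ ^ 2 / 2)) := by
      have := hT0 v
      gcongr; linarith
    linarith
  have hHi : Integrable (satMoment γ ν n) μ := by
    refine ((integrable_const D).add (hTi.div_const K)).mono' hmH.aestronglyMeasurable
      (ae_of_all _ fun v => ?_)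
    rw [Real.norm_eq_abs, abs_of_nonneg (satMoment_nonneg hn0 v)]
    exact hHT v
  have hE1 : Integrable (fun w : Velocity => 1 - ‖w‖ ^ 2 / 2) μ :=
    (integrable_const _).sub (hE.div_const 2)
  have i1 := hHi.mul_prod hE
  have i2 := hE.mul_prod hHi
  have i12 : Integrable (fun p : Velocity × Velocity => satMoment γ ν n p.1 * ‖p.2‖ ^ 2
    + ‖p.1‖ ^ 2 * satMoment γ ν n p.2) (μ.prod μ) := i1.add i2
  have i3 := hTi.mul_prod hE1
  have step := integral_mono hQ ((i12.const_mul (2 * A)).sub (i3.const_mul c₁))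
    (fun p => hpt p.1 p.2)
  refine step.trans ?_
  have e : (∫ p : Velocity × Velocity, (2 * A * (satMoment γ ν n p.1 * ‖p.2‖ ^ 2
        + ‖p.1‖ ^ 2 * satMoment γ ν n p.2) - c₁ * (T p.1 * (1 - ‖p.2‖ ^ 2 / 2))) ∂(μ.prod μ))
      = 4 * A * (∫ v, satMoment γ ν n v ∂μ) - c₁ / 2 * ∫ v, T v ∂μ := by
    rw [integral_sub (i12.const_mul (2 * A)) (i3.const_mul c₁), integral_const_mul,
      integral_const_mul, integral_add i1 i2, hf.integral_mul_one_sub ht.le,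
      integral_prod_mul (satMoment γ ν n) (fun w : Velocity => ‖w‖ ^ 2),
      integral_prod_mul (fun v : Velocity => ‖v‖ ^ 2) (satMoment γ ν n), hf.energy t ht.le]
    ring
  refine (le_of_eq e).trans ?_
  have hI1 : ∫ v, satMoment γ ν n v ∂μ ≤ D + (∫ v, T v ∂μ) / K := by
    have := integral_mono hHi ((integrable_const D).add (hTi.div_const K)) hHT
    refine this.trans (le_of_eq ?_)
    rw [show (∫ a, ((fun _ : Velocity => D) + fun x => T x / K) a ∂μ)
      = ∫ a, (D + T a / K) ∂μ from rfl, integral_add (integrable_const D) (hTi.div_const K),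
      integral_div K T, integral_const]
    simp
  have hTint : 0 ≤ ∫ v, T v ∂μ := integral_nonneg hT0
  have hI2 : 4 * A * ((∫ v, T v ∂μ) / K) ≤ c₁ / 4 * ∫ v, T v ∂μ := by
    rw [← mul_div_assoc, div_le_iff₀ (by linarith)]
    nlinarith
  have hI3 : angularSpread ν * ∫ v, fastLoss γ n 0 N r v ∂μ ≤ ∫ v, T v ∂μ := by
    rw [← integral_const_mul]
    refine integral_mono ((integrable_fastLoss μ hγ0 hn0 0 hN r).const_mul _) hTi fun v => ?_
    have hx : 0 ≤ ‖v‖ ^ 2 := by positivity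
    simp only [hT, fastLoss]
    split_ifs with h
    · have h1 : min (atomLoss γ n 0 v) N ≤ atomLoss γ n 0 v := min_le_left _ _
      have h2 := (angularSpread_mul_le_satSpread hν hn0 hx).trans (satSpread_le_satMass hν hn0 hx)
      have h3 := satRatio_nonneg hn0 hx
      calc angularSpread ν * min (atomLoss γ n 0 v) N ≤ angularSpread ν * atomLoss γ n 0 v := by
            gcongr
        _ = n * satRatio n (‖v‖ ^ 2) * (‖v‖ ^ γ * (angularSpread ν * satRatio n (‖v‖ ^ 2))) := by
            unfold atomLoss; ring
        _ ≤ _ := by unfold satMoment; gcongr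
    · simp
  have hI4 := integral_min_atomLoss_le μ hγ0 hγ1 hn0 0 hN (r := r) (by linarith)
  have hI5 := mul_le_mul_of_nonneg_left hI4
    (show 0 ≤ c₁ * angularSpread ν / 4 by positivity)
  have hI6 := mul_le_mul_of_nonneg_left hI3 (show 0 ≤ c₁ / 4 by positivity)
  have hI7 := mul_le_mul_of_nonneg_left hI1 (show 0 ≤ 4 * A by positivity)
  have e2 : (4 * A * (angularMass ν * r ^ 2) + c₁ * angularSpread ν / 4 * r ^ 3) / n
      = 4 * A * D + c₁ * angularSpread ν / 4 * (r ^ (0 + 3) / n ^ (0 + 1)) := by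
    rw [hD]; ring
  rw [e2]
  linarith

end SharpDissipation

/-! ### Moments as monotone limits. -/

/-- The moment `∫ |v|^{2r} μ(dv)`, with values in `[0, ∞]`. -/
noncomputable def energyMoment (r : ℝ) (μ : Measure Velocity) : ENNReal :=
  ∫⁻ v, ENNReal.ofReal ((‖v‖ ^ 2) ^ r) ∂μ

/-- Monotone convergence: at each point some term of the increasing sequence already dominates φ, so
uniform bounds on truncated sums pass to φ without measurability of φ. It serves for dyadic sums of
atoms and of losses, and for truncated exponential series. -/
theorem lintegral_ofReal_le_of_monotone {Ω : Type*} [MeasurableSpace Ω] (μ : Measure Ω)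
    [IsProbabilityMeasure μ] {φ : Ω → ℝ} {g : ℕ → Ω → ℝ} {C₀ C₁ K : ℝ} (hC₀ : 0 ≤ C₀)
    (hC₁ : 0 ≤ C₁) (hm : ∀ v, Monotone fun N => g N v) (h0 : ∀ N v, 0 ≤ g N v)
    (hi : ∀ N, Integrable (g N) μ) (hK : ∀ N, ∫ v, g N v ∂μ ≤ K)
    (hφ : ∀ v, ∃ N, φ v ≤ C₀ + C₁ * g N v) :
    ∫⁻ v, ENNReal.ofReal (φ v) ∂μ ≤ ENNReal.ofReal (C₀ + C₁ * K) := by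
  have h1 : ∀ v, ENNReal.ofReal (φ v) ≤ ⨆ N, ENNReal.ofReal (C₀ + C₁ * g N v) := by
    intro v
    obtain ⟨N, hN⟩ := hφ v
    exact (ENNReal.ofReal_le_ofReal hN).trans (le_iSup (fun N => ENNReal.ofReal (C₀ + C₁ * g N v)) N)
  refine (lintegral_mono h1).trans ?_
  have hi' : ∀ N, Integrable (fun v => C₀ + C₁ * g N v) μ := fun N =>
    (integrable_const C₀).add ((hi N).const_mul C₁)
  rw [lintegral_iSup' (fun N => (hi' N).aestronglyMeasurable.aemeasurable.ennreal_ofReal)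
    (ae_of_all _ fun v N M hNM => ENNReal.ofReal_le_ofReal (by
      have := hm v hNM
      dsimp only at this
      gcongr))]
  refine iSup_le fun N => ?_
  rw [← ofReal_integral_eq_lintegral_ofReal (hi' N)
    (ae_of_all _ fun v => by have := h0 N v; positivity)]
  refine ENNReal.ofReal_le_ofReal ?_
  rw [integral_add (integrable_const C₀) ((hi N).const_mul C₁), integral_const_mul]
  have := mul_le_mul_of_nonneg_left (hK N) hC₁
  simpa using this

/-! ### Powers as dyadic sums of atoms. -/

section Dyadic

variable {γ : ℝ}

theorem rpow_neg_abs_mul_le {n z α : ℝ} (hn : 0 < n) (h1 : n ≤ z) (h2 : z ≤ 2 * n) :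
    z ^ α ≤ 2 ^ |α| * n ^ α := by
  have hz : 0 < z := by linarith
  rcases le_or_gt 0 α with hα | hα
  · rw [abs_of_nonneg hα, ← Real.mul_rpow (by norm_num) hn.le]
    exact Real.rpow_le_rpow hz.le h2 hα
  · have h3 : (1 : ℝ) ≤ 2 ^ |α| := Real.one_le_rpow (by norm_num) (abs_nonneg _)
    have h4 : z ^ α ≤ n ^ α := Real.rpow_le_rpow_of_nonpos hn h1 hα.le
    have : 0 ≤ n ^ α := by positivity
    nlinarith

theorem exists_dyadic {j₀ : ℕ} {z : ℝ} (hz : 2 ^ j₀ ≤ z) :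
    ∃ j : ℕ, (2 : ℝ) ^ (j₀ + j) ≤ z ∧ z ≤ 2 * 2 ^ (j₀ + j) := by
  obtain ⟨i, hi1, hi2⟩ := exists_nat_pow_near
    (le_trans (one_le_pow₀ (by norm_num : (1 : ℝ) ≤ 2)) hz) (by norm_num : (1 : ℝ) < 2)
  have : j₀ ≤ i := by
    by_contra h
    push Not at h
    have h1 : (2 : ℝ) ^ (i + 1) ≤ 2 ^ j₀ := pow_le_pow_right₀ (by norm_num) h
    linarith
  obtain ⟨j, rfl⟩ := Nat.exists_eq_add_of_le this
  refine ⟨j, hi1, ?_⟩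
  rw [pow_succ] at hi2
  linarith

theorem half_le_satRatio {n z : ℝ} (hn : 0 < n) (h : n ≤ z) : 1 / 2 ≤ satRatio n z := by
  unfold satRatio
  rw [div_le_div_iff₀ (by norm_num) (by linarith)]
  linarith

/-- At the scale n comparable to z the saturation ratio is at least 1/2, so a single atom of the
dyadic sum recovers the whole power. -/
theorem rpow_le_dyadic_atom {n z α : ℝ} (q : ℕ) (hn : 0 < n) (h1 : n ≤ z) (h2 : z ≤ 2 * n) :
    z ^ (1 + α) ≤ 2 ^ |α| * 2 ^ (q + 1) * (n ^ α * atom n q z) := by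
  have hz : 0 < z := by linarith
  have ha := half_le_satRatio hn h1
  have h3 := rpow_neg_abs_mul_le (α := α) hn h1 h2
  have h4 : 1 ≤ 2 ^ (q + 1) * satRatio n z ^ (q + 1) := by
    rw [← mul_pow]; exact one_le_pow₀ (by linarith)
  rw [Real.rpow_add hz, Real.rpow_one]
  unfold atom
  calc z * z ^ α ≤ z * (2 ^ |α| * n ^ α) := by gcongr
    _ = z * (2 ^ |α| * n ^ α) * 1 := by ring
    _ ≤ z * (2 ^ |α| * n ^ α) * (2 ^ (q + 1) * satRatio n z ^ (q + 1)) := by gcongr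
    _ = _ := by ring

theorem rpow_le_dyadic_atomLoss {n α : ℝ} (q : ℕ) (hn : 0 < n) {v : Velocity} (h1 : n ≤ ‖v‖ ^ 2)
    (h2 : ‖v‖ ^ 2 ≤ 2 * n) :
    (‖v‖ ^ 2) ^ (1 + α + γ / 2) ≤ 2 ^ |α| * 2 ^ (q + 3) * (n ^ α * atomLoss γ n q v) := by
  set z := ‖v‖ ^ 2 with hz'
  have hz : 0 < z := by linarith
  have ha := half_le_satRatio hn h1
  have h3 := rpow_neg_abs_mul_le (α := α) hn h1 h2
  have h4 : 1 ≤ 2 ^ (q + 2) * satRatio n z ^ (q + 2) := by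
    rw [← mul_pow]; exact one_le_pow₀ (by linarith)
  rw [Real.rpow_add hz, Real.rpow_add hz, Real.rpow_one, hz', rpow_half_norm_sq, ← hz']
  unfold atomLoss
  rw [← hz']
  have hv : 0 ≤ ‖v‖ ^ γ := by positivity
  calc z * z ^ α * ‖v‖ ^ γ ≤ (2 * n) * (2 ^ |α| * n ^ α) * ‖v‖ ^ γ := by gcongr
    _ = (2 * n) * (2 ^ |α| * n ^ α) * ‖v‖ ^ γ * 1 := by ring
    _ ≤ (2 * n) * (2 ^ |α| * n ^ α) * ‖v‖ ^ γ * (2 ^ (q + 2) * satRatio n z ^ (q + 2)) := by gcongr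
    _ = _ := by ring

/-- The ratio is at most 1 and at most z/n, so its power q + 1 is bounded by (z/n)^(α+e). The spare
exponent e pays for summability over dyadic scales. -/
theorem dyadic_atom_le {n z α e : ℝ} (q : ℕ) (hn : 0 < n) (hz : 0 ≤ z) (h0 : 0 ≤ α + e)
    (hq : α + e ≤ q + 1) : n ^ α * atom n q z ≤ n ^ (-e) * z ^ (1 + α + e) := by
  rcases hz.eq_or_lt with rfl | hz
  · simp only [atom, zero_mul, mul_zero]; positivity
  have ha0 : 0 < satRatio n z := by unfold satRatio; positivity
  have ha1 := (satRatio_lt_one hn hz.le).le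
  have h1 : satRatio n z ^ (q + 1) ≤ (z / n) ^ (α + e) := by
    rw [← Real.rpow_natCast]
    refine (Real.rpow_le_rpow_of_exponent_ge ha0 ha1 (by push_cast; exact hq)).trans ?_
    exact Real.rpow_le_rpow ha0.le (satRatio_le_div hn hz.le) h0
  unfold atom
  calc n ^ α * (z * satRatio n z ^ (q + 1)) ≤ n ^ α * (z * (z / n) ^ (α + e)) := by gcongr
    _ = n ^ (-e) * z ^ (1 + α + e) := by
      rw [Real.div_rpow hz.le hn.le, add_assoc 1, Real.rpow_add hz 1, Real.rpow_one,
        Real.rpow_add hn α e, Real.rpow_neg hn.le]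
      have : 0 < n ^ α := by positivity
      have : 0 < n ^ e := by positivity
      field_simp

theorem sum_dyadic_le {e : ℝ} (he : 0 < e) : ∃ S : ℝ, 0 ≤ S ∧ ∀ j₀ N : ℕ,
    ∑ j ∈ Finset.range N, ((2 : ℝ) ^ (j₀ + j)) ^ (-e) ≤ S := by
  have hr0 : (0 : ℝ) < 2 ^ (-e) := by positivity
  have hr1 : (2 : ℝ) ^ (-e) < 1 := Real.rpow_lt_one_of_one_lt_of_neg (by norm_num) (by linarith)
  have hs := summable_geometric_of_lt_one hr0.le hr1
  refine ⟨∑' j : ℕ, ((2 : ℝ) ^ (-e)) ^ j, tsum_nonneg fun j => by positivity, fun j₀ N => ?_⟩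
  refine le_trans (Finset.sum_le_sum fun j _ => ?_) (hs.sum_le_tsum (Finset.range N)
    fun j _ => by positivity)
  have : ((2 : ℝ) ^ (j₀ + j)) ^ (-e) = ((2 : ℝ) ^ (-e)) ^ (j₀ + j) := by
    rw [← Real.rpow_natCast, ← Real.rpow_natCast, ← Real.rpow_mul (by norm_num),
      ← Real.rpow_mul (by norm_num), mul_comm]
  rw [this]
  exact pow_le_pow_of_le_one hr0.le hr1.le (by omega)

end Dyadic

/-! ### One step of moment improvement. -/

section MomentStep

variable {γ : ℝ} {β : ℝ → ℝ} {I J : Velocity → Velocity} {f : ℝ → ProbabilityMeasure Velocity}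

theorem continuous_energy_rpow {r : ℝ} (hr : 0 ≤ r) :
    Continuous fun v : Velocity => (‖v‖ ^ 2) ^ r :=
  (continuous_norm.pow 2).rpow_const fun _ => Or.inr hr

theorem integrable_of_energyMoment_lt_top {r : ℝ} (hr : 0 ≤ r) {μ : Measure Velocity}
    (h : energyMoment r μ < ⊤) : Integrable (fun v : Velocity => (‖v‖ ^ 2) ^ r) μ := by
  refine ⟨(continuous_energy_rpow hr).aestronglyMeasurable, ?_⟩
  rw [hasFiniteIntegral_iff_ofReal (ae_of_all _ fun v => by positivity)]
  exact h

theorem integral_le_of_energyMoment_le {r K : ℝ} (hr : 0 ≤ r) (hK : 0 ≤ K) {μ : Measure Velocity}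
    (h : energyMoment r μ ≤ ENNReal.ofReal K) : ∫ v, (‖v‖ ^ 2) ^ r ∂μ ≤ K := by
  have hi := integrable_of_energyMoment_lt_top hr (h.trans_lt ENNReal.ofReal_lt_top)
  unfold energyMoment at h
  rw [← ofReal_integral_eq_lintegral_ofReal hi (ae_of_all _ fun v => by positivity)] at h
  exact (ENNReal.ofReal_le_ofReal_iff hK).1 h

theorem IsWeakSolution.continuousOn_min_atomLoss (hf : IsWeakSolution γ β I J f) (hγ0 : 0 ≤ γ)
    {n : ℝ} (hn : 0 < n) (q : ℕ) {N : ℝ} (hN : 0 ≤ N) :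
    ContinuousOn (fun t => ∫ v, min (atomLoss γ n q v) N ∂(f t : Measure Velocity))
      (Set.Ici 0) := by
  refine hf.continuousOn_integral (C := N) ((continuous_atomLoss hγ0 hn q).min continuous_const)
    fun v => ?_
  rw [abs_of_nonneg (le_min (atomLoss_nonneg hn q v) hN)]
  exact min_le_right _ _

theorem IsWeakSolution.atom_add_integral_le (hf : IsWeakSolution γ β I J f) (hF : IsFrame I J)
    (hγ0 : 0 ≤ γ) {n : ℝ} (hn : 1 ≤ n) {q : ℕ} {N : ℝ} (hN : 0 ≤ N) {s t c D : ℝ} (hs : 0 ≤ s)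
    (hst : s ≤ t)
    (hD : ∀ τ ∈ Set.Ioo s t,
      ∫ p, collisionIntegral γ β I J (fun v => atom n q (‖v‖ ^ 2)) p.1 p.2
        ∂((f τ : Measure Velocity).prod (f τ : Measure Velocity)) ≤
      -c * ∫ v, min (atomLoss γ n q v) N ∂(f τ : Measure Velocity) + D) :
    ∫ v, atom n q (‖v‖ ^ 2) ∂(f t : Measure Velocity)
      + c * ∫ τ in s..t, ∫ v, min (atomLoss γ n q v) N ∂(f τ : Measure Velocity)
      ≤ ∫ v, atom n q (‖v‖ ^ 2) ∂(f s : Measure Velocity) + D * (t - s) := by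
  have hsub : Set.Icc s t ⊆ Set.Ici 0 := fun τ hτ => hs.trans hτ.1
  have hA := (hf.continuousOn_min_atomLoss hγ0 (zero_lt_one.trans_le hn) q hN).mono hsub
  have hint : ContinuousOn (fun τ => -c * ∫ v, min (atomLoss γ n q v) N ∂(f τ : Measure Velocity)
      + D) (Set.Icc s t) := (continuousOn_const.mul hA).add continuousOn_const
  -- A one-sided fundamental theorem: only the upper bound on the derivative has to be integrable in
  -- time, so no regularity in time of the collision term is required. Differentiability at time s
  -- itself is not needed either, which allows s = 0.
  have h := intervalIntegral.sub_le_integral_of_hasDeriv_right_of_le hst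
    ((hf.continuousOn_atom hn q).mono hsub)
    (fun τ hτ => (hf.hasDerivAt_atom hF hn q (hs.trans_lt hτ.1)).hasDerivWithinAt)
    (hint.integrableOn_Icc) hD
  rw [intervalIntegral.integral_add, intervalIntegral.integral_const_mul,
    intervalIntegral.integral_const, smul_eq_mul] at h
  · linarith
  · exact (ContinuousOn.intervalIntegrable_of_Icc hst (continuousOn_const.mul hA))
  · exact intervalIntegrable_const

/-- Dyadic sums of atoms. -/
noncomputable def dyadicAtom (α : ℝ) (q j₀ N : ℕ) (v : Velocity) : ℝ :=
  ∑ j ∈ Finset.range N, ((2 : ℝ) ^ (j₀ + j)) ^ α * atom (2 ^ (j₀ + j)) q (‖v‖ ^ 2)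

/-- Truncated dyadic sums of the dissipation of the atoms. -/
noncomputable def dyadicLoss (γ α : ℝ) (q j₀ N : ℕ) (v : Velocity) : ℝ :=
  ∑ j ∈ Finset.range N, ((2 : ℝ) ^ (j₀ + j)) ^ α * min (atomLoss γ (2 ^ (j₀ + j)) q v) N

theorem dyadicAtom_mono (α : ℝ) (q j₀ : ℕ) (v : Velocity) :
    Monotone fun N => dyadicAtom α q j₀ N v := by
  intro N M h
  refine Finset.sum_le_sum_of_subset_of_nonneg (Finset.range_mono h) fun j _ _ => ?_
  have := atom_nonneg (n := (2 : ℝ) ^ (j₀ + j)) (by positivity) q (sq_nonneg ‖v‖)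
  positivity

theorem dyadicLoss_mono (γ α : ℝ) (q j₀ : ℕ) (v : Velocity) :
    Monotone fun N => dyadicLoss γ α q j₀ N v := by
  intro N M h
  have hNM : (N : ℝ) ≤ M := by exact_mod_cast h
  have h1 : ∀ j, 0 ≤ atomLoss γ (2 ^ (j₀ + j)) q v := fun j => atomLoss_nonneg (by positivity) q v
  refine le_trans (Finset.sum_le_sum fun j _ => ?_)
    (Finset.sum_le_sum_of_subset_of_nonneg (Finset.range_mono h) fun j _ _ => ?_)
  · gcongr
  · have := le_min (h1 j) (Nat.cast_nonneg M)
    positivity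

theorem dyadicAtom_nonneg (α : ℝ) (q j₀ N : ℕ) (v : Velocity) : 0 ≤ dyadicAtom α q j₀ N v :=
  Finset.sum_nonneg fun j _ => mul_nonneg (by positivity)
    (atom_nonneg (by positivity) q (sq_nonneg ‖v‖))

theorem dyadicLoss_nonneg (γ α : ℝ) (q j₀ N : ℕ) (v : Velocity) : 0 ≤ dyadicLoss γ α q j₀ N v :=
  Finset.sum_nonneg fun j _ => mul_nonneg (by positivity)
    (le_min (atomLoss_nonneg (by positivity) q v) (Nat.cast_nonneg N))

theorem exists_rpow_le_dyadicAtom (α : ℝ) (hα : 0 ≤ 1 + α) (q j₀ : ℕ) (v : Velocity) :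
    ∃ N, (‖v‖ ^ 2) ^ (1 + α) ≤
      (2 ^ j₀) ^ (1 + α) + 2 ^ |α| * 2 ^ (q + 1) * dyadicAtom α q j₀ N v := by
  have hz : 0 ≤ ‖v‖ ^ 2 := by positivity
  rcases le_total (‖v‖ ^ 2) (2 ^ j₀) with h | h
  · refine ⟨0, ?_⟩
    have := Real.rpow_le_rpow hz h hα
    simpa [dyadicAtom] using this
  · obtain ⟨j, h1, h2⟩ := exists_dyadic h
    refine ⟨j + 1, ?_⟩
    have h3 := rpow_le_dyadic_atom (α := α) q (by positivity) h1 h2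
    have h4 : ((2 : ℝ) ^ (j₀ + j)) ^ α * atom (2 ^ (j₀ + j)) q (‖v‖ ^ 2)
        ≤ dyadicAtom α q j₀ (j + 1) v :=
      Finset.single_le_sum (f := fun j => ((2 : ℝ) ^ (j₀ + j)) ^ α
        * atom (2 ^ (j₀ + j)) q (‖v‖ ^ 2)) (fun i _ => mul_nonneg (by positivity)
        (atom_nonneg (by positivity) q hz)) (Finset.self_mem_range_succ j)
    have h5 : (0 : ℝ) ≤ (2 ^ j₀) ^ (1 + α) := by positivity
    have h6 := mul_le_mul_of_nonneg_left h4 (show (0 : ℝ) ≤ 2 ^ |α| * 2 ^ (q + 1) by positivity)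
    linarith

theorem exists_rpow_le_dyadicLoss (α : ℝ) (hα : 0 ≤ 1 + α + γ / 2) (q j₀ : ℕ) (v : Velocity) :
    ∃ N, (‖v‖ ^ 2) ^ (1 + α + γ / 2) ≤
      (2 ^ j₀) ^ (1 + α + γ / 2) + 2 ^ |α| * 2 ^ (q + 3) * dyadicLoss γ α q j₀ N v := by
  have hz : 0 ≤ ‖v‖ ^ 2 := by positivity
  rcases le_total (‖v‖ ^ 2) (2 ^ j₀) with h | h
  · refine ⟨0, ?_⟩
    have := Real.rpow_le_rpow hz h hα
    simpa [dyadicLoss] using this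
  · obtain ⟨j, h1, h2⟩ := exists_dyadic h
    obtain ⟨M, hM⟩ := exists_nat_ge (atomLoss γ (2 ^ (j₀ + j)) q v)
    -- The same index is the number of scales and the height of truncation: j + 1 brings scale j
    -- into the sum, M lifts the truncation above the value of the loss.
    refine ⟨j + 1 + M, ?_⟩
    have h3 := rpow_le_dyadic_atomLoss (γ := γ) (α := α) q (by positivity) h1 h2
    have h4 : ((2 : ℝ) ^ (j₀ + j)) ^ α * min (atomLoss γ (2 ^ (j₀ + j)) q v) (j + 1 + M : ℕ)
        ≤ dyadicLoss γ α q j₀ (j + 1 + M) v :=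
      Finset.single_le_sum (f := fun i => ((2 : ℝ) ^ (j₀ + i)) ^ α
        * min (atomLoss γ (2 ^ (j₀ + i)) q v) (j + 1 + M : ℕ)) (fun i _ =>
        mul_nonneg (by positivity) (le_min (atomLoss_nonneg (by positivity) q v)
          (Nat.cast_nonneg _))) (Finset.mem_range.2 (by omega))
    rw [min_eq_left (hM.trans (by push_cast; linarith [show (0 : ℝ) ≤ j by positivity]))] at h4
    have h5 : (0 : ℝ) ≤ (2 ^ j₀) ^ (1 + α + γ / 2) := by positivity
    have h6 := mul_le_mul_of_nonneg_left h4 (show (0 : ℝ) ≤ 2 ^ |α| * 2 ^ (q + 3) by positivity)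
    linarith

/-- Multiply the integrated inequality at scale n by n^α and sum over dyadic n. Both the initial
datum and the source come with n^(-e), hence are summable; the atoms bound the moment of order 1 + α
at every time, and the time integral of the losses bounds that of order 1 + α + γ/2. -/
theorem IsWeakSolution.moment_step (hf : IsWeakSolution γ β I J f) (hF : IsFrame I J)
    (hγ0 : 0 ≤ γ) {q j₀ : ℕ} {α e s T c C : ℝ} (hs : 0 ≤ s) (hsT : s < T) (he : 0 < e)
    (h0 : 0 ≤ α + e) (hq : α + e ≤ q + 1) (hα : 0 ≤ 1 + α) (hc : 0 < c) (hC : 0 ≤ C)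
    (hD : ∀ n : ℝ, 2 ^ j₀ ≤ n → ∀ t ∈ Set.Ioc s T, ∀ N : ℝ, 0 ≤ N →
      ∫ p, collisionIntegral γ β I J (fun v => atom n q (‖v‖ ^ 2)) p.1 p.2
        ∂((f t : Measure Velocity).prod (f t : Measure Velocity)) ≤
      -c * ∫ v, min (atomLoss γ n q v) N ∂(f t : Measure Velocity) + C * n ^ (-(α + e)))
    (hM : energyMoment (1 + α + e) (f s) < ⊤) :
    (∃ K : ℝ, 0 ≤ K ∧ ∀ t ∈ Set.Icc s T, energyMoment (1 + α) (f t) ≤ ENNReal.ofReal K) ∧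
      ∃ t ∈ Set.Ioo s T, energyMoment (1 + α + γ / 2) (f t) < ⊤ := by
  obtain ⟨S, hS0, hS⟩ := sum_dyadic_le he
  have hMi := integrable_of_energyMoment_lt_top (by linarith) hM
  set M := ∫ v, (‖v‖ ^ 2) ^ (1 + α + e) ∂(f s : Measure Velocity) with hMdef
  have hM0 : 0 ≤ M := integral_nonneg fun v => by positivity
  set K := S * M + C * (T - s) * S with hK
  have hTs : 0 ≤ T - s := by linarith
  have hK0 : 0 ≤ K := by positivity
  have hai : ∀ t, 0 ≤ t → ∀ j, Integrable (fun v : Velocity =>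
      ((2 : ℝ) ^ (j₀ + j)) ^ α * atom (2 ^ (j₀ + j)) q (‖v‖ ^ 2)) (f t : Measure Velocity) :=
    fun t ht j => (hf.integrable_atom (by positivity) q ht).const_mul _
  have hli : ∀ t (N : ℕ) j, Integrable (fun v : Velocity =>
      ((2 : ℝ) ^ (j₀ + j)) ^ α * min (atomLoss γ (2 ^ (j₀ + j)) q v) N) (f t : Measure Velocity) :=
    fun t N j => (integrable_min_atomLoss _ hγ0 (by positivity) q (Nat.cast_nonneg N)).const_mul _
  have hai' : ∀ t, 0 ≤ t → ∀ N, Integrable (dyadicAtom α q j₀ N) (f t : Measure Velocity) :=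
    fun t ht N => integrable_finsetSum _ fun j _ => hai t ht j
  have hli' : ∀ t N, Integrable (dyadicLoss γ α q j₀ N) (f t : Measure Velocity) :=
    fun t N => integrable_finsetSum _ fun j _ => hli t N j
  have hstart : ∀ N, ∫ v, dyadicAtom α q j₀ N v ∂(f s : Measure Velocity) ≤ S * M := by
    intro N
    rw [hMdef, ← integral_const_mul]
    refine integral_mono (hai' s hs N) (hMi.const_mul S) fun v => ?_
    calc dyadicAtom α q j₀ N v ≤ ∑ j ∈ Finset.range N, ((2 : ℝ) ^ (j₀ + j)) ^ (-e)
          * (‖v‖ ^ 2) ^ (1 + α + e) := Finset.sum_le_sum fun j _ =>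
            dyadic_atom_le q (by positivity) (by positivity) h0 hq
      _ = (∑ j ∈ Finset.range N, ((2 : ℝ) ^ (j₀ + j)) ^ (-e)) * (‖v‖ ^ 2) ^ (1 + α + e) := by
          rw [Finset.sum_mul]
      _ ≤ _ := by
          exact mul_le_mul_of_nonneg_right (hS j₀ N) (by positivity)
  have hcontL : ∀ N, ContinuousOn (fun t => ∫ v, dyadicLoss γ α q j₀ N v ∂(f t : Measure Velocity))
      (Set.Ici 0) := by
    intro N
    have : (fun t => ∫ v, dyadicLoss γ α q j₀ N v ∂(f t : Measure Velocity)) = fun t =>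
        ∑ j ∈ Finset.range N, ((2 : ℝ) ^ (j₀ + j)) ^ α
          * ∫ v, min (atomLoss γ (2 ^ (j₀ + j)) q v) N ∂(f t : Measure Velocity) := by
      funext t
      simp only [dyadicLoss]
      rw [integral_finsetSum _ fun j _ => hli t N j]
      simp only [integral_const_mul]
    rw [this]
    exact continuousOn_finsetSum _ fun j _ => continuousOn_const.mul
      (hf.continuousOn_min_atomLoss hγ0 (by positivity) q (Nat.cast_nonneg N))
  have key : ∀ N, ∀ t ∈ Set.Icc s T, ∫ v, dyadicAtom α q j₀ N v ∂(f t : Measure Velocity)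
      + c * ∫ τ in s..t, ∫ v, dyadicLoss γ α q j₀ N v ∂(f τ : Measure Velocity) ≤ K := by
    intro N t ht
    have ht0 : 0 ≤ t := hs.trans ht.1
    have hj : ∀ j ∈ Finset.range N,
        ((2 : ℝ) ^ (j₀ + j)) ^ α * (∫ v, atom (2 ^ (j₀ + j)) q (‖v‖ ^ 2) ∂(f t : Measure Velocity))
        + c * (((2 : ℝ) ^ (j₀ + j)) ^ α * ∫ τ in s..t, ∫ v, min (atomLoss γ (2 ^ (j₀ + j)) q v) N
          ∂(f τ : Measure Velocity))
        ≤ ((2 : ℝ) ^ (j₀ + j)) ^ α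
            * (∫ v, atom (2 ^ (j₀ + j)) q (‖v‖ ^ 2) ∂(f s : Measure Velocity))
          + C * (T - s) * ((2 : ℝ) ^ (j₀ + j)) ^ (-e) := by
      intro j _
      set n : ℝ := 2 ^ (j₀ + j) with hn
      have hn0 : 0 < n := by positivity
      have h := hf.atom_add_integral_le hF hγ0 (n := n) (one_le_pow₀ (by norm_num)) (q := q)
        (N := N) (Nat.cast_nonneg N) hs ht.1 (c := c) (D := C * n ^ (-(α + e)))
        (fun τ hτ => hD n (pow_le_pow_right₀ (by norm_num) (by omega)) τ
          ⟨hτ.1, hτ.2.le.trans ht.2⟩ N (Nat.cast_nonneg N))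
      have h2 := mul_le_mul_of_nonneg_left h (show 0 ≤ n ^ α by positivity)
      have e1 : n ^ α * n ^ (-(α + e)) = n ^ (-e) := by
        rw [← Real.rpow_add hn0]; congr 1; ring
      have h3 : n ^ α * (C * n ^ (-(α + e)) * (t - s)) ≤ C * (T - s) * n ^ (-e) := by
        rw [← e1]
        have h4 : t - s ≤ T - s := by linarith [ht.2]
        calc n ^ α * (C * n ^ (-(α + e)) * (t - s))
            ≤ n ^ α * (C * n ^ (-(α + e)) * (T - s)) := by gcongr
          _ = _ := by ring
      linarith
    have hsum := Finset.sum_le_sum hj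
    rw [Finset.sum_add_distrib, Finset.sum_add_distrib, ← Finset.mul_sum, ← Finset.mul_sum] at hsum
    have e1 : ∀ t, 0 ≤ t → ∫ v, dyadicAtom α q j₀ N v ∂(f t : Measure Velocity)
        = ∑ j ∈ Finset.range N, ((2 : ℝ) ^ (j₀ + j)) ^ α
          * ∫ v, atom (2 ^ (j₀ + j)) q (‖v‖ ^ 2) ∂(f t : Measure Velocity) := by
      intro t ht
      simp only [dyadicAtom]
      rw [integral_finsetSum _ fun j _ => hai t ht j]
      simp only [integral_const_mul]
    have e2 : ∫ τ in s..t, ∫ v, dyadicLoss γ α q j₀ N v ∂(f τ : Measure Velocity)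
        = ∑ j ∈ Finset.range N, ((2 : ℝ) ^ (j₀ + j)) ^ α * ∫ τ in s..t,
          ∫ v, min (atomLoss γ (2 ^ (j₀ + j)) q v) N ∂(f τ : Measure Velocity) := by
      have : ∀ τ, ∫ v, dyadicLoss γ α q j₀ N v ∂(f τ : Measure Velocity)
          = ∑ j ∈ Finset.range N, ((2 : ℝ) ^ (j₀ + j)) ^ α *
            ∫ v, min (atomLoss γ (2 ^ (j₀ + j)) q v) N ∂(f τ : Measure Velocity) := by
        intro τ
        simp only [dyadicLoss]
        rw [integral_finsetSum _ fun j _ => hli τ N j]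
        simp only [integral_const_mul]
      simp only [this]
      rw [intervalIntegral.integral_finsetSum]
      · simp only [intervalIntegral.integral_const_mul]
      · intro j _
        refine (ContinuousOn.intervalIntegrable_of_Icc ht.1 (((hf.continuousOn_min_atomLoss hγ0
          (by positivity) q (Nat.cast_nonneg N)).mono fun τ hτ => hs.trans hτ.1))).const_mul _
    rw [← e1 t ht0, ← e2, ← e1 s hs] at hsum
    have h5 := mul_le_mul_of_nonneg_left (hS j₀ N) (show 0 ≤ C * (T - s) by positivity)
    have h6 := hstart N
    linarith
  have hloss0 : ∀ N τ, 0 ≤ ∫ v, dyadicLoss γ α q j₀ N v ∂(f τ : Measure Velocity) :=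
    fun N τ => integral_nonneg fun v => dyadicLoss_nonneg γ α q j₀ N v
  constructor
  · refine ⟨(2 ^ j₀) ^ (1 + α) + 2 ^ |α| * 2 ^ (q + 1) * K, by positivity, fun t ht => ?_⟩
    refine lintegral_ofReal_le_of_monotone _ (by positivity) (by positivity)
      (dyadicAtom_mono α q j₀) (fun N v => dyadicAtom_nonneg α q j₀ N v)
      (hai' t (hs.trans ht.1)) (fun N => ?_) (exists_rpow_le_dyadicAtom α hα q j₀)
    have h1 := key N t ht
    have h2 : 0 ≤ c * ∫ τ in s..t, ∫ v, dyadicLoss γ α q j₀ N v ∂(f τ : Measure Velocity) :=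
      mul_nonneg hc.le (intervalIntegral.integral_nonneg ht.1 fun τ _ => hloss0 N τ)
    linarith
  -- If the higher moment were infinite at every time of the interval, the increasing truncated
  -- losses would tend to infinity at each of these times, contradicting the uniform bound on their
  -- time integrals by monotone convergence.
  · by_contra hcon
    push Not at hcon
    have hint : ∀ N, IntegrableOn
        (fun τ => ∫ v, dyadicLoss γ α q j₀ N v ∂(f τ : Measure Velocity)) (Set.Ioo s T) := fun N =>
      (((hcontL N).mono fun τ (hτ : τ ∈ Set.Icc s T) => hs.trans hτ.1).integrableOn_Icc).mono_set
        Set.Ioo_subset_Icc_self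
    have hsup : ∀ τ ∈ Set.Ioo s T, ⨆ N, ENNReal.ofReal
        (∫ v, dyadicLoss γ α q j₀ N v ∂(f τ : Measure Velocity)) = ⊤ := by
      intro τ hτ
      by_contra hne
      have hle : ∀ N, ∫ v, dyadicLoss γ α q j₀ N v ∂(f τ : Measure Velocity) ≤ (⨆ N,
          ENNReal.ofReal (∫ v, dyadicLoss γ α q j₀ N v ∂(f τ : Measure Velocity))).toReal := by
        intro N
        have := le_iSup (fun N => ENNReal.ofReal
          (∫ v, dyadicLoss γ α q j₀ N v ∂(f τ : Measure Velocity))) N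
        have h2 := ENNReal.toReal_mono hne this
        rwa [ENNReal.toReal_ofReal (hloss0 N τ)] at h2
      have := lintegral_ofReal_le_of_monotone (f τ : Measure Velocity)
        (C₀ := (2 ^ j₀) ^ (1 + α + γ / 2)) (C₁ := 2 ^ |α| * 2 ^ (q + 3)) (by positivity)
        (by positivity) (dyadicLoss_mono γ α q j₀)
        (fun N v => dyadicLoss_nonneg γ α q j₀ N v) (hli' τ) hle
        (exists_rpow_le_dyadicLoss (γ := γ) α (by linarith) q j₀)
      have h3 := hcon τ hτ
      unfold energyMoment at h3
      exact absurd (h3.trans this) (by simp)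
    have hlim : ∫⁻ τ in Set.Ioo s T, ⨆ N, ENNReal.ofReal
        (∫ v, dyadicLoss γ α q j₀ N v ∂(f τ : Measure Velocity)) ≤ ENNReal.ofReal (K / c) := by
      rw [lintegral_iSup' (fun N => (hint N).aestronglyMeasurable.aemeasurable.ennreal_ofReal)
        (ae_of_all _ fun τ N N' hNN => ENNReal.ofReal_le_ofReal
          (integral_mono (hli' τ N) (hli' τ N') fun v => dyadicLoss_mono γ α q j₀ v hNN))]
      refine iSup_le fun N => ?_
      rw [← ofReal_integral_eq_lintegral_ofReal (hint N) (ae_of_all _ fun τ => hloss0 N τ)]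
      refine ENNReal.ofReal_le_ofReal ?_
      have h1 := key N T ⟨hsT.le, le_rfl⟩
      have h2 : 0 ≤ ∫ v, dyadicAtom α q j₀ N v ∂(f T : Measure Velocity) :=
        integral_nonneg fun v => dyadicAtom_nonneg α q j₀ N v
      rw [intervalIntegral.integral_of_le hsT.le, integral_Ioc_eq_integral_Ioo] at h1
      rw [le_div_iff₀ hc]
      linarith
    rw [setLIntegral_congr_fun measurableSet_Ioo hsup, setLIntegral_const, Real.volume_Ioo,
      ENNReal.top_mul (by simpa using hsT)] at hlim
    simp at hlim

end MomentStep

/-! ### Climbing the ladder: finiteness of all moments. -/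

section MomentBounds

variable {γ ν κ₁ κ₂ : ℝ} {B : ℝ → ℝ → ℝ} {β : ℝ → ℝ} {I J : Velocity → Velocity}
  {f : ℝ → ProbabilityMeasure Velocity}

/-- The ladder of exponents along which finiteness of moments is bootstrapped. -/
noncomputable def momentLadder (γ : ℝ) (k : ℕ) : ℝ := 1 - γ / 8 + 3 * (γ / 8) * k

theorem energyMoment_mono {r r' : ℝ} (hr : 0 ≤ r) (h : r ≤ r') (μ : Measure Velocity)
    [IsProbabilityMeasure μ] : energyMoment r μ ≤ 1 + energyMoment r' μ := by
  unfold energyMoment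
  calc ∫⁻ v, ENNReal.ofReal ((‖v‖ ^ 2) ^ r) ∂μ
      ≤ ∫⁻ v, (1 + ENNReal.ofReal ((‖v‖ ^ 2) ^ r')) ∂μ := by
        refine lintegral_mono fun v => ?_
        have hz : 0 ≤ ‖v‖ ^ 2 := by positivity
        dsimp only
        rw [← ENNReal.ofReal_one, ← ENNReal.ofReal_add zero_le_one (by positivity)]
        refine ENNReal.ofReal_le_ofReal ?_
        rcases le_total (‖v‖ ^ 2) 1 with h1 | h1
        · have := Real.rpow_le_one hz h1 hr
          have : 0 ≤ (‖v‖ ^ 2) ^ r' := by positivity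
          linarith
        · have := Real.rpow_le_rpow_of_exponent_le h1 h
          linarith
    _ = _ := by rw [lintegral_add_left measurable_const]; simp

theorem exists_le_momentLadder (hγ0 : 0 < γ) (r : ℝ) : ∃ k, r ≤ momentLadder γ k := by
  obtain ⟨k, hk⟩ := exists_nat_ge ((r - (1 - γ / 8)) / (3 * (γ / 8)))
  rw [div_le_iff₀ (by positivity)] at hk
  exact ⟨k, by unfold momentLadder; linarith⟩

/-- Each application of `moment_step` loses γ/8 for summability and gains γ/2, so the ladder rises
by 3γ/8. The three lowest rungs use the sharp dissipation, which needs only the energy; above them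
the crude one is fed with the previous rung. -/
theorem IsWeakSolution.momentLadder_step (hf : IsWeakSolution γ β I J f)
    (hB : IsHardPotential γ ν κ₁ κ₂ B β) (hF : IsFrame I J) (hγ0 : 0 < γ) (hγ1 : γ ≤ 1)
    (hν : ν < 2) (hκ₁ : 0 < κ₁) (hκ₂ : 0 < κ₂) {k : ℕ} {s T : ℝ} (hs : 0 ≤ s) (hsT : s < T)
    (hprev : k < 3 ∨ ∃ K : ℝ, 0 ≤ K ∧ ∀ t ∈ Set.Ioc s T,
      energyMoment (momentLadder γ (k - 1)) (f t) ≤ ENNReal.ofReal K)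
    (hM : energyMoment (momentLadder γ k + γ / 8) (f s) < ⊤) :
    (∃ K : ℝ, 0 ≤ K ∧ ∀ t ∈ Set.Icc s T,
      energyMoment (momentLadder γ k) (f t) ≤ ENNReal.ofReal K) ∧
      ∃ t ∈ Set.Ioo s T, energyMoment (momentLadder γ (k + 1) + γ / 8) (f t) < ⊤ := by
  have e1 : momentLadder γ k = 1 + (momentLadder γ k - 1) := by ring
  have e2 : momentLadder γ (k + 1) + γ / 8 = 1 + (momentLadder γ k - 1) + γ / 2 := by
    unfold momentLadder; push_cast; ring
  have hk0 : (0 : ℝ) ≤ k := Nat.cast_nonneg k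
  have hα : momentLadder γ k - 1 + γ / 8 = 3 * (γ / 8) * k := by unfold momentLadder; ring
  have h0 : 0 ≤ momentLadder γ k - 1 + γ / 8 := by rw [hα]; positivity
  rw [e1] at hM ⊢
  rw [e2]
  set α := momentLadder γ k - 1 with hαdef
  -- For k ≤ 2 the decay exponent is 3γk/8 ≤ 3/4, weaker than the 1/n of the sharp estimate, and q =
  -- 0 suffices. For k ≥ 3 the previous rung has α₀ ≥ 5γ/8, above the threshold γ/2 of the crude
  -- estimate.
  rcases lt_or_ge k 3 with hk | hk
  · have hk2 : (k : ℝ) ≤ 2 := by exact_mod_cast Nat.le_of_lt_succ hk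
    have hα1 : α + γ / 8 ≤ 1 := by rw [hα]; nlinarith
    obtain ⟨c, C, n₀, hc, hC, hn₀, H⟩ := exists_sharp_dissipation hγ0.le hγ1 hν hκ₁ hκ₂
    obtain ⟨j₀, hj₀⟩ := pow_unbounded_of_one_lt n₀ (by norm_num : (1 : ℝ) < 2)
    refine hf.moment_step hF hγ0.le (q := 0) (j₀ := j₀) (e := γ / 8) hs hsT (by positivity) h0
      (by simpa using hα1) (by linarith) hc hC ?_ hM
    intro n hn t ht N hN
    have hn1 : 1 ≤ n := by linarith
    refine (H B β I J f hB hF hf n (by linarith) t (hs.trans_lt ht.1) N hN).trans ?_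
    have : n⁻¹ ≤ n ^ (-(α + γ / 8)) := by
      rw [← Real.rpow_neg_one]
      exact Real.rpow_le_rpow_of_exponent_le hn1 (by linarith)
    rw [div_eq_mul_inv]
    gcongr
  · obtain ⟨K, hK0, hK⟩ := hprev.resolve_left (by omega)
    have hk3 : (3 : ℝ) ≤ k := by exact_mod_cast hk
    set α₀ := momentLadder γ (k - 1) - 1 with hα₀
    have hα₀' : α₀ = α - 3 * (γ / 8) := by
      rw [hα₀, hαdef]; unfold momentLadder
      rw [Nat.cast_sub (by omega)]; push_cast; ring
    have h5 : γ / 2 ≤ α₀ := by rw [hα₀']; nlinarith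
    set q := ⌈α + γ / 8⌉₊ with hq
    have hq1 : α + γ / 8 ≤ q := Nat.le_ceil _
    set c := 3 * Real.pi * κ₁ * angularSpread ν / 16 with hc
    have hSp := angularSpread_pos hν
    have hMass := angularMass_nonneg ν
    have hpi := Real.pi_pos
    have hc0 : 0 < c := by positivity
    set D := κ₂ * (32 * Real.pi * ((q + 2) * (q + 1) * 2 ^ (q + 1))) * angularMass ν * K with hD
    have hD0 : 0 ≤ D := by positivity
    refine hf.moment_step hF hγ0.le (q := q) (j₀ := 5) (e := γ / 8)
      (C := c * 32 ^ (q + 3) + D) hs hsT (by positivity) h0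
      (by linarith) (by linarith) hc0 (by positivity) ?_ hM
    intro n hn t ht N hN
    have hn32 : 32 ≤ n := by norm_num at hn; exact hn
    have hn1 : 1 ≤ n := by linarith
    have e3 : (fun v : Velocity => ‖v‖ ^ 2 * (‖v‖ ^ 2) ^ α₀)
        = fun v => (‖v‖ ^ 2) ^ momentLadder γ (k - 1) := by
      funext v
      rw [← Real.rpow_one_add' (by positivity) (by linarith), hα₀]
      congr 1; ring
    have hr0 : 0 ≤ momentLadder γ (k - 1) := by linarith
    have h7 := hf.collision_atom_le hB hF hγ0.le hγ1 hν hκ₁ hκ₂ q h5 (by linarith) hn32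
      (hs.trans_lt ht.1) (K := K)
      (by rw [e3]; exact integrable_of_energyMoment_lt_top hr0
            ((hK t ht).trans_lt ENNReal.ofReal_lt_top))
      (by rw [e3]; exact integral_le_of_energyMoment_le hr0 hK0 (hK t ht)) hN
    rw [← hc, ← hD] at h7
    refine h7.trans ?_
    have h8 : 1 / n ^ (q + 1) ≤ n ^ (-(α + γ / 8)) := by
      rw [one_div, ← Real.rpow_natCast, ← Real.rpow_neg (by linarith)]
      refine Real.rpow_le_rpow_of_exponent_le hn1 ?_
      push_cast; linarith
    -- As α₀ = α - 3γ/8, comparing the exponents amounts to γ/2 + 3γ/8 + γ/8 ≤ 1, that is γ ≤ 1.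
    have h9 : n ^ (γ / 2 - α₀ - 1) ≤ n ^ (-(α + γ / 8)) :=
      Real.rpow_le_rpow_of_exponent_le hn1 (by rw [hα₀']; linarith)
    have h10 := mul_le_mul_of_nonneg_left h8 (show 0 ≤ c * 32 ^ (q + 3) by positivity)
    have h11 := mul_le_mul_of_nonneg_left h9 hD0
    have e4 : c * (32 ^ (q + 3) / n ^ (q + 1)) = c * 32 ^ (q + 3) * (1 / n ^ (q + 1)) := by ring
    rw [e4]
    linarith

theorem IsWeakSolution.energyMoment_one_lt_top (hf : IsWeakSolution γ β I J f) {t : ℝ}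
    (ht : 0 ≤ t) : energyMoment 1 (f t) < ⊤ := by
  have := (hf.integrable_energy ht).2
  rw [hasFiniteIntegral_iff_ofReal (ae_of_all _ fun v => by positivity)] at this
  simpa [energyMoment] using this

/-- The induction carries two facts for each rung: finiteness of a slightly higher moment at
arbitrarily early times, and local boundedness of the moment on times bounded away from 0. A step
taken from an early good time reproduces both on the next rung. -/
theorem IsWeakSolution.energyMoment_le_of_pos (hf : IsWeakSolution γ β I J f)
    (hB : IsHardPotential γ ν κ₁ κ₂ B β) (hF : IsFrame I J) (hγ0 : 0 < γ) (hγ1 : γ ≤ 1)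
    (hν : ν < 2) (hκ₁ : 0 < κ₁) (hκ₂ : 0 < κ₂) {r : ℝ} (hr : 0 ≤ r) {s : ℝ} (hs : 0 < s) (T : ℝ) :
    ∃ K : ℝ, 0 ≤ K ∧ ∀ t ∈ Set.Icc s T, energyMoment r (f t) ≤ ENNReal.ofReal K := by
  have main : ∀ k : ℕ,
      (∀ s > 0, ∃ t ∈ Set.Ioo 0 s, energyMoment (momentLadder γ k + γ / 8) (f t) < ⊤) ∧
      ∀ s > 0, ∀ T, ∃ K : ℝ, 0 ≤ K ∧ ∀ t ∈ Set.Icc s T,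
        energyMoment (momentLadder γ k) (f t) ≤ ENNReal.ofReal K := by
    have step : ∀ k : ℕ,
        (∀ s > 0, ∃ t ∈ Set.Ioo 0 s, energyMoment (momentLadder γ k + γ / 8) (f t) < ⊤) →
        (k < 3 ∨ ∀ s > 0, ∀ T, ∃ K : ℝ, 0 ≤ K ∧ ∀ t ∈ Set.Icc s T,
          energyMoment (momentLadder γ (k - 1)) (f t) ≤ ENNReal.ofReal K) →
        (∀ s > 0, ∃ t ∈ Set.Ioo 0 s, energyMoment (momentLadder γ (k + 1) + γ / 8) (f t) < ⊤) ∧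
        ∀ s > 0, ∀ T, ∃ K : ℝ, 0 ≤ K ∧ ∀ t ∈ Set.Icc s T,
          energyMoment (momentLadder γ k) (f t) ≤ ENNReal.ofReal K := by
      intro k hA hb
      have aux : ∀ s > 0, ∀ T, s < T → ∃ t₀ ∈ Set.Ioo 0 s,
          (∃ K : ℝ, 0 ≤ K ∧ ∀ t ∈ Set.Icc t₀ T,
            energyMoment (momentLadder γ k) (f t) ≤ ENNReal.ofReal K) ∧
          ∃ t ∈ Set.Ioo t₀ T, energyMoment (momentLadder γ (k + 1) + γ / 8) (f t) < ⊤ := by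
        intro s hs T hT
        obtain ⟨t₀, ht₀, hM⟩ := hA s hs
        refine ⟨t₀, ht₀, hf.momentLadder_step hB hF hγ0 hγ1 hν hκ₁ hκ₂ ht₀.1.le
          (ht₀.2.trans hT) ?_ hM⟩
        refine hb.imp_right fun h => ?_
        obtain ⟨K, hK0, hK⟩ := h t₀ ht₀.1 T
        exact ⟨K, hK0, fun t ht => hK t (Set.Ioc_subset_Icc_self ht)⟩
      constructor
      · intro s hs
        obtain ⟨t₀, ht₀, -, t, ht, hM⟩ := aux (s / 2) (by linarith) s (by linarith)
        exact ⟨t, ⟨ht₀.1.trans ht.1, ht.2⟩, hM⟩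
      · intro s hs T
        obtain ⟨t₀, ht₀, ⟨K, hK0, hK⟩, -⟩ := aux s hs (max T s + 1)
          (by linarith [le_max_right T s])
        exact ⟨K, hK0, fun t ht => hK t ⟨ht₀.2.le.trans ht.1, by
          linarith [le_max_left T s, ht.2]⟩⟩
    intro k
    have start : ∀ s > 0, ∃ t ∈ Set.Ioo 0 s,
        energyMoment (momentLadder γ 0 + γ / 8) (f t) < ⊤ := by
      intro s hs
      refine ⟨s / 2, ⟨by linarith, by linarith⟩, ?_⟩
      have : momentLadder γ 0 + γ / 8 = 1 := by unfold momentLadder; push_cast; ring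
      rw [this]
      exact hf.energyMoment_one_lt_top (by linarith)
    induction k with
    | zero => exact ⟨start, (step 0 start (Or.inl (by norm_num))).2⟩
    | succ k ih =>
      have hA : ∀ s > 0, ∃ t ∈ Set.Ioo 0 s,
          energyMoment (momentLadder γ (k + 1) + γ / 8) (f t) < ⊤ := by
        intro s hs
        obtain ⟨t₀, ht₀, hM⟩ := ih.1 (s / 2) (by linarith)
        have hprev : k < 3 ∨ ∃ K : ℝ, 0 ≤ K ∧ ∀ t ∈ Set.Ioc t₀ s,
            energyMoment (momentLadder γ (k - 1)) (f t) ≤ ENNReal.ofReal K := by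
          obtain ⟨K, hK0, hK⟩ := ih.2 t₀ ht₀.1 s
          refine Or.inr ⟨1 + K, by positivity, fun t ht => ?_⟩
          have h1 : momentLadder γ (k - 1) ≤ momentLadder γ k := by
            unfold momentLadder
            gcongr
            omega
          have h2 : 0 ≤ momentLadder γ (k - 1) := by
            unfold momentLadder
            have : 0 ≤ 3 * (γ / 8) * ((k - 1 : ℕ) : ℝ) := by positivity
            linarith
          refine (energyMoment_mono h2 h1 _).trans ?_
          rw [ENNReal.ofReal_add zero_le_one hK0, ENNReal.ofReal_one]
          gcongr
          exact hK t (Set.Ioc_subset_Icc_self ht)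
        obtain ⟨-, t, ht, hM'⟩ := hf.momentLadder_step hB hF hγ0 hγ1 hν hκ₁ hκ₂ ht₀.1.le
          (T := s) (by linarith [ht₀.2]) hprev hM
        exact ⟨t, ⟨ht₀.1.trans ht.1, ht.2⟩, hM'⟩
      exact ⟨hA, (step (k + 1) hA (Or.inr (by simpa using ih.2))).2⟩
  obtain ⟨k, hk⟩ := exists_le_momentLadder hγ0 r
  obtain ⟨K, hK0, hK⟩ := (main k).2 s hs T
  refine ⟨1 + K, by positivity, fun t ht => (energyMoment_mono hr hk _).trans ?_⟩
  rw [ENNReal.ofReal_add zero_le_one hK0, ENNReal.ofReal_one]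
  gcongr
  exact hK t ht

theorem IsWeakSolution.energyMoment_le_of_initial (hf : IsWeakSolution γ β I J f)
    (hB : IsHardPotential γ ν κ₁ κ₂ B β) (hF : IsFrame I J) (hγ0 : 0 < γ) (hγ1 : γ ≤ 1)
    (hν : ν < 2) (hκ₁ : 0 < κ₁) (hκ₂ : 0 < κ₂)
    (h0 : ∀ r : ℝ, 0 ≤ r → energyMoment r (f 0) < ⊤) {r : ℝ} (hr : 0 ≤ r) (T : ℝ) :
    ∃ K : ℝ, 0 ≤ K ∧ ∀ t ∈ Set.Icc 0 T, energyMoment r (f t) ≤ ENNReal.ofReal K := by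
  have hl : ∀ k, 0 ≤ momentLadder γ k := by
    intro k
    unfold momentLadder
    have : 0 ≤ 3 * (γ / 8) * (k : ℝ) := by positivity
    linarith
  have main : ∀ k : ℕ, ∃ K : ℝ, 0 ≤ K ∧ ∀ t ∈ Set.Icc 0 (max T 1),
      energyMoment (momentLadder γ k) (f t) ≤ ENNReal.ofReal K := by
    have hT : 0 < max T 1 := by positivity
    have hM : ∀ k, energyMoment (momentLadder γ k + γ / 8) (f 0) < ⊤ := fun k =>
      h0 _ (by have := hl k; positivity)
    intro k
    induction k with
    | zero =>
      exact (hf.momentLadder_step hB hF hγ0 hγ1 hν hκ₁ hκ₂ le_rfl hT (Or.inl (by norm_num))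
        (hM 0)).1
    | succ k ih =>
      refine (hf.momentLadder_step hB hF hγ0 hγ1 hν hκ₁ hκ₂ le_rfl hT (Or.inr ?_) (hM _)).1
      obtain ⟨K, hK0, hK⟩ := ih
      exact ⟨K, hK0, fun t ht => by simpa using hK t (Set.Ioc_subset_Icc_self ht)⟩
  obtain ⟨k, hk⟩ := exists_le_momentLadder hγ0 r
  obtain ⟨K, hK0, hK⟩ := main k
  refine ⟨1 + K, by positivity, fun t ht => (energyMoment_mono hr hk _).trans ?_⟩
  rw [ENNReal.ofReal_add zero_le_one hK0, ENNReal.ofReal_one]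
  gcongr
  exact hK t ⟨ht.1, ht.2.trans (le_max_left _ _)⟩

end MomentBounds

/-! ### From atoms to integer powers of the energy. -/

section PowerLimit

variable {γ ν κ₁ κ₂ : ℝ} {B : ℝ → ℝ → ℝ} {β : ℝ → ℝ} {I J : Velocity → Velocity}
  {f : ℝ → ProbabilityMeasure Velocity} {n z : ℝ}

theorem one_sub_one_sub_pow_mem {a : ℝ} (h0 : 0 ≤ a) (h1 : a ≤ 1) (m : ℕ) :
    0 ≤ 1 - (1 - a) ^ m ∧ 1 - (1 - a) ^ m ≤ m * a := by
  constructor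
  · have := pow_le_one₀ (n := m) (by linarith : 0 ≤ 1 - a) (by linarith)
    linarith
  · have := one_add_mul_le_pow (a := -a) (by linarith) m
    rw [← sub_eq_add_neg] at this
    linarith

/-- Since n · z/(n+z) = z(1 - z/(n+z)), rescaled atoms converge to z^(q+2) as n tends to infinity.
Bernoulli's inequality then makes the errors in the profile and in its second derivative of order
1/n, up to powers of z. -/
theorem pow_mul_atom (hn : 0 < n) (q : ℕ) (hz : 0 ≤ z) :
    n ^ (q + 1) * atom n q z = z ^ (q + 2) * (1 - satRatio n z) ^ (q + 1) := by
  unfold atom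
  calc n ^ (q + 1) * (z * satRatio n z ^ (q + 1)) = z * (n * satRatio n z) ^ (q + 1) := by
        rw [mul_pow]; ring
    _ = _ := by rw [← mul_one_sub_satRatio hn hz, mul_pow]; ring

theorem pow_sub_pow_mul_atom_mem (hn : 0 < n) (q : ℕ) (hz : 0 ≤ z) :
    0 ≤ z ^ (q + 2) - n ^ (q + 1) * atom n q z ∧
      z ^ (q + 2) - n ^ (q + 1) * atom n q z ≤ (q + 1) * z ^ (q + 3) / n := by
  have ha0 := satRatio_nonneg hn hz
  have ha1 := (satRatio_lt_one hn hz).le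
  obtain ⟨h1, h2⟩ := one_sub_one_sub_pow_mem ha0 ha1 (q + 1)
  rw [pow_mul_atom hn q hz]
  have hp : 0 ≤ z ^ (q + 2) := by positivity
  have e : z ^ (q + 2) - z ^ (q + 2) * (1 - satRatio n z) ^ (q + 1)
      = z ^ (q + 2) * (1 - (1 - satRatio n z) ^ (q + 1)) := by ring
  rw [e]
  refine ⟨mul_nonneg hp h1, ?_⟩
  calc z ^ (q + 2) * (1 - (1 - satRatio n z) ^ (q + 1))
      ≤ z ^ (q + 2) * ((q + 1 : ℕ) * satRatio n z) := by gcongr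
    _ ≤ z ^ (q + 2) * ((q + 1 : ℕ) * (z / n)) := by gcongr; exact satRatio_le_div hn hz
    _ = _ := by push_cast; ring

theorem abs_pow_mul_atomDeriv₂_sub_le (hn : 0 < n) (q : ℕ) (hz : 0 ≤ z) :
    |n ^ (q + 1) * atomDeriv₂ n q z - (q + 2) * (q + 1) * z ^ q|
      ≤ (q + 2) * (q + 1) * (q + 3) * z ^ (q + 1) / n := by
  have ha0 := satRatio_nonneg hn hz
  have ha1 := (satRatio_lt_one hn hz).le
  obtain ⟨h1, h2⟩ := one_sub_one_sub_pow_mem ha0 ha1 (q + 3)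
  have e : n ^ (q + 1) * atomDeriv₂ n q z
      = (q + 2) * (q + 1) * z ^ q * (1 - satRatio n z) ^ (q + 3) := by
    unfold atomDeriv₂
    calc _ = (q + 2) * (q + 1) * (n * satRatio n z) ^ q * (1 - satRatio n z) ^ 3 := by
          rw [mul_pow]; field_simp; ring
      _ = _ := by rw [← mul_one_sub_satRatio hn hz, mul_pow]; ring
  have e2 : (q + 2) * (q + 1) * z ^ q * (1 - satRatio n z) ^ (q + 3) - (q + 2) * (q + 1) * z ^ q
      = -((q + 2) * (q + 1) * z ^ q * (1 - (1 - satRatio n z) ^ (q + 3))) := by ring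
  rw [e, e2, abs_neg, abs_of_nonneg (by positivity)]
  calc _ ≤ (q + 2) * (q + 1) * z ^ q * ((q + 3 : ℕ) * satRatio n z) := by gcongr
    _ ≤ (q + 2) * (q + 1) * z ^ q * ((q + 3 : ℕ) * (z / n)) := by
        gcongr; exact satRatio_le_div hn hz
    _ = _ := by push_cast; ring

theorem abs_angularAverage_pow_sub_le {x y R : ℝ} (hn : 0 < n) (q : ℕ) (hx : 0 ≤ x) (hy : 0 ≤ y)
    (hR : R ^ 2 ≤ x * y) (θ : ℝ) :
    |angularAverage (fun z => n ^ (q + 1) * atom n q z - z ^ (q + 2)) x y R θ|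
      ≤ 30 * Real.pi * ((q + 2) * (q + 1) * (q + 3)) * (x + y) ^ (q + 3) / n * halfSinSq θ := by
  have h1 : ∀ z : ℝ, 0 ≤ z → HasDerivAt (fun z => n ^ (q + 1) * atom n q z - z ^ (q + 2))
      (n ^ (q + 1) * atomDeriv n q z - (q + 2) * z ^ (q + 1)) z := fun z hz => by
    have := ((hasDerivAt_atom hn q hz).const_mul (n ^ (q + 1))).sub (hasDerivAt_pow (q + 2) z)
    exact this.congr_deriv (by push_cast; rfl)
  have h2 : ∀ z : ℝ, 0 ≤ z →
      HasDerivAt (fun z => n ^ (q + 1) * atomDeriv n q z - (q + 2) * z ^ (q + 1))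
      (n ^ (q + 1) * atomDeriv₂ n q z - (q + 2) * (q + 1) * z ^ q) z := fun z hz => by
    have := ((hasDerivAt_atomDeriv hn q hz).const_mul (n ^ (q + 1))).sub
      ((hasDerivAt_pow (q + 1) z).const_mul ((q : ℝ) + 2))
    exact this.congr_deriv (by push_cast; ring)
  refine (abs_angularAverage_le_of_deriv (D := (q + 2) * (q + 1) * (q + 3) * (x + y) ^ (q + 1) / n)
    h1 h2 hx hy hR (fun z hz hzS => (abs_pow_mul_atomDeriv₂_sub_le hn q hz).trans (by gcongr))
    θ).trans (le_of_eq ?_)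
  ring

theorem abs_angularAverage_pow_le {x y R : ℝ} (q : ℕ) (hx : 0 ≤ x) (hy : 0 ≤ y)
    (hR : R ^ 2 ≤ x * y) (θ : ℝ) :
    |angularAverage (fun z => z ^ (q + 2)) x y R θ|
      ≤ 30 * Real.pi * ((q + 2) * (q + 1)) * (x + y) ^ (q + 2) * halfSinSq θ := by
  have h1 : ∀ z : ℝ, 0 ≤ z → HasDerivAt (fun z => z ^ (q + 2))
      ((q + 2) * z ^ (q + 1)) z := fun z hz =>
    (hasDerivAt_pow (q + 2) z).congr_deriv (by push_cast; rfl)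
  have h2 : ∀ z : ℝ, 0 ≤ z → HasDerivAt (fun z => ((q : ℝ) + 2) * z ^ (q + 1))
      ((q + 2) * (q + 1) * z ^ q) z := fun z hz =>
    ((hasDerivAt_pow (q + 1) z).const_mul ((q : ℝ) + 2)).congr_deriv
      (by push_cast; ring)
  refine (abs_angularAverage_le_of_deriv (D := (q + 2) * (q + 1) * (x + y) ^ q)
    h1 h2 hx hy hR (fun z hz hzS => ?_) θ).trans (le_of_eq (by ring))
  rw [abs_of_nonneg (by positivity)]
  gcongr

theorem IsHardPotential.abs_integral_le (hB : IsHardPotential γ ν κ₁ κ₂ B β) (hν : ν < 2)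
    {A : ℝ → ℝ} {C : ℝ} (hA : Continuous A) (hC : 0 ≤ C)
    (h : ∀ θ ∈ Set.Ioc 0 Real.pi, |A θ| ≤ C * halfSinSq θ) :
    |∫ θ in (0 : ℝ)..Real.pi, A θ * β θ| ≤ κ₂ * (C * angularMass ν) := by
  have hu := continuous_halfSinSq
  have key : ∀ A : ℝ → ℝ, Continuous A → (∀ θ ∈ Set.Ioc 0 Real.pi, |A θ| ≤ C * halfSinSq θ) →
      ∫ θ in (0 : ℝ)..Real.pi, A θ * β θ ≤ κ₂ * (C * angularMass ν) := by
    intro A hA h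
    have := hB.integral_le hν (A := A) (L := fun _ => 0) (G := fun θ => C * halfSinSq θ)
      (CA := C) (CL := 0) (CG := C) hA continuous_const (by fun_prop) h (fun _ _ => le_rfl)
      (fun θ _ => by simp) (fun θ _ => mul_nonneg hC (halfSinSq_nonneg θ)) (fun θ _ => le_rfl)
      (fun θ hθ => by simpa using (le_abs_self _).trans (h θ hθ))
    refine this.trans (le_of_eq ?_)
    simp only [mul_assoc C, intervalIntegral.integral_const_mul, zero_mul,
      intervalIntegral.integral_zero]
    unfold angularMass
    ring
  rw [abs_le]
  have h2 := key (fun θ => -A θ) hA.neg (fun θ hθ => by rw [abs_neg]; exact h θ hθ)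
  simp only [neg_mul, intervalIntegral.integral_neg] at h2
  exact ⟨by linarith, key A hA h⟩

theorem norm_sub_rpow_le_mul (hγ0 : 0 ≤ γ) (hγ1 : γ ≤ 1) (v w : Velocity) :
    ‖v - w‖ ^ γ ≤ 2 * ((1 + ‖v‖ ^ 2) * (1 + ‖w‖ ^ 2)) := by
  have h : ∀ v : Velocity, ‖v‖ ^ γ ≤ 1 + ‖v‖ ^ 2 := by
    intro v
    have hv := norm_nonneg v
    rcases le_total ‖v‖ 1 with h1 | h1
    · have := Real.rpow_le_one hv h1 hγ0
      nlinarith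
    · have := Real.rpow_le_rpow_of_exponent_le h1 hγ1
      rw [Real.rpow_one] at this
      nlinarith
  have := norm_sub_rpow_le hγ0 hγ1 v w
  have h1 := h v
  have h2 := h w
  have h3 : 0 ≤ ‖v‖ ^ 2 := by positivity
  have h4 : 0 ≤ ‖w‖ ^ 2 := by positivity
  nlinarith [mul_nonneg h3 h4]

theorem abs_collisionIntegral_pow_sub_le (hB : IsHardPotential γ ν κ₁ κ₂ B β) (hF : IsFrame I J)
    (hγ0 : 0 ≤ γ) (hγ1 : γ ≤ 1) (hν : ν < 2) (hκ₂ : 0 < κ₂) (hn : 0 < n) (q : ℕ)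
    (v w : Velocity) :
    |n ^ (q + 1) * collisionIntegral γ β I J (fun v => atom n q (‖v‖ ^ 2)) v w
      - collisionIntegral γ β I J (fun v => (‖v‖ ^ 2) ^ (q + 2)) v w| ≤
    κ₂ * (60 * Real.pi * ((q + 2) * (q + 1) * (q + 3))) * angularMass ν / n
      * ((1 + ‖v‖ ^ 2) ^ (q + 4) * (1 + ‖w‖ ^ 2) ^ (q + 4)) := by
  obtain ⟨R, hR0, hR, h⟩ := hF.exists_collisionIntegral_eq γ β v w
  rw [h, h (fun z => z ^ (q + 2))]
  have hx : 0 ≤ ‖v‖ ^ 2 := by positivity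
  have hy : 0 ≤ ‖w‖ ^ 2 := by positivity
  have hV := norm_sub_rpow_le_mul hγ0 hγ1 v w
  have hV0 : 0 ≤ ‖v - w‖ ^ γ := by positivity
  have hM := angularMass_nonneg ν
  set x := ‖v‖ ^ 2
  set y := ‖w‖ ^ 2
  have c1 : ContinuousOn (fun z => n ^ (q + 1) * atom n q z) (Set.Ici 0) :=
    continuousOn_const.mul (continuousOn_atom hn q)
  have c2 : ContinuousOn (fun z : ℝ => z ^ (q + 2)) (Set.Ici 0) := (continuous_pow _).continuousOn
  have i1 := hB.intervalIntegrable_mul hν (continuous_angularAverage (continuousOn_atom hn q)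
    hx hy hR) (fun θ _ => abs_angularAverage_atom_le hn q hx hy hR θ)
  have i2 := hB.intervalIntegrable_mul hν (continuous_angularAverage c2
    hx hy hR) (fun θ _ => abs_angularAverage_pow_le q hx hy hR θ)
  have e : n ^ (q + 1) * (‖v - w‖ ^ γ
        * ∫ θ in (0 : ℝ)..Real.pi, angularAverage (atom n q) x y R θ * β θ)
      - ‖v - w‖ ^ γ * ∫ θ in (0 : ℝ)..Real.pi, angularAverage (fun z => z ^ (q + 2)) x y R θ * β θ
      = ‖v - w‖ ^ γ * ∫ θ in (0 : ℝ)..Real.pi,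
        angularAverage (fun z => n ^ (q + 1) * atom n q z - z ^ (q + 2)) x y R θ * β θ := by
    simp_rw [angularAverage_sub c1 c2 hx hy hR, angularAverage_const_mul, sub_mul, mul_assoc]
    rw [intervalIntegral.integral_sub (i1.const_mul _) i2, intervalIntegral.integral_const_mul]
    ring
  rw [e, abs_mul, abs_of_nonneg hV0]
  have key := hB.abs_integral_le hν (continuous_angularAverage (c1.sub c2) hx hy hR)
    (C := 30 * Real.pi * ((q + 2) * (q + 1) * (q + 3)) * (x + y) ^ (q + 3) / n)
    (by positivity) (fun θ _ => abs_angularAverage_pow_sub_le hn q hx hy hR θ)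
  have hS : (x + y) ^ (q + 3) ≤ ((1 + x) * (1 + y)) ^ (q + 3) := by
    gcongr
    nlinarith [mul_nonneg hx hy]
  calc _ ≤ (2 * ((1 + x) * (1 + y))) * (κ₂ * (30 * Real.pi * ((q + 2) * (q + 1) * (q + 3))
        * ((1 + x) * (1 + y)) ^ (q + 3) / n * angularMass ν)) := by
        refine mul_le_mul hV (key.trans ?_) (abs_nonneg _) (by positivity)
        gcongr
    _ = _ := by rw [← mul_pow]; ring

/-- All moments are bounded on the time interval `[s, T]`. -/
def HasMoments (f : ℝ → ProbabilityMeasure Velocity) (s T : ℝ) : Prop :=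
  ∀ r : ℕ, ∃ K : ℝ, ∀ t ∈ Set.Icc s T,
    Integrable (fun v : Velocity => (1 + ‖v‖ ^ 2) ^ r) (f t : Measure Velocity) ∧
      ∫ v, (1 + ‖v‖ ^ 2) ^ r ∂(f t : Measure Velocity) ≤ K

theorem hasMoments_of_energyMoment_le {s T : ℝ}
    (h : ∀ r : ℝ, 0 ≤ r → ∃ K : ℝ, 0 ≤ K ∧ ∀ t ∈ Set.Icc s T,
      energyMoment r (f t) ≤ ENNReal.ofReal K) : HasMoments f s T := by
  intro r
  obtain ⟨K, hK0, hK⟩ := h r (Nat.cast_nonneg r)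
  refine ⟨2 ^ r * (1 + K), fun t ht => ?_⟩
  have hi := integrable_of_energyMoment_lt_top (Nat.cast_nonneg r)
    ((hK t ht).trans_lt ENNReal.ofReal_lt_top)
  have hle := integral_le_of_energyMoment_le (Nat.cast_nonneg r) hK0 (hK t ht)
  simp only [Real.rpow_natCast] at hi hle
  have hb : ∀ v : Velocity, (1 + ‖v‖ ^ 2) ^ r ≤ 2 ^ r * (1 + (‖v‖ ^ 2) ^ r) := by
    intro v
    have hx : 0 ≤ ‖v‖ ^ 2 := by positivity
    have := add_pow_le zero_le_one hx r
    rw [one_pow] at this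
    refine this.trans ?_
    have h2 : (2 : ℝ) ^ (r - 1) ≤ 2 ^ r := pow_le_pow_right₀ (by norm_num) (Nat.sub_le _ _)
    gcongr
  have hd : Integrable (fun v : Velocity => (2 : ℝ) ^ r * (1 + (‖v‖ ^ 2) ^ r))
      (f t : Measure Velocity) := ((integrable_const _).add hi).const_mul _
  have hI : Integrable (fun v : Velocity => (1 + ‖v‖ ^ 2) ^ r) (f t : Measure Velocity) := by
    refine hd.mono' (by fun_prop) (ae_of_all _ fun v => ?_)
    rw [Real.norm_eq_abs, abs_of_nonneg (by positivity)]
    exact hb v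
  refine ⟨hI, (integral_mono hI hd hb).trans ?_⟩
  rw [integral_const_mul, integral_add (integrable_const _) hi]
  simp only [integral_const, probReal_univ, smul_eq_mul, mul_one]
  gcongr

theorem HasMoments.integrable_pow {s T : ℝ} (h : HasMoments f s T) (r : ℕ) {t : ℝ}
    (ht : t ∈ Set.Icc s T) :
    Integrable (fun v : Velocity => (‖v‖ ^ 2) ^ r) (f t : Measure Velocity) := by
  obtain ⟨K, hK⟩ := h r
  refine (hK t ht).1.mono' (by fun_prop) (ae_of_all _ fun v => ?_)
  rw [Real.norm_eq_abs, abs_of_nonneg (by positivity)]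
  gcongr
  linarith

theorem HasMoments.abs_integral_atom_sub_le {s T : ℝ} (hf : IsWeakSolution γ β I J f)
    (h : HasMoments f s T) (hs : 0 ≤ s) (q : ℕ) :
    ∃ K : ℝ, 0 ≤ K ∧ ∀ n : ℝ, 0 < n → ∀ t ∈ Set.Icc s T,
      |n ^ (q + 1) * (∫ v, atom n q (‖v‖ ^ 2) ∂(f t : Measure Velocity))
        - ∫ v, (‖v‖ ^ 2) ^ (q + 2) ∂(f t : Measure Velocity)| ≤ K / n := by
  obtain ⟨K, hK⟩ := h (q + 3)
  refine ⟨(q + 1) * max K 0, by positivity, fun n hn t ht => ?_⟩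
  have ht0 : 0 ≤ t := hs.trans ht.1
  rw [← integral_const_mul, ← integral_sub ((hf.integrable_atom hn q ht0).const_mul _)
    (h.integrable_pow (q + 2) ht)]
  refine (abs_integral_le_integral_abs).trans ?_
  have hmem : ∀ v : Velocity, |n ^ (q + 1) * atom n q (‖v‖ ^ 2) - (‖v‖ ^ 2) ^ (q + 2)|
      ≤ (q + 1) / n * (1 + ‖v‖ ^ 2) ^ (q + 3) := by
    intro v
    have hx : 0 ≤ ‖v‖ ^ 2 := by positivity
    obtain ⟨h1, h2⟩ := pow_sub_pow_mul_atom_mem hn q hx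
    rw [abs_sub_comm, abs_of_nonneg h1]
    refine h2.trans ?_
    rw [mul_div_right_comm]
    gcongr
    linarith
  refine (integral_mono (((hf.integrable_atom hn q ht0).const_mul _).sub
    (h.integrable_pow (q + 2) ht)).abs ((hK t ht).1.const_mul _) hmem).trans ?_
  rw [integral_const_mul, mul_div_right_comm]
  gcongr
  exact (hK t ht).2.trans (le_max_left _ _)

theorem HasMoments.continuousOn_integral_pow {s T : ℝ} (hf : IsWeakSolution γ β I J f)
    (h : HasMoments f s T) (hs : 0 ≤ s) (q : ℕ) :
    ContinuousOn (fun t => ∫ v, (‖v‖ ^ 2) ^ (q + 2) ∂(f t : Measure Velocity)) (Set.Icc s T) := by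
  obtain ⟨K, hK0, hK⟩ := h.abs_integral_atom_sub_le hf hs q
  have hlim : TendstoUniformlyOn (fun (k : ℕ) t => ((k : ℝ) + 1) ^ (q + 1)
      * ∫ v, atom ((k : ℝ) + 1) q (‖v‖ ^ 2) ∂(f t : Measure Velocity))
      (fun t => ∫ v, (‖v‖ ^ 2) ^ (q + 2) ∂(f t : Measure Velocity)) Filter.atTop
      (Set.Icc s T) := by
    rw [Metric.tendstoUniformlyOn_iff]
    intro ε hε
    have := (tendsto_one_div_add_atTop_nhds_zero_nat (𝕜 := ℝ)).const_mul K
    rw [mul_zero] at this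
    filter_upwards [this.eventually (gt_mem_nhds hε)] with k hk t ht
    rw [Real.dist_eq, abs_sub_comm]
    refine (hK (k + 1) (by positivity) t ht).trans_lt ?_
    rwa [mul_one_div] at hk
  refine hlim.continuousOn (Filter.Eventually.frequently (Filter.Eventually.of_forall fun k => ?_))
  exact continuousOn_const.mul ((hf.continuousOn_atom (by
    linarith [Nat.cast_nonneg (α := ℝ) k]) q).mono fun t ht => hs.trans ht.1)

theorem HasMoments.integrable_collisionIntegral_pow {s T : ℝ} (hf : IsWeakSolution γ β I J f)
    (hB : IsHardPotential γ ν κ₁ κ₂ B β) (hF : IsFrame I J)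
    (hγ0 : 0 ≤ γ) (hγ1 : γ ≤ 1) (hν : ν < 2) (hκ₂ : 0 < κ₂)
    (h : HasMoments f s T) (q : ℕ) {t : ℝ} (ht : t ∈ Set.Icc s T) (ht0 : 0 < t) :
    Integrable (fun p : Velocity × Velocity =>
      collisionIntegral γ β I J (fun v => (‖v‖ ^ 2) ^ (q + 2)) p.1 p.2)
      ((f t : Measure Velocity).prod (f t : Measure Velocity)) := by
  set μ := (f t : Measure Velocity)
  obtain ⟨K, hK⟩ := h (q + 4)
  have hW : Integrable (fun p : Velocity × Velocity =>
      (1 + ‖p.1‖ ^ 2) ^ (q + 4) * (1 + ‖p.2‖ ^ 2) ^ (q + 4)) (μ.prod μ) :=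
    (hK t ht).1.mul_prod (hK t ht).1
  set C := κ₂ * (60 * Real.pi * ((q + 2) * (q + 1) * (q + 3))) * angularMass ν with hC
  have hQ : ∀ k : ℕ, Integrable (fun p : Velocity × Velocity => ((k : ℝ) + 1) ^ (q + 1) *
      collisionIntegral γ β I J (fun v => atom ((k : ℝ) + 1) q (‖v‖ ^ 2)) p.1 p.2) (μ.prod μ) :=
    fun k => (hf.integrable_collision_atom hF (by linarith [Nat.cast_nonneg (α := ℝ) k]) q
      ht0).const_mul _
  have herr := fun (k : ℕ) (p : Velocity × Velocity) => abs_collisionIntegral_pow_sub_le hB hF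
    hγ0 hγ1 hν hκ₂ (n := (k : ℝ) + 1) (by positivity) q p.1 p.2
  -- The frame maps `I` and `J` are not assumed measurable. Measurability is inherited as a
  -- pointwise limit of the collision integrals of atoms, whose integrability belongs to the notion
  -- of weak solution.
  have hmeas : AEStronglyMeasurable (fun p : Velocity × Velocity =>
      collisionIntegral γ β I J (fun v => (‖v‖ ^ 2) ^ (q + 2)) p.1 p.2) (μ.prod μ) := by
    refine aestronglyMeasurable_of_tendsto_ae Filter.atTop (fun k => (hQ k).aestronglyMeasurable)
      (ae_of_all _ fun p => ?_)
    rw [tendsto_iff_norm_sub_tendsto_zero]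
    have := (tendsto_one_div_add_atTop_nhds_zero_nat (𝕜 := ℝ)).const_mul
      (C * ((1 + ‖p.1‖ ^ 2) ^ (q + 4) * (1 + ‖p.2‖ ^ 2) ^ (q + 4)))
    rw [mul_zero] at this
    refine squeeze_zero (fun k => norm_nonneg _) (fun k => ?_) this
    refine (herr k p).trans (le_of_eq ?_)
    ring
  refine ((hQ 0).abs.add (hW.const_mul (C / ((0 : ℕ) + 1)))).mono' hmeas (ae_of_all _ fun p => ?_)
  have h1 := herr 0 p
  rw [abs_sub_comm, ← hC] at h1
  have h2 := abs_sub_abs_le_abs_sub (collisionIntegral γ β I J (fun v => (‖v‖ ^ 2) ^ (q + 2)) p.1 p.2)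
    (((0 : ℕ) + 1 : ℝ) ^ (q + 1) *
      collisionIntegral γ β I J (fun v => atom ((0 : ℕ) + 1 : ℝ) q (‖v‖ ^ 2)) p.1 p.2)
  rw [Real.norm_eq_abs, Pi.add_apply]
  exact sub_le_iff_le_add'.1 (h2.trans h1)

/-- The rescaled atom moments converge, and their time derivatives converge uniformly, at rate 1/n
on the interval because all moments are bounded there. The limit is therefore differentiable with
the limiting derivative. -/
theorem HasMoments.hasDerivAt_integral_pow {s T : ℝ} (hf : IsWeakSolution γ β I J f)
    (hB : IsHardPotential γ ν κ₁ κ₂ B β) (hF : IsFrame I J)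
    (hγ0 : 0 ≤ γ) (hγ1 : γ ≤ 1) (hν : ν < 2) (hκ₂ : 0 < κ₂)
    (h : HasMoments f s T) (hs : 0 ≤ s) (q : ℕ) {t : ℝ} (ht : t ∈ Set.Ioo s T) :
    HasDerivAt (fun t => ∫ v, (‖v‖ ^ 2) ^ (q + 2) ∂(f t : Measure Velocity))
      (∫ p, collisionIntegral γ β I J (fun v => (‖v‖ ^ 2) ^ (q + 2)) p.1 p.2
        ∂((f t : Measure Velocity).prod (f t : Measure Velocity))) t := by
  have hM := angularMass_nonneg ν
  have hpi := Real.pi_pos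
  set C := κ₂ * (60 * Real.pi * ((q + 2) * (q + 1) * (q + 3))) * angularMass ν with hC
  have hC0 : 0 ≤ C := by positivity
  obtain ⟨K, hK⟩ := h (q + 4)
  obtain ⟨K', hK'0, hK'⟩ := h.abs_integral_atom_sub_le hf hs q
  have hk1 : ∀ k : ℕ, (1 : ℝ) ≤ k + 1 := fun k => by linarith [Nat.cast_nonneg (α := ℝ) k]
  refine hasDerivAt_of_tendstoUniformlyOn (l := Filter.atTop) (s := Set.Ioo s T) isOpen_Ioo
    (f := fun (k : ℕ) t => ((k : ℝ) + 1) ^ (q + 1)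
      * ∫ v, atom ((k : ℝ) + 1) q (‖v‖ ^ 2) ∂(f t : Measure Velocity))
    (f' := fun (k : ℕ) t => ((k : ℝ) + 1) ^ (q + 1) *
      ∫ p, collisionIntegral γ β I J (fun v => atom ((k : ℝ) + 1) q (‖v‖ ^ 2)) p.1 p.2
        ∂((f t : Measure Velocity).prod (f t : Measure Velocity)))
    (g' := fun t => ∫ p, collisionIntegral γ β I J (fun v => (‖v‖ ^ 2) ^ (q + 2)) p.1 p.2
        ∂((f t : Measure Velocity).prod (f t : Measure Velocity))) ?_ ?_ ?_ ht
  · rw [Metric.tendstoUniformlyOn_iff]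
    intro ε hε
    have := (tendsto_one_div_add_atTop_nhds_zero_nat (𝕜 := ℝ)).const_mul (C * (K * K))
    rw [mul_zero] at this
    filter_upwards [this.eventually (gt_mem_nhds hε)] with k hk t ht
    have ht' := Set.Ioo_subset_Icc_self ht
    have ht0 : 0 < t := hs.trans_lt ht.1
    rw [Real.dist_eq, abs_sub_comm]
    refine lt_of_le_of_lt ?_ hk
    set μ := (f t : Measure Velocity) with hμ
    have hW : Integrable (fun p : Velocity × Velocity =>
        (1 + ‖p.1‖ ^ 2) ^ (q + 4) * (1 + ‖p.2‖ ^ 2) ^ (q + 4)) (μ.prod μ) :=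
      (hK t ht').1.mul_prod (hK t ht').1
    have i1 := (hf.integrable_collision_atom hF (hk1 k) q ht0).const_mul (((k : ℝ) + 1) ^ (q + 1))
    have i2 := h.integrable_collisionIntegral_pow hf hB hF hγ0 hγ1 hν hκ₂ q ht' ht0
    rw [← integral_const_mul, ← integral_sub i1 i2]
    refine abs_integral_le_integral_abs.trans ?_
    refine (integral_mono (i1.sub i2).abs (hW.const_mul (C / (k + 1))) fun p =>
      abs_collisionIntegral_pow_sub_le hB hF hγ0 hγ1 hν hκ₂ (n := (k : ℝ) + 1) (by positivity)
        q p.1 p.2).trans ?_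
    rw [integral_const_mul, integral_prod_mul (fun v : Velocity => (1 + ‖v‖ ^ 2) ^ (q + 4))
      (fun w : Velocity => (1 + ‖w‖ ^ 2) ^ (q + 4))]
    have h1 := (hK t ht').2
    have h0 : 0 ≤ ∫ v, (1 + ‖v‖ ^ 2) ^ (q + 4) ∂μ := integral_nonneg fun v => by positivity
    calc C / (k + 1) * ((∫ v, (1 + ‖v‖ ^ 2) ^ (q + 4) ∂μ) * ∫ v, (1 + ‖v‖ ^ 2) ^ (q + 4) ∂μ)
        ≤ C / (k + 1) * (K * K) := by gcongr; exact h0.trans h1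
      _ = _ := by ring
  · refine Filter.Eventually.of_forall fun k t ht => ?_
    exact (hf.hasDerivAt_atom hF (hk1 k) q (hs.trans_lt ht.1)).const_mul _
  · intro t ht
    rw [tendsto_iff_norm_sub_tendsto_zero]
    have := (tendsto_one_div_add_atTop_nhds_zero_nat (𝕜 := ℝ)).const_mul K'
    rw [mul_zero] at this
    refine squeeze_zero (fun k => norm_nonneg _) (fun k => ?_) this
    refine (hK' (k + 1) (by positivity) t (Set.Ioo_subset_Icc_self ht)).trans (le_of_eq ?_)
    ring

end PowerLimit

/-! ### A Povzner inequality for integer powers. -/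

section PolynomialPovzner

/-- The base is |A exp(iφ) + B|². Both conjugate factors are expanded by the binomial theorem,
giving a Fourier series whose mean, in `integral_pow_add_mul_cos`, keeps the diagonal terms only. -/
theorem pow_add_mul_cos_eq_sum (A B φ : ℝ) (p : ℕ) :
    (A ^ 2 + B ^ 2 + 2 * (A * B) * Real.cos φ) ^ p =
      ∑ k ∈ Finset.range (p + 1), ∑ l ∈ Finset.range (p + 1),
        (A ^ k * B ^ (p - k) * p.choose k) * (A ^ l * B ^ (p - l) * p.choose l)
          * Real.cos (((k : ℤ) - l : ℤ) * φ) := by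
  set E := Complex.exp (φ * Complex.I) with hE
  set E' := Complex.exp (-(φ * Complex.I)) with hE'
  have hEE : E * E' = 1 := by rw [hE, hE', ← Complex.exp_add]; simp
  have h1 : ((A ^ 2 + B ^ 2 + 2 * (A * B) * Real.cos φ : ℝ) : ℂ) = (A * E' + B) * (A * E + B) := by
    have hc : (2 : ℂ) * Complex.cos φ = E + E' := by
      rw [Complex.two_cos, hE, hE', neg_mul]
    push_cast
    calc (A : ℂ) ^ 2 + B ^ 2 + 2 * (A * B) * Complex.cos φ
        = A ^ 2 + B ^ 2 + (A * B) * (2 * Complex.cos φ) := by ring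
      _ = A ^ 2 * (E * E') + B ^ 2 + (A * B) * (E + E') := by rw [hc, hEE, mul_one]
      _ = _ := by ring
  have h2 : (((A ^ 2 + B ^ 2 + 2 * (A * B) * Real.cos φ) ^ p : ℝ) : ℂ) =
      ∑ k ∈ Finset.range (p + 1), ∑ l ∈ Finset.range (p + 1),
        (((A ^ k * B ^ (p - k) * p.choose k) * (A ^ l * B ^ (p - l) * p.choose l) : ℝ) : ℂ)
          * Complex.exp (((((k : ℤ) - l : ℤ) * φ : ℝ) : ℂ) * Complex.I) := by
    rw [Complex.ofReal_pow, h1, mul_pow, mul_comm, add_pow, add_pow, Finset.sum_mul_sum]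
    refine Finset.sum_congr rfl fun k _ => Finset.sum_congr rfl fun l _ => ?_
    have h3 : Complex.exp (((((k : ℤ) - l : ℤ) * φ : ℝ) : ℂ) * Complex.I) = E ^ k * E' ^ l := by
      rw [hE, hE', ← Complex.exp_nat_mul, ← Complex.exp_nat_mul, ← Complex.exp_add]
      congr 1
      push_cast
      ring
    rw [h3, mul_pow, mul_pow]
    push_cast
    ring
  have h4 := congrArg Complex.re h2
  rw [Complex.ofReal_re] at h4
  rw [h4]
  simp only [Complex.re_sum, Complex.re_ofReal_mul, Complex.exp_ofReal_mul_I_re]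

theorem integral_cos_int_mul (m : ℤ) :
    ∫ φ in (0 : ℝ)..(2 * Real.pi), Real.cos (m * φ) = if m = 0 then 2 * Real.pi else 0 := by
  split_ifs with h
  · simp [h]
  · have hm : (m : ℝ) ≠ 0 := by exact_mod_cast h
    rw [intervalIntegral.integral_comp_mul_left (fun x => Real.cos x) hm, integral_cos]
    have : Real.sin (m * (2 * Real.pi)) = 0 := by
      have := Real.sin_int_mul_pi (m * 2)
      push_cast at this
      rwa [mul_assoc] at this
    simp [this]

theorem integral_pow_add_mul_cos (A B : ℝ) (p : ℕ) :
    ∫ φ in (0 : ℝ)..(2 * Real.pi), (A ^ 2 + B ^ 2 + 2 * (A * B) * Real.cos φ) ^ p =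
      2 * Real.pi * ∑ k ∈ Finset.range (p + 1),
        (p.choose k : ℝ) ^ 2 * (A ^ 2) ^ k * (B ^ 2) ^ (p - k) := by
  simp_rw [pow_add_mul_cos_eq_sum]
  rw [intervalIntegral.integral_finsetSum]
  swap
  · intro k _
    exact Continuous.intervalIntegrable (by fun_prop) _ _
  rw [Finset.mul_sum]
  refine Finset.sum_congr rfl fun k hk => ?_
  rw [intervalIntegral.integral_finsetSum]
  swap
  · intro l _
    exact Continuous.intervalIntegrable (by fun_prop) _ _
  simp_rw [intervalIntegral.integral_const_mul, integral_cos_int_mul]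
  rw [Finset.sum_eq_single k]
  · simp only [sub_self, if_true]
    rw [← pow_mul, ← pow_mul]
    ring
  · intro l _ hl
    rw [if_neg, mul_zero]
    omega
  · intro h; exact absurd hk h

/-- The shift r is a convex combination of ±2√(ab). The power is convex on nonnegative numbers, and
the two extreme shifts have the same mean over φ. -/
theorem integral_pow_shift_le {a b r : ℝ} (ha : 0 ≤ a) (hb : 0 ≤ b) (hr : r ^ 2 ≤ 4 * (a * b))
    (p : ℕ) :
    ∫ φ in (0 : ℝ)..(2 * Real.pi), (a + b + r * Real.cos φ) ^ p ≤
      2 * Real.pi * ∑ k ∈ Finset.range (p + 1), (p.choose k : ℝ) ^ 2 * a ^ k * b ^ (p - k) := by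
  set A := Real.sqrt a
  set C := Real.sqrt b
  have hA : A ^ 2 = a := Real.sq_sqrt ha
  have hC : C ^ 2 = b := Real.sq_sqrt hb
  have hA0 : 0 ≤ A := Real.sqrt_nonneg a
  have hC0 : 0 ≤ C := Real.sqrt_nonneg b
  have h1 := integral_pow_add_mul_cos A C p
  have h2 := integral_pow_add_mul_cos A (-C) p
  rw [neg_sq] at h2
  rw [hA, hC] at h1 h2
  set S := 2 * Real.pi * ∑ k ∈ Finset.range (p + 1), (p.choose k : ℝ) ^ 2 * a ^ k * b ^ (p - k)
  have hr' : |r| ≤ 2 * (A * C) := by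
    refine abs_le_of_sq_le_sq ?_ (by positivity)
    rw [mul_pow, mul_pow, hA, hC]; linarith
  obtain ⟨hr1, hr2⟩ := abs_le.1 hr'
  obtain ⟨l, hl0, hl1, hl⟩ : ∃ l : ℝ, 0 ≤ l ∧ l ≤ 1 ∧ r = l * (2 * (A * C))
      + (1 - l) * (2 * (A * -C)) := by
    rcases (mul_nonneg hA0 hC0).eq_or_lt with h0 | h0
    · refine ⟨0, le_rfl, zero_le_one, ?_⟩
      rw [← h0] at hr1 hr2
      rw [mul_neg, ← h0]
      linarith
    · refine ⟨(r / (2 * (A * C)) + 1) / 2, ?_, ?_, ?_⟩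
      · have : -1 ≤ r / (2 * (A * C)) := by rw [le_div_iff₀ (by positivity)]; linarith
        linarith
      · have : r / (2 * (A * C)) ≤ 1 := by rw [div_le_iff₀ (by positivity)]; linarith
        linarith
      · have hne := h0.ne'
        rw [mul_neg]
        generalize A * C = d at hne
        field_simp
        ring
  have hpt : ∀ φ ∈ Set.Icc 0 (2 * Real.pi), (a + b + r * Real.cos φ) ^ p ≤
      l * (a + b + 2 * (A * C) * Real.cos φ) ^ p
        + (1 - l) * (a + b + 2 * (A * -C) * Real.cos φ) ^ p := by
    intro φ _
    have hcos := Real.abs_cos_le_one φ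
    obtain ⟨c1, c2⟩ := abs_le.1 hcos
    have hm : 0 ≤ a + b + 2 * (A * C) * Real.cos φ := by
      rw [← hA, ← hC]; nlinarith [sq_nonneg (A - C), mul_nonneg hA0 hC0]
    have hm' : 0 ≤ a + b + 2 * (A * -C) * Real.cos φ := by
      rw [← hA, ← hC]; nlinarith [sq_nonneg (A - C), mul_nonneg hA0 hC0]
    have := (convexOn_pow p).2 hm hm' hl0 (by linarith : 0 ≤ 1 - l) (by ring)
    simp only [smul_eq_mul] at this
    refine le_trans (le_of_eq ?_) this
    congr 1
    rw [hl]; ring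
  have hcont : ∀ r, Continuous fun φ => (a + b + r * Real.cos φ) ^ p := fun r => by fun_prop
  calc ∫ φ in (0 : ℝ)..(2 * Real.pi), (a + b + r * Real.cos φ) ^ p
      ≤ ∫ φ in (0 : ℝ)..(2 * Real.pi), (l * (a + b + 2 * (A * C) * Real.cos φ) ^ p
        + (1 - l) * (a + b + 2 * (A * -C) * Real.cos φ) ^ p) := by
        refine intervalIntegral.integral_mono_on (by positivity)
          ((hcont r).intervalIntegrable _ _) ?_ hpt
        exact ((continuous_const.mul (hcont _)).add
          (continuous_const.mul (hcont _))).intervalIntegrable _ _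
    _ = S := by
        have i1 : IntervalIntegrable (fun φ => l * (a + b + 2 * (A * C) * Real.cos φ) ^ p) volume 0
          (2 * Real.pi) := (continuous_const.mul (hcont _)).intervalIntegrable _ _
        have i2 : IntervalIntegrable (fun φ => (1 - l) * (a + b + 2 * (A * -C) * Real.cos φ) ^ p)
          volume 0 (2 * Real.pi) := (continuous_const.mul (hcont _)).intervalIntegrable _ _
        rw [intervalIntegral.integral_add i1 i2,
          intervalIntegral.integral_const_mul, intervalIntegral.integral_const_mul, h1, h2]
        ring

/-- One of the two binomial coefficients, with the powers of u and 1 - u, is a binomial probability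
of a positive number of successes, hence at most 1 - (1-u)^p ≤ min(1, pu). The other coefficient
rebuilds the cross terms of (x+y)^p. The two end terms k = 0 and k = p are kept exactly: they
produce the loss. -/
theorem sum_choose_sq_le {u x y : ℝ} (h0 : 0 ≤ u) (h1 : u ≤ 1) (hx : 0 ≤ x) (hy : 0 ≤ y) {p : ℕ}
    (hp : 2 ≤ p) :
    ∑ k ∈ Finset.range (p + 1), (p.choose k : ℝ) ^ 2 * (u * x) ^ k * ((1 - u) * y) ^ (p - k) ≤
      u ^ p * x ^ p + (1 - u) ^ p * y ^ p
        + min 1 (p * u) * ((x + y) ^ p - x ^ p - y ^ p) := by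
  have h1u : 0 ≤ 1 - u := by linarith
  have hbin : ∀ k ∈ Finset.Ico 1 p, (p.choose k : ℝ) * u ^ k * (1 - u) ^ (p - k) ≤ min 1 (p * u) := by
    intro k hk
    rw [Finset.mem_Ico] at hk
    have hs : ∑ k ∈ Finset.range (p + 1), u ^ k * (1 - u) ^ (p - k) * (p.choose k : ℝ) = 1 := by
      rw [← add_pow]; simp
    have hb := one_sub_one_sub_pow_mem h0 h1 p
    have h2 : (p.choose k : ℝ) * u ^ k * (1 - u) ^ (p - k) ≤ 1 - (1 - u) ^ p := by
      rw [Finset.sum_range_succ', ] at hs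
      have hle := Finset.single_le_sum (f := fun k => u ^ (k + 1) * (1 - u) ^ (p - (k + 1))
        * (p.choose (k + 1) : ℝ)) (s := Finset.range p) (fun i _ => by positivity)
        (Finset.mem_range.2 (by omega : k - 1 < p))
      rw [Nat.sub_add_cancel hk.1] at hle
      simp only [pow_zero, Nat.sub_zero, Nat.choose_zero_right, Nat.cast_one, mul_one,
        one_mul] at hs
      linarith
    refine le_min ?_ (h2.trans hb.2)
    have : 0 ≤ (1 - u) ^ p := by positivity
    linarith
  have hsplit : ∀ g : ℕ → ℝ, ∑ k ∈ Finset.range (p + 1), g k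
      = g 0 + ∑ k ∈ Finset.Ico 1 p, g k + g p := by
    intro g
    rw [Finset.sum_range_succ, Finset.range_eq_Ico,
      Finset.sum_eq_sum_Ico_succ_bot (by omega : 0 < p)]
  have hmix : (x + y) ^ p - x ^ p - y ^ p
      = ∑ k ∈ Finset.Ico 1 p, x ^ k * y ^ (p - k) * (p.choose k : ℝ) := by
    rw [add_pow, hsplit]
    simp
  rw [hsplit, hmix, Finset.mul_sum]
  have hmid : ∑ k ∈ Finset.Ico 1 p, (p.choose k : ℝ) ^ 2 * (u * x) ^ k * ((1 - u) * y) ^ (p - k)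
      ≤ ∑ k ∈ Finset.Ico 1 p, min 1 (p * u) * (x ^ k * y ^ (p - k) * (p.choose k : ℝ)) := by
    refine Finset.sum_le_sum fun k hk => ?_
    calc (p.choose k : ℝ) ^ 2 * (u * x) ^ k * ((1 - u) * y) ^ (p - k)
        = ((p.choose k : ℝ) * u ^ k * (1 - u) ^ (p - k)) * (x ^ k * y ^ (p - k) * (p.choose k : ℝ)) := by
          rw [mul_pow, mul_pow]; ring
      _ ≤ _ := mul_le_mul_of_nonneg_right (hbin k hk) (by positivity)
  have e1 : ((p.choose 0 : ℕ) : ℝ) ^ 2 * (u * x) ^ 0 * ((1 - u) * y) ^ (p - 0)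
      = (1 - u) ^ p * y ^ p := by
    rw [← mul_pow]; simp
  have e2 : ((p.choose p : ℕ) : ℝ) ^ 2 * (u * x) ^ p * ((1 - u) * y) ^ (p - p)
      = u ^ p * x ^ p := by
    rw [← mul_pow]; simp
  rw [e1, e2]
  linarith

/-- The loss coefficient of the `p`-th power at mixing parameter `u`. -/
noncomputable def powerDefect (p : ℕ) (u : ℝ) : ℝ := 1 - (1 - u) ^ p - u ^ p

theorem angularAverage_pow_le {x y R : ℝ} {p : ℕ} (hp : 2 ≤ p) (hx : 0 ≤ x) (hy : 0 ≤ y)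
    (hR : R ^ 2 ≤ x * y) (θ : ℝ) :
    angularAverage (fun z => z ^ p) x y R θ ≤
      4 * Real.pi * ((x + y) ^ p - x ^ p - y ^ p) * min 1 (p * halfSinSq θ)
        - 2 * Real.pi * (x ^ p + y ^ p) * powerDefect p (halfSinSq θ) := by
  set u := halfSinSq θ with hu
  have h0 : 0 ≤ u := halfSinSq_nonneg θ
  have h1 : u ≤ 1 := halfSinSq_le_one θ
  have h1u : 0 ≤ 1 - u := by linarith
  have hr : (Real.sin θ * R) ^ 2 ≤ 4 * (u * (1 - u)) * (x * y) := by
    have := collision_shift_sq_le hR θ 0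
    rwa [Real.cos_zero, mul_one] at this
  have i1 := integral_pow_shift_le (a := u * y) (b := (1 - u) * x) (r := Real.sin θ * R)
    (by positivity) (by positivity) (by linarith) p
  have i2 := integral_pow_shift_le (a := u * x) (b := (1 - u) * y) (r := -(Real.sin θ * R))
    (by positivity) (by positivity) (by rw [neg_sq]; linarith) p
  have s1 := sum_choose_sq_le h0 h1 hy hx hp
  have s2 := sum_choose_sq_le h0 h1 hx hy hp
  have hpi := Real.pi_pos
  have s1' := mul_le_mul_of_nonneg_left s1 (show 0 ≤ 2 * Real.pi by positivity)
  have s2' := mul_le_mul_of_nonneg_left s2 (show 0 ≤ 2 * Real.pi by positivity)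
  have hcont : ∀ a b r : ℝ, IntervalIntegrable (fun φ => (a + b + r * Real.cos φ) ^ p) volume 0
      (2 * Real.pi) := fun a b r => Continuous.intervalIntegrable (by fun_prop) _ _
  have e : angularAverage (fun z => z ^ p) x y R θ =
      (∫ φ in (0 : ℝ)..(2 * Real.pi), (u * y + (1 - u) * x + Real.sin θ * R * Real.cos φ) ^ p)
      + (∫ φ in (0 : ℝ)..(2 * Real.pi), (u * x + (1 - u) * y + -(Real.sin θ * R) * Real.cos φ) ^ p)
      - 2 * Real.pi * (x ^ p + y ^ p) := by
    rw [← intervalIntegral.integral_add (hcont _ _ _) (hcont _ _ _)]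
    have : 2 * Real.pi * (x ^ p + y ^ p) = ∫ φ in (0 : ℝ)..(2 * Real.pi), (x ^ p + y ^ p) := by
      rw [intervalIntegral.integral_const, sub_zero, smul_eq_mul]
    rw [this, ← intervalIntegral.integral_sub ((hcont _ _ _).add (hcont _ _ _))
      intervalIntegrable_const]
    unfold angularAverage
    refine intervalIntegral.integral_congr fun φ _ => ?_
    dsimp only
    rw [← hu]
    ring_nf
  rw [e]
  unfold powerDefect
  have e3 : (y + x) ^ p - y ^ p - x ^ p = (x + y) ^ p - x ^ p - y ^ p := by rw [add_comm]; ring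
  rw [e3] at s1'
  linarith

end PolynomialPovzner

/-! ### Angular integrals of size p^(ν/2). -/

section PowerAngular

variable {ν : ℝ} {p : ℕ}

theorem powerDefect_nonneg (hp : 1 ≤ p) {u : ℝ} (h0 : 0 ≤ u) (h1 : u ≤ 1) :
    0 ≤ powerDefect p u := by
  unfold powerDefect
  have h2 := pow_le_of_le_one h0 h1 (by omega : p ≠ 0)
  have h3 := pow_le_of_le_one (by linarith : 0 ≤ 1 - u) (by linarith) (by omega : p ≠ 0)
  linarith

theorem powerDefect_le {u : ℝ} (h0 : 0 ≤ u) (h1 : u ≤ 1) : powerDefect p u ≤ p * u := by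
  unfold powerDefect
  have := (one_sub_one_sub_pow_mem h0 h1 p).2
  have : 0 ≤ u ^ p := by positivity
  linarith

/-- For u ≤ 1/2 one has u^p + (1-u)^p ≤ (1-u)^(p-1), by factoring out (1-u)^(p-1) from both terms;
then 1 - u ≤ exp(-u). -/
theorem one_sub_exp_le_powerDefect (hp : 2 ≤ p) {u : ℝ} (h0 : 0 ≤ u) (h1 : u ≤ 1 / 2) :
    1 - Real.exp (-(u * (p - 1))) ≤ powerDefect p u := by
  obtain ⟨m, rfl⟩ := Nat.exists_eq_add_of_le' (by omega : 1 ≤ p)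
  have h2 : u ^ m ≤ (1 - u) ^ m := by gcongr; linarith
  have h3 : (1 - u) ^ m ≤ Real.exp (-(u * ((m + 1 : ℕ) - 1))) := by
    push_cast
    rw [show -(u * ((m : ℝ) + 1 - 1)) = m * -u by ring, Real.exp_nat_mul]
    have := Real.one_sub_le_exp_neg u
    have h4 : 0 ≤ 1 - u := by linarith
    gcongr
  unfold powerDefect
  rw [pow_succ, pow_succ]
  nlinarith

/-- Cut at θ = p^(-1/2), where p sin²(θ/2) is of order one: below it the integrand is at most p
θ^(1-ν), above it θ^(-ν-1), and both pieces have size p^(ν/2). -/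
theorem integral_min_one_mul_le (hν0 : 0 < ν) (hν : ν < 2) (hp : 1 ≤ p) :
    ∫ θ in (0 : ℝ)..Real.pi, min 1 (p * halfSinSq θ) * θ ^ (-ν - 1)
      ≤ (1 / (2 - ν) + 1 / ν) * (p : ℝ) ^ (ν / 2) := by
  have hp1 : (1 : ℝ) ≤ p := by exact_mod_cast hp
  have hp0 : (0 : ℝ) < p := by linarith
  set δ : ℝ := (p : ℝ) ^ (-(1 / 2) : ℝ) with hδ
  have hδ0 : 0 < δ := by positivity
  have hδ1 : δ ≤ 1 := Real.rpow_le_one_of_one_le_of_nonpos hp1 (by norm_num)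
  have hδπ : δ ≤ Real.pi := by linarith [Real.pi_gt_three]
  have hu := continuous_halfSinSq
  have hint : IntervalIntegrable (fun θ => min 1 (p * halfSinSq θ) * θ ^ (-ν - 1)) volume 0
      Real.pi := by
    refine intervalIntegrable_mul_rpow (f := fun θ => min 1 (p * halfSinSq θ)) (C := p) hν
      (by fun_prop) fun θ _ => ?_
    have := halfSinSq_nonneg θ
    rw [abs_of_nonneg (le_min zero_le_one (by positivity))]
    exact min_le_right _ _
  have hint1 := hint.mono_set (c := 0) (d := δ) (by
    rw [Set.uIcc_of_le hδ0.le, Set.uIcc_of_le Real.pi_pos.le]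
    exact Set.Icc_subset_Icc_right hδπ)
  have hint2 := hint.mono_set (c := δ) (d := Real.pi) (by
    rw [Set.uIcc_of_le hδπ, Set.uIcc_of_le Real.pi_pos.le]
    exact Set.Icc_subset_Icc_left hδ0.le)
  rw [← intervalIntegral.integral_add_adjacent_intervals hint1 hint2]
  have b1 : ∫ θ in (0 : ℝ)..δ, min 1 (p * halfSinSq θ) * θ ^ (-ν - 1)
      ≤ ∫ θ in (0 : ℝ)..δ, p * θ ^ (1 - ν) := by
    refine intervalIntegral.integral_mono_on_of_le_Ioo hδ0.le hint1
      ((intervalIntegral.intervalIntegrable_rpow' (by linarith)).const_mul _) fun θ hθ => ?_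
    have e : θ ^ (1 - ν) = θ ^ 2 * θ ^ (-ν - 1) := by
      rw [← Real.rpow_natCast, ← Real.rpow_add hθ.1]; congr 1; push_cast; ring
    have h0 : 0 ≤ θ ^ (-ν - 1) := Real.rpow_nonneg hθ.1.le _
    rw [e, ← mul_assoc]
    refine mul_le_mul_of_nonneg_right ((min_le_right _ _).trans ?_) h0
    have := halfSinSq_le θ
    have : 0 ≤ θ ^ 2 := by positivity
    gcongr
    linarith
  have b2 : ∫ θ in δ..Real.pi, min 1 (p * halfSinSq θ) * θ ^ (-ν - 1)
      ≤ ∫ θ in δ..Real.pi, θ ^ (-ν - 1) := by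
    refine intervalIntegral.integral_mono_on hδπ hint2
      (intervalIntegral.intervalIntegrable_rpow (Or.inr ?_)) fun θ hθ => ?_
    · rw [Set.uIcc_of_le hδπ]; exact fun h => absurd h.1 (not_le.2 hδ0)
    · have h0 : 0 ≤ θ ^ (-ν - 1) := Real.rpow_nonneg (hδ0.le.trans hθ.1) _
      exact mul_le_of_le_one_left h0 (min_le_left _ _)
  have e1 : ∫ θ in (0 : ℝ)..δ, (p : ℝ) * θ ^ (1 - ν) = 1 / (2 - ν) * (p : ℝ) ^ (ν / 2) := by
    rw [intervalIntegral.integral_const_mul, integral_rpow (Or.inl (by linarith)),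
      Real.zero_rpow (by linarith), hδ, ← Real.rpow_mul hp0.le]
    have : (p : ℝ) ^ (ν / 2) = p * (p : ℝ) ^ (-(1 / 2) * (1 - ν + 1)) := by
      rw [← Real.rpow_one_add' hp0.le (by intro h; nlinarith)]
      congr 1; ring
    rw [this]
    have : 1 - ν + 1 = 2 - ν := by ring
    rw [this]
    field_simp
    ring
  have e2 : ∫ θ in δ..Real.pi, θ ^ (-ν - 1) ≤ 1 / ν * (p : ℝ) ^ (ν / 2) := by
    rw [integral_rpow (Or.inr ⟨by linarith, by
      rw [Set.uIcc_of_le hδπ]; exact fun h => absurd h.1 (not_le.2 hδ0)⟩)]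
    have e3 : δ ^ (-ν - 1 + 1) = (p : ℝ) ^ (ν / 2) := by
      rw [hδ, ← Real.rpow_mul hp0.le]; congr 1; ring
    rw [e3, show -ν - 1 + 1 = -ν by ring, div_neg, ← neg_div, neg_sub, one_div_mul_eq_div]
    have : 0 ≤ Real.pi ^ (-ν) := by have := Real.pi_pos; positivity
    gcongr
    linarith
  rw [add_mul]
  linarith

/-- On [p^(-1/2), 2p^(-1/2)] the product (p-1) sin²(θ/2) is bounded below, so the defect is at least
a constant there, and the weight integrates to order p^(ν/2). The loss thus has the same growth in p
as the gain. -/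
theorem exists_le_integral_powerDefect (hν : ν < 2) : ∃ c : ℝ, 0 < c ∧ ∀ p : ℕ, 2 ≤ p →
    c * (p : ℝ) ^ (ν / 2) ≤
      ∫ θ in (0 : ℝ)..Real.pi, powerDefect p (halfSinSq θ) * θ ^ (-ν - 1) := by
  have hpi := Real.pi_pos
  set c' : ℝ := 1 - Real.exp (-(1 / (2 * Real.pi ^ 2))) with hc'
  have hc'0 : 0 < c' := by
    have : Real.exp (-(1 / (2 * Real.pi ^ 2))) < 1 := by
      rw [Real.exp_lt_one_iff]
      have : 0 < 1 / (2 * Real.pi ^ 2) := by positivity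
      linarith
    linarith
  refine ⟨c' * min 1 (2 ^ (-ν - 1)), by positivity, fun p hp => ?_⟩
  have hp2 : (2 : ℝ) ≤ p := by exact_mod_cast hp
  have hp0 : (0 : ℝ) < p := by linarith
  set δ : ℝ := (p : ℝ) ^ (-(1 / 2) : ℝ) with hδ
  have hδ0 : 0 < δ := by positivity
  have hδ2 : δ ^ 2 = 1 / p := by
    rw [hδ, ← Real.rpow_natCast, ← Real.rpow_mul hp0.le]
    norm_num
    rw [Real.rpow_neg_one]
  have hδ1 : δ ≤ 1 := Real.rpow_le_one_of_one_le_of_nonpos (by linarith) (by norm_num)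
  have hδπ : 2 * δ ≤ Real.pi := by linarith [Real.pi_gt_three]
  have hu := continuous_halfSinSq
  have hcd : Continuous fun θ => powerDefect p (halfSinSq θ) := by unfold powerDefect; fun_prop
  have hnn : ∀ θ, 0 ≤ powerDefect p (halfSinSq θ) := fun θ =>
    powerDefect_nonneg (by omega) (halfSinSq_nonneg θ) (halfSinSq_le_one θ)
  have hint : IntervalIntegrable (fun θ => powerDefect p (halfSinSq θ) * θ ^ (-ν - 1)) volume 0
      Real.pi := by
    refine intervalIntegrable_mul_rpow (C := p) hν hcd fun θ _ => ?_
    rw [abs_of_nonneg (hnn θ)]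
    exact powerDefect_le (halfSinSq_nonneg θ) (halfSinSq_le_one θ)
  have hsub : Set.uIcc δ (2 * δ) ⊆ Set.uIcc 0 Real.pi := by
    rw [Set.uIcc_of_le (by linarith), Set.uIcc_of_le hpi.le]
    exact Set.Icc_subset_Icc hδ0.le hδπ
  have hmono : ∫ θ in δ..(2 * δ), powerDefect p (halfSinSq θ) * θ ^ (-ν - 1) ≤
      ∫ θ in (0 : ℝ)..Real.pi, powerDefect p (halfSinSq θ) * θ ^ (-ν - 1) := by
    refine intervalIntegral.integral_mono_interval hδ0.le (by linarith) hδπ ?_ hint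
    refine (ae_restrict_iff' measurableSet_Ioc).2 (ae_of_all _ fun θ hθ => ?_)
    exact mul_nonneg (hnn θ) (Real.rpow_nonneg hθ.1.le _)
  refine le_trans ?_ hmono
  have hlow : ∫ θ in δ..(2 * δ), c' * (min 1 (2 ^ (-ν - 1)) * δ ^ (-ν - 1)) ≤
      ∫ θ in δ..(2 * δ), powerDefect p (halfSinSq θ) * θ ^ (-ν - 1) := by
    refine intervalIntegral.integral_mono_on (by linarith) intervalIntegrable_const
      (hint.mono_set hsub) fun θ hθ => ?_
    have hθ0 : 0 < θ := hδ0.trans_le hθ.1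
    have hu2 : halfSinSq θ ≤ 1 / 2 := by
      refine (halfSinSq_le θ).trans ?_
      have h1 : θ ^ 2 ≤ (2 * δ) ^ 2 := by gcongr; exact hθ.2
      rw [mul_pow, hδ2] at h1
      have h2 : 1 / (p : ℝ) ≤ 1 / 2 := by gcongr
      linarith
    have hd := one_sub_exp_le_powerDefect hp (halfSinSq_nonneg θ) hu2
    have hl : 1 / (2 * Real.pi ^ 2) ≤ halfSinSq θ * (p - 1) := by
      have h1 := le_halfSinSq hθ0.le (hθ.2.trans hδπ)
      have h2 : δ ^ 2 ≤ θ ^ 2 := by gcongr; exact hθ.1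
      rw [hδ2] at h2
      calc 1 / (2 * Real.pi ^ 2) ≤ 1 / (p : ℝ) / Real.pi ^ 2 * (p - 1) := by
            rw [div_div, div_mul_eq_mul_div, one_mul,
              div_le_div_iff₀ (by positivity) (by positivity)]
            nlinarith [sq_nonneg Real.pi, mul_nonneg (sq_nonneg Real.pi) (by linarith : 0 ≤ (p : ℝ) - 2)]
        _ ≤ θ ^ 2 / Real.pi ^ 2 * (p - 1) := by
            have : (0 : ℝ) ≤ p - 1 := by linarith
            gcongr
        _ ≤ _ := by
            have : (0 : ℝ) ≤ p - 1 := by linarith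
            gcongr
    have hexp : Real.exp (-(halfSinSq θ * (p - 1))) ≤ Real.exp (-(1 / (2 * Real.pi ^ 2))) :=
      Real.exp_le_exp.2 (by linarith)
    have hw : min 1 (2 ^ (-ν - 1)) * δ ^ (-ν - 1) ≤ θ ^ (-ν - 1) := by
      have hδr : 0 ≤ δ ^ (-ν - 1) := by positivity
      rcases le_total 0 (-ν - 1) with h | h
      · calc _ ≤ 1 * δ ^ (-ν - 1) := by gcongr; exact min_le_left _ _
          _ ≤ _ := by rw [one_mul]; exact Real.rpow_le_rpow hδ0.le hθ.1 h
      · calc _ ≤ 2 ^ (-ν - 1) * δ ^ (-ν - 1) := by gcongr; exact min_le_right _ _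
          _ = (2 * δ) ^ (-ν - 1) := by rw [Real.mul_rpow (by norm_num) hδ0.le]
          _ ≤ _ := Real.rpow_le_rpow_of_nonpos hθ0 hθ.2 h
    exact mul_le_mul (by linarith) hw (by positivity) (hnn θ)
  refine le_trans (le_of_eq ?_) hlow
  rw [intervalIntegral.integral_const, smul_eq_mul]
  have e3 : (p : ℝ) ^ (ν / 2) = δ * δ ^ (-ν - 1) := by
    rw [mul_comm δ, ← Real.rpow_add_one hδ0.ne', hδ, ← Real.rpow_mul hp0.le]; congr 1; ring
  rw [e3]
  ring

end PowerAngular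

/-! ### The differential inequality for moments. -/

section MomentInequality

variable {γ ν κ₁ κ₂ : ℝ} {B : ℝ → ℝ → ℝ} {β : ℝ → ℝ} {I J : Velocity → Velocity}
  {f : ℝ → ProbabilityMeasure Velocity}

theorem exists_collisionIntegral_pow_le (hν0 : 0 < ν) (hν : ν < 2) (hκ₁ : 0 < κ₁)
    (hκ₂ : 0 < κ₂) : ∃ c C : ℝ, 0 < c ∧ 0 ≤ C ∧
      ∀ (γ : ℝ) (B : ℝ → ℝ → ℝ) (β : ℝ → ℝ) (I J : Velocity → Velocity),
        IsHardPotential γ ν κ₁ κ₂ B β → IsFrame I J → ∀ q : ℕ, ∀ v w : Velocity,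
        collisionIntegral γ β I J (fun v => (‖v‖ ^ 2) ^ (q + 2)) v w ≤
          ‖v - w‖ ^ γ * ((q + 2 : ℕ) : ℝ) ^ (ν / 2)
            * (C * ((‖v‖ ^ 2 + ‖w‖ ^ 2) ^ (q + 2) - (‖v‖ ^ 2) ^ (q + 2) - (‖w‖ ^ 2) ^ (q + 2))
              - c * ((‖v‖ ^ 2) ^ (q + 2) + (‖w‖ ^ 2) ^ (q + 2))) := by
  obtain ⟨c₀, hc₀, hlow⟩ := exists_le_integral_powerDefect hν
  have hpi := Real.pi_pos
  have h2ν : 0 < 2 - ν := by linarith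
  refine ⟨2 * Real.pi * κ₁ * c₀, 4 * Real.pi * κ₂ * (1 / (2 - ν) + 1 / ν), by positivity,
    by positivity, ?_⟩
  intro γ B β I J hB hF q v w
  obtain ⟨R, hR0, hR, h⟩ := hF.exists_collisionIntegral_eq γ β v w
  rw [h (fun z => z ^ (q + 2)), mul_assoc]
  refine mul_le_mul_of_nonneg_left ?_ (Real.rpow_nonneg (norm_nonneg _) _)
  have hx : 0 ≤ ‖v‖ ^ 2 := by positivity
  have hy : 0 ≤ ‖w‖ ^ 2 := by positivity
  set x := ‖v‖ ^ 2
  set y := ‖w‖ ^ 2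
  have hu := continuous_halfSinSq
  have hS : 0 ≤ (x + y) ^ (q + 2) - x ^ (q + 2) - y ^ (q + 2) := by
    have := pow_add_pow_le hx hy (by omega : q + 2 ≠ 0)
    linarith
  set S := (x + y) ^ (q + 2) - x ^ (q + 2) - y ^ (q + 2)
  set p := q + 2 with hp
  have hE0 : 0 ≤ 4 * Real.pi * S := by positivity
  have hP0 : 0 ≤ 2 * Real.pi * (x ^ p + y ^ p) := by positivity
  have c2 : ContinuousOn (fun z : ℝ => z ^ p) (Set.Ici 0) := (continuous_pow _).continuousOn
  have key := hB.integral_le hν (A := angularAverage (fun z => z ^ p) x y R)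
    (L := fun θ => 2 * Real.pi * (x ^ p + y ^ p) * powerDefect p (halfSinSq θ))
    (G := fun θ => 4 * Real.pi * S * min 1 (p * halfSinSq θ))
    (CL := 2 * Real.pi * (x ^ p + y ^ p) * p) (CG := 4 * Real.pi * S * p)
    (continuous_angularAverage c2 hx hy hR) (by unfold powerDefect; fun_prop) (by fun_prop)
    (fun θ _ => abs_angularAverage_pow_le q hx hy hR θ)
    (fun θ _ => mul_nonneg hP0 (powerDefect_nonneg (by omega) (halfSinSq_nonneg θ)
      (halfSinSq_le_one θ)))
    (fun θ _ => by
      rw [mul_assoc _ (p : ℝ)]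
      exact mul_le_mul_of_nonneg_left (powerDefect_le (halfSinSq_nonneg θ)
        (halfSinSq_le_one θ)) hP0)
    (fun θ _ => mul_nonneg hE0 (le_min zero_le_one (by
      have := halfSinSq_nonneg θ; positivity)))
    (fun θ _ => by
      rw [mul_assoc _ (p : ℝ)]
      exact mul_le_mul_of_nonneg_left (min_le_right _ _) hE0)
    (fun θ _ => angularAverage_pow_le (by omega) hx hy hR θ)
  refine key.trans ?_
  simp only [mul_assoc (4 * Real.pi * S), mul_assoc (2 * Real.pi * (x ^ p + y ^ p)),
    intervalIntegral.integral_const_mul]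
  have h1 := mul_le_mul_of_nonneg_left (integral_min_one_mul_le hν0 hν (by omega : 1 ≤ p))
    (show 0 ≤ κ₂ * (4 * Real.pi * S) by positivity)
  have h2 := mul_le_mul_of_nonneg_left (hlow p (by omega))
    (show 0 ≤ κ₁ * (2 * Real.pi * (x ^ p + y ^ p)) by positivity)
  linarith

/-- The moment `∫ |v|^{2p} μ(dv)`. -/
noncomputable def powerMoment (μ : Measure Velocity) (p : ℕ) : ℝ := ∫ v, (‖v‖ ^ 2) ^ p ∂μ

/-- The moment `∫ |v|^{2p + γ} μ(dv)`. -/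
noncomputable def weightedMoment (γ : ℝ) (μ : Measure Velocity) (p : ℕ) : ℝ :=
  ∫ v, (‖v‖ ^ 2) ^ p * ‖v‖ ^ γ ∂μ

theorem norm_rpow_le_one_add_sq (hγ0 : 0 ≤ γ) (hγ1 : γ ≤ 1) (v : Velocity) :
    ‖v‖ ^ γ ≤ 1 + ‖v‖ ^ 2 := by
  have hv := norm_nonneg v
  rcases le_total ‖v‖ 1 with h1 | h1
  · have := Real.rpow_le_one hv h1 hγ0
    nlinarith
  · have := Real.rpow_le_rpow_of_exponent_le h1 hγ1
    rw [Real.rpow_one] at this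
    nlinarith

theorem HasMoments.integrable_pow_mul (hγ0 : 0 ≤ γ) (hγ1 : γ ≤ 1) {s T : ℝ}
    (h : HasMoments f s T) (r : ℕ) {t : ℝ} (ht : t ∈ Set.Icc s T) :
    Integrable (fun v : Velocity => (‖v‖ ^ 2) ^ r * ‖v‖ ^ γ) (f t : Measure Velocity) := by
  obtain ⟨K, hK⟩ := h (r + 1)
  have hc := continuous_norm_rpow hγ0
  refine (hK t ht).1.mono' (by fun_prop) (ae_of_all _ fun v => ?_)
  rw [Real.norm_eq_abs, abs_of_nonneg (by positivity), pow_succ (1 + ‖v‖ ^ 2) r]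
  refine mul_le_mul ?_ (norm_rpow_le_one_add_sq hγ0 hγ1 v) (by positivity) (by positivity)
  gcongr
  linarith

theorem powerMoment_nonneg (μ : Measure Velocity) (p : ℕ) : 0 ≤ powerMoment μ p :=
  integral_nonneg fun v => by positivity

theorem weightedMoment_nonneg (γ : ℝ) (μ : Measure Velocity) (p : ℕ) :
    0 ≤ weightedMoment γ μ p := integral_nonneg fun v => by positivity

/-- Rearrangement: the symmetrized product is largest when the kinetic factor sits on the particle
with the higher power. The weighted moments produced are thus always of order max(k, l), as the
summation over p requires. -/
theorem kinetic_mul_pow_le (hγ0 : 0 ≤ γ) {k l : ℕ} (hkl : k ≤ l) (v w : Velocity) :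
    ‖v‖ ^ γ * ((‖v‖ ^ 2) ^ k * (‖w‖ ^ 2) ^ l) + ‖w‖ ^ γ * ((‖w‖ ^ 2) ^ k * (‖v‖ ^ 2) ^ l) ≤
      ‖v‖ ^ γ * ((‖v‖ ^ 2) ^ l * (‖w‖ ^ 2) ^ k) + ‖w‖ ^ γ * ((‖w‖ ^ 2) ^ l * (‖v‖ ^ 2) ^ k) := by
  have key : ∀ v w : Velocity, ‖v‖ ≤ ‖w‖ →
      ‖v‖ ^ γ ≤ ‖w‖ ^ γ ∧ (‖v‖ ^ 2) ^ l * (‖w‖ ^ 2) ^ k ≤ (‖v‖ ^ 2) ^ k * (‖w‖ ^ 2) ^ l := by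
    intro v w h
    refine ⟨Real.rpow_le_rpow (norm_nonneg _) h hγ0, ?_⟩
    obtain ⟨m, rfl⟩ := Nat.exists_eq_add_of_le hkl
    rw [pow_add, pow_add]
    have : (‖v‖ ^ 2) ^ m ≤ (‖w‖ ^ 2) ^ m := by gcongr
    have h0 : 0 ≤ (‖v‖ ^ 2) ^ k * (‖w‖ ^ 2) ^ k := by positivity
    nlinarith
  rcases le_total ‖v‖ ‖w‖ with h | h
  · obtain ⟨h1, h2⟩ := key v w h
    nlinarith [mul_nonneg (sub_nonneg.2 h1) (sub_nonneg.2 h2)]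
  · obtain ⟨h1, h2⟩ := key w v h
    nlinarith [mul_nonneg (sub_nonneg.2 h1) (sub_nonneg.2 h2)]

theorem kinetic_binomial_le (hγ0 : 0 ≤ γ) (hγ1 : γ ≤ 1) {k l : ℕ} (v w : Velocity) :
    ‖v - w‖ ^ γ * ((‖v‖ ^ 2) ^ k * (‖w‖ ^ 2) ^ l + (‖v‖ ^ 2) ^ l * (‖w‖ ^ 2) ^ k) ≤
      2 * ((‖v‖ ^ 2) ^ max k l * ‖v‖ ^ γ * (‖w‖ ^ 2) ^ min k l
        + (‖v‖ ^ 2) ^ min k l * ((‖w‖ ^ 2) ^ max k l * ‖w‖ ^ γ)) := by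
  have key : ∀ k l : ℕ, k ≤ l →
      ‖v - w‖ ^ γ * ((‖v‖ ^ 2) ^ k * (‖w‖ ^ 2) ^ l + (‖v‖ ^ 2) ^ l * (‖w‖ ^ 2) ^ k) ≤
      2 * ((‖v‖ ^ 2) ^ l * ‖v‖ ^ γ * (‖w‖ ^ 2) ^ k + (‖v‖ ^ 2) ^ k * ((‖w‖ ^ 2) ^ l * ‖w‖ ^ γ)) := by
    intro k l hkl
    have h1 := kinetic_mul_pow_le hγ0 hkl v w
    have h2 := mul_le_mul_of_nonneg_right (norm_sub_rpow_le hγ0 hγ1 v w)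
      (show 0 ≤ (‖v‖ ^ 2) ^ k * (‖w‖ ^ 2) ^ l + (‖v‖ ^ 2) ^ l * (‖w‖ ^ 2) ^ k by positivity)
    linarith
  rcases le_total k l with h | h
  · rw [max_eq_right h, min_eq_left h]; exact key k l h
  · rw [max_eq_left h, min_eq_right h]
    have := key l k h
    rwa [add_comm ((‖v‖ ^ 2) ^ l * (‖w‖ ^ 2) ^ k)] at this

theorem two_mul_binomial_eq (x y : ℝ) {p : ℕ} (hp : 1 ≤ p) :
    2 * ((x + y) ^ p - x ^ p - y ^ p) =
      ∑ k ∈ Finset.Ico 1 p, (p.choose k : ℝ) * (x ^ k * y ^ (p - k) + x ^ (p - k) * y ^ k) := by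
  have hmix : ∀ x y : ℝ, (x + y) ^ p - x ^ p - y ^ p
      = ∑ k ∈ Finset.Ico 1 p, x ^ k * y ^ (p - k) * (p.choose k : ℝ) := by
    intro x y
    rw [add_pow, Finset.sum_range_succ, Finset.range_eq_Ico,
      Finset.sum_eq_sum_Ico_succ_bot (by omega : 0 < p)]
    simp
  rw [two_mul]
  nth_rewrite 1 [hmix x y]
  have := hmix y x
  rw [show (x + y) ^ p - x ^ p - y ^ p = (y + x) ^ p - y ^ p - x ^ p by rw [add_comm]; ring, this,
    ← Finset.sum_add_distrib]
  refine Finset.sum_congr rfl fun k _ => ?_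
  ring

/-- The gain splits |v - w|^γ by subadditivity and rearrangement. The loss uses |v - w|^γ ≥ |v|^γ -
|w|^γ; the subtracted part only costs a multiple of the p-th moment because the mean of |v|^γ is at
most 2. -/
theorem exists_moment_inequality (hγ0 : 0 ≤ γ) (hγ1 : γ ≤ 1) (hν0 : 0 < ν) (hν : ν < 2)
    (hκ₁ : 0 < κ₁) (hκ₂ : 0 < κ₂) : ∃ c C : ℝ, 0 < c ∧ 0 ≤ C ∧
      ∀ (B : ℝ → ℝ → ℝ) (β : ℝ → ℝ) (I J : Velocity → Velocity)
        (f : ℝ → ProbabilityMeasure Velocity) (s T : ℝ),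
        IsHardPotential γ ν κ₁ κ₂ B β → IsFrame I J → IsWeakSolution γ β I J f →
        HasMoments f s T → ∀ q : ℕ, ∀ t ∈ Set.Icc s T, 0 < t →
        ∫ p, collisionIntegral γ β I J (fun v => (‖v‖ ^ 2) ^ (q + 2)) p.1 p.2
          ∂((f t : Measure Velocity).prod (f t : Measure Velocity)) ≤
        ((q + 2 : ℕ) : ℝ) ^ (ν / 2) *
          (C * ∑ k ∈ Finset.Ico 1 (q + 2), ((q + 2).choose k : ℝ)
              * (weightedMoment γ (f t) (max k (q + 2 - k)) * powerMoment (f t) (min k (q + 2 - k)))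
            + C * powerMoment (f t) (q + 2) - c * weightedMoment γ (f t) (q + 2)) := by
  obtain ⟨c, C, hc, hC, H⟩ := exists_collisionIntegral_pow_le hν0 hν hκ₁ hκ₂
  refine ⟨2 * c, 2 * C + 4 * c, by positivity, by positivity, ?_⟩
  intro B β I J f s T hB hF hf hmom q t ht ht0
  set μ := (f t : Measure Velocity) with hμ
  set p := q + 2 with hp
  have hP0 : 0 ≤ (p : ℝ) ^ (ν / 2) := by positivity
  have hpt : ∀ z : Velocity × Velocity,
      collisionIntegral γ β I J (fun v => (‖v‖ ^ 2) ^ p) z.1 z.2 ≤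
      (p : ℝ) ^ (ν / 2) * (C * (∑ k ∈ Finset.Ico 1 p, (p.choose k : ℝ)
        * ((‖z.1‖ ^ 2) ^ max k (p - k) * ‖z.1‖ ^ γ * (‖z.2‖ ^ 2) ^ min k (p - k)
          + (‖z.1‖ ^ 2) ^ min k (p - k) * ((‖z.2‖ ^ 2) ^ max k (p - k) * ‖z.2‖ ^ γ)))
        + (c * ((‖z.1‖ ^ 2) ^ p * ‖z.2‖ ^ γ + ‖z.1‖ ^ γ * (‖z.2‖ ^ 2) ^ p)
        - c * ((‖z.1‖ ^ 2) ^ p * ‖z.1‖ ^ γ + (‖z.2‖ ^ 2) ^ p * ‖z.2‖ ^ γ))) := by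
    rintro ⟨v, w⟩
    dsimp only
    refine (H γ B β I J hB hF q v w).trans ?_
    rw [mul_comm (‖v - w‖ ^ γ), mul_assoc]
    refine mul_le_mul_of_nonneg_left ?_ hP0
    have h1 : ‖v - w‖ ^ γ * ((‖v‖ ^ 2 + ‖w‖ ^ 2) ^ p - (‖v‖ ^ 2) ^ p - (‖w‖ ^ 2) ^ p) ≤
        ∑ k ∈ Finset.Ico 1 p, (p.choose k : ℝ)
        * ((‖v‖ ^ 2) ^ max k (p - k) * ‖v‖ ^ γ * (‖w‖ ^ 2) ^ min k (p - k)
          + (‖v‖ ^ 2) ^ min k (p - k) * ((‖w‖ ^ 2) ^ max k (p - k) * ‖w‖ ^ γ)) := by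
      have e := two_mul_binomial_eq (‖v‖ ^ 2) (‖w‖ ^ 2) (by omega : 1 ≤ p)
      have e2 : ‖v - w‖ ^ γ * (2 * ((‖v‖ ^ 2 + ‖w‖ ^ 2) ^ p - (‖v‖ ^ 2) ^ p - (‖w‖ ^ 2) ^ p)) ≤
          2 * ∑ k ∈ Finset.Ico 1 p, (p.choose k : ℝ)
        * ((‖v‖ ^ 2) ^ max k (p - k) * ‖v‖ ^ γ * (‖w‖ ^ 2) ^ min k (p - k)
          + (‖v‖ ^ 2) ^ min k (p - k) * ((‖w‖ ^ 2) ^ max k (p - k) * ‖w‖ ^ γ)) := by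
        rw [e, Finset.mul_sum, Finset.mul_sum]
        refine Finset.sum_le_sum fun k _ => ?_
        have := mul_le_mul_of_nonneg_left (kinetic_binomial_le hγ0 hγ1 (k := k) (l := p - k) v w)
          (Nat.cast_nonneg (α := ℝ) (p.choose k))
        linarith
      linarith
    have h2 := norm_rpow_sub_le hγ0 hγ1 v w
    have h3 := norm_rpow_sub_le hγ0 hγ1 w v
    rw [norm_sub_rev] at h3
    have h4 := mul_le_mul_of_nonneg_left h2 (show 0 ≤ (‖v‖ ^ 2) ^ p by positivity)
    have h5 := mul_le_mul_of_nonneg_left h3 (show 0 ≤ (‖w‖ ^ 2) ^ p by positivity)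
    have h6 := mul_le_mul_of_nonneg_left h1 hC
    have h7 := mul_le_mul_of_nonneg_left (add_le_add h4 h5) hc.le
    linarith
  have hm := fun r => hmom.integrable_pow r ht
  have hg := fun r => hmom.integrable_pow_mul hγ0 hγ1 r ht
  have hk : Integrable (fun v : Velocity => ‖v‖ ^ γ) μ := by simpa using hg 0
  have h1i : Integrable (fun _ : Velocity => (1 : ℝ)) μ := integrable_const 1
  have isum : ∀ k ∈ Finset.Ico 1 p, Integrable (fun z : Velocity × Velocity => (p.choose k : ℝ)
        * ((‖z.1‖ ^ 2) ^ max k (p - k) * ‖z.1‖ ^ γ * (‖z.2‖ ^ 2) ^ min k (p - k)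
          + (‖z.1‖ ^ 2) ^ min k (p - k) * ((‖z.2‖ ^ 2) ^ max k (p - k) * ‖z.2‖ ^ γ)))
      (μ.prod μ) := fun k _ =>
    (((hg _).mul_prod (hm _)).add ((hm _).mul_prod (hg _))).const_mul _
  have iA := integrable_finsetSum (Finset.Ico 1 p) isum
  have i3 : Integrable (fun z : Velocity × Velocity => (‖z.1‖ ^ 2) ^ p * ‖z.2‖ ^ γ
      + ‖z.1‖ ^ γ * (‖z.2‖ ^ 2) ^ p) (μ.prod μ) := ((hm p).mul_prod hk).add (hk.mul_prod (hm p))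
  have j1 : Integrable (fun z : Velocity × Velocity => (‖z.1‖ ^ 2) ^ p * ‖z.1‖ ^ γ)
      (μ.prod μ) := by simpa using (hg p).mul_prod h1i
  have j2 : Integrable (fun z : Velocity × Velocity => (‖z.2‖ ^ 2) ^ p * ‖z.2‖ ^ γ)
      (μ.prod μ) := by simpa using h1i.mul_prod (hg p)
  have i4 : Integrable (fun z : Velocity × Velocity => (‖z.1‖ ^ 2) ^ p * ‖z.1‖ ^ γ
      + (‖z.2‖ ^ 2) ^ p * ‖z.2‖ ^ γ) (μ.prod μ) := j1.add j2
  have iB : Integrable (fun z : Velocity × Velocity =>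
      c * ((‖z.1‖ ^ 2) ^ p * ‖z.2‖ ^ γ + ‖z.1‖ ^ γ * (‖z.2‖ ^ 2) ^ p)
        - c * ((‖z.1‖ ^ 2) ^ p * ‖z.1‖ ^ γ + (‖z.2‖ ^ 2) ^ p * ‖z.2‖ ^ γ)) (μ.prod μ) :=
    (i3.const_mul c).sub (i4.const_mul c)
  have step := integral_mono
    (hmom.integrable_collisionIntegral_pow hf hB hF hγ0 hγ1 hν hκ₂ q ht ht0)
    (((iA.const_mul C).add iB).const_mul ((p : ℝ) ^ (ν / 2))) hpt
  refine step.trans ?_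
  rw [integral_const_mul]
  refine mul_le_mul_of_nonneg_left ?_ hP0
  have eA : ∫ z : Velocity × Velocity, ∑ k ∈ Finset.Ico 1 p, (p.choose k : ℝ)
        * ((‖z.1‖ ^ 2) ^ max k (p - k) * ‖z.1‖ ^ γ * (‖z.2‖ ^ 2) ^ min k (p - k)
          + (‖z.1‖ ^ 2) ^ min k (p - k) * ((‖z.2‖ ^ 2) ^ max k (p - k) * ‖z.2‖ ^ γ)) ∂(μ.prod μ)
      = 2 * ∑ k ∈ Finset.Ico 1 p, (p.choose k : ℝ)
        * (weightedMoment γ μ (max k (p - k)) * powerMoment μ (min k (p - k))) := by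
    rw [integral_finsetSum _ isum, Finset.mul_sum]
    refine Finset.sum_congr rfl fun k _ => ?_
    rw [integral_const_mul, integral_add ((hg _).mul_prod (hm _)) ((hm _).mul_prod (hg _)),
      integral_prod_mul (fun v : Velocity => (‖v‖ ^ 2) ^ max k (p - k) * ‖v‖ ^ γ)
        (fun w : Velocity => (‖w‖ ^ 2) ^ min k (p - k)),
      integral_prod_mul (fun w : Velocity => (‖w‖ ^ 2) ^ min k (p - k))
        (fun v : Velocity => (‖v‖ ^ 2) ^ max k (p - k) * ‖v‖ ^ γ)]
    unfold weightedMoment powerMoment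
    ring
  have e3 : ∫ z : Velocity × Velocity, ((‖z.1‖ ^ 2) ^ p * ‖z.2‖ ^ γ
      + ‖z.1‖ ^ γ * (‖z.2‖ ^ 2) ^ p) ∂(μ.prod μ) = 2 * (∫ v, ‖v‖ ^ γ ∂μ) * powerMoment μ p := by
    rw [integral_add ((hm p).mul_prod hk) (hk.mul_prod (hm p)),
      integral_prod_mul (fun v : Velocity => (‖v‖ ^ 2) ^ p) (fun w : Velocity => ‖w‖ ^ γ),
      integral_prod_mul (fun w : Velocity => ‖w‖ ^ γ) (fun v : Velocity => (‖v‖ ^ 2) ^ p)]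
    unfold powerMoment
    ring
  have e4 : ∫ z : Velocity × Velocity, ((‖z.1‖ ^ 2) ^ p * ‖z.1‖ ^ γ
      + (‖z.2‖ ^ 2) ^ p * ‖z.2‖ ^ γ) ∂(μ.prod μ) = 2 * weightedMoment γ μ p := by
    rw [integral_add j1 j2, integral_fun_fst (fun v : Velocity => (‖v‖ ^ 2) ^ p * ‖v‖ ^ γ),
      integral_fun_snd (fun v : Velocity => (‖v‖ ^ 2) ^ p * ‖v‖ ^ γ)]
    simp only [probReal_univ, one_smul]
    unfold weightedMoment
    ring
  have etot : ∫ z : Velocity × Velocity, ((fun z : Velocity × Velocity => C *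
        (∑ k ∈ Finset.Ico 1 p, (p.choose k : ℝ)
        * ((‖z.1‖ ^ 2) ^ max k (p - k) * ‖z.1‖ ^ γ * (‖z.2‖ ^ 2) ^ min k (p - k)
          + (‖z.1‖ ^ 2) ^ min k (p - k) * ((‖z.2‖ ^ 2) ^ max k (p - k) * ‖z.2‖ ^ γ))))
        + fun z : Velocity × Velocity =>
        (c * ((‖z.1‖ ^ 2) ^ p * ‖z.2‖ ^ γ + ‖z.1‖ ^ γ * (‖z.2‖ ^ 2) ^ p)
        - c * ((‖z.1‖ ^ 2) ^ p * ‖z.1‖ ^ γ + (‖z.2‖ ^ 2) ^ p * ‖z.2‖ ^ γ))) z ∂(μ.prod μ)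
      = C * (2 * ∑ k ∈ Finset.Ico 1 p, (p.choose k : ℝ)
        * (weightedMoment γ μ (max k (p - k)) * powerMoment μ (min k (p - k))))
        + (c * (2 * (∫ v, ‖v‖ ^ γ ∂μ) * powerMoment μ p) - c * (2 * weightedMoment γ μ p)) := by
    rw [integral_add' (iA.const_mul C) iB, integral_const_mul, eA,
      integral_sub (i3.const_mul c) (i4.const_mul c), integral_const_mul, integral_const_mul,
      e3, e4]
  refine (le_of_eq etot).trans ?_
  have hk2 : ∫ v, ‖v‖ ^ γ ∂μ ≤ 2 := by
    have hE := hf.integrable_energy ht0.le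
    have := integral_mono hk ((integrable_const (1 : ℝ)).add hE)
      (norm_rpow_le_one_add_sq hγ0 hγ1)
    rw [integral_add' (integrable_const (1 : ℝ)) hE, hf.energy t ht0.le] at this
    simp only [integral_const, probReal_univ, one_smul] at this
    linarith
  have hsum0 : 0 ≤ ∑ k ∈ Finset.Ico 1 p, (p.choose k : ℝ)
        * (weightedMoment γ μ (max k (p - k)) * powerMoment μ (min k (p - k))) :=
    Finset.sum_nonneg fun k _ => mul_nonneg (by positivity)
      (mul_nonneg (weightedMoment_nonneg _ _ _) (powerMoment_nonneg _ _))
  have hm0 := powerMoment_nonneg μ p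
  have h8 := mul_le_mul_of_nonneg_right hk2 (mul_nonneg hc.le hm0)
  have h9 := mul_nonneg hc.le hsum0
  have h10 := mul_nonneg hC hm0
  linarith

end MomentInequality

/-! ### Summing the moment inequalities with factorial weights. -/

section SummedMoments

/-- The weights `a^p / (p!)^s` of a generalized exponential series. -/
noncomputable def momentWeight (a s : ℝ) (p : ℕ) : ℝ := a ^ p / (p.factorial : ℝ) ^ s

variable {a s : ℝ}

theorem momentWeight_nonneg (ha : 0 ≤ a) (s : ℝ) (p : ℕ) : 0 ≤ momentWeight a s p := by
  unfold momentWeight; positivity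

theorem momentWeight_le (ha : 0 ≤ a) (hs : 1 ≤ s) (p : ℕ) :
    momentWeight a s p ≤ a ^ p / p.factorial := by
  unfold momentWeight
  have h1 : (1 : ℝ) ≤ p.factorial := by exact_mod_cast p.factorial_pos
  have h2 : (p.factorial : ℝ) ≤ (p.factorial : ℝ) ^ s := by
    conv_lhs => rw [← Real.rpow_one (p.factorial : ℝ)]
    exact Real.rpow_le_rpow_of_exponent_le h1 hs
  gcongr

/-- The weight of order p equals the product of those of orders k and p - k divided by the s-th
power of the binomial coefficient, and s ≥ 1 allows one factor of that coefficient to be absorbed.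
This is where ρ ≤ 2 enters. -/
theorem choose_mul_momentWeight_le (ha : 0 ≤ a) (hs : 1 ≤ s) {p k : ℕ} (hk : k ≤ p) :
    (p.choose k : ℝ) * momentWeight a s p ≤ momentWeight a s k * momentWeight a s (p - k) := by
  unfold momentWeight
  have hk0 : (0 : ℝ) < k.factorial := by positivity
  have hpk0 : (0 : ℝ) < (p - k).factorial := by positivity
  have hC1 : (1 : ℝ) ≤ p.choose k := by exact_mod_cast Nat.choose_pos hk
  have hP : (p.factorial : ℝ) = p.choose k * (k.factorial * (p - k).factorial) := by
    have := Nat.choose_mul_factorial_mul_factorial hk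
    rw [← this]; push_cast; ring
  have hC : (p.choose k : ℝ) ≤ (p.choose k : ℝ) ^ s := by
    conv_lhs => rw [← Real.rpow_one (p.choose k : ℝ)]
    exact Real.rpow_le_rpow_of_exponent_le hC1 hs
  rw [hP, Real.mul_rpow (by positivity) (by positivity), Real.mul_rpow hk0.le hpk0.le,
    div_mul_div_comm, ← pow_add, Nat.add_sub_cancel' hk]
  set b := (k.factorial : ℝ) ^ s * ((p - k).factorial : ℝ) ^ s
  have hb : 0 < b := by positivity
  have hCs : (0 : ℝ) < (p.choose k : ℝ) ^ s := by positivity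
  rw [← mul_div_assoc, div_le_div_iff₀ (by positivity) hb]
  have : 0 ≤ a ^ p * b := by positivity
  nlinarith

theorem sum_convolution_le {F G : ℕ → ℝ} (hF : ∀ i, 0 ≤ F i) (hG : ∀ i, 0 ≤ G i) (N : ℕ) :
    ∑ p ∈ Finset.Icc 2 N, ∑ k ∈ Finset.Ico 1 p, F k * G (p - k) ≤
      (∑ i ∈ Finset.Icc 1 N, F i) * ∑ j ∈ Finset.Icc 1 N, G j := by
  rw [Finset.sum_sigma', Finset.sum_mul_sum, ← Finset.sum_product']
  set S := (Finset.Icc 2 N).sigma fun p => Finset.Ico 1 p with hS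
  have hmem : ∀ x ∈ S, 2 ≤ x.1 ∧ x.1 ≤ N ∧ 1 ≤ x.2 ∧ x.2 < x.1 := by
    intro x hx
    simp only [hS, Finset.mem_sigma, Finset.mem_Icc, Finset.mem_Ico] at hx
    omega
  have hinj : Set.InjOn (fun x : (_ : ℕ) × ℕ => (x.2, x.1 - x.2)) S := by
    rintro ⟨p, k⟩ hx ⟨p', k'⟩ hx' h
    have h1 := hmem _ hx
    have h2 := hmem _ hx'
    simp only [Prod.mk.injEq] at h h1 h2
    obtain ⟨rfl, h3⟩ := h
    have : p = p' := by omega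
    rw [this]
  calc ∑ x ∈ S, F x.2 * G (x.1 - x.2)
      = ∑ y ∈ S.image (fun x : (_ : ℕ) × ℕ => (x.2, x.1 - x.2)), F y.1 * G y.2 := by
        rw [Finset.sum_image hinj]
    _ ≤ _ := by
        refine Finset.sum_le_sum_of_subset_of_nonneg ?_ fun y _ _ => mul_nonneg (hF _) (hG _)
        intro y hy
        obtain ⟨x, hx, rfl⟩ := Finset.mem_image.1 hy
        have := hmem x hx
        simp only [Finset.mem_product, Finset.mem_Icc]
        omega

theorem sum_mul_pow_div_factorial_le {K : ℝ} (hK : 0 ≤ K) (N : ℕ) :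
    ∑ p ∈ Finset.Icc 2 N, (p : ℝ) * K ^ p / p.factorial ≤ Real.exp (2 * K) := by
  refine le_trans ?_ (Real.sum_le_exp_of_nonneg (by positivity : 0 ≤ 2 * K) (N + 1))
  refine le_trans (Finset.sum_le_sum fun p _ => ?_)
    (Finset.sum_le_sum_of_subset_of_nonneg (f := fun p => (2 * K) ^ p / p.factorial) ?_
      fun p _ _ => by positivity)
  · have : (p : ℝ) ≤ 2 ^ p := by exact_mod_cast p.lt_two_pow_self.le
    rw [mul_pow]
    gcongr
  · intro p hp
    simp only [Finset.mem_Icc, Finset.mem_range] at hp ⊢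
    omega

/-- The bound for the derivative of the `p`-th moment in terms of the moments `m` and the weighted
moments `g`. -/
noncomputable def momentRate (c C η : ℝ) (g m : ℕ → ℝ) (p : ℕ) : ℝ :=
  (p : ℝ) ^ η * (C * ∑ k ∈ Finset.Ico 1 p, (p.choose k : ℝ) * (g (max k (p - k)) * m (min k (p - k)))
    + C * m p - c * g p)

/-- The larger of k and p - k is at least p/2, so p^η is at most twice its η-th power and can be
carried by the factor with g. For p ≥ 3 this index is at least 2, so it belongs to the dissipation
sum, which starts at 2. -/
theorem weighted_convolution_le {η : ℝ} {g m : ℕ → ℝ} (hη0 : 0 ≤ η) (hη1 : η ≤ 1) (hs : 1 ≤ s)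
    (ha : 0 ≤ a) (hg : ∀ p, 0 ≤ g p) (hm : ∀ p, 0 ≤ m p) {p k : ℕ} (hp : 3 ≤ p) (hk1 : 1 ≤ k)
    (hkp : k < p) :
    momentWeight a s p * (p : ℝ) ^ η * ((p.choose k : ℝ) * (g (max k (p - k)) * m (min k (p - k)))) ≤
      2 * ((if 2 ≤ k then momentWeight a s k * (k : ℝ) ^ η * g k else 0)
          * (momentWeight a s (p - k) * m (p - k))
        + (momentWeight a s k * m k) * (if 2 ≤ p - k then
          momentWeight a s (p - k) * ((p - k : ℕ) : ℝ) ^ η * g (p - k) else 0)) := by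
  have hw := fun p => momentWeight_nonneg ha s p
  have key : ∀ k l : ℕ, k + l = p → 1 ≤ k → 1 ≤ l → k ≤ l →
      momentWeight a s p * (p : ℝ) ^ η * ((p.choose k : ℝ) * (g l * m k)) ≤
      2 * ((momentWeight a s k * m k) * (if 2 ≤ l then
          momentWeight a s l * (l : ℝ) ^ η * g l else 0)) := by
    intro k l hkl hk hl hle
    rw [if_pos (by omega)]
    have h1 := choose_mul_momentWeight_le (s := s) ha hs (by omega : k ≤ p)
    rw [show p - k = l by omega] at h1
    have h2 : (p : ℝ) ^ η ≤ 2 * (l : ℝ) ^ η := by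
      calc (p : ℝ) ^ η ≤ (2 * l : ℝ) ^ η := by
            refine Real.rpow_le_rpow (Nat.cast_nonneg _) ?_ hη0
            have : p ≤ 2 * l := by omega
            exact_mod_cast this
        _ = 2 ^ η * (l : ℝ) ^ η := Real.mul_rpow (by norm_num) (Nat.cast_nonneg _)
        _ ≤ 2 ^ (1 : ℝ) * (l : ℝ) ^ η := by
            refine mul_le_mul_of_nonneg_right ?_ (by positivity)
            exact Real.rpow_le_rpow_of_exponent_le one_le_two hη1
        _ = _ := by rw [Real.rpow_one]
    have h3 := hg l
    have h4 := hm k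
    have h5 := hw k
    have h6 := hw l
    have h7 := hw p
    calc momentWeight a s p * (p : ℝ) ^ η * ((p.choose k : ℝ) * (g l * m k))
        = ((p.choose k : ℝ) * momentWeight a s p) * (p : ℝ) ^ η * (g l * m k) := by ring
      _ ≤ (momentWeight a s k * momentWeight a s l) * (2 * (l : ℝ) ^ η) * (g l * m k) := by gcongr
      _ = _ := by ring
  have hnn : ∀ l : ℕ, 0 ≤ (if 2 ≤ l then momentWeight a s l * (l : ℝ) ^ η * g l else 0) := by
    intro l
    split_ifs
    · exact mul_nonneg (mul_nonneg (hw l) (by positivity)) (hg l)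
    · exact le_rfl
  rcases le_total k (p - k) with h | h
  · rw [max_eq_right h, min_eq_left h, mul_add]
    refine (key k (p - k) (by omega) hk1 (by omega) h).trans (le_add_of_nonneg_left ?_)
    exact mul_nonneg (by norm_num) (mul_nonneg (hnn k) (mul_nonneg (hw _) (hm _)))
  · rw [max_eq_left h, min_eq_right h, mul_add]
    have := key (p - k) k (by omega) (by omega) hk1 h
    rw [Nat.choose_symm hkp.le, mul_comm (momentWeight a s (p - k) * m (p - k))] at this
    refine this.trans (le_add_of_nonneg_right ?_)
    exact mul_nonneg (by norm_num) (mul_nonneg (mul_nonneg (hw _) (hm _)) (hnn _))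

/-- Half of the dissipation is spent in three sixths: on C m_p, by interpolation at a large level K;
on the exceptional term p = 2; and on the convolution, by smallness of the weighted sum of moments.
What remains carries a^2, since p ≥ 2 and a ≤ 1. The constants do not depend on s, a, η or N. -/
theorem exists_sum_momentRate_le {γ c C : ℝ} (hγ0 : 0 < γ) (hc : 0 < c) (hC : 0 ≤ C) :
    ∃ δ L : ℝ, 0 < δ ∧ δ ≤ 1 ∧ 0 ≤ L ∧ ∀ (η s a : ℝ) (g m : ℕ → ℝ) (N : ℕ), 0 ≤ η → η ≤ 1 →
      1 ≤ s → 0 ≤ a → a ≤ 1 → (∀ p, 0 ≤ g p) → (∀ p, 0 ≤ m p) → m 1 = 1 →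
      (∀ K : ℝ, 0 < K → ∀ p, 1 ≤ p → m p ≤ K ^ (-(γ / 2)) * g p + K ^ (p - 1)) →
      (∀ K : ℝ, 0 < K → g 1 ≤ g 2 / K + K ^ (γ / 2)) →
      ∑ p ∈ Finset.Icc 1 N, momentWeight a s p * m p ≤ δ →
      ∑ p ∈ Finset.Icc 2 N, momentWeight a s p * momentRate c C η g m p ≤
        -(c / 2) * ∑ p ∈ Finset.Icc 2 N, momentWeight a s p * (p : ℝ) ^ η * g p + L * a ^ 2 := by
  set K₂ := 12 * (C + 1) / c with hK₂
  have hK₂0 : 0 < K₂ := by positivity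
  set K := max 1 ((6 * (C + 1) / c) ^ (2 / γ)) with hK
  have hK1 : 1 ≤ K := le_max_left _ _
  have hKpow : C * K ^ (-(γ / 2)) ≤ c / 6 := by
    have h1 : 6 * (C + 1) / c ≤ K ^ (γ / 2) := by
      calc 6 * (C + 1) / c = ((6 * (C + 1) / c) ^ (2 / γ)) ^ (γ / 2) := by
            rw [← Real.rpow_mul (by positivity)]
            rw [show 2 / γ * (γ / 2) = 1 by field_simp, Real.rpow_one]
        _ ≤ _ := Real.rpow_le_rpow (by positivity) (le_max_right _ _) (by linarith)
    rw [Real.rpow_neg (by linarith), ← div_eq_mul_inv, div_le_iff₀ (by positivity)]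
    calc C ≤ c / 6 * (6 * (C + 1) / c) := by field_simp; linarith
      _ ≤ _ := by gcongr
  have hK₂le : 2 * C / K₂ ≤ c / 6 := by
    rw [div_le_iff₀ hK₂0, hK₂]
    field_simp
    linarith
  set δ := min 1 (c / (24 * (C + 1))) with hδ
  have hδ4 : 4 * C * δ ≤ c / 6 := by
    have h1 : δ ≤ c / (24 * (C + 1)) := min_le_right _ _
    calc 4 * C * δ ≤ 4 * C * (c / (24 * (C + 1))) := by gcongr
      _ ≤ _ := by
        rw [← mul_div_assoc, div_le_div_iff₀ (by positivity) (by norm_num)]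
        nlinarith
  refine ⟨δ, C * Real.exp (2 * K) + 4 * C * K₂ ^ (γ / 2), by positivity, min_le_left _ _,
    by positivity, ?_⟩
  intro η s a g m N hη0 hη1 hs ha0 ha1 hg hm hm1 hmg hg1 hE
  have hw := fun p => momentWeight_nonneg ha0 s p
  set D : ℕ → ℝ := fun p => momentWeight a s p * (p : ℝ) ^ η * g p with hD
  have hD0 : ∀ p, 0 ≤ D p := fun p => mul_nonneg (mul_nonneg (hw p) (by positivity)) (hg p)
  set D' : ℕ → ℝ := fun p => if 2 ≤ p then D p else 0 with hD'
  have hD'0 : ∀ p, 0 ≤ D' p := by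
    intro p
    simp only [hD']
    split_ifs
    · exact hD0 p
    · exact le_rfl
  set e : ℕ → ℝ := fun p => momentWeight a s p * m p with he
  have he0 : ∀ p, 0 ≤ e p := fun p => mul_nonneg (hw p) (hm p)
  have hpη : ∀ p : ℕ, 1 ≤ p → (p : ℝ) ^ η ≤ p := by
    intro p hp
    have h1 : (1 : ℝ) ≤ p := by exact_mod_cast hp
    conv_rhs => rw [← Real.rpow_one (p : ℝ)]
    exact Real.rpow_le_rpow_of_exponent_le h1 hη1
  have hterm : ∀ p ∈ Finset.Icc 2 N, momentWeight a s p * momentRate c C η g m p ≤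
      2 * C * (∑ k ∈ Finset.Ico 1 p, D' k * e (p - k) + ∑ k ∈ Finset.Ico 1 p, e k * D' (p - k))
      + (c / 6 + c / 6 - c) * D p + C * a ^ 2 * ((p : ℝ) * K ^ p / p.factorial)
      + (if p = 2 then 4 * C * K₂ ^ (γ / 2) * a ^ 2 else 0) := by
    intro p hp
    rw [Finset.mem_Icc] at hp
    have hap : a ^ p ≤ a ^ 2 := pow_le_pow_of_le_one ha0 ha1 hp.1
    have t1 : C * (momentWeight a s p * (p : ℝ) ^ η * m p) ≤
        c / 6 * D p + C * a ^ 2 * ((p : ℝ) * K ^ p / p.factorial) := by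
      have h1 := hmg K (by linarith) p (by omega)
      have h2 : K ^ (p - 1) ≤ K ^ p := pow_le_pow_right₀ hK1 (Nat.sub_le _ _)
      have h3 : momentWeight a s p * (p : ℝ) ^ η * K ^ (p - 1)
          ≤ a ^ 2 * ((p : ℝ) * K ^ p / p.factorial) := by
        calc momentWeight a s p * (p : ℝ) ^ η * K ^ (p - 1)
            ≤ (a ^ 2 / p.factorial) * p * K ^ p := by
              have h4 : momentWeight a s p ≤ a ^ 2 / p.factorial :=
                (momentWeight_le ha0 hs p).trans (by gcongr)
              have h5 := hpη p (by omega)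
              have h6 := hw p
              gcongr
          _ = _ := by ring
      have h7 : 0 ≤ momentWeight a s p * (p : ℝ) ^ η := mul_nonneg (hw p) (by positivity)
      calc C * (momentWeight a s p * (p : ℝ) ^ η * m p)
          ≤ C * (momentWeight a s p * (p : ℝ) ^ η * (K ^ (-(γ / 2)) * g p + K ^ (p - 1))) := by
            gcongr
        _ = C * K ^ (-(γ / 2)) * D p
            + C * (momentWeight a s p * (p : ℝ) ^ η * K ^ (p - 1)) := by rw [hD]; ring
        _ ≤ c / 6 * D p + C * (a ^ 2 * ((p : ℝ) * K ^ p / p.factorial)) := by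
            have := hD0 p
            gcongr
        _ = _ := by ring
    have t2 : C * (momentWeight a s p * (p : ℝ) ^ η * ∑ k ∈ Finset.Ico 1 p,
          (p.choose k : ℝ) * (g (max k (p - k)) * m (min k (p - k)))) ≤
        2 * C * (∑ k ∈ Finset.Ico 1 p, D' k * e (p - k) + ∑ k ∈ Finset.Ico 1 p, e k * D' (p - k))
        + c / 6 * D p + (if p = 2 then 4 * C * K₂ ^ (γ / 2) * a ^ 2 else 0) := by
      have hconv : 0 ≤ 2 * C * (∑ k ∈ Finset.Ico 1 p, D' k * e (p - k)
          + ∑ k ∈ Finset.Ico 1 p, e k * D' (p - k)) := by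
        refine mul_nonneg (by positivity) (add_nonneg ?_ ?_)
        · exact Finset.sum_nonneg fun k _ => mul_nonneg (hD'0 _) (he0 _)
        · exact Finset.sum_nonneg fun k _ => mul_nonneg (he0 _) (hD'0 _)
      have hDp : 0 ≤ c / 6 * D p := mul_nonneg (by positivity) (hD0 p)
      rcases hp.1.eq_or_lt with h2 | h3
      -- For p = 2 the only term is k = 1, which contains g 1, absent from the dissipation sum. It
      -- is interpolated between g 2 and a constant.
      · subst h2
        rw [if_pos rfl]
        have hico : Finset.Ico 1 2 = {1} := rfl
        have hsum : ∑ k ∈ Finset.Ico 1 2, ((2 : ℕ).choose k : ℝ)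
            * (g (max k (2 - k)) * m (min k (2 - k))) = 2 * g 1 := by
          rw [hico, Finset.sum_singleton]
          simp [hm1]
        rw [hsum]
        have h1 := hg1 K₂ hK₂0
        have h7 : 0 ≤ momentWeight a s 2 * ((2 : ℕ) : ℝ) ^ η := mul_nonneg (hw 2) (by positivity)
        have h8 : momentWeight a s 2 * ((2 : ℕ) : ℝ) ^ η ≤ 2 * a ^ 2 := by
          have h4 : momentWeight a s 2 ≤ a ^ 2 := by
            refine (momentWeight_le ha0 hs 2).trans ?_
            have : 0 ≤ a ^ 2 := by positivity
            simp only [Nat.factorial_two, Nat.cast_ofNat]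
            linarith
          have h5 := hpη 2 (by norm_num)
          push_cast at h5 ⊢
          have := hw 2
          calc momentWeight a s 2 * 2 ^ η ≤ a ^ 2 * 2 := by gcongr
            _ = _ := by ring
        have hgK : 0 ≤ K₂ ^ (γ / 2) := by positivity
        have hmain : C * (momentWeight a s 2 * ((2 : ℕ) : ℝ) ^ η * (2 * g 1)) ≤
            c / 6 * D 2 + 4 * C * K₂ ^ (γ / 2) * a ^ 2 := by
          calc C * (momentWeight a s 2 * ((2 : ℕ) : ℝ) ^ η * (2 * g 1))
              ≤ C * (momentWeight a s 2 * ((2 : ℕ) : ℝ) ^ η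
                * (2 * (g 2 / K₂ + K₂ ^ (γ / 2)))) := by gcongr
            _ = 2 * C / K₂ * D 2 + 2 * C * K₂ ^ (γ / 2)
                * (momentWeight a s 2 * ((2 : ℕ) : ℝ) ^ η) := by rw [hD]; ring
            _ ≤ c / 6 * D 2 + 2 * C * K₂ ^ (γ / 2) * (2 * a ^ 2) := by
                have := hD0 2
                gcongr
            _ = _ := by ring
        linarith
      · rw [if_neg (by omega), Finset.mul_sum, ← Finset.sum_add_distrib]
        have : ∑ k ∈ Finset.Ico 1 p, momentWeight a s p * (p : ℝ) ^ η *
            ((p.choose k : ℝ) * (g (max k (p - k)) * m (min k (p - k)))) ≤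
            ∑ k ∈ Finset.Ico 1 p, 2 * (D' k * e (p - k) + e k * D' (p - k)) := by
          refine Finset.sum_le_sum fun k hk => ?_
          rw [Finset.mem_Ico] at hk
          exact weighted_convolution_le hη0 hη1 hs ha0 hg hm h3 hk.1 hk.2
        have h4 := mul_le_mul_of_nonneg_left (this.trans_eq (Finset.mul_sum _ _ _).symm) hC
        linarith
    have e1 : momentWeight a s p * momentRate c C η g m p =
        C * (momentWeight a s p * (p : ℝ) ^ η * ∑ k ∈ Finset.Ico 1 p,
          (p.choose k : ℝ) * (g (max k (p - k)) * m (min k (p - k))))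
        + C * (momentWeight a s p * (p : ℝ) ^ η * m p) - c * D p := by
      unfold momentRate
      rw [hD]; ring
    rw [e1]
    linarith
  refine (Finset.sum_le_sum hterm).trans ?_
  rw [Finset.sum_add_distrib, Finset.sum_add_distrib, Finset.sum_add_distrib, ← Finset.mul_sum,
    ← Finset.mul_sum, ← Finset.mul_sum, Finset.sum_add_distrib]
  have hI : ∑ i ∈ Finset.Icc 1 N, D' i ≤ ∑ p ∈ Finset.Icc 2 N, D p := by
    have : ∑ i ∈ Finset.Icc 1 N, D' i = ∑ p ∈ (Finset.Icc 1 N).filter (2 ≤ ·), D p := by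
      rw [Finset.sum_filter]
    rw [this]
    refine Finset.sum_le_sum_of_subset_of_nonneg (fun p hp => ?_) fun p _ _ => hD0 p
    simp only [Finset.mem_filter, Finset.mem_Icc] at hp ⊢
    omega
  set Itot := ∑ p ∈ Finset.Icc 2 N, D p with hItot
  have hI0 : 0 ≤ Itot := Finset.sum_nonneg fun p _ => hD0 p
  have hE0 : 0 ≤ ∑ p ∈ Finset.Icc 1 N, e p := Finset.sum_nonneg fun p _ => he0 p
  have hD'1 : 0 ≤ ∑ p ∈ Finset.Icc 1 N, D' p := Finset.sum_nonneg fun p _ => hD'0 p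
  have v1 := (sum_convolution_le hD'0 he0 N).trans (mul_le_mul hI hE hE0 hI0)
  have v2 := (sum_convolution_le he0 hD'0 N).trans
    (mul_le_mul hE hI hD'1 (hE0.trans hE))
  have v3 := mul_le_mul_of_nonneg_left (sum_mul_pow_div_factorial_le (by linarith : 0 ≤ K) N)
    (show 0 ≤ C * a ^ 2 by positivity)
  have v4 : ∑ p ∈ Finset.Icc 2 N, (if p = 2 then 4 * C * K₂ ^ (γ / 2) * a ^ 2 else 0)
      ≤ 4 * C * K₂ ^ (γ / 2) * a ^ 2 := by
    rw [Finset.sum_ite_eq']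
    split_ifs
    · exact le_rfl
    · positivity
  have v5 := mul_le_mul_of_nonneg_left (add_le_add v1 v2) (show 0 ≤ 2 * C by positivity)
  have v6 := mul_le_mul_of_nonneg_right hδ4 hI0
  linarith

end SummedMoments

/-! ### A barrier argument and a geometric sum. -/

section Barrier

/-- A function that starts strictly below a line of slope `k`, and whose derivative is smaller
than `k` whenever it touches the line, stays below the line. -/
theorem le_line_of_deriv_lt {E E' : ℝ → ℝ} {s T d k : ℝ} (hE : ContinuousOn E (Set.Icc s T))
    (hE' : ∀ t ∈ Set.Ioo s T, HasDerivAt E (E' t) t) (hs : E s < d)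
    (hb : ∀ t ∈ Set.Ioo s T, E t = d + k * (t - s) → E' t < k) {t : ℝ} (ht : t ∈ Set.Icc s T) :
    E t ≤ d + k * (t - s) := by
  rcases ht.1.eq_or_lt with rfl | hst
  · simpa using hs.le
  have hsT : s ≤ T := ht.1.trans ht.2
  have hcont : ContinuousOn (fun t => d + k * (t - s) - E t) (Set.Icc s T) :=
    ContinuousOn.sub (by fun_prop) hE
  have hpos : 0 < d + k * (s - s) - E s := by simpa using hs
  have hev := (hcont s (Set.left_mem_Icc.2 hsT)).eventually (lt_mem_nhds hpos)
  -- Nothing is known about the derivative at s, so continuity first carries the strict inequality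
  -- to some [s, u], and the comparison theorem is applied from u on.
  rw [nhdsWithin_Icc_eq_nhdsGE (hst.trans_le ht.2)] at hev
  obtain ⟨u, hu, hsub⟩ := mem_nhdsGE_iff_exists_Icc_subset.1 hev
  by_cases htu : t ≤ u
  · have : 0 < d + k * (t - s) - E t := hsub ⟨ht.1, htu⟩
    linarith
  push Not at htu
  have hu0 : 0 < d + k * (u - s) - E u := hsub ⟨le_of_lt hu, le_rfl⟩
  exact image_le_of_deriv_right_lt_deriv_boundary' (f := E) (f' := E') (a := u) (b := T)
    (B := fun t => d + k * (t - s)) (B' := fun _ => k)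
    (hE.mono (Set.Icc_subset_Icc_left (le_of_lt hu)))
    (fun x hx => (hE' x ⟨lt_of_lt_of_le hu hx.1, hx.2⟩).hasDerivWithinAt)
    (by linarith) (by fun_prop)
    (fun x _ => by
      have := ((((hasDerivAt_id x).sub_const s).const_mul k).const_add d)
      exact (this.congr_deriv (by ring)).hasDerivWithinAt)
    (fun x hx h => hb x ⟨lt_of_lt_of_le hu hx.1, hx.2⟩ h) ⟨htu.le, ht.2⟩

theorem sum_pow_le_two_mul {r : ℝ} (h0 : 0 ≤ r) (h1 : r ≤ 1 / 2) (N : ℕ) :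
    ∑ p ∈ Finset.Icc 1 N, r ^ p ≤ 2 * r := by
  have : ∑ p ∈ Finset.Icc 1 N, r ^ p + 2 * r ^ (N + 1) ≤ 2 * r := by
    induction N with
    | zero => simp
    | succ N ih =>
      rw [Finset.sum_Icc_succ_top (by omega)]
      have : 0 ≤ r ^ (N + 1) := by positivity
      have e : r ^ (N + 1 + 1) = r ^ (N + 1) * r := pow_succ _ _
      nlinarith
  have : 0 ≤ r ^ (N + 1) := by positivity
  linarith

end Barrier

/-! ### Interpolation and time derivatives of moments. -/

section MomentBasics

variable {γ ν κ₁ κ₂ : ℝ} {B : ℝ → ℝ → ℝ} {β : ℝ → ℝ} {I J : Velocity → Velocity}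
  {f : ℝ → ProbabilityMeasure Velocity} {s T t : ℝ}

theorem IsWeakSolution.powerMoment_one (hf : IsWeakSolution γ β I J f) (ht : 0 ≤ t) :
    powerMoment (f t) 1 = 1 := by
  unfold powerMoment
  simpa using hf.energy t ht

/-- Split at |v|² = K: above, |v|^γ ≥ K^(γ/2); below, all but one power of the energy is bounded by
K, and the energy is 1. The level K stays free: it is fixed in propagation and depends on p and τ in
creation. -/
theorem HasMoments.powerMoment_le (hf : IsWeakSolution γ β I J f) (h : HasMoments f s T)
    (hγ0 : 0 ≤ γ) (hγ1 : γ ≤ 1) (ht : t ∈ Set.Icc s T) (ht0 : 0 ≤ t) {K : ℝ} (hK : 0 < K) {p : ℕ}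
    (hp : 1 ≤ p) :
    powerMoment (f t) p ≤ K ^ (-(γ / 2)) * weightedMoment γ (f t) p + K ^ (p - 1) := by
  have h1 := h.integrable_pow_mul hγ0 hγ1 p ht
  have h2 := hf.integrable_energy ht0
  have hle : ∀ v : Velocity, (‖v‖ ^ 2) ^ p ≤
      K ^ (-(γ / 2)) * ((‖v‖ ^ 2) ^ p * ‖v‖ ^ γ) + K ^ (p - 1) * ‖v‖ ^ 2 := by
    intro v
    have hx : 0 ≤ ‖v‖ ^ 2 := by positivity
    rcases le_total K (‖v‖ ^ 2) with h | h
    · have h3 : 1 ≤ K ^ (-(γ / 2)) * ‖v‖ ^ γ := by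
        rw [Real.rpow_neg hK.le, ← div_eq_inv_mul, le_div_iff₀ (by positivity), one_mul,
          ← rpow_half_norm_sq]
        exact Real.rpow_le_rpow hK.le h (by linarith)
      have h4 : 0 ≤ (‖v‖ ^ 2) ^ p := by positivity
      have h5 : 0 ≤ K ^ (p - 1) * ‖v‖ ^ 2 := by positivity
      nlinarith
    · have h3 : (‖v‖ ^ 2) ^ p ≤ K ^ (p - 1) * ‖v‖ ^ 2 := by
        obtain ⟨m, rfl⟩ := Nat.exists_eq_add_of_le' hp
        rw [pow_succ (‖v‖ ^ 2) m, Nat.add_sub_cancel]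
        gcongr
      have h4 : 0 ≤ K ^ (-(γ / 2)) * ((‖v‖ ^ 2) ^ p * ‖v‖ ^ γ) := by positivity
      linarith
  have := integral_mono (h.integrable_pow p ht) ((h1.const_mul (K ^ (-(γ / 2)))).add
    (h2.const_mul (K ^ (p - 1)))) hle
  rw [integral_add' (h1.const_mul (K ^ (-(γ / 2)))) (h2.const_mul (K ^ (p - 1))),
    integral_const_mul, integral_const_mul, hf.energy t ht0, mul_one] at this
  exact this

theorem HasMoments.weightedMoment_one_le (hf : IsWeakSolution γ β I J f) (h : HasMoments f s T)
    (hγ0 : 0 ≤ γ) (hγ1 : γ ≤ 1) (ht : t ∈ Set.Icc s T) (ht0 : 0 ≤ t) {K : ℝ} (hK : 0 < K) :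
    weightedMoment γ (f t) 1 ≤ weightedMoment γ (f t) 2 / K + K ^ (γ / 2) := by
  have h1 := h.integrable_pow_mul hγ0 hγ1 1 ht
  have h2 := h.integrable_pow_mul hγ0 hγ1 2 ht
  have h3 := hf.integrable_energy ht0
  have hle : ∀ v : Velocity, (‖v‖ ^ 2) ^ 1 * ‖v‖ ^ γ ≤
      (‖v‖ ^ 2) ^ 2 * ‖v‖ ^ γ / K + K ^ (γ / 2) * ‖v‖ ^ 2 := by
    intro v
    have hx : 0 ≤ ‖v‖ ^ 2 := by positivity
    rcases le_total K (‖v‖ ^ 2) with h | h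
    · have h4 : (‖v‖ ^ 2) ^ 1 * ‖v‖ ^ γ ≤ (‖v‖ ^ 2) ^ 2 * ‖v‖ ^ γ / K := by
        rw [le_div_iff₀ hK]
        have : 0 ≤ ‖v‖ ^ 2 * ‖v‖ ^ γ := by positivity
        nlinarith
      have : 0 ≤ K ^ (γ / 2) * ‖v‖ ^ 2 := by positivity
      linarith
    · have h4 : ‖v‖ ^ γ ≤ K ^ (γ / 2) := by
        rw [← rpow_half_norm_sq]
        exact Real.rpow_le_rpow hx h (by linarith)
      have h5 : 0 ≤ (‖v‖ ^ 2) ^ 2 * ‖v‖ ^ γ / K := by positivity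
      nlinarith
  have := integral_mono h1 ((h2.div_const K).add (h3.const_mul (K ^ (γ / 2)))) hle
  rw [integral_add' (h2.div_const K) (h3.const_mul (K ^ (γ / 2))), integral_div,
    integral_const_mul, hf.energy t ht0, mul_one] at this
  exact this

theorem HasMoments.continuousOn_powerMoment (hf : IsWeakSolution γ β I J f)
    (h : HasMoments f s T) (hs : 0 ≤ s) {p : ℕ} (hp : 1 ≤ p) :
    ContinuousOn (fun t => powerMoment (f t) p) (Set.Icc s T) := by
  rcases hp.eq_or_lt with rfl | hp
  · exact continuousOn_const.congr fun t ht => hf.powerMoment_one (hs.trans ht.1)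
  · obtain ⟨q, rfl⟩ := Nat.exists_eq_add_of_le' hp
    exact h.continuousOn_integral_pow hf hs q

/-- The solution has moments whose time derivatives are bounded by `momentRate`. -/
theorem exists_hasDerivAt_powerMoment_le (hγ0 : 0 ≤ γ) (hγ1 : γ ≤ 1) (hν0 : 0 < ν) (hν : ν < 2)
    (hκ₁ : 0 < κ₁) (hκ₂ : 0 < κ₂) : ∃ c C : ℝ, 0 < c ∧ 0 ≤ C ∧
      ∀ (B : ℝ → ℝ → ℝ) (β : ℝ → ℝ) (I J : Velocity → Velocity)
        (f : ℝ → ProbabilityMeasure Velocity) (s T : ℝ),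
        IsHardPotential γ ν κ₁ κ₂ B β → IsFrame I J → IsWeakSolution γ β I J f →
        HasMoments f s T → 0 ≤ s → ∀ t ∈ Set.Ioo s T, ∃ d : ℕ → ℝ,
          (∀ p, 1 ≤ p → HasDerivAt (fun t => powerMoment (f t) p) (d p) t) ∧ d 1 = 0 ∧
          ∀ p, 2 ≤ p → d p ≤
            momentRate c C (ν / 2) (weightedMoment γ (f t)) (powerMoment (f t)) p := by
  obtain ⟨c, C, hc, hC, H⟩ := exists_moment_inequality hγ0 hγ1 hν0 hν hκ₁ hκ₂
  refine ⟨c, C, hc, hC, ?_⟩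
  intro B β I J f s T hB hF hf hmom hs t ht
  have ht0 : 0 < t := hs.trans_lt ht.1
  refine ⟨fun p => if p = 1 then 0 else
    ∫ z, collisionIntegral γ β I J (fun v => (‖v‖ ^ 2) ^ p) z.1 z.2
      ∂((f t : Measure Velocity).prod (f t : Measure Velocity)), ?_, if_pos rfl, ?_⟩
  · intro p hp
    rcases hp.eq_or_lt with rfl | hp
    · dsimp only
      rw [if_pos rfl]
      refine (hasDerivAt_const t (1 : ℝ)).congr_of_eventuallyEq ?_
      filter_upwards [lt_mem_nhds ht0] with τ hτ
      exact hf.powerMoment_one hτ.le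
    · obtain ⟨q, rfl⟩ := Nat.exists_eq_add_of_le' hp
      dsimp only
      rw [if_neg (by omega)]
      exact hmom.hasDerivAt_integral_pow hf hB hF hγ0 hγ1 hν hκ₂ hs q ht
  · intro p hp
    obtain ⟨q, rfl⟩ := Nat.exists_eq_add_of_le' hp
    dsimp only
    rw [if_neg (by omega)]
    exact H B β I J f s T hB hF hf hmom q t (Set.Ioo_subset_Icc_self ht) ht0

end MomentBasics

/-! ### The cost of a growing exponential parameter. -/

section CreationTerm

/-- Control of the time derivative of the weights when the parameter grows like `b τ^(2/γ)`. -/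
theorem creation_term_le {γ c η s b τ g m : ℝ} {p : ℕ} (hγ0 : 0 < γ) (hγ1 : γ ≤ 1) (hc : 0 < c)
    (hs0 : 0 ≤ s) (hs : (1 - η) * (2 / γ) ≤ s) (hb : 0 ≤ b) (hτ0 : 0 < τ)
    (hτ1 : τ ≤ 1) (hp : 1 ≤ p)
    (hm : ∀ K : ℝ, 0 < K → m ≤ K ^ (-(γ / 2)) * g + K ^ (p - 1)) :
    p * (2 / γ) / τ * momentWeight (b * τ ^ (2 / γ)) s p * m ≤
      c / 4 * (momentWeight (b * τ ^ (2 / γ)) s p * (p : ℝ) ^ η * g)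
        + 2 / γ * (2 * Real.exp s * max 1 ((8 / (c * γ)) ^ (2 / γ)) * b) ^ p := by
  have hp1 : (1 : ℝ) ≤ p := by exact_mod_cast hp
  have hp0 : (0 : ℝ) < p := by linarith
  set H := max 1 ((8 / (c * γ)) ^ (2 / γ)) with hH
  have hH1 : 1 ≤ H := le_max_left _ _
  set h := (8 / (c * γ)) ^ (2 / γ) with hh
  have hh0 : 0 ≤ h := by positivity
  set a := b * τ ^ (2 / γ) with ha
  have ha0 : 0 ≤ a := by positivity
  set Y := 8 / (c * γ) * (p : ℝ) ^ (1 - η) / τ with hY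
  have hY0 : 0 < Y := by positivity
  have hw := momentWeight_nonneg ha0 s p
  -- The level is tuned so that p/τ times its power -γ/2 is exactly a multiple of p^η: the first
  -- part then consumes only a quarter of the dissipation constant.
  have h1 := hm (Y ^ (2 / γ)) (by positivity)
  have e1 : (Y ^ (2 / γ)) ^ (-(γ / 2)) = c * γ / 8 * ((p : ℝ) ^ η / p) * τ := by
    rw [← Real.rpow_mul hY0.le, show 2 / γ * -(γ / 2) = -1 by field_simp, Real.rpow_neg_one, hY,
      Real.rpow_sub hp0, Real.rpow_one]
    field_simp
  have hcoef : 0 ≤ p * (2 / γ) / τ * momentWeight a s p := by positivity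
  have h2 := mul_le_mul_of_nonneg_left h1 hcoef
  refine h2.trans ?_
  rw [mul_add, e1]
  have e2 : p * (2 / γ) / τ * momentWeight a s p * (c * γ / 8 * ((p : ℝ) ^ η / p) * τ * g)
      = c / 4 * (momentWeight a s p * (p : ℝ) ^ η * g) := by
    field_simp
    ring
  rw [e2]
  refine add_le_add le_rfl ?_
  have e3 : Y ^ (2 / γ) = h * (p : ℝ) ^ ((1 - η) * (2 / γ)) / τ ^ (2 / γ) := by
    rw [hY, Real.div_rpow (by positivity) hτ0.le, Real.mul_rpow (by positivity) (by positivity),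
      ← Real.rpow_mul hp0.le]
  have e4 : a * Y ^ (2 / γ) = b * h * (p : ℝ) ^ ((1 - η) * (2 / γ)) := by
    rw [e3, ha]
    have : 0 < τ ^ (2 / γ) := by positivity
    field_simp
  have haτ : a / τ ≤ b := by
    rw [div_le_iff₀ hτ0, ha]
    have h2γ : 1 ≤ 2 / γ := by rw [le_div_iff₀ hγ0]; linarith
    have : τ ^ (2 / γ) ≤ τ := by
      conv_rhs => rw [← Real.rpow_one τ]
      exact Real.rpow_le_rpow_of_exponent_ge hτ0 hτ1 h2γ
    gcongr
  -- Here s has to be at least (1 - η)·2/γ, which is (2 - ν)/γ for η = ν/2. The remainder then grows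
  -- at most like p^(sp), compensated by (p!)^s through p^p/p! ≤ e^p.
  have hPs : (p : ℝ) ^ ((1 - η) * (2 / γ)) ≤ (p : ℝ) ^ s :=
    Real.rpow_le_rpow_of_exponent_le hp1 hs
  have hps1 : 1 ≤ (p : ℝ) ^ s := Real.one_le_rpow hp1 hs0
  have hfac : (0 : ℝ) < (p.factorial : ℝ) ^ s := by positivity
  have hstir : ((p : ℝ) ^ s) ^ p / (p.factorial : ℝ) ^ s ≤ Real.exp s ^ p := by
    have h3 := Real.pow_div_factorial_le_exp (p : ℝ) hp0.le p
    have h4 := Real.rpow_le_rpow (by positivity) h3 hs0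
    rw [Real.div_rpow (by positivity) (by positivity), ← Real.exp_mul] at h4
    rw [← Real.exp_nat_mul]
    refine le_trans (le_of_eq ?_) h4
    rw [← Real.rpow_natCast, ← Real.rpow_natCast, ← Real.rpow_mul hp0.le, ← Real.rpow_mul hp0.le,
      mul_comm]
  have h2p : (p : ℝ) ≤ 2 ^ p := by exact_mod_cast p.lt_two_pow_self.le
  obtain ⟨q, hq⟩ := Nat.exists_eq_add_of_le' hp
  have e5 : p * (2 / γ) / τ * momentWeight a s p * (Y ^ (2 / γ)) ^ (p - 1)
      = 2 / γ * (p * (a / τ) * (a * Y ^ (2 / γ)) ^ (p - 1) / (p.factorial : ℝ) ^ s) := by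
    unfold momentWeight
    have : a ^ p = a * a ^ (p - 1) := by rw [hq, Nat.add_sub_cancel, pow_succ]; ring
    rw [this, mul_pow a]
    field_simp
  rw [e5, e4]
  have hstep : (b * h * (p : ℝ) ^ ((1 - η) * (2 / γ))) ^ (p - 1)
      ≤ b ^ (p - 1) * H ^ p * ((p : ℝ) ^ s) ^ p := by
    calc (b * h * (p : ℝ) ^ ((1 - η) * (2 / γ))) ^ (p - 1)
        ≤ (b * H * (p : ℝ) ^ s) ^ (p - 1) := by
          gcongr
          exact le_max_right _ _
      _ = b ^ (p - 1) * H ^ (p - 1) * ((p : ℝ) ^ s) ^ (p - 1) := by rw [mul_pow, mul_pow]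
      _ ≤ _ := by
          gcongr b ^ (p - 1) * ?_ * ?_
          · exact pow_le_pow_right₀ hH1 (Nat.sub_le _ _)
          · exact pow_le_pow_right₀ hps1 (Nat.sub_le _ _)
  have hγ2 : 0 ≤ 2 / γ := by positivity
  refine mul_le_mul_of_nonneg_left ?_ hγ2
  calc p * (a / τ) * (b * h * (p : ℝ) ^ ((1 - η) * (2 / γ))) ^ (p - 1) / (p.factorial : ℝ) ^ s
      ≤ 2 ^ p * b * (b ^ (p - 1) * H ^ p * ((p : ℝ) ^ s) ^ p) / (p.factorial : ℝ) ^ s := by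
        gcongr
    _ = 2 ^ p * (b * b ^ (p - 1)) * H ^ p * (((p : ℝ) ^ s) ^ p / (p.factorial : ℝ) ^ s) := by
        ring
    _ ≤ 2 ^ p * (b * b ^ (p - 1)) * H ^ p * Real.exp s ^ p := by gcongr
    _ = _ := by
        rw [show b * b ^ (p - 1) = b ^ p by rw [hq, Nat.add_sub_cancel, pow_succ]; ring,
          mul_pow, mul_pow, mul_pow]
        ring

end CreationTerm

/-! ### Uniform bounds for the weighted sums. -/

section ExponentialMoments

variable {γ ν κ₁ κ₂ : ℝ}

theorem hasDerivAt_momentWeight {a : ℝ → ℝ} {a' t : ℝ} (ha : HasDerivAt a a' t) (s : ℝ) (p : ℕ) :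
    HasDerivAt (fun t => momentWeight (a t) s p)
      (p * a t ^ (p - 1) * a' / (p.factorial : ℝ) ^ s) t :=
  (ha.fun_pow p).div_const _

theorem momentWeight_zero_left (s : ℝ) {p : ℕ} (hp : 1 ≤ p) : momentWeight 0 s p = 0 := by
  unfold momentWeight
  rw [zero_pow (by omega), zero_div]

theorem sum_momentRate_nonneg_part {N : ℕ} {d w R : ℕ → ℝ} (hd1 : d 1 = 0)
    (hd : ∀ p, 2 ≤ p → d p ≤ R p) (hw : ∀ p, 0 ≤ w p) :
    ∑ p ∈ Finset.Icc 1 N, w p * d p ≤ ∑ p ∈ Finset.Icc 2 N, w p * R p := by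
  have h1 : ∑ p ∈ Finset.Icc 1 N, w p * d p = ∑ p ∈ Finset.Icc 2 N, w p * d p := by
    symm
    refine Finset.sum_subset (Finset.Icc_subset_Icc_left (by norm_num)) fun p hp hp2 => ?_
    simp only [Finset.mem_Icc] at hp hp2
    have : p = 1 := by omega
    rw [this, hd1, mul_zero]
  rw [h1]
  exact Finset.sum_le_sum fun p hp =>
    mul_le_mul_of_nonneg_left (hd p (Finset.mem_Icc.1 hp).1) (hw p)

/-- The parameter vanishes at s₀, so the sum starts from 0 whatever the moments are there. While the
sum is at most δ its derivative is below δ/2, so over a unit of time it stays under the line δ/2 +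
(δ/2)(t - s₀). Finite sums make the differentiation legitimate; the bound is uniform in N. -/
theorem exists_uniform_creation (hγ0 : 0 < γ) (hγ1 : γ ≤ 1) (hν0 : 0 < ν) (hν : ν < 2)
    (hκ₁ : 0 < κ₁) (hκ₂ : 0 < κ₂) {s : ℝ} (hs1 : 1 ≤ s) (hs : (2 - ν) / γ ≤ s) :
    ∃ b : ℝ, 0 < b ∧
      ∀ (B : ℝ → ℝ → ℝ) (β : ℝ → ℝ) (I J : Velocity → Velocity)
        (f : ℝ → ProbabilityMeasure Velocity) (s₀ : ℝ),
        IsHardPotential γ ν κ₁ κ₂ B β → IsFrame I J → IsWeakSolution γ β I J f →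
        HasMoments f s₀ (s₀ + 1) → 0 ≤ s₀ → ∀ N : ℕ, ∀ t ∈ Set.Icc s₀ (s₀ + 1),
        ∑ p ∈ Finset.Icc 1 N, momentWeight (b * (t - s₀) ^ (2 / γ)) s p * powerMoment (f t) p
          ≤ 1 := by
  obtain ⟨c, C, hc, hC, H⟩ := exists_hasDerivAt_powerMoment_le hγ0.le hγ1 hν0 hν hκ₁ hκ₂
  obtain ⟨δ, L, hδ0, hδ1, hL0, HS⟩ := exists_sum_momentRate_le hγ0 hc hC
  set Θ := 2 * Real.exp s * max 1 ((8 / (c * γ)) ^ (2 / γ)) with hΘ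
  have hΘ0 : 0 < Θ := by positivity
  set M := 2 / γ + L + 4 / γ * Θ + 1 with hM
  have hM0 : 0 < M := by positivity
  -- Θb ≤ 1/2 makes the remainders of `creation_term_le` a convergent geometric series, and Mb ≤ δ/4
  -- bounds the total forcing.
  set b := min 1 (min (1 / (2 * Θ)) (δ / (4 * M))) with hb
  have hb0 : 0 < b := by positivity
  have hb1 : b ≤ 1 := min_le_left _ _
  have hbΘ : Θ * b ≤ 1 / 2 := by
    have : b ≤ 1 / (2 * Θ) := (min_le_right _ _).trans (min_le_left _ _)
    rw [le_div_iff₀ (by positivity)] at this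
    linarith
  have hbM : M * b ≤ δ / 4 := by
    have : b ≤ δ / (4 * M) := (min_le_right _ _).trans (min_le_right _ _)
    rw [le_div_iff₀ (by positivity)] at this
    linarith
  refine ⟨b, hb0, ?_⟩
  intro B β I J f s₀ hB hF hf hmom hs₀ N t ht
  have h2γ : 2 ≤ 2 / γ := by rw [le_div_iff₀ hγ0]; linarith
  set a : ℝ → ℝ := fun t => b * (t - s₀) ^ (2 / γ) with ha
  have hacont : Continuous a := by
    rw [ha]
    exact continuous_const.mul ((continuous_id.sub continuous_const).rpow_const
      fun _ => Or.inr (by positivity))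
  set E : ℝ → ℝ := fun t => ∑ p ∈ Finset.Icc 1 N, momentWeight (a t) s p * powerMoment (f t) p
    with hE
  have hd : ∀ t ∈ Set.Ioo s₀ (s₀ + 1), ∃ E', HasDerivAt E E' t ∧
      (E t ≤ δ → E' < δ / 2) := by
    intro t ht
    have ht' := Set.Ioo_subset_Icc_self ht
    have ht0 : 0 ≤ t := hs₀.trans ht.1.le
    obtain ⟨d, hd, hd1, hdle⟩ := H B β I J f s₀ (s₀ + 1) hB hF hf hmom hs₀ t ht
    set τ := t - s₀ with hτ
    have hτ0 : 0 < τ := by rw [hτ]; linarith [ht.1]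
    have hτ1 : τ ≤ 1 := by rw [hτ]; linarith [ht.2]
    set g := weightedMoment γ (f t : Measure Velocity) with hg
    set m := powerMoment (f t : Measure Velocity) with hm
    have hat : a t = b * τ ^ (2 / γ) := rfl
    have ha0 : 0 ≤ a t := by rw [hat]; positivity
    have hτ2 : τ ^ (2 / γ) ≤ 1 := Real.rpow_le_one hτ0.le hτ1 (by positivity)
    have hab : a t ≤ b := by rw [hat]; exact mul_le_of_le_one_right hb0.le hτ2
    have hw := fun p => momentWeight_nonneg ha0 s p
    have hda : HasDerivAt a (2 / γ * a t / τ) t := by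
      have h1 := (((hasDerivAt_id t).sub_const s₀).rpow_const (p := 2 / γ)
        (Or.inl hτ0.ne')).const_mul b
      refine h1.congr_deriv ?_
      rw [hat]
      simp only [id_eq]
      rw [← hτ, Real.rpow_sub_one hτ0.ne']
      ring
    have hsum : HasDerivAt E (∑ p ∈ Finset.Icc 1 N,
        (p * a t ^ (p - 1) * (2 / γ * a t / τ) / (p.factorial : ℝ) ^ s * m p
          + momentWeight (a t) s p * d p)) t :=
      HasDerivAt.fun_sum fun p hp =>
        (hasDerivAt_momentWeight hda s p).fun_mul (hd p (Finset.mem_Icc.1 hp).1)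
    refine ⟨_, hsum, fun hEδ => ?_⟩
    have hmK : ∀ K : ℝ, 0 < K → ∀ p, 1 ≤ p → m p ≤ K ^ (-(γ / 2)) * g p + K ^ (p - 1) :=
      fun K hK p hp => hmom.powerMoment_le hf hγ0.le hγ1 ht' ht0 hK hp
    have hm1 : m 1 = 1 := hf.powerMoment_one ht0
    have hS := HS (ν / 2) s (a t) g m N (by linarith) (by linarith) hs1 ha0 (hab.trans hb1)
      (weightedMoment_nonneg γ _) (powerMoment_nonneg _) hm1 hmK
      (fun K hK => hmom.weightedMoment_one_le hf hγ0.le hγ1 ht' ht0 hK) hEδ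
    have hQ := sum_momentRate_nonneg_part (N := N) hd1 hdle hw
    rw [Finset.sum_add_distrib]
    set Itot := ∑ p ∈ Finset.Icc 2 N, momentWeight (a t) s p * (p : ℝ) ^ (ν / 2) * g p with hItot
    have hI0 : 0 ≤ Itot := Finset.sum_nonneg fun p _ => mul_nonneg (mul_nonneg (hw p)
      (by positivity)) (weightedMoment_nonneg γ _ p)
    have hterm : ∀ p ∈ Finset.Icc 1 N,
        p * a t ^ (p - 1) * (2 / γ * a t / τ) / (p.factorial : ℝ) ^ s * m p ≤
        (if p = 1 then 2 / γ * b else 0)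
        + ((if 2 ≤ p then c / 4 * (momentWeight (a t) s p * (p : ℝ) ^ (ν / 2) * g p) else 0)
        + 2 / γ * (Θ * b) ^ p) := by
      intro p hp
      have hp1 := (Finset.mem_Icc.1 hp).1
      have hΘp : 0 ≤ 2 / γ * (Θ * b) ^ p := by positivity
      rcases hp1.eq_or_lt with rfl | hp2
      -- The first moment is the conserved energy and has no dissipation to compensate it, so its
      -- term is bounded directly from a/τ ≤ b.
      · rw [if_pos rfl, if_neg (by norm_num), hm1]
        have h3 : a t / τ ≤ b := by
          rw [div_le_iff₀ hτ0, hat]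
          have : τ ^ (2 / γ) ≤ τ := by
            conv_rhs => rw [← Real.rpow_one τ]
            exact Real.rpow_le_rpow_of_exponent_ge hτ0 hτ1 (by linarith)
          gcongr
        have h4 : 2 / γ * a t / τ ≤ 2 / γ * b := by
          rw [mul_div_assoc]
          have : 0 ≤ 2 / γ := by positivity
          gcongr
        simp only [Nat.sub_self, pow_zero, Nat.factorial_one, Nat.cast_one, Real.one_rpow,
          mul_one, div_one, one_mul]
        linarith
      · rw [if_neg (by omega), if_pos (show 2 ≤ p from hp2), zero_add]
        have := creation_term_le (η := ν / 2) (s := s) (g := g p) (m := m p) hγ0 hγ1 hc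
          (by linarith) (by refine le_trans (le_of_eq ?_) hs; field_simp) hb0.le hτ0 hτ1 hp1
          (fun K hK => hmK K hK p hp1)
        rw [← hΘ, ← hat] at this
        refine le_trans (le_of_eq ?_) this
        obtain ⟨q, rfl⟩ := Nat.exists_eq_add_of_le' hp1
        unfold momentWeight
        rw [Nat.add_sub_cancel, pow_succ]
        ring
    have hsum1 := Finset.sum_le_sum hterm
    rw [Finset.sum_add_distrib, Finset.sum_add_distrib, ← Finset.mul_sum] at hsum1
    have v1 : ∑ p ∈ Finset.Icc 1 N, (if p = 1 then 2 / γ * b else 0) ≤ 2 / γ * b := by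
      rw [Finset.sum_ite_eq']
      split_ifs
      · exact le_rfl
      · positivity
    have v2 : ∑ p ∈ Finset.Icc 1 N, (if 2 ≤ p then
        c / 4 * (momentWeight (a t) s p * (p : ℝ) ^ (ν / 2) * g p) else 0) ≤ c / 4 * Itot := by
      rw [← Finset.sum_filter, hItot, Finset.mul_sum]
      refine Finset.sum_le_sum_of_subset_of_nonneg (fun p hp => ?_) fun p _ _ => ?_
      · simp only [Finset.mem_filter, Finset.mem_Icc] at hp ⊢
        omega
      · exact mul_nonneg (by positivity) (mul_nonneg (mul_nonneg (hw p) (by positivity))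
          (weightedMoment_nonneg γ _ p))
    have v3 := mul_le_mul_of_nonneg_left (sum_pow_le_two_mul (by positivity) hbΘ N)
      (show 0 ≤ 2 / γ by positivity)
    have v4 : L * a t ^ 2 ≤ L * b := by
      have : a t ^ 2 ≤ b := by nlinarith
      gcongr
    have v5 : 0 ≤ c / 4 * Itot := by positivity
    have v6 : M * b = 2 / γ * b + L * b + 2 / γ * (2 * (Θ * b)) + b := by rw [hM]; ring
    linarith
  have hd' : ∀ t, ∃ E', t ∈ Set.Ioo s₀ (s₀ + 1) → HasDerivAt E E' t ∧ (E t ≤ δ → E' < δ / 2) := by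
    intro t
    by_cases h : t ∈ Set.Ioo s₀ (s₀ + 1)
    · obtain ⟨E', h'⟩ := hd t h
      exact ⟨E', fun _ => h'⟩
    · exact ⟨0, fun h' => absurd h' h⟩
  choose E' hE' using hd'
  have hcontE : ContinuousOn E (Set.Icc s₀ (s₀ + 1)) :=
    continuousOn_finsetSum _ fun p hp => ContinuousOn.mul
      (((hacont.pow p).div_const _).continuousOn)
      (hmom.continuousOn_powerMoment hf hs₀ (Finset.mem_Icc.1 hp).1)
  have hEs : E s₀ < δ / 2 := by
    have : E s₀ = 0 := by
      refine Finset.sum_eq_zero fun p hp => ?_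
      have : a s₀ = 0 := by
        simp only [ha, sub_self]
        rw [Real.zero_rpow (by positivity), mul_zero]
      rw [this, momentWeight_zero_left s (Finset.mem_Icc.1 hp).1, zero_mul]
    rw [this]; positivity
  have hline := le_line_of_deriv_lt (k := δ / 2) hcontE (fun t ht => (hE' t ht).1) hEs
    (fun t ht hEt => (hE' t ht).2 (by rw [hEt]; nlinarith [ht.2])) ht
  refine hline.trans ?_
  nlinarith [ht.2]

/-- With a constant parameter the barrier is the level δ. The sum is at most the dissipation plus
3a, so at that level the dissipation is at least δ/2 (as a ≤ δ/6) and beats the source L a², which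
makes the derivative negative. Neither a₀ nor δ depends on s or T. -/
theorem exists_uniform_propagation (hγ0 : 0 < γ) (hγ1 : γ ≤ 1) (hν0 : 0 < ν) (hν : ν < 2)
    (hκ₁ : 0 < κ₁) (hκ₂ : 0 < κ₂) : ∃ a₀ δ : ℝ, 0 < a₀ ∧ 0 < δ ∧ δ ≤ 1 ∧
      ∀ (B : ℝ → ℝ → ℝ) (β : ℝ → ℝ) (I J : Velocity → Velocity)
        (f : ℝ → ProbabilityMeasure Velocity) (T s a : ℝ),
        IsHardPotential γ ν κ₁ κ₂ B β → IsFrame I J → IsWeakSolution γ β I J f →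
        HasMoments f 0 T → 1 ≤ s → 0 ≤ a → a ≤ a₀ → ∀ N : ℕ,
        ∑ p ∈ Finset.Icc 1 N, momentWeight a s p * powerMoment (f 0) p < δ →
        ∀ t ∈ Set.Icc 0 T, ∑ p ∈ Finset.Icc 1 N, momentWeight a s p * powerMoment (f t) p
          ≤ δ := by
  obtain ⟨c, C, hc, hC, H⟩ := exists_hasDerivAt_powerMoment_le hγ0.le hγ1 hν0 hν hκ₁ hκ₂
  obtain ⟨δ, L, hδ0, hδ1, hL0, HS⟩ := exists_sum_momentRate_le hγ0 hc hC
  set a₀ := min (1 / 2) (min (δ / 6) (c * δ / (8 * (L + 1)))) with ha₀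
  refine ⟨a₀, δ, by positivity, hδ0, hδ1, ?_⟩
  intro B β I J f T s a hB hF hf hmom hs1 ha0 haa N h0 t ht
  have ha12 : a ≤ 1 / 2 := haa.trans (min_le_left _ _)
  have haδ : a ≤ δ / 6 := haa.trans ((min_le_right _ _).trans (min_le_left _ _))
  have haL : L * a ≤ c * δ / 8 := by
    have h1 : a ≤ c * δ / (8 * (L + 1)) := haa.trans ((min_le_right _ _).trans (min_le_right _ _))
    rw [le_div_iff₀ (by positivity)] at h1
    nlinarith
  have hw := fun p => momentWeight_nonneg ha0 s p
  set E : ℝ → ℝ := fun t => ∑ p ∈ Finset.Icc 1 N, momentWeight a s p * powerMoment (f t) p with hE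
  have hd : ∀ t ∈ Set.Ioo 0 T, ∃ E', HasDerivAt E E' t ∧ (E t = δ → E' < 0) := by
    intro t ht
    have ht' := Set.Ioo_subset_Icc_self ht
    have ht0 : 0 ≤ t := ht.1.le
    obtain ⟨d, hd, hd1, hdle⟩ := H B β I J f 0 T hB hF hf hmom le_rfl t ht
    set g := weightedMoment γ (f t : Measure Velocity) with hg
    set m := powerMoment (f t : Measure Velocity) with hm
    have hsum : HasDerivAt E (∑ p ∈ Finset.Icc 1 N, momentWeight a s p * d p) t :=
      HasDerivAt.fun_sum fun p hp => (hd p (Finset.mem_Icc.1 hp).1).const_mul _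
    refine ⟨_, hsum, fun hEδ => ?_⟩
    have hmK : ∀ K : ℝ, 0 < K → ∀ p, 1 ≤ p → m p ≤ K ^ (-(γ / 2)) * g p + K ^ (p - 1) :=
      fun K hK p hp => hmom.powerMoment_le hf hγ0.le hγ1 ht' ht0 hK hp
    have hm1 : m 1 = 1 := hf.powerMoment_one ht0
    have hS := HS (ν / 2) s a g m N (by linarith) (by linarith) hs1 ha0 (by linarith)
      (weightedMoment_nonneg γ _) (powerMoment_nonneg _) hm1 hmK
      (fun K hK => hmom.weightedMoment_one_le hf hγ0.le hγ1 ht' ht0 hK) hEδ.le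
    have hQ := sum_momentRate_nonneg_part (N := N) hd1 hdle hw
    set Itot := ∑ p ∈ Finset.Icc 2 N, momentWeight a s p * (p : ℝ) ^ (ν / 2) * g p with hItot
    have hwa : ∀ p, momentWeight a s p ≤ a ^ p := by
      intro p
      refine (momentWeight_le ha0 hs1 p).trans (div_le_self (by positivity) ?_)
      exact_mod_cast p.factorial_pos
    have hEI : E t ≤ Itot + 3 * a := by
      have hterm : ∀ p ∈ Finset.Icc 1 N, momentWeight a s p * m p ≤
          (if p = 1 then a else 0) + ((if 2 ≤ p then
            momentWeight a s p * (p : ℝ) ^ (ν / 2) * g p else 0) + a ^ p) := by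
        intro p hp
        have hp1 := (Finset.mem_Icc.1 hp).1
        have hap : 0 ≤ a ^ p := by positivity
        rcases hp1.eq_or_lt with rfl | hp2
        · rw [if_pos rfl, if_neg (by norm_num), hm1]
          have := hwa 1
          rw [pow_one] at this ⊢
          linarith
        · rw [if_neg (by omega), if_pos (show 2 ≤ p from hp2), zero_add]
          have h1 := hmK 1 one_pos p hp1
          rw [Real.one_rpow, one_pow, one_mul] at h1
          have hpη : 1 ≤ (p : ℝ) ^ (ν / 2) :=
            Real.one_le_rpow (by exact_mod_cast hp1) (by linarith)
          have hgp : 0 ≤ g p := weightedMoment_nonneg γ _ p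
          calc momentWeight a s p * m p ≤ momentWeight a s p * (g p + 1) :=
                mul_le_mul_of_nonneg_left h1 (hw p)
            _ = momentWeight a s p * 1 * g p + momentWeight a s p := by ring
            _ ≤ _ := add_le_add (mul_le_mul_of_nonneg_right
                (mul_le_mul_of_nonneg_left hpη (hw p)) hgp) (hwa p)
      have hsum1 := Finset.sum_le_sum hterm
      rw [Finset.sum_add_distrib, Finset.sum_add_distrib] at hsum1
      have v1 : ∑ p ∈ Finset.Icc 1 N, (if p = 1 then a else 0) ≤ a := by
        rw [Finset.sum_ite_eq']
        split_ifs
        · exact le_rfl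
        · exact ha0
      have v2 : ∑ p ∈ Finset.Icc 1 N, (if 2 ≤ p then
          momentWeight a s p * (p : ℝ) ^ (ν / 2) * g p else 0) ≤ Itot := by
        rw [← Finset.sum_filter, hItot]
        refine Finset.sum_le_sum_of_subset_of_nonneg (fun p hp => ?_) fun p _ _ => ?_
        · simp only [Finset.mem_filter, Finset.mem_Icc] at hp ⊢
          omega
        · exact mul_nonneg (mul_nonneg (hw p) (by positivity)) (weightedMoment_nonneg γ _ p)
      have v3 := sum_pow_le_two_mul ha0 ha12 N
      exact hsum1.trans (by linarith)
    rw [hEδ] at hEI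
    have h5 : c / 2 * (δ / 2) ≤ c / 2 * Itot := by
      have : δ / 2 ≤ Itot := by linarith
      gcongr
    have h6 : L * a ^ 2 ≤ L * a := by
      have : a ^ 2 ≤ a := by nlinarith
      gcongr
    have h7 : 0 < c * δ := by positivity
    linarith
  have hd' : ∀ t, ∃ E', t ∈ Set.Ioo 0 T → HasDerivAt E E' t ∧ (E t = δ → E' < 0) := by
    intro t
    by_cases h : t ∈ Set.Ioo 0 T
    · obtain ⟨E', h'⟩ := hd t h
      exact ⟨E', fun _ => h'⟩
    · exact ⟨0, fun h' => absurd h' h⟩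
  choose E' hE' using hd'
  have hcontE : ContinuousOn E (Set.Icc 0 T) :=
    continuousOn_finsetSum _ fun p hp => continuousOn_const.mul
      (hmom.continuousOn_powerMoment hf le_rfl (Finset.mem_Icc.1 hp).1)
  have hline := le_line_of_deriv_lt (k := 0) hcontE (fun t ht => (hE' t ht).1) h0
    (fun t ht hEt => (hE' t ht).2 (by rw [hEt]; ring)) ht
  simpa using hline

end ExponentialMoments

/-! ### Between exponential moments and weighted sums. -/

section Conversion

/-- Each term y^p/p! is 2^(-p) ω with ω = (2y)^p/p!, and ω ≤ 1 + ω^s since s ≥ 1. The constant 3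
collects the term p = 0, the geometric sum and the discarded tail. -/
theorem exp_le_three_add_sum {y u s : ℝ} (hy : 0 ≤ y) (hs : 1 ≤ s) (hu : (2 * y) ^ s ≤ u) :
    ∃ N : ℕ, Real.exp y ≤ 3 + ∑ p ∈ Finset.Icc 1 N, u ^ p / (p.factorial : ℝ) ^ s := by
  have hexp : HasSum (fun n : ℕ => y ^ n / n.factorial) (Real.exp y) := by
    rw [Real.exp_eq_exp_ℝ]
    exact NormedSpace.expSeries_div_hasSum_exp y
  have hlim := (hexp.tendsto_sum_nat.comp (Filter.tendsto_add_atTop_nat 1)).eventually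
    (lt_mem_nhds (show Real.exp y - 1 < Real.exp y by linarith))
  obtain ⟨N, hN⟩ := hlim.exists
  refine ⟨N, ?_⟩
  simp only [Function.comp_apply] at hN
  rw [Finset.sum_range_succ', pow_zero, Nat.factorial_zero, Nat.cast_one, div_one] at hN
  have hterm : ∀ p : ℕ, y ^ p / p.factorial ≤ (1 / 2) ^ p + u ^ p / (p.factorial : ℝ) ^ s := by
    intro p
    set ω := (2 * y) ^ p / (p.factorial : ℝ) with hω
    have hω0 : 0 ≤ ω := by positivity
    have h1 : ω ≤ 1 + ω ^ s := by
      rcases le_total ω 1 with h | h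
      · have := Real.rpow_nonneg hω0 s
        linarith
      · have := Real.self_le_rpow_of_one_le h hs
        linarith
    have h2 : ω ^ s ≤ u ^ p / (p.factorial : ℝ) ^ s := by
      rw [hω, Real.div_rpow (by positivity) (by positivity), ← Real.rpow_natCast,
        ← Real.rpow_mul (by positivity), mul_comm (p : ℝ) s, Real.rpow_mul (by positivity),
        Real.rpow_natCast]
      gcongr
    have h3 : y ^ p / p.factorial = (1 / 2) ^ p * ω := by
      rw [hω, ← mul_div_assoc, ← mul_pow]
      congr 2
      ring
    have hp : ((1 : ℝ) / 2) ^ p ≤ 1 := pow_le_one₀ (by norm_num) (by norm_num)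
    have hp0 : (0 : ℝ) ≤ (1 / 2) ^ p := by positivity
    rw [h3]
    nlinarith [Real.rpow_nonneg hω0 s]
  have hsum := Finset.sum_le_sum fun p (_ : p ∈ Finset.Icc 1 N) => hterm p
  rw [Finset.sum_add_distrib] at hsum
  have hgeom := sum_pow_le_two_mul (r := 1 / 2) (by norm_num) le_rfl N
  have hshift : ∑ k ∈ Finset.range N, y ^ (k + 1) / ((k + 1).factorial : ℝ)
      = ∑ p ∈ Finset.Icc 1 N, y ^ p / (p.factorial : ℝ) := by
    rw [Finset.range_eq_Ico, Finset.sum_Ico_add' (fun p => y ^ p / (p.factorial : ℝ)) 0 N 1]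
    rfl
  rw [hshift] at hN
  linarith

theorem norm_rpow_eq_sq_rpow_inv (v : Velocity) {s ρ : ℝ} (hρ : ρ = 2 / s) :
    ‖v‖ ^ ρ = (‖v‖ ^ 2) ^ (1 / s) := by
  rw [← Real.rpow_natCast, ← Real.rpow_mul (norm_nonneg v), hρ]
  congr 1
  push_cast
  ring

theorem expMoment_le_four {μ : ProbabilityMeasure Velocity} {s ρ a σ : ℝ} (hs : 1 ≤ s)
    (hρ : ρ = 2 / s) (hσ : 0 ≤ σ) (ha : (2 * σ) ^ s ≤ a)
    (hi : ∀ p : ℕ, Integrable (fun v : Velocity => (‖v‖ ^ 2) ^ p) (μ : Measure Velocity))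
    (h : ∀ N : ℕ, ∑ p ∈ Finset.Icc 1 N, momentWeight a s p * powerMoment μ p ≤ 1) :
    expMoment σ ρ μ ≤ 4 := by
  have ha0 : 0 ≤ a := (Real.rpow_nonneg (by positivity) s).trans ha
  have hw := fun p => momentWeight_nonneg ha0 s p
  have key := lintegral_ofReal_le_of_monotone (μ : Measure Velocity)
    (φ := fun v => Real.exp (σ * ‖v‖ ^ ρ))
    (g := fun N v => ∑ p ∈ Finset.Icc 1 N, momentWeight a s p * (‖v‖ ^ 2) ^ p)
    (C₀ := 3) (C₁ := 1) (K := 1) (by norm_num) (by norm_num) ?_ ?_ ?_ ?_ ?_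
  · unfold expMoment
    refine key.trans (le_of_eq ?_)
    norm_num
  · intro v N M hNM
    exact Finset.sum_le_sum_of_subset_of_nonneg (Finset.Icc_subset_Icc_right hNM)
      fun p _ _ => mul_nonneg (hw p) (by positivity)
  · exact fun N v => Finset.sum_nonneg fun p _ => mul_nonneg (hw p) (by positivity)
  · exact fun N => integrable_finsetSum _ fun p _ => (hi p).const_mul _
  · intro N
    rw [integral_finsetSum _ fun p _ => (hi p).const_mul _]
    refine le_trans (le_of_eq (Finset.sum_congr rfl fun p _ => ?_)) (h N)
    rw [integral_const_mul]
    rfl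
  · intro v
    obtain ⟨N, hN⟩ := exp_le_three_add_sum (y := σ * ‖v‖ ^ ρ) (u := a * ‖v‖ ^ 2) (s := s)
      (by positivity) hs (by
        rw [norm_rpow_eq_sq_rpow_inv v hρ, ← mul_assoc, Real.mul_rpow (by positivity)
          (by positivity), ← Real.rpow_mul (by positivity), one_div_mul_cancel (by positivity),
          Real.rpow_one]
        gcongr)
    refine ⟨N, hN.trans (le_of_eq ?_)⟩
    rw [one_mul]
    congr 1
    refine Finset.sum_congr rfl fun p _ => ?_
    unfold momentWeight
    rw [mul_pow a]
    ring

/-- Raise y^p/p! ≤ e^y to the power s, with y = (σ₀/s) x^(1/s) chosen so that sy is the given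
exponent. -/
theorem pow_div_factorial_rpow_le {x s σ₀ : ℝ} (hx : 0 ≤ x) (hs : 0 < s) (hσ₀ : 0 < σ₀) (p : ℕ) :
    x ^ p / (p.factorial : ℝ) ^ s ≤ ((s / σ₀) ^ s) ^ p * Real.exp (σ₀ * x ^ (1 / s)) := by
  set y := σ₀ / s * x ^ (1 / s) with hy
  have hy0 : 0 ≤ y := by positivity
  have h1 := Real.rpow_le_rpow (by positivity) (Real.pow_div_factorial_le_exp y hy0 p) hs.le
  rw [Real.div_rpow (by positivity) (by positivity), ← Real.exp_mul, ← Real.rpow_natCast y,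
    ← Real.rpow_mul hy0, mul_comm (p : ℝ) s, Real.rpow_mul hy0, Real.rpow_natCast] at h1
  have h2 : y ^ s = (σ₀ / s) ^ s * x := by
    rw [hy, Real.mul_rpow (by positivity) (by positivity), ← Real.rpow_mul hx,
      one_div_mul_cancel hs.ne', Real.rpow_one]
  have h3 : y * s = σ₀ * x ^ (1 / s) := by rw [hy]; field_simp
  have h4 : (s / σ₀) ^ s * (σ₀ / s) ^ s = 1 := by
    rw [← Real.mul_rpow (by positivity) (by positivity),
      show s / σ₀ * (σ₀ / s) = 1 by field_simp, Real.one_rpow]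
  rw [h2, h3] at h1
  calc x ^ p / (p.factorial : ℝ) ^ s
      = ((s / σ₀) ^ s) ^ p * (((σ₀ / s) ^ s * x) ^ p / (p.factorial : ℝ) ^ s) := by
        rw [← mul_div_assoc, ← mul_pow, ← mul_assoc, h4, one_mul]
    _ ≤ _ := mul_le_mul_of_nonneg_left h1 (by positivity)

theorem expMoment_initial {μ : ProbabilityMeasure Velocity} {s ρ σ₀ A : ℝ} (hs : 0 < s)
    (hρ : ρ = 2 / s) (hσ₀ : 0 < σ₀) (hA : 0 ≤ A) (h : expMoment σ₀ ρ μ ≤ ENNReal.ofReal A) :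
    (∀ r : ℝ, 0 ≤ r → energyMoment r (μ : Measure Velocity) < ⊤) ∧
      ∀ a : ℝ, 0 ≤ a → ∀ p : ℕ,
        momentWeight a s p * powerMoment μ p ≤ A * (a * (s / σ₀) ^ s) ^ p := by
  have hm : AEStronglyMeasurable (fun v : Velocity => Real.exp (σ₀ * ‖v‖ ^ ρ))
      (μ : Measure Velocity) := by
    have : Measurable fun v : Velocity => Real.exp (σ₀ * ‖v‖ ^ ρ) := by fun_prop
    exact this.aestronglyMeasurable
  have hexp : Integrable (fun v : Velocity => Real.exp (σ₀ * ‖v‖ ^ ρ)) (μ : Measure Velocity) :=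
    (lintegral_ofReal_ne_top_iff_integrable hm (ae_of_all _ fun v => (Real.exp_pos _).le)).1
      (h.trans_lt ENNReal.ofReal_lt_top).ne
  have hexpA : ∫ v, Real.exp (σ₀ * ‖v‖ ^ ρ) ∂(μ : Measure Velocity) ≤ A := by
    rw [integral_eq_lintegral_of_nonneg_ae (ae_of_all _ fun v => (Real.exp_pos _).le) hm]
    exact ENNReal.toReal_le_of_le_ofReal hA h
  have hpt : ∀ (v : Velocity) (p : ℕ), (‖v‖ ^ 2) ^ p / (p.factorial : ℝ) ^ s
      ≤ ((s / σ₀) ^ s) ^ p * Real.exp (σ₀ * ‖v‖ ^ ρ) := by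
    intro v p
    rw [norm_rpow_eq_sq_rpow_inv v hρ]
    exact pow_div_factorial_rpow_le (by positivity) hs hσ₀ p
  have hF : ∀ p : ℕ, 0 < (p.factorial : ℝ) ^ s := fun p =>
    Real.rpow_pos_of_pos (by exact_mod_cast p.factorial_pos) s
  have hint : ∀ p : ℕ, Integrable (fun v : Velocity => (‖v‖ ^ 2) ^ p) (μ : Measure Velocity) := by
    intro p
    refine (hexp.const_mul (((s / σ₀) ^ s) ^ p * (p.factorial : ℝ) ^ s)).mono'
      (by fun_prop) (ae_of_all _ fun v => ?_)
    rw [Real.norm_of_nonneg (by positivity)]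
    have := hpt v p
    rw [div_le_iff₀ (hF p)] at this
    linarith
  refine ⟨fun r hr => ?_, fun a ha p => ?_⟩
  · obtain ⟨n, hn⟩ := exists_nat_ge r
    refine (energyMoment_mono hr hn _).trans_lt (ENNReal.add_lt_top.2 ⟨ENNReal.one_lt_top, ?_⟩)
    unfold energyMoment
    simp only [Real.rpow_natCast]
    exact (hint n).lintegral_lt_top
  · have h1 : powerMoment μ p / (p.factorial : ℝ) ^ s ≤ ((s / σ₀) ^ s) ^ p * A := by
      unfold powerMoment
      rw [← integral_div]
      refine (integral_mono ((hint p).div_const _) (hexp.const_mul _) fun v => hpt v p).trans ?_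
      rw [integral_const_mul]
      gcongr
    have h2 := mul_le_mul_of_nonneg_left h1 (show 0 ≤ a ^ p by positivity)
    unfold momentWeight
    rw [mul_pow]
    calc _ = a ^ p * (powerMoment μ p / (p.factorial : ℝ) ^ s) := by ring
      _ ≤ _ := h2
      _ = _ := by ring

end Conversion

/-! ### Creation and propagation. -/

theorem creation_of_expMoment {γ ν κ₁ κ₂ : ℝ} (hγ0 : 0 < γ) (hγ1 : γ ≤ 1) (hν0 : 0 < ν)
    (hν2 : ν < 2) (hκ₁ : 0 < κ₁) (hκ₂ : 0 < κ₂) :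
    ∃ σ : ℝ, 0 < σ ∧ ∀ (B : ℝ → ℝ → ℝ) (β : ℝ → ℝ) (I J : Velocity → Velocity)
      (f : ℝ → ProbabilityMeasure Velocity),
      IsHardPotential γ ν κ₁ κ₂ B β → IsFrame I J → IsWeakSolution γ β I J f →
      ∀ t ∈ Set.Icc (0 : ℝ) 1,
        expMoment (σ * t ^ (min (2 * γ / (2 - ν)) 2 / γ)) (min (2 * γ / (2 - ν)) 2) (f t) ≤ 4 := by
  set ρ := min (2 * γ / (2 - ν)) 2 with hρ
  have h2ν : 0 < 2 - ν := by linarith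
  have hρ0 : 0 < ρ := by positivity
  set s := 2 / ρ with hs
  have hs1 : 1 ≤ s := by
    rw [hs, le_div_iff₀ hρ0, one_mul]
    exact min_le_right _ _
  have hsγ : (2 - ν) / γ ≤ s := by
    rw [hs, div_le_div_iff₀ hγ0 hρ0]
    calc (2 - ν) * ρ ≤ (2 - ν) * (2 * γ / (2 - ν)) :=
          mul_le_mul_of_nonneg_left (min_le_left _ _) h2ν.le
      _ = 2 * γ := by field_simp
  have hρs : ρ = 2 / s := by rw [hs]; field_simp
  have hs0 : 0 < s := by linarith
  obtain ⟨b, hb, H⟩ := exists_uniform_creation hγ0 hγ1 hν0 hν2 hκ₁ hκ₂ hs1 hsγ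
  set a := b * (1 / 2) ^ (2 / γ) with ha
  have ha0 : 0 < a := by positivity
  refine ⟨a ^ (1 / s) / 2, by positivity, ?_⟩
  intro B β I J f hB hF hf t ht
  rcases ht.1.eq_or_lt with rfl | ht0
  -- At t = 0 the exponent vanishes and the moment is 1.
  · rw [Real.zero_rpow (by positivity), mul_zero]
    simp [expMoment]
  -- Starting at t/2 > 0, all moments are available there, with bounds that do not enter b. The
  -- elapsed time t/2 accounts for the factor (1/2)^(2/γ) in a.
  have hmom : HasMoments f (t / 2) (t / 2 + 1) := hasMoments_of_energyMoment_le fun r hr =>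
    hf.energyMoment_le_of_pos hB hF hγ0 hγ1 hν2 hκ₁ hκ₂ hr (by positivity) _
  have htm : t ∈ Set.Icc (t / 2) (t / 2 + 1) := ⟨by linarith, by linarith [ht.2]⟩
  refine expMoment_le_four hs1 hρs (by positivity) ?_ (fun p => hmom.integrable_pow p htm)
    fun N => H B β I J f (t / 2) hB hF hf hmom (by positivity) N t htm
  have h1 : 2 * (a ^ (1 / s) / 2 * t ^ (ρ / γ)) = a ^ (1 / s) * t ^ (ρ / γ) := by ring
  have h2 : ρ / γ * s = 2 / γ := by rw [hρs]; field_simp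
  rw [h1, Real.mul_rpow (by positivity) (by positivity), ← Real.rpow_mul ha0.le,
    one_div_mul_cancel hs0.ne', Real.rpow_one, ← Real.rpow_mul ht0.le, h2, ha, mul_assoc,
    ← Real.mul_rpow (by norm_num) ht0.le]
  refine le_of_eq ?_
  congr 2
  ring

theorem propagation_of_expMoment {γ ν κ₁ κ₂ : ℝ} (hγ0 : 0 < γ) (hγ1 : γ ≤ 1) (hν0 : 0 < ν)
    (hν2 : ν < 2) (hκ₁ : 0 < κ₁) (hκ₂ : 0 < κ₂) {A σ₀ ρ : ℝ} (hA : 0 < A) (hσ₀ : 0 < σ₀)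
    (hρ0 : 0 < ρ) (hρ2 : ρ ≤ 2) :
    ∃ σ : ℝ, 0 < σ ∧ ∀ (B : ℝ → ℝ → ℝ) (β : ℝ → ℝ) (I J : Velocity → Velocity)
      (f : ℝ → ProbabilityMeasure Velocity),
      IsHardPotential γ ν κ₁ κ₂ B β → IsFrame I J → IsWeakSolution γ β I J f →
      expMoment σ₀ ρ (f 0) ≤ ENNReal.ofReal A → ∀ t, 0 ≤ t → expMoment σ ρ (f t) ≤ 4 := by
  set s := 2 / ρ with hs
  have hs1 : 1 ≤ s := by rw [hs, le_div_iff₀ hρ0]; linarith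
  have hs0 : 0 < s := by linarith
  have hρs : ρ = 2 / s := by rw [hs]; field_simp
  obtain ⟨a₀, δ, ha₀, hδ0, hδ1, H⟩ := exists_uniform_propagation hγ0 hγ1 hν0 hν2 hκ₁ hκ₂
  set q := (s / σ₀) ^ s with hq
  have hq0 : 0 < q := by positivity
  -- At time 0 the weighted terms are at most A(aq)^p: aq ≤ 1/2 sums them to at most 2A·aq, and the
  -- last entry makes this at most δ/2, strictly below the barrier.
  set a := min a₀ (min (1 / (2 * q)) (δ / (4 * A * q))) with ha
  have ha0 : 0 < a := by positivity
  have haq : a * q ≤ 1 / 2 := by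
    have : a ≤ 1 / (2 * q) := (min_le_right _ _).trans (min_le_left _ _)
    rw [le_div_iff₀ (by positivity)] at this
    linarith
  have haδ : A * (2 * (a * q)) < δ := by
    have : a ≤ δ / (4 * A * q) := (min_le_right _ _).trans (min_le_right _ _)
    rw [le_div_iff₀ (by positivity)] at this
    linarith
  refine ⟨a ^ (1 / s) / 2, by positivity, ?_⟩
  intro B β I J f hB hF hf h0 t ht
  obtain ⟨hfin, hwt⟩ := expMoment_initial hs0 hρs hσ₀ hA.le h0
  have hmom : HasMoments f 0 t := hasMoments_of_energyMoment_le fun r hr =>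
    hf.energyMoment_le_of_initial hB hF hγ0 hγ1 hν2 hκ₁ hκ₂ hfin hr t
  have htm : t ∈ Set.Icc 0 t := ⟨ht, le_rfl⟩
  refine expMoment_le_four (a := a) hs1 hρs (by positivity) ?_
    (fun p => hmom.integrable_pow p htm) fun N => ?_
  · rw [show 2 * (a ^ (1 / s) / 2) = a ^ (1 / s) by ring, ← Real.rpow_mul ha0.le,
      one_div_mul_cancel hs0.ne', Real.rpow_one]
  · refine (H B β I J f t s a hB hF hf hmom hs1 ha0.le (min_le_left _ _) N ?_ t htm).trans hδ1
    have h1 := Finset.sum_le_sum fun p (_ : p ∈ Finset.Icc 1 N) => hwt a ha0.le p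
    refine h1.trans_lt ?_
    rw [← Finset.mul_sum]
    exact (mul_le_mul_of_nonneg_left (sum_pow_le_two_mul (by positivity) haq N) hA.le).trans_lt haδ

theorem theorem1 (γ ν κ₁ κ₂ : ℝ) (hγ0 : 0 < γ) (hγ1 : γ ≤ 1) (hν0 : 0 < ν) (hν2 : ν < 2)
    (hκ₁ : 0 < κ₁) (hκ₂ : 0 < κ₂) :
    (∃ T : ℝ, 0 < T ∧ ∃ σ : ℝ, 0 < σ ∧
      ∀ (B : ℝ → ℝ → ℝ) (β : ℝ → ℝ) (I J : Velocity → Velocity)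
        (f : ℝ → ProbabilityMeasure Velocity),
        IsHardPotential γ ν κ₁ κ₂ B β → IsFrame I J → IsWeakSolution γ β I J f →
        (⨆ t ∈ Set.Icc 0 T,
          expMoment (σ * t ^ (min (2 * γ / (2 - ν)) 2 / γ)) (min (2 * γ / (2 - ν)) 2) (f t)) ≤ 4) ∧
    (∀ A : ℝ, 0 < A → ∀ σ₀ : ℝ, 0 < σ₀ → ∀ ρ : ℝ, 0 < ρ → ρ ≤ 2 →
      ∃ σ : ℝ, 0 < σ ∧
        ∀ (B : ℝ → ℝ → ℝ) (β : ℝ → ℝ) (I J : Velocity → Velocity)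
          (f : ℝ → ProbabilityMeasure Velocity),
          IsHardPotential γ ν κ₁ κ₂ B β → IsFrame I J → IsWeakSolution γ β I J f →
          expMoment σ₀ ρ (f 0) ≤ ENNReal.ofReal A →
          (⨆ t ∈ Set.Ici (0 : ℝ), expMoment σ ρ (f t)) ≤ 6) := by
  refine ⟨⟨1, one_pos, ?_⟩, fun A hA σ₀ hσ₀ ρ hρ0 hρ2 => ?_⟩
  · obtain ⟨σ, hσ, H⟩ := creation_of_expMoment hγ0 hγ1 hν0 hν2 hκ₁ hκ₂
    exact ⟨σ, hσ, fun B β I J f hB hF hf => iSup₂_le fun t ht => H B β I J f hB hF hf t ht⟩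
  · obtain ⟨σ, hσ, H⟩ := propagation_of_expMoment hγ0 hγ1 hν0 hν2 hκ₁ hκ₂ hA hσ₀ hρ0 hρ2
    exact ⟨σ, hσ, fun B β I J f hB hF hf h0 => iSup₂_le fun t ht =>
      (H B β I J f hB hF hf h0 t ht).trans (by norm_num)⟩
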